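/- Let $n\ge 1$, let $W\in \mathcal W^{1,\infty}(\mathbb R^n)$ (that is, $W$ and its weak gradient $\nabla W$ are in $L^\infty(\mathbb R^n)$) be even, $W(-x)=W(x)$, and for $\rho\in L^1(\mathbb R^n)$, $\rho \ge 0$, let $$E[\rho]=\int_{\mathbb R^n}\Big(\rho\log\rho+\tfrac12\,\rho\,(W*\rho)\Big)\,dx\in[-\infty,\infty],$$ where $E[\rho]<\infty$ means that the positive part of the integrand is integrable (so that the integral is well defined in $[-\infty,\infty)$). Let $\rho_0\in L^1(\mathbb R^n)$, $\rho_0\ge 0$, with $\int\rho_0\,dx=1$ and $E[\rho_0]<\infty$, and let $\rho\in C([0,\infty);L^1(\mathbb R^n))$ be the mild solution of $$\partial_t\rho=\Delta\rho+\nabla\cdot(\rho\,\nabla W*\rho),\qquad \rho(0)=\rho_0,$$ that is, for every $t>0$, with the heat kernel $G_t(x)=(4\pi t)^{-n/2}e^{-|x|^2/(4t)}$, $$\rho(t)=G_t*\rho_0+\int_0^t(\nabla G_{t-s})*\big(\rho(s)\,(\nabla W*\rho(s))\big)\,ds .$$ Then there is a constant $c>0$ depending only on $n$ and $\|W\|_{L^\infty}$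 such that $$E[\rho(t)]\le-\frac n2\log\Big(ct+e^{-\frac2nE[\rho_0]}\Big)\qquad\text{for all }t\ge0,$$ where the right-hand side is $-\infty$ if $E[\rho_0]=-\infty$; in particular $E[\rho(t)]$ is well defined in $[-\infty,\infty)$. As a consequence, for the rescaled density $\tilde\rho(\tau,y)=e^{n\tau}\rho\big(\tfrac12(e^{2\tau}-1),e^\tau y\big)$ and the rescaled potential $\widetilde W(\tau,y)=W(e^\tau y)$, the rescaled energy $$\widetilde E(\tau)=\int_{\mathbb R^n}\Big(\tilde\rho\log\tilde\rho+\tfrac12\,\tilde\rho\,(\widetilde W(\tau,\cdot)*\tilde\rho)\Big)\,dy$$ satisfies $\widetilde E(\tau)\le C$ for all $\tau\ge0$, with a constant $C$ depending only on $n$, $\|W\|_{L^\infty}$ and $E[\rho_0]$. -/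

import Mathlib

open MeasureTheory Set
open scoped ENNReal Convolution

noncomputable section

/-- Euclidean space `ℝⁿ` (Euclidean norm, Lebesgue measure `volume`). -/
abbrev Rn (n : ℕ) : Type := EuclideanSpace ℝ (Fin n)

/-- `g` is the weak (distributional) gradient of `W` on `ℝⁿ`:
`∫ W ∇φ = - ∫ φ g` for every test function `φ ∈ C_c^∞(ℝⁿ)`. -/
def IsWeakGradient {n : ℕ} (W : Rn n → ℝ) (g : Rn n → Rn n) : Prop :=
  ∀ φ : Rn n → ℝ, ContDiff ℝ (⊤ : ℕ∞) φ → HasCompactSupport φ →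
    ∫ x, W x • gradient φ x = - ∫ x, φ x • g x

/-- `W` belongs to the Sobolev space `𝒲^{1,∞}(ℝⁿ)` with weak gradient `∇W = g`: both `W` and `g`
are in `L^∞`. -/
structure IsSobolevOneInfty {n : ℕ} (W : Rn n → ℝ) (g : Rn n → Rn n) : Prop where
  memLp : MemLp W ∞ volume
  memLp_grad : MemLp g ∞ volume
  weakGradient : IsWeakGradient W g

/-- The heat kernel `G_t(x) = (4πt)^{-n/2} exp(-|x|²/(4t))`, `t > 0`. -/
def heatKernel (n : ℕ) (t : ℝ) (x : Rn n) : ℝ :=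
  (4 * Real.pi * t) ^ (-(n : ℝ) / 2) * Real.exp (-‖x‖ ^ 2 / (4 * t))

/-- The convolution `W * ρ` of two scalar functions,
`(W * ρ)(x) = ∫ W(y) ρ(x - y) dy`. -/
def conv {n : ℕ} (W ρ : Rn n → ℝ) : Rn n → ℝ :=
  W ⋆[ContinuousLinearMap.mul ℝ ℝ, volume] ρ

/-- The vector field `F = ρ (∇W * ρ)`, where `g = ∇W`. -/
def drift {n : ℕ} (g : Rn n → Rn n) (ρ : Rn n → ℝ) (x : Rn n) : Rn n :=
  ρ x • (ρ ⋆[ContinuousLinearMap.lsmul ℝ ℝ, volume] g) x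

/-- `ρ : [0,∞) → L¹(ℝⁿ)` is a global mild solution of
`∂ₜρ = Δρ + ∇ · (ρ ∇W * ρ)` with `∇W = g` and initial datum `ρ₀`: it is continuous with values in
`L¹`, starts at `ρ₀`, and satisfies Duhamel's formula
`ρ_t = G_t * ρ₀ + ∫₀ᵗ (∇G_{t-s}) * (ρ_s (∇W * ρ_s)) ds` for `t > 0`, where the convolution of two
vector fields is the sum of the convolutions of their components.
Only the values `ρ t` with `t ≥ 0` matter. -/
structure IsMildSolution {n : ℕ} (g : Rn n → Rn n)
    (ρ₀ : Rn n →₁[volume] ℝ) (ρ : ℝ → (Rn n →₁[volume] ℝ)) : Prop where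
  continuousOn : ContinuousOn ρ (Ici 0)
  initial : ρ 0 = ρ₀
  duhamel : ∀ t : ℝ, 0 < t → ∀ᵐ x : Rn n, ρ t x = conv (heatKernel n t) ρ₀ x
    + ∫ s in (0 : ℝ)..t,
        ((gradient (heatKernel n (t - s))) ⋆[innerSL ℝ, volume] (drift g (ρ s))) x

/-- The integral of a real function with values in `[-∞, ∞]`:
`∫ f⁺ - ∫ f⁻`, with the convention that it is `+∞` as soon as `∫ f⁺ = +∞`. Hence
`extIntegral f < ⊤` says exactly that the integral of `f` is well defined in `[-∞, ∞)`. -/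
def extIntegral {n : ℕ} (f : Rn n → ℝ) : EReal :=
  open Classical in
  if ∫⁻ x, ENNReal.ofReal (f x) = ⊤ then ⊤
  else ((∫⁻ x, ENNReal.ofReal (f x) : ℝ≥0∞) : EReal)
    - ((∫⁻ x, ENNReal.ofReal (-f x) : ℝ≥0∞) : EReal)

/-- The free energy `E[ρ] = ∫ (ρ log ρ + ½ ρ (W * ρ)) dx ∈ [-∞, ∞]`. -/
def freeEnergy {n : ℕ} (W ρ : Rn n → ℝ) : EReal :=
  extIntegral fun x => ρ x * Real.log (ρ x) + 1 / 2 * (ρ x * conv W ρ x)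

/-- The essential supremum norm `‖W‖_{L^∞}`, a real number for `W ∈ L^∞`. -/
def supNorm {n : ℕ} (W : Rn n → ℝ) : ℝ := (eLpNorm W ∞ volume).toReal

/-- The rescaled density `ρ̃(τ, y) = e^{nτ} ρ((e^{2τ} - 1)/2, e^τ y)`. -/
def rescaledDensity {n : ℕ} (ρ : ℝ → (Rn n →₁[volume] ℝ)) (τ : ℝ) (y : Rn n) : ℝ :=
  Real.exp (n * τ) * ρ ((Real.exp (2 * τ) - 1) / 2) (Real.exp τ • y)

/-- The rescaled potential `W̃(τ, y) = W(e^τ y)`. -/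
def rescaledPotential {n : ℕ} (W : Rn n → ℝ) (τ : ℝ) (y : Rn n) : ℝ :=
  W (Real.exp τ • y)

/-- The rescaled energy `Ẽ(τ) = ∫ (ρ̃ log ρ̃ + ½ ρ̃ (W̃(τ,·) * ρ̃)) dy`. -/
def rescaledEnergy {n : ℕ} (W : Rn n → ℝ) (ρ : ℝ → (Rn n →₁[volume] ℝ)) (τ : ℝ) : EReal :=
  freeEnergy (rescaledPotential W τ) (rescaledDensity ρ τ)

end

/-!
# Decay of the free energy for the aggregation-diffusion equation

The equation is `∂ₜρ = ∇ · J` with the flux `J = ∇ρ + ρ (∇W * ρ) = e^{-W * ρ} ∇(ρ e^{W * ρ})`, and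
the free energy `E` decreases at the rate `D = ∫ |J|² / ρ`. Let `M` be the supremum norm of `W`.
The function `h = ρ e^{W * ρ}` satisfies `‖∇h‖₁ ≤ e^M √D` by Cauchy-Schwarz, for `ρ` has mass one.
On the other hand, a probability density whose `h` has total variation at most `S` has energy at
most `n log S + C` (`IsDensity.freeEnergy_le_log`): comparing `h` with its Gaussian mollification
gives `∫ (ρ - a)₊ ≤ C S a^{-1/n}` (`lintegral_layer_le`), and the entropy is a sum of such integrals
over dyadic levels `a`. Together, `E' ≤ -c e^{2E/n}`, so that `e^{-2E/n}` grows at least linearly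
(`exp_neg_add_le_of_decay`), which is the claim. In self-similar variables the energy is shifted by
`nτ`, which is compensated by the logarithmic decay (`rescaledEnergy_le`).

No regularity of the mild solution is used in making this rigorous. The dissipation is computed
for the mollified solution `u = G_δ * ρ`, which has a right derivative in time that can be read off
from Duhamel's formula (`IsMildSolution.hasDerivWithinAt_of_quadratic`), for a smooth even kernel in
place of `W`, and for the regularised entropy `(r + ε) log (1 + r/ε)`
(`IsMildSolution.hasDerivWithinAt_regEnergy`, `production_energy_le`). The mean value inequality
yields a time `s` in a given interval at which the regularised dissipation is at most the mean
decrease of the energy, up to errors (`IsMildSolution.exists_dissip_le`). As the regularisations are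
removed, these times accumulate at some `r`, and the bound on the variation of `h`, expressed by
translations in `L¹`, passes to the limit at `r`
(`IsMildSolution.exists_translate_le_of_decrease`). Since the energy is nonincreasing, the
functional inequality at time `r` bounds the energy at the end of the interval. This is the
difference form of `E' ≤ -c e^{2E/n}` (`IsMildSolution.mul_exp_le_sub`), and it holds without
continuity of `E`. Energies equal to `-∞` need no separate treatment until the end, because the
difference form is stated for real numbers above and below the two energies.

All this needs `ρ ≥ 0` (`IsMildSolution.nonneg`). For a short time after any given time, the
solution has bounded variation (`IsMildSolution.exists_translate_le`), hence the commutator between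
mollification and the drift is of order `√δ` in the space of functions of bounded variation
(`integral_norm_driftComm_translate_le`), and the `L¹` norm does not increase
(`IsMildSolution.norm_le_of_translate_le`). Since the mass is conserved, a nonnegative solution
stays nonnegative.
-/

noncomputable section

open Filter Topology Real

/-! ### The heat kernel -/

section Gaussian

variable {n : ℕ}

lemma heatKernel_pos {t : ℝ} (ht : 0 < t) (x : Rn n) : 0 < heatKernel n t x := by
  unfold heatKernel; positivity

lemma heatKernel_le {t : ℝ} (ht : 0 < t) (x : Rn n) :
    heatKernel n t x ≤ (4 * π * t) ^ (-(n : ℝ) / 2) := by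
  unfold heatKernel
  refine mul_le_of_le_one_right (by positivity) (Real.exp_le_one_iff.2 ?_)
  rw [neg_div]
  exact neg_nonpos.2 (by positivity)

lemma heatKernel_neg (t : ℝ) (x : Rn n) : heatKernel n t (-x) = heatKernel n t x := by
  simp [heatKernel]

@[fun_prop]
lemma continuous_heatKernel (t : ℝ) : Continuous (heatKernel n t) := by
  unfold heatKernel; fun_prop

lemma contDiff_heatKernel (t : ℝ) : ContDiff ℝ (⊤ : ℕ∞) (heatKernel n t) := by
  unfold heatKernel
  have : ContDiff ℝ (⊤ : ℕ∞) (fun x : Rn n => ‖x‖ ^ 2) := contDiff_norm_sq ℝ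
  exact contDiff_const.mul (Real.contDiff_exp.comp ((this.neg).div_const _))

lemma integral_heatKernel {t : ℝ} (ht : 0 < t) : ∫ x : Rn n, heatKernel n t x = 1 := by
  unfold heatKernel
  rw [integral_const_mul]
  have h := GaussianFourier.integral_rexp_neg_mul_sq_norm (V := Rn n) (b := 1 / (4 * t))
    (by positivity)
  have h2 : (fun x : Rn n => Real.exp (-‖x‖ ^ 2 / (4 * t)))
      = fun x => Real.exp (-(1 / (4 * t)) * ‖x‖ ^ 2) := by
    ext x; congr 1; field_simp
  rw [h2, h, finrank_euclideanSpace, Fintype.card_fin]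
  have : π / (1 / (4 * t)) = 4 * π * t := by field_simp
  rw [this, ← Real.rpow_add (by positivity)]
  have : -(n : ℝ) / 2 + n / 2 = 0 := by ring
  rw [this, Real.rpow_zero]

lemma integrable_heatKernel {t : ℝ} (ht : 0 < t) : Integrable (heatKernel n t) := by
  by_contra h
  have := integral_heatKernel (n := n) ht
  rw [integral_undef h] at this
  exact zero_ne_one this

/-- Completing the square: the product of two heat kernels is, as a function of `y`, a multiple of
a third, translated one. -/
lemma heatKernel_mul_heatKernel {a b : ℝ} (ha : 0 < a) (hb : 0 < b) (x y : Rn n) :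
    heatKernel n a (x - y) * heatKernel n b y
      = heatKernel n (a + b) x * heatKernel n (a * b / (a + b)) (y - (b / (a + b)) • x) := by
  unfold heatKernel
  have e1 : (4 * π * a) ^ (-(n : ℝ) / 2) * (4 * π * b) ^ (-(n : ℝ) / 2)
      = (4 * π * (a + b)) ^ (-(n : ℝ) / 2) * (4 * π * (a * b / (a + b))) ^ (-(n : ℝ) / 2) := by
    rw [← Real.mul_rpow (by positivity) (by positivity),
      ← Real.mul_rpow (by positivity) (by positivity)]
    congr 1; field_simp
  have e2 : -‖x - y‖ ^ 2 / (4 * a) + -‖y‖ ^ 2 / (4 * b)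
      = -‖x‖ ^ 2 / (4 * (a + b)) + -‖y - (b / (a + b)) • x‖ ^ 2 / (4 * (a * b / (a + b))) := by
    rw [norm_sub_sq_real, norm_sub_sq_real, norm_smul, inner_smul_right, real_inner_comm x y,
      mul_pow, Real.norm_eq_abs, sq_abs]
    have : a + b ≠ 0 := by positivity
    field_simp
    ring
  calc _ = ((4 * π * a) ^ (-(n : ℝ) / 2) * (4 * π * b) ^ (-(n : ℝ) / 2))
        * Real.exp (-‖x - y‖ ^ 2 / (4 * a) + -‖y‖ ^ 2 / (4 * b)) := by rw [Real.exp_add]; ring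
    _ = _ := by rw [e1, e2, Real.exp_add]; ring

/-- The gradient of the heat kernel, in closed form. -/
def gradHeat (n : ℕ) (t : ℝ) (x : Rn n) : Rn n := (-(1 / (2 * t)) * heatKernel n t x) • x

lemma hasGradientAt_heatKernel (t : ℝ) (x : Rn n) :
    HasGradientAt (heatKernel n t) (gradHeat n t x) x := by
  rw [hasGradientAt_iff_hasFDerivAt]
  have h1 : HasFDerivAt (fun x : Rn n => ‖x‖ ^ 2) (2 • innerSL ℝ x) x :=
    (hasStrictFDerivAt_norm_sq x).hasFDerivAt
  have h2 := ((h1.neg.mul_const (4 * t)⁻¹).exp).const_mul ((4 * π * t) ^ (-(n : ℝ) / 2))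
  have h3 : heatKernel n t = fun x : Rn n => (4 * π * t) ^ (-(n : ℝ) / 2) *
      Real.exp (-‖x‖ ^ 2 * (4 * t)⁻¹) := by
    ext x; simp [heatKernel, div_eq_mul_inv]
  rw [h3]
  refine h2.congr_fderiv ?_
  ext v
  simp only [gradHeat, heatKernel, div_eq_mul_inv, mul_inv]
  simp
  ring

lemma gradient_heatKernel (t : ℝ) : gradient (heatKernel n t) = gradHeat n t :=
  gradient_eq fun x => hasGradientAt_heatKernel t x

@[fun_prop]
lemma continuous_gradHeat (t : ℝ) : Continuous (gradHeat n t) := by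
  unfold gradHeat; fun_prop

lemma gradHeat_neg (t : ℝ) (x : Rn n) : gradHeat n t (-x) = -gradHeat n t x := by
  simp [gradHeat, heatKernel_neg]

/-- Trading half of the Gaussian decay: `G_t` is `G_{2t}` times a Gaussian factor, which absorbs
polynomial weights. -/
lemma heatKernel_two_mul {t : ℝ} (ht : 0 < t) (x : Rn n) :
    heatKernel n t x
      = 2 ^ ((n : ℝ) / 2) * Real.exp (-‖x‖ ^ 2 / (8 * t)) * heatKernel n (2 * t) x := by
  unfold heatKernel
  have e1 : (4 * π * (2 * t)) ^ (-(n : ℝ) / 2)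
      = 2 ^ (-(n : ℝ) / 2) * (4 * π * t) ^ (-(n : ℝ) / 2) := by
    rw [← Real.mul_rpow (by positivity) (by positivity)]; congr 1; ring
  have e2 : (2 : ℝ) ^ ((n : ℝ) / 2) * 2 ^ (-(n : ℝ) / 2) = 1 := by
    rw [← Real.rpow_add (by positivity)]; ring_nf; simp
  have e3 : Real.exp (-‖x‖ ^ 2 / (4 * t))
      = Real.exp (-‖x‖ ^ 2 / (8 * t)) * Real.exp (-‖x‖ ^ 2 / (4 * (2 * t))) := by
    rw [← Real.exp_add]; congr 1; field_simp; ring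
  rw [e1, e3]
  linear_combination (-(4 * π * t) ^ (-(n : ℝ) / 2) * Real.exp (-‖x‖ ^ 2 / (8 * t)) *
    Real.exp (-‖x‖ ^ 2 / (4 * (2 * t)))) * e2

/-- The dimensional constant in the pointwise bounds for derivatives of the heat kernel. -/
def heatC (n : ℕ) : ℝ := 2 ^ ((n : ℝ) / 2) * (n + 3)

lemma heatC_pos (n : ℕ) : 0 < heatC n := by unfold heatC; positivity

lemma mul_exp_neg_le (s : ℝ) : s * Real.exp (-s) ≤ 1 := by
  have h : s ≤ Real.exp s := by linarith [Real.add_one_le_exp s]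
  calc s * Real.exp (-s) ≤ Real.exp s * Real.exp (-s) := by gcongr
    _ = 1 := by rw [← Real.exp_add]; simp

lemma norm_mul_heatKernel_le {t : ℝ} (ht : 0 < t) (x : Rn n) :
    ‖x‖ * heatKernel n t x ≤ heatC n * √t * heatKernel n (2 * t) x := by
  have hG := (heatKernel_pos (n := n) (t := 2 * t) (by positivity) x).le
  rw [heatKernel_two_mul ht x]
  have key : ‖x‖ * Real.exp (-‖x‖ ^ 2 / (8 * t)) ≤ 3 * √t := by
    set s := ‖x‖ ^ 2 / (8 * t) with hs
    have hs0 : 0 ≤ s := by positivity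
    have e : -‖x‖ ^ 2 / (8 * t) = -s := by rw [hs]; ring
    rw [e]
    have h1 := mul_exp_neg_le s
    have h2 : Real.exp (-s) ≤ 1 := Real.exp_le_one_iff.2 (by linarith)
    have h3 : ‖x‖ ^ 2 = 8 * t * s := by rw [hs]; field_simp
    have h0 := Real.exp_pos (-s)
    refine abs_le_of_sq_le_sq' ?_ (by positivity) |>.2
    rw [mul_pow, mul_pow, Real.sq_sqrt ht.le, h3]
    nlinarith [mul_le_mul h1 h2 h0.le zero_le_one]
  have h2 : (0 : ℝ) ≤ 2 ^ ((n : ℝ) / 2) := by positivity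
  calc ‖x‖ * (2 ^ ((n : ℝ) / 2) * Real.exp (-‖x‖ ^ 2 / (8 * t)) * heatKernel n (2 * t) x)
      = 2 ^ ((n : ℝ) / 2) * (‖x‖ * Real.exp (-‖x‖ ^ 2 / (8 * t))) * heatKernel n (2 * t) x := by
        ring
    _ ≤ 2 ^ ((n : ℝ) / 2) * ((n + 3) * √t) * heatKernel n (2 * t) x := by
        have : (0 : ℝ) ≤ n := by positivity
        have k2 : ‖x‖ * Real.exp (-‖x‖ ^ 2 / (8 * t)) ≤ (n + 3) * √t :=
          key.trans (by gcongr; linarith)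
        exact mul_le_mul_of_nonneg_right (mul_le_mul_of_nonneg_left k2 h2) hG
    _ = _ := by unfold heatC; ring

lemma norm_sq_mul_heatKernel_le {t : ℝ} (ht : 0 < t) (x : Rn n) :
    ‖x‖ ^ 2 * heatKernel n t x ≤ 8 * heatC n * t * heatKernel n (2 * t) x := by
  have hG := (heatKernel_pos (n := n) (t := 2 * t) (by positivity) x).le
  rw [heatKernel_two_mul ht x]
  have key : ‖x‖ ^ 2 * Real.exp (-‖x‖ ^ 2 / (8 * t)) ≤ 8 * t := by
    set s := ‖x‖ ^ 2 / (8 * t) with hs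
    have hs0 : 0 ≤ s := by positivity
    have e : -‖x‖ ^ 2 / (8 * t) = -s := by rw [hs]; ring
    have h1 := mul_exp_neg_le s
    have h3 : ‖x‖ ^ 2 = 8 * t * s := by rw [hs]; field_simp
    rw [e, h3]; nlinarith
  have h2 : (0 : ℝ) ≤ 2 ^ ((n : ℝ) / 2) := by positivity
  have h4 : (0 : ℝ) ≤ n := by positivity
  calc ‖x‖ ^ 2 * (2 ^ ((n : ℝ) / 2) * Real.exp (-‖x‖ ^ 2 / (8 * t)) * heatKernel n (2 * t) x)
      = 2 ^ ((n : ℝ) / 2) * (‖x‖ ^ 2 * Real.exp (-‖x‖ ^ 2 / (8 * t))) * heatKernel n (2 * t) x := by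
        ring
    _ ≤ 2 ^ ((n : ℝ) / 2) * ((n + 3) * (8 * t)) * heatKernel n (2 * t) x := by
        exact mul_le_mul_of_nonneg_right
          (mul_le_mul_of_nonneg_left (key.trans (by nlinarith)) h2) hG
    _ = _ := by unfold heatC; ring

/-- `|∇G_t| ≤ C t^{-1/2} G_{2t}`. -/
lemma norm_gradHeat_le {t : ℝ} (ht : 0 < t) (x : Rn n) :
    ‖gradHeat n t x‖ ≤ heatC n / √t * heatKernel n (2 * t) x := by
  have h := norm_mul_heatKernel_le ht x
  have hG := (heatKernel_pos (n := n) (t := 2 * t) (by positivity) x).le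
  have hG' := (heatKernel_pos (n := n) (t := t) (by positivity) x).le
  rw [gradHeat, norm_smul, norm_mul, norm_neg,
    Real.norm_of_nonneg (by positivity : 0 ≤ 1 / (2 * t)),
    Real.norm_of_nonneg hG']
  calc 1 / (2 * t) * heatKernel n t x * ‖x‖ = 1 / (2 * t) * (‖x‖ * heatKernel n t x) := by ring
    _ ≤ 1 / (2 * t) * (heatC n * √t * heatKernel n (2 * t) x) := by gcongr
    _ = (1 / 2) * (heatC n / √t * heatKernel n (2 * t) x) := by
        nth_rewrite 1 [← Real.mul_self_sqrt ht.le]; field_simp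
    _ ≤ _ := by
        have : 0 ≤ heatC n / √t * heatKernel n (2 * t) x := by
          have := heatC_pos n; positivity
        linarith

lemma integrable_gradHeat {t : ℝ} (ht : 0 < t) : Integrable (gradHeat n t) :=
  ((integrable_heatKernel (n := n) (t := 2 * t) (by positivity)).const_mul (heatC n / √t)).mono'
    (continuous_gradHeat t).aestronglyMeasurable (ae_of_all _ fun x => norm_gradHeat_le ht x)

lemma integral_norm_gradHeat_le {t : ℝ} (ht : 0 < t) :
    ∫ x, ‖gradHeat n t x‖ ≤ heatC n / √t := by
  calc ∫ x, ‖gradHeat n t x‖ ≤ ∫ x : Rn n, heatC n / √t * heatKernel n (2 * t) x :=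
        integral_mono (integrable_gradHeat ht).norm
          ((integrable_heatKernel (by positivity)).const_mul _) fun x => norm_gradHeat_le ht x
    _ = _ := by rw [integral_const_mul, integral_heatKernel (by positivity), mul_one]

/-- The gradient kernel is odd. -/
lemma integral_gradHeat (t : ℝ) : ∫ x, gradHeat n t x = 0 := by
  have h := integral_neg_eq_self (gradHeat n t) volume
  simp only [gradHeat_neg, integral_neg] at h
  have h2 : (2 : ℝ) • ∫ x, gradHeat n t x = 0 := by
    rw [two_smul]; nth_rewrite 1 [← h]; simp
  simpa using h2

lemma integrable_norm_mul_heatKernel {t : ℝ} (ht : 0 < t) :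
    Integrable fun x : Rn n => ‖x‖ * heatKernel n t x :=
  ((integrable_heatKernel (n := n) (t := 2 * t) (by positivity)).const_mul (heatC n * √t)).mono'
    (by fun_prop : Continuous _).aestronglyMeasurable (ae_of_all _ fun x => by
      rw [Real.norm_of_nonneg (mul_nonneg (norm_nonneg _) (heatKernel_pos ht x).le)]
      exact norm_mul_heatKernel_le ht x)

lemma integral_norm_mul_heatKernel_le {t : ℝ} (ht : 0 < t) :
    ∫ x : Rn n, ‖x‖ * heatKernel n t x ≤ heatC n * √t := by
  calc _ ≤ ∫ x : Rn n, heatC n * √t * heatKernel n (2 * t) x :=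
        integral_mono (integrable_norm_mul_heatKernel ht)
          ((integrable_heatKernel (by positivity)).const_mul _) fun x => norm_mul_heatKernel_le ht x
    _ = _ := by rw [integral_const_mul, integral_heatKernel (by positivity), mul_one]

/-- The semigroup property `∇G_b * G_a = ∇G_{a+b}`. -/
lemma integral_heatKernel_smul_gradHeat {a b : ℝ} (ha : 0 < a) (hb : 0 < b) (x : Rn n) :
    ∫ y, heatKernel n a (x - y) • gradHeat n b y = gradHeat n (a + b) x := by
  have hc : 0 < a * b / (a + b) := by positivity
  have hi := integrable_heatKernel (n := n) hc
  have hi2 : Integrable fun y : Rn n => heatKernel n (a * b / (a + b)) y • y := by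
    refine (integrable_norm_mul_heatKernel (n := n) hc).mono
      (by fun_prop : Continuous _).aestronglyMeasurable (ae_of_all _ fun x => ?_)
    simp [norm_smul, mul_comm]
  have hodd : ∫ y : Rn n, heatKernel n (a * b / (a + b)) y • y = 0 := by
    have h := integral_neg_eq_self (fun y : Rn n => heatKernel n (a * b / (a + b)) y • y) volume
    simp only [heatKernel_neg, smul_neg, integral_neg] at h
    have h2 : (2 : ℝ) • ∫ y : Rn n, heatKernel n (a * b / (a + b)) y • y = 0 := by
      rw [two_smul]; nth_rewrite 1 [← h]; simp
    simpa using h2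
  set m : Rn n := (b / (a + b)) • x with hm
  calc ∫ y, heatKernel n a (x - y) • gradHeat n b y
      = ∫ y, (-(1 / (2 * b)) * heatKernel n (a + b) x) •
          (heatKernel n (a * b / (a + b)) (y - m) • (y - m)
            + heatKernel n (a * b / (a + b)) (y - m) • m) := by
        congr 1; ext1 y
        rw [← smul_add, sub_add_cancel, gradHeat, smul_smul, smul_smul]
        congr 1
        linear_combination (-(1 / (2 * b))) * heatKernel_mul_heatKernel ha hb x y
    _ = (-(1 / (2 * b)) * heatKernel n (a + b) x) • m := by
        rw [integral_smul, integral_add (hi2.comp_sub_right m)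
          ((hi.comp_sub_right m).smul_const m),
          integral_sub_right_eq_self (fun y : Rn n => heatKernel n (a * b / (a + b)) y • y) m,
          hodd, zero_add, integral_smul_const,
          integral_sub_right_eq_self (heatKernel n (a * b / (a + b))) m, integral_heatKernel hc,
          one_smul]
    _ = _ := by
        rw [hm, gradHeat, smul_smul]
        congr 1; field_simp

lemma integral_heatKernel_mul_heatKernel {a b : ℝ} (ha : 0 < a) (hb : 0 < b) (x : Rn n) :
    ∫ y, heatKernel n a (x - y) * heatKernel n b y = heatKernel n (a + b) x := by
  have hc : 0 < a * b / (a + b) := by positivity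
  simp_rw [heatKernel_mul_heatKernel ha hb]
  rw [integral_const_mul, integral_sub_right_eq_self (heatKernel n (a * b / (a + b))),
    integral_heatKernel hc, mul_one]

/-- The time derivative of the heat kernel, in closed form. -/
def dtHeat (n : ℕ) (t : ℝ) (x : Rn n) : ℝ :=
  (‖x‖ ^ 2 / (4 * t ^ 2) - n / (2 * t)) * heatKernel n t x

lemma hasDerivAt_heatKernel_time {t : ℝ} (ht : 0 < t) (x : Rn n) :
    HasDerivAt (fun s => heatKernel n s x) (dtHeat n t x) t := by
  have h1 : HasDerivAt (fun s : ℝ => 4 * π * s) (4 * π) t := by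
    simpa using (hasDerivAt_id t).const_mul (4 * π)
  have hp : 4 * π * t ≠ 0 := by positivity
  have h2 := h1.rpow_const (p := -(n : ℝ) / 2) (Or.inl hp)
  have h3 : HasDerivAt (fun s : ℝ => -‖x‖ ^ 2 / (4 * s)) (‖x‖ ^ 2 / (4 * t ^ 2)) t := by
    have h4 : HasDerivAt (fun s : ℝ => 4 * s) 4 t := by
      simpa using (hasDerivAt_id t).const_mul (4 : ℝ)
    have := (hasDerivAt_const t (-‖x‖ ^ 2)).div h4 (by positivity)
    refine this.congr_deriv ?_
    field_simp; ring
  refine (h2.mul h3.exp).congr_deriv ?_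
  unfold dtHeat heatKernel
  rw [Real.rpow_sub_one hp]
  field_simp
  ring

@[fun_prop]
lemma continuous_dtHeat (t : ℝ) : Continuous (dtHeat n t) := by
  unfold dtHeat; fun_prop

/-- `|∂ₜG_t| ≤ C t^{-1} G_{2t}`. -/
lemma abs_dtHeat_le {t : ℝ} (ht : 0 < t) (x : Rn n) :
    |dtHeat n t x| ≤ 3 * heatC n * (n + 1) / t * heatKernel n (2 * t) x := by
  have h := norm_sq_mul_heatKernel_le ht x
  have hG := (heatKernel_pos (n := n) (t := 2 * t) (by positivity) x).le
  have hG' := (heatKernel_pos (n := n) (t := t) (by positivity) x).le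
  have hC := heatC_pos n
  have h2 : heatKernel n t x ≤ heatC n * heatKernel n (2 * t) x := by
    rw [heatKernel_two_mul ht x, heatC]
    gcongr
    have : Real.exp (-‖x‖ ^ 2 / (8 * t)) ≤ 1 := by
      rw [Real.exp_le_one_iff, neg_div]; exact neg_nonpos.2 (by positivity)
    have h4 : (0 : ℝ) ≤ n := by positivity
    linarith
  have h1 : |dtHeat n t x| ≤ ‖x‖ ^ 2 / (4 * t ^ 2) * heatKernel n t x
      + n / (2 * t) * heatKernel n t x := by
    rw [dtHeat, sub_mul]
    refine (abs_sub _ _).trans (le_of_eq ?_)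
    rw [abs_of_nonneg (by positivity), abs_of_nonneg (by positivity)]
  refine h1.trans ?_
  have e1 : ‖x‖ ^ 2 / (4 * t ^ 2) * heatKernel n t x
      ≤ 2 * heatC n / t * heatKernel n (2 * t) x := by
    calc _ = 1 / (4 * t ^ 2) * (‖x‖ ^ 2 * heatKernel n t x) := by ring
      _ ≤ 1 / (4 * t ^ 2) * (8 * heatC n * t * heatKernel n (2 * t) x) := by gcongr
      _ = _ := by field_simp; ring
  have e2 : n / (2 * t) * heatKernel n t x ≤ n * heatC n / t * heatKernel n (2 * t) x := by
    calc _ ≤ n / (2 * t) * (heatC n * heatKernel n (2 * t) x) := by gcongr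
      _ = (1 / 2) * (n * heatC n / t * heatKernel n (2 * t) x) := by field_simp
      _ ≤ _ := by
        have : 0 ≤ n * heatC n / t * heatKernel n (2 * t) x := by positivity
        linarith
  have e3 : 3 * heatC n * (n + 1) / t * heatKernel n (2 * t) x
      = 2 * heatC n / t * heatKernel n (2 * t) x + n * heatC n / t * heatKernel n (2 * t) x
        + (2 * n + 1) * heatC n / t * heatKernel n (2 * t) x := by ring
  have e4 : 0 ≤ (2 * n + 1) * heatC n / t * heatKernel n (2 * t) x := by positivity
  linarith

lemma continuousOn_heatKernel_uncurry :
    ContinuousOn (fun p : ℝ × Rn n => heatKernel n p.1 p.2) {p | 0 < p.1} := by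
  unfold heatKernel
  refine ContinuousOn.mul (ContinuousOn.rpow_const (by fun_prop) fun p hp => Or.inl ?_)
    (ContinuousOn.rexp (ContinuousOn.div (by fun_prop) (by fun_prop) fun p hp => ?_))
  · have : 0 < p.1 := hp
    positivity
  · have : 0 < p.1 := hp
    positivity

lemma continuousOn_gradHeat_uncurry :
    ContinuousOn (fun p : ℝ × Rn n => gradHeat n p.1 p.2) {p | 0 < p.1} := by
  unfold gradHeat
  refine ContinuousOn.smul (ContinuousOn.mul (ContinuousOn.neg (ContinuousOn.div (by fun_prop)
    (by fun_prop) fun p hp => ?_)) continuousOn_heatKernel_uncurry) (by fun_prop)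
  have : 0 < p.1 := hp
  positivity

/-- A heat kernel is dominated by any later one, up to a constant. -/
lemma heatKernel_le_of_le {s t : ℝ} (hs : 0 < s) (hst : s ≤ t) (x : Rn n) :
    heatKernel n s x ≤ (t / s) ^ ((n : ℝ) / 2) * heatKernel n t x := by
  unfold heatKernel
  have ht : 0 < t := hs.trans_le hst
  have e1 : (4 * π * s) ^ (-(n : ℝ) / 2)
      = (t / s) ^ ((n : ℝ) / 2) * (4 * π * t) ^ (-(n : ℝ) / 2) := by
    have h1 : 4 * π * t = t / s * (4 * π * s) := by field_simp
    have h2 : (t / s) ^ ((n : ℝ) / 2) * (t / s) ^ (-(n : ℝ) / 2) = 1 := by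
      rw [← Real.rpow_add (by positivity)]; ring_nf; simp
    rw [h1, Real.mul_rpow (x := t / s) (by positivity) (by positivity), ← mul_assoc, h2, one_mul]
  rw [e1, mul_assoc]
  gcongr _ * (_ * Real.exp ?_)
  rw [neg_div, neg_div]
  refine neg_le_neg ?_
  gcongr

lemma norm_gradHeat_le_const {s t : ℝ} (hs : 0 < s) (hst : s ≤ t) (x : Rn n) :
    ‖gradHeat n t x‖ ≤ heatC n / √s * (4 * π * s) ^ (-(n : ℝ) / 2) := by
  have ht : 0 < t := hs.trans_le hst
  have h1 := heatKernel_le (n := n) (t := 2 * t) (by positivity) x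
  have hC := heatC_pos n
  refine (norm_gradHeat_le ht x).trans ?_
  have h2 : (4 * π * (2 * t)) ^ (-(n : ℝ) / 2) ≤ (4 * π * s) ^ (-(n : ℝ) / 2) := by
    refine Real.rpow_le_rpow_of_nonpos (by positivity) (by nlinarith [Real.pi_pos]) ?_
    rw [neg_div]; exact neg_nonpos.2 (by positivity)
  have := (heatKernel_pos (n := n) (t := 2 * t) (by positivity) x).le
  gcongr
  exact h1.trans h2

end Gaussian

/-! ### Convolutions and translations in `L¹` -/

section LOne

variable {n : ℕ} {E₁ E₂ E₃ : Type*} [NormedAddCommGroup E₁] [NormedSpace ℝ E₁]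
  [NormedAddCommGroup E₂] [NormedSpace ℝ E₂] [NormedAddCommGroup E₃] [NormedSpace ℝ E₃]

lemma integral_norm_convolution_le {L : E₁ →L[ℝ] E₂ →L[ℝ] E₃} (hL : ∀ a b, ‖L a b‖ ≤ ‖a‖ * ‖b‖)
    {K : Rn n → E₁} {f : Rn n → E₂} (hK : Integrable K) (hf : Integrable f) :
    ∫ x, ‖(K ⋆[L, volume] f) x‖ ≤ (∫ x, ‖K x‖) * ∫ x, ‖f x‖ := by
  have h1 : Integrable (fun p : Rn n × Rn n => L (K p.2) (f (p.1 - p.2))) :=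
    hK.convolution_integrand L hf
  have h2 : Integrable (fun p : Rn n × Rn n => ‖K p.2‖ * ‖f (p.1 - p.2)‖) :=
    hK.norm.convolution_integrand (ContinuousLinearMap.mul ℝ ℝ) hf.norm
  calc ∫ x, ‖(K ⋆[L, volume] f) x‖ ≤ ∫ x, ∫ y, ‖L (K y) (f (x - y))‖ :=
        integral_mono_of_nonneg (ae_of_all _ fun _ => norm_nonneg _) h1.norm.integral_prod_left
          (ae_of_all _ fun x => norm_integral_le_integral_norm _)
    _ ≤ ∫ x, ∫ y, ‖K y‖ * ‖f (x - y)‖ := by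
        refine integral_mono_ae h1.norm.integral_prod_left h2.integral_prod_left ?_
        filter_upwards [h1.norm.prod_right_ae, h2.prod_right_ae] with x hx1 hx2
        exact integral_mono hx1 hx2 fun y => hL _ _
    _ = ∫ y, ∫ x, ‖K y‖ * ‖f (x - y)‖ := integral_integral_swap h2
    _ = _ := by
        simp_rw [integral_const_mul, integral_sub_right_eq_self (fun x => ‖f x‖),
          integral_mul_const]

lemma norm_convolution_le {L : E₁ →L[ℝ] E₂ →L[ℝ] E₃} (hL : ∀ a b, ‖L a b‖ ≤ ‖a‖ * ‖b‖)
    {K : Rn n → E₁} {f : Rn n → E₂} {C : ℝ} (hK : ∀ x, ‖K x‖ ≤ C) (hf : Integrable f) (x : Rn n) :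
    ‖(K ⋆[L, volume] f) x‖ ≤ C * ∫ y, ‖f y‖ := by
  rw [convolution_eq_swap, ← integral_const_mul]
  refine norm_integral_le_of_norm_le (hf.norm.const_mul C) (ae_of_all _ fun y => ?_)
  exact (hL _ _).trans (by gcongr; exact hK _)

lemma integrable_convolution_integrand_of_bounded {L : E₁ →L[ℝ] E₂ →L[ℝ] E₃}
    (hL : ∀ a b, ‖L a b‖ ≤ ‖a‖ * ‖b‖)
    {K : Rn n → E₁} {f : Rn n → E₂} {C : ℝ} (hKm : AEStronglyMeasurable K)
    (hK : ∀ x, ‖K x‖ ≤ C) (hf : Integrable f) (x : Rn n) :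
    Integrable fun y => L (K (x - y)) (f y) := by
  have hm : AEStronglyMeasurable (fun y => K (x - y)) :=
    hKm.comp_quasiMeasurePreserving (quasiMeasurePreserving_sub_left volume x)
  refine (hf.norm.const_mul C).mono' (L.aestronglyMeasurable_comp₂ hm hf.aestronglyMeasurable)
    (ae_of_all _ fun y => (hL _ _).trans ?_)
  gcongr; exact hK _

/-- Continuity of the pairing of bounded kernels, converging pointwise, with `L¹` functions,
converging in norm. -/
lemma tendsto_integral_bilin {ι : Type*} {l : Filter ι} [l.IsCountablyGenerated]
    {L : E₁ →L[ℝ] E₂ →L[ℝ] E₃} (hL : ∀ a b, ‖L a b‖ ≤ ‖a‖ * ‖b‖)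
    {K : ι → Rn n → E₁} {K₀ : Rn n → E₁} {f : ι → Rn n → E₂} {f₀ : Rn n → E₂} {C : ℝ}
    (hKm : ∀ᶠ i in l, AEStronglyMeasurable (K i)) (hKb : ∀ᶠ i in l, ∀ y, ‖K i y‖ ≤ C)
    (hK : ∀ y, Tendsto (fun i => K i y) l (𝓝 (K₀ y)))
    (hfi : ∀ᶠ i in l, Integrable (f i)) (hf₀ : Integrable f₀)
    (hf : Tendsto (fun i => ∫ y, ‖f i y - f₀ y‖) l (𝓝 0)) :
    Tendsto (fun i => ∫ y, L (K i y) (f i y)) l (𝓝 (∫ y, L (K₀ y) (f₀ y))) := by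
  have h1 : Tendsto (fun i => ∫ y, L (K i y) (f₀ y)) l (𝓝 (∫ y, L (K₀ y) (f₀ y))) := by
    refine tendsto_integral_filter_of_dominated_convergence (fun y => C * ‖f₀ y‖) ?_ ?_
      (hf₀.norm.const_mul C) (ae_of_all _ fun y => ?_)
    · filter_upwards [hKm] with i hi
      exact L.aestronglyMeasurable_comp₂ hi hf₀.aestronglyMeasurable
    · filter_upwards [hKb] with i hi
      exact ae_of_all _ fun y => (hL _ _).trans (by gcongr; exact hi y)
    · exact ((L.flip (f₀ y)).continuous.tendsto _).comp (hK y)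
  have h2 : Tendsto (fun i => ∫ y, L (K i y) (f i y - f₀ y)) l (𝓝 0) := by
    have h3 : Tendsto (fun i => C * ∫ y, ‖f i y - f₀ y‖) l (𝓝 0) := by simpa using hf.const_mul C
    refine squeeze_zero_norm' ?_ h3
    filter_upwards [hKb, hfi] with i hi hii
    rw [← integral_const_mul]
    refine norm_integral_le_of_norm_le ((hii.sub hf₀).norm.const_mul C) (ae_of_all _ fun y => ?_)
    exact (hL _ _).trans (by gcongr; exact hi y)
  have h4 := h2.add h1
  rw [zero_add] at h4
  refine h4.congr' ?_
  filter_upwards [hKm, hKb, hfi] with i hm hi hii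
  have a1 : Integrable fun y => L (K i y) (f i y) :=
    (hii.norm.const_mul C).mono' (L.aestronglyMeasurable_comp₂ hm hii.aestronglyMeasurable)
      (ae_of_all _ fun y => (hL _ _).trans (by gcongr; exact hi y))
  have a2 : Integrable fun y => L (K i y) (f₀ y) :=
    (hf₀.norm.const_mul C).mono' (L.aestronglyMeasurable_comp₂ hm hf₀.aestronglyMeasurable)
      (ae_of_all _ fun y => (hL _ _).trans (by gcongr; exact hi y))
  simp only [map_sub]
  rw [integral_sub a1 a2]
  abel

omit [NormedSpace ℝ E₁] in
/-- Translations are continuous in `L¹`. -/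
lemma tendsto_integral_norm_translate_sub {f : Rn n → E₁} (hf : Integrable f) :
    Tendsto (fun z : Rn n => ∫ x, ‖f (x + z) - f x‖) (𝓝 0) (𝓝 0) := by
  have hmp : ∀ z : Rn n, MeasurePreserving (fun x : Rn n => x + z) volume volume :=
    fun z => measurePreserving_add_right volume z
  let T : Rn n → C(Rn n, Rn n) := fun z => ⟨fun x => x + z, by fun_prop⟩
  have hT : Continuous T := by
    have : Continuous fun p : Rn n × Rn n => p.2 + p.1 := by fun_prop
    exact (ContinuousMap.curry ⟨_, this⟩).continuous
  let F := (memLp_one_iff_integrable.2 hf).toLp f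
  have : Fact ((1 : ℝ≥0∞) ≤ 1) := ⟨le_rfl⟩
  have hc : Continuous fun z => Lp.compMeasurePreserving (T z) (hmp z) F :=
    Continuous.compMeasurePreservingLp (continuous_const (y := F)) hT hmp (by simp)
  have h0 : Lp.compMeasurePreserving (T 0) (hmp 0) F = F := by
    refine Lp.ext ?_
    filter_upwards [Lp.coeFn_compMeasurePreserving F (hmp 0)] with x hx
    simp only [T] at hx ⊢
    erw [hx]; simp
  have h1 : Tendsto (fun z => ‖Lp.compMeasurePreserving (T z) (hmp z) F - F‖) (𝓝 0) (𝓝 0) := by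
    have := ((hc.tendsto 0).sub_const F).norm
    rw [h0, sub_self, norm_zero] at this
    exact this
  refine h1.congr fun z => ?_
  rw [L1.norm_eq_integral_norm]
  refine integral_congr_ae ?_
  have e1 : F =ᵐ[volume] f := MemLp.coeFn_toLp _
  filter_upwards [Lp.coeFn_compMeasurePreserving F (hmp z), e1,
    (hmp z).quasiMeasurePreserving.ae e1, Lp.coeFn_sub (Lp.compMeasurePreserving (T z) (hmp z) F) F]
    with x h1 h2 h3 h4
  rw [h4, Pi.sub_apply, h2]
  erw [h1]
  simp only [Function.comp]
  erw [h3]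

/-- A `C¹` function with integrable gradient moves in `L¹` by at most `‖z‖ ∫ ‖∇f‖` under the
translation by `z`. -/
lemma integral_norm_translate_sub_le {f : Rn n → ℝ} {f' : Rn n → Rn n}
    (hf : ∀ x, HasGradientAt f (f' x) x) (hc : Continuous f') (hi : Integrable f') (z : Rn n) :
    ∫ x, ‖f (x + z) - f x‖ ≤ ‖z‖ * ∫ x, ‖f' x‖ := by
  have hcont : Continuous fun p : Rn n × ℝ => f' (p.1 + p.2 • z) := by fun_prop
  have hshift : ∀ θ : ℝ, ∫ x, ‖f' (x + θ • z)‖ = ∫ x, ‖f' x‖ :=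
    fun θ => integral_add_right_eq_self (fun x => ‖f' x‖) (θ • z)
  have hInt : Integrable (fun p : Rn n × ℝ => ‖f' (p.1 + p.2 • z)‖)
      (volume.prod (volume.restrict (Ioc (0 : ℝ) 1))) := by
    rw [integrable_prod_iff' hcont.norm.aestronglyMeasurable]
    refine ⟨ae_of_all _ fun θ => (hi.comp_add_right (θ • z)).norm, ?_⟩
    simp only [norm_norm]
    simp_rw [hshift]
    exact integrable_const _
  have key : ∀ x, ‖f (x + z) - f x‖ ≤ ‖z‖ * ∫ θ in Ioc (0 : ℝ) 1, ‖f' (x + θ • z)‖ := by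
    intro x
    have hd : ∀ θ ∈ uIcc (0 : ℝ) 1, HasDerivAt (fun θ : ℝ => f (x + θ • z))
        (inner ℝ (f' (x + θ • z)) z) θ := by
      intro θ _
      have h1 := (hasGradientAt_iff_hasFDerivAt.1 (hf (x + θ • z)))
      have h2 : HasDerivAt (fun θ : ℝ => x + θ • z) z θ := by
        simpa using ((hasDerivAt_id θ).smul_const z).const_add x
      simpa [Function.comp_def] using h1.comp_hasDerivAt θ h2
    have hci : Continuous fun θ : ℝ => (inner ℝ (f' (x + θ • z)) z : ℝ) := by fun_prop
    have := intervalIntegral.integral_eq_sub_of_hasDerivAt hd (hci.intervalIntegrable 0 1)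
    simp only [one_smul, zero_smul, add_zero] at this
    rw [← this, intervalIntegral.integral_of_le zero_le_one, ← integral_const_mul]
    have hc2 : Continuous fun θ : ℝ => ‖z‖ * ‖f' (x + θ • z)‖ := by fun_prop
    refine norm_integral_le_of_norm_le
      (((hc2.intervalIntegrable 0 1).1)) (ae_of_all _ fun θ => ?_)
    rw [mul_comm]; exact norm_inner_le_norm _ _
  calc ∫ x, ‖f (x + z) - f x‖ ≤ ∫ x, ‖z‖ * ∫ θ in Ioc (0 : ℝ) 1, ‖f' (x + θ • z)‖ :=
        integral_mono_of_nonneg (ae_of_all _ fun _ => norm_nonneg _)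
          (hInt.integral_prod_left.const_mul _) (ae_of_all _ key)
    _ = ‖z‖ * ∫ θ in Ioc (0 : ℝ) 1, ∫ x, ‖f' (x + θ • z)‖ := by
        rw [integral_const_mul, integral_integral_swap hInt]
    _ = _ := by
        simp_rw [hshift]
        simp

/-- Gaussian mollification `G_δ * f`, for vector-valued `f`. -/
def mollify (δ : ℝ) (f : Rn n → E₁) : Rn n → E₁ :=
  heatKernel n δ ⋆[ContinuousLinearMap.lsmul ℝ ℝ, volume] f

lemma mollify_apply (δ : ℝ) (f : Rn n → E₁) (x : Rn n) :
    mollify δ f x = ∫ y, heatKernel n δ (x - y) • f y := by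
  rw [mollify, convolution_eq_swap]; rfl

lemma mollify_apply' (δ : ℝ) (f : Rn n → E₁) (x : Rn n) :
    mollify δ f x = ∫ y, heatKernel n δ y • f (x - y) := rfl

lemma conv_heatKernel (δ : ℝ) (f : Rn n → ℝ) : conv (heatKernel n δ) f = mollify δ f := rfl

lemma norm_lsmul_apply_le (a : ℝ) (b : E₁) :
    ‖ContinuousLinearMap.lsmul ℝ ℝ a b‖ ≤ ‖a‖ * ‖b‖ := by
  simp [norm_smul]

lemma integrable_mollify {δ : ℝ} (hδ : 0 < δ) {f : Rn n → E₁} (hf : Integrable f) :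
    Integrable (mollify δ f) :=
  (integrable_heatKernel hδ).integrable_convolution _ hf

lemma integral_norm_mollify_le {δ : ℝ} (hδ : 0 < δ) {f : Rn n → E₁} (hf : Integrable f) :
    ∫ x, ‖mollify δ f x‖ ≤ ∫ x, ‖f x‖ := by
  have h := integral_norm_convolution_le norm_lsmul_apply_le (integrable_heatKernel (n := n) hδ) hf
  have h2 : ∫ x : Rn n, ‖heatKernel n δ x‖ = 1 := by
    rw [← integral_heatKernel (n := n) hδ]
    congr 1; ext x; exact Real.norm_of_nonneg (heatKernel_pos hδ x).le
  rwa [h2, one_mul] at h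

lemma norm_heatKernel_le {t : ℝ} (ht : 0 < t) (x : Rn n) :
    ‖heatKernel n t x‖ ≤ (4 * π * t) ^ (-(n : ℝ) / 2) := by
  rw [Real.norm_of_nonneg (heatKernel_pos ht x).le]; exact heatKernel_le ht x

lemma norm_mollify_le {δ : ℝ} (hδ : 0 < δ) {f : Rn n → E₁} (hf : Integrable f) (x : Rn n) :
    ‖mollify δ f x‖ ≤ (4 * π * δ) ^ (-(n : ℝ) / 2) * ∫ y, ‖f y‖ :=
  norm_convolution_le norm_lsmul_apply_le (norm_heatKernel_le hδ) hf x

lemma integrable_heatKernel_smul {δ : ℝ} (hδ : 0 < δ) {f : Rn n → E₁} (hf : Integrable f)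
    (x : Rn n) : Integrable fun y => heatKernel n δ (x - y) • f y :=
  integrable_convolution_integrand_of_bounded norm_lsmul_apply_le
    (continuous_heatKernel δ).aestronglyMeasurable (norm_heatKernel_le hδ) hf x

lemma integrable_heatKernel_sub {δ : ℝ} (hδ : 0 < δ) (x : Rn n) :
    Integrable fun y => heatKernel n δ (x - y) :=
  (integrable_heatKernel hδ).comp_sub_left x

lemma integral_heatKernel_sub {δ : ℝ} (hδ : 0 < δ) (x : Rn n) :
    ∫ y, heatKernel n δ (x - y) = 1 := by
  rw [integral_sub_left_eq_self (heatKernel n δ), integral_heatKernel hδ]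

lemma mollify_sub {δ : ℝ} (hδ : 0 < δ) {f g : Rn n → E₁} (hf : Integrable f) (hg : Integrable g)
    (x : Rn n) : mollify δ (fun y => f y - g y) x = mollify δ f x - mollify δ g x := by
  simp only [mollify_apply, smul_sub]
  exact integral_sub (integrable_heatKernel_smul hδ hf x) (integrable_heatKernel_smul hδ hg x)

lemma integrable_heatKernel_smul_prod {δ : ℝ} (hδ : 0 < δ) {f : Rn n → E₁} (hf : Integrable f) :
    Integrable fun p : Rn n × Rn n => heatKernel n δ p.2 • (f (p.1 - p.2) - f p.1) := by
  have h1 : Integrable (fun p : Rn n × Rn n => heatKernel n δ p.2 • f (p.1 - p.2)) :=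
    (integrable_heatKernel hδ).convolution_integrand (ContinuousLinearMap.lsmul ℝ ℝ) hf
  have h2 : Integrable (fun p : Rn n × Rn n => heatKernel n δ p.2 • f p.1) := by
    have := ((integrable_heatKernel (n := n) hδ).smul_prod hf).swap
    exact this
  simp only [smul_sub]
  exact h1.sub h2

/-- A modulus of continuity of `f` in `L¹` controls the rate at which `G_δ * f` converges to
`f`. -/
lemma integral_norm_mollify_sub_le {δ : ℝ} (hδ : 0 < δ) {f : Rn n → E₁} [CompleteSpace E₁]
    (hf : Integrable f)
    {a c : ℝ} (hω : ∀ y, ∫ x, ‖f (x - y) - f x‖ ≤ a + c * ‖y‖) (hc : 0 ≤ c) :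
    ∫ x, ‖mollify δ f x - f x‖ ≤ a + c * (heatC n * √δ) := by
  have hI := integrable_heatKernel_smul_prod hδ hf
  have e : ∀ᵐ x : Rn n, mollify δ f x - f x = ∫ y, heatKernel n δ y • (f (x - y) - f x) := by
    have h1 : Integrable (fun p : Rn n × Rn n => heatKernel n δ p.2 • f (p.1 - p.2)) :=
      (integrable_heatKernel hδ).convolution_integrand (ContinuousLinearMap.lsmul ℝ ℝ) hf
    filter_upwards [h1.prod_right_ae] with x hx
    simp only [smul_sub]
    rw [integral_sub hx ((integrable_heatKernel hδ).smul_const _), integral_smul_const,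
      integral_heatKernel hδ, one_smul, mollify_apply']
  rw [integral_congr_ae (e.mono fun x hx => congrArg norm hx)]
  have hmaj : Integrable fun y : Rn n => a * heatKernel n δ y + c * (‖y‖ * heatKernel n δ y) :=
    ((integrable_heatKernel hδ).const_mul a).add ((integrable_norm_mul_heatKernel hδ).const_mul c)
  calc ∫ x, ‖∫ y, heatKernel n δ y • (f (x - y) - f x)‖
      ≤ ∫ x, ∫ y, ‖heatKernel n δ y • (f (x - y) - f x)‖ :=
        integral_mono_of_nonneg (ae_of_all _ fun _ => norm_nonneg _) hI.norm.integral_prod_left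
          (ae_of_all _ fun x => norm_integral_le_integral_norm _)
    _ = ∫ y, ∫ x, ‖heatKernel n δ y • (f (x - y) - f x)‖ := integral_integral_swap hI.norm
    _ ≤ ∫ y : Rn n, (a * heatKernel n δ y + c * (‖y‖ * heatKernel n δ y)) := by
        refine integral_mono hI.norm.integral_prod_right hmaj fun y => ?_
        have hG := (heatKernel_pos (n := n) hδ y).le
        simp only [norm_smul, integral_const_mul, Real.norm_of_nonneg hG]
        calc _ ≤ heatKernel n δ y * (a + c * ‖y‖) := by gcongr; exact hω y
          _ = _ := by ring
    _ ≤ _ := by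
        rw [integral_add ((integrable_heatKernel hδ).const_mul a)
          ((integrable_norm_mul_heatKernel hδ).const_mul c), integral_const_mul,
          integral_const_mul, integral_heatKernel hδ, mul_one]
        gcongr
        exact integral_norm_mul_heatKernel_le hδ

omit [NormedSpace ℝ E₁] in
lemma integral_norm_translate_le {f : Rn n → E₁} (hf : Integrable f) (y : Rn n) :
    ∫ x, ‖f (x - y) - f x‖ ≤ 2 * ∫ x, ‖f x‖ := by
  calc ∫ x, ‖f (x - y) - f x‖ ≤ ∫ x, (‖f (x - y)‖ + ‖f x‖) :=
        integral_mono ((hf.comp_sub_right y).sub hf).norm ((hf.comp_sub_right y).norm.add hf.norm)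
          fun x => norm_sub_le _ _
    _ = _ := by
        rw [integral_add (hf.comp_sub_right y).norm hf.norm,
          integral_sub_right_eq_self (fun x => ‖f x‖)]
        ring

lemma tendsto_integral_norm_mollify_sub {f : Rn n → E₁} [CompleteSpace E₁] (hf : Integrable f) :
    Tendsto (fun δ : ℝ => ∫ x, ‖mollify δ f x - f x‖) (𝓝[>] 0) (𝓝 0) := by
  rw [Metric.tendsto_nhds]
  intro ε hε
  have h := tendsto_integral_norm_translate_sub hf
  rw [Metric.tendsto_nhds_nhds] at h
  obtain ⟨r, hr, hr2⟩ := h (ε / 2) (by positivity)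
  set A := ∫ x, ‖f x‖ with hA
  have hA0 : 0 ≤ A := integral_nonneg fun _ => norm_nonneg _
  have hω : ∀ y, ∫ x, ‖f (x - y) - f x‖ ≤ ε / 2 + 2 * A / r * ‖y‖ := by
    intro y
    by_cases hy : ‖y‖ < r
    · have := hr2 (x := -y) (by simpa using hy)
      rw [Real.dist_eq, sub_zero, abs_of_nonneg (integral_nonneg fun _ => norm_nonneg _)] at this
      simp only [← sub_eq_add_neg] at this
      have h2 : 0 ≤ 2 * A / r * ‖y‖ := by positivity
      linarith
    · push Not at hy
      refine (integral_norm_translate_le hf y).trans ?_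
      have : 2 * A ≤ 2 * A / r * ‖y‖ := by
        rw [div_mul_eq_mul_div, le_div_iff₀ hr]; gcongr
      linarith
  have hlim : Tendsto (fun δ : ℝ => 2 * A / r * (heatC n * √δ)) (𝓝[>] 0) (𝓝 0) := by
    have : Continuous fun δ : ℝ => 2 * A / r * (heatC n * √δ) := by fun_prop
    simpa using (this.tendsto 0).mono_left nhdsWithin_le_nhds
  have h3 := hlim.eventually (gt_mem_nhds (show 0 < ε / 2 by positivity))
  filter_upwards [h3, self_mem_nhdsWithin] with δ h4 h5
  have := integral_norm_mollify_sub_le (Set.mem_Ioi.1 h5) hf hω (by positivity)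
  rw [Real.dist_eq, sub_zero, abs_of_nonneg (integral_nonneg fun _ => norm_nonneg _)]
  linarith

end LOne

/-! ### Mollification and convolution with the gradient kernel -/

section Pairing

variable {n : ℕ} {E₁ E₂ E₃ : Type*} [NormedAddCommGroup E₁] [NormedSpace ℝ E₁] [CompleteSpace E₁]
  [NormedAddCommGroup E₂] [NormedSpace ℝ E₂] [NormedAddCommGroup E₃] [NormedSpace ℝ E₃]
  [CompleteSpace E₃]

omit [CompleteSpace E₁] [CompleteSpace E₃] in
lemma integrable_smul_convolution_integrand {L : E₁ →L[ℝ] E₂ →L[ℝ] E₃} {K : Rn n → E₁}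
    {f : Rn n → E₂} {φ : Rn n → ℝ} {C : ℝ} (hK : Integrable K) (hf : Integrable f)
    (hφ : AEStronglyMeasurable φ) (hφb : ∀ x, ‖φ x‖ ≤ C) :
    Integrable fun p : Rn n × Rn n => φ p.1 • L (K (p.1 - p.2)) (f p.2) := by
  have h1 : Integrable (fun p : Rn n × Rn n => L.flip (f p.2) (K (p.1 - p.2))) :=
    hf.convolution_integrand L.flip hK
  exact h1.bdd_smul C hφ.comp_fst (ae_of_all _ fun p => hφb p.1)

/-- Fubini: a convolution is tested by testing its kernel. -/
lemma integral_smul_convolution {L : E₁ →L[ℝ] E₂ →L[ℝ] E₃} {K : Rn n → E₁} {f : Rn n → E₂}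
    {φ : Rn n → ℝ} {C : ℝ} (hK : Integrable K) (hf : Integrable f)
    (hφ : AEStronglyMeasurable φ) (hφb : ∀ x, ‖φ x‖ ≤ C) :
    ∫ x, φ x • (K ⋆[L, volume] f) x = ∫ y, L (∫ x, φ x • K (x - y)) (f y) := by
  have h2 := integrable_smul_convolution_integrand (L := L) hK hf hφ hφb
  calc ∫ x, φ x • (K ⋆[L, volume] f) x = ∫ x, ∫ y, φ x • L (K (x - y)) (f y) := by
        congr 1; ext1 x; rw [convolution_eq_swap, integral_smul]
    _ = ∫ y, ∫ x, φ x • L (K (x - y)) (f y) := integral_integral_swap h2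
    _ = _ := by
        congr 1; ext1 y
        have h3 : Integrable fun x => φ x • K (x - y) :=
          (hK.comp_sub_right y).bdd_smul C hφ (ae_of_all _ hφb)
        have := (L.flip (f y)).integral_comp_comm h3
        simp only [ContinuousLinearMap.flip_apply, map_smul] at this
        rw [← this]

end Pairing

section Mollify

variable {n : ℕ} {E₁ : Type*} [NormedAddCommGroup E₁] [NormedSpace ℝ E₁] [CompleteSpace E₁]

/-- The convolution `∇G_r * F` of two vector fields. -/
def divMoll (r : ℝ) (F : Rn n → Rn n) : Rn n → ℝ := gradHeat n r ⋆[innerSL ℝ, volume] F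

lemma divMoll_apply (r : ℝ) (F : Rn n → Rn n) (x : Rn n) :
    divMoll r F x = ∫ y, inner ℝ (gradHeat n r (x - y)) (F y) := by
  rw [divMoll, convolution_eq_swap]; rfl

lemma norm_innerSL_apply_le (a b : Rn n) : ‖innerSL ℝ a b‖ ≤ ‖a‖ * ‖b‖ := norm_inner_le_norm a b

lemma integrable_divMoll {r : ℝ} (hr : 0 < r) {F : Rn n → Rn n} (hF : Integrable F) :
    Integrable (divMoll r F) :=
  (integrable_gradHeat hr).integrable_convolution _ hF

lemma integral_norm_divMoll_le {r : ℝ} (hr : 0 < r) {F : Rn n → Rn n} (hF : Integrable F) :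
    ∫ x, ‖divMoll r F x‖ ≤ heatC n / √r * ∫ x, ‖F x‖ :=
  (integral_norm_convolution_le norm_innerSL_apply_le (integrable_gradHeat hr) hF).trans
    (mul_le_mul_of_nonneg_right (integral_norm_gradHeat_le hr)
      (integral_nonneg fun _ => norm_nonneg _))

lemma mollify_mollify {δ r : ℝ} (hδ : 0 < δ) (hr : 0 < r) {f : Rn n → E₁} (hf : Integrable f)
    (x : Rn n) : mollify δ (mollify r f) x = mollify (δ + r) f x := by
  rw [mollify_apply, mollify, integral_smul_convolution (φ := fun y => heatKernel n δ (x - y))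
    (integrable_heatKernel hr) hf (by fun_prop : Continuous _).aestronglyMeasurable
    (fun y => norm_heatKernel_le hδ _), mollify_apply]
  congr 1; ext1 w
  have h := integral_sub_right_eq_self
    (fun y => heatKernel n δ ((x - w) - y) * heatKernel n r y) w (μ := volume)
  rw [integral_heatKernel_mul_heatKernel hδ hr] at h
  rw [← h]
  simp

lemma mollify_divMoll {δ r : ℝ} (hδ : 0 < δ) (hr : 0 < r) {F : Rn n → Rn n} (hF : Integrable F)
    (x : Rn n) : mollify δ (divMoll r F) x = divMoll (δ + r) F x := by
  rw [mollify_apply, divMoll, integral_smul_convolution (φ := fun y => heatKernel n δ (x - y))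
    (integrable_gradHeat hr) hF (by fun_prop : Continuous _).aestronglyMeasurable
    (fun y => norm_heatKernel_le hδ _), divMoll_apply]
  congr 1; ext1 w
  have h := integral_sub_right_eq_self
    (fun y => heatKernel n δ ((x - w) - y) • gradHeat n r y) w (μ := volume)
  rw [integral_heatKernel_smul_gradHeat hδ hr] at h
  rw [← h]
  simp only [sub_sub_sub_cancel_right]
  rfl

end Mollify

/-! ### The velocity field and the drift -/

section Velocity

variable {n : ℕ} {E : Type*} [NormedAddCommGroup E] [NormedSpace ℝ E]
variable {g : Rn n → E} {Γ : ℝ}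

/-- The convolution `g * ρ` of a bounded field `g` with a density `ρ`. -/
def vel (g : Rn n → E) (ρ : Rn n → ℝ) : Rn n → E :=
  ρ ⋆[ContinuousLinearMap.lsmul ℝ ℝ, volume] g

lemma vel_apply (ρ : Rn n → ℝ) (x : Rn n) : vel g ρ x = ∫ y, ρ y • g (x - y) := rfl

lemma drift_eq (g : Rn n → Rn n) (ρ : Rn n → ℝ) : drift g ρ = fun x => ρ x • vel g ρ x := rfl

omit [NormedSpace ℝ E] in
lemma ae_norm_sub_le (hΓ : ∀ᵐ x, ‖g x‖ ≤ Γ) (x : Rn n) : ∀ᵐ y : Rn n, ‖g (x - y)‖ ≤ Γ :=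
  (quasiMeasurePreserving_sub_left volume x).ae hΓ

lemma integrable_vel_integrand (hg : AEStronglyMeasurable g) (hΓ : ∀ᵐ x, ‖g x‖ ≤ Γ)
    {ρ : Rn n → ℝ} (hρ : Integrable ρ) (x : Rn n) : Integrable fun y => ρ y • g (x - y) := by
  have hm : AEStronglyMeasurable (fun y => g (x - y)) :=
    hg.comp_quasiMeasurePreserving (quasiMeasurePreserving_sub_left volume x)
  exact hρ.smul_bdd Γ hm (ae_norm_sub_le hΓ x)

lemma norm_vel_le (hΓ : ∀ᵐ x, ‖g x‖ ≤ Γ) {ρ : Rn n → ℝ} (hρ : Integrable ρ) (x : Rn n) :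
    ‖vel g ρ x‖ ≤ Γ * ∫ y, ‖ρ y‖ := by
  rw [vel_apply, ← integral_const_mul]
  refine norm_integral_le_of_norm_le (hρ.norm.const_mul Γ) ?_
  filter_upwards [ae_norm_sub_le hΓ x] with y hy
  rw [norm_smul, mul_comm]; gcongr

lemma vel_sub (hg : AEStronglyMeasurable g) (hΓ : ∀ᵐ x, ‖g x‖ ≤ Γ)
    {ρ σ : Rn n → ℝ} (hρ : Integrable ρ) (hσ : Integrable σ) (x : Rn n) :
    vel g ρ x - vel g σ x = vel g (fun y => ρ y - σ y) x := by
  simp only [vel_apply, sub_smul]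
  exact (integral_sub (integrable_vel_integrand hg hΓ hρ x)
    (integrable_vel_integrand hg hΓ hσ x)).symm

lemma norm_vel_sub_le (hg : AEStronglyMeasurable g) (hΓ : ∀ᵐ x, ‖g x‖ ≤ Γ)
    {ρ σ : Rn n → ℝ} (hρ : Integrable ρ) (hσ : Integrable σ) (x : Rn n) :
    ‖vel g ρ x - vel g σ x‖ ≤ Γ * ∫ y, ‖ρ y - σ y‖ := by
  rw [vel_sub hg hΓ hρ hσ]
  exact norm_vel_le hΓ (hρ.sub hσ) x

lemma vel_translate (ρ : Rn n → ℝ) (z x : Rn n) :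
    vel g ρ (x + z) = vel g (fun y => ρ (y + z)) x := by
  rw [vel_apply, vel_apply]
  rw [← integral_add_right_eq_self (fun y => ρ y • g (x + z - y)) z]
  simp

lemma aestronglyMeasurable_vel (hg : AEStronglyMeasurable g) {ρ : Rn n → ℝ}
    (hρ : AEStronglyMeasurable ρ) : AEStronglyMeasurable (vel g ρ) :=
  AEStronglyMeasurable.integral_prod_right'
    (hρ.convolution_integrand (ContinuousLinearMap.lsmul ℝ ℝ) hg)

lemma integrable_smul_vel (hg : AEStronglyMeasurable g) (hΓ : ∀ᵐ x, ‖g x‖ ≤ Γ)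
    {ρ σ : Rn n → ℝ} (hρ : Integrable ρ) (hσ : Integrable σ) :
    Integrable fun x => ρ x • vel g σ x :=
  hρ.smul_bdd _ (aestronglyMeasurable_vel hg hσ.aestronglyMeasurable)
    (ae_of_all _ fun x => norm_vel_le hΓ hσ x)

lemma integrable_drift {g : Rn n → Rn n} (hg : AEStronglyMeasurable g) (hΓ : ∀ᵐ x, ‖g x‖ ≤ Γ)
    {ρ : Rn n → ℝ} (hρ : Integrable ρ) : Integrable (drift g ρ) :=
  integrable_smul_vel hg hΓ hρ hρ

lemma integral_norm_drift_le {g : Rn n → Rn n} (hg : AEStronglyMeasurable g)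
    (hΓ : ∀ᵐ x, ‖g x‖ ≤ Γ)
    {ρ : Rn n → ℝ} (hρ : Integrable ρ) :
    ∫ x, ‖drift g ρ x‖ ≤ Γ * (∫ x, ‖ρ x‖) ^ 2 := by
  calc ∫ x, ‖drift g ρ x‖ ≤ ∫ x, ‖ρ x‖ * (Γ * ∫ y, ‖ρ y‖) := by
        refine integral_mono (integrable_drift hg hΓ hρ).norm (hρ.norm.mul_const _) fun x => ?_
        simp only [drift_eq, norm_smul]
        gcongr; exact norm_vel_le hΓ hρ x
    _ = _ := by rw [integral_mul_const]; ring

lemma integral_norm_drift_sub_le {g : Rn n → Rn n} (hg : AEStronglyMeasurable g)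
    (hΓ : ∀ᵐ x, ‖g x‖ ≤ Γ)
    {ρ σ : Rn n → ℝ} (hρ : Integrable ρ) (hσ : Integrable σ) :
    ∫ x, ‖drift g ρ x - drift g σ x‖
      ≤ Γ * ((∫ x, ‖ρ x‖) + ∫ x, ‖σ x‖) * ∫ x, ‖ρ x - σ x‖ := by
  calc _ ≤ ∫ x, (‖ρ x - σ x‖ * (Γ * ∫ y, ‖ρ y‖) + ‖σ x‖ * (Γ * ∫ y, ‖ρ y - σ y‖)) := by
        refine integral_mono ((integrable_drift hg hΓ hρ).sub (integrable_drift hg hΓ hσ)).norm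
          (((hρ.sub hσ).norm.mul_const _).add (hσ.norm.mul_const _)) fun x => ?_
        simp only [drift_eq]
        have : ρ x • vel g ρ x - σ x • vel g σ x
            = (ρ x - σ x) • vel g ρ x + σ x • (vel g ρ x - vel g σ x) := by
          rw [sub_smul, smul_sub]; abel
        rw [this]
        refine (norm_add_le _ _).trans ?_
        rw [norm_smul, norm_smul]
        gcongr
        · exact norm_vel_le hΓ hρ x
        · exact norm_vel_sub_le hg hΓ hρ hσ x
    _ = _ := by
        have i1 : Integrable fun x => ‖ρ x - σ x‖ * (Γ * ∫ y, ‖ρ y‖) :=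
          (hρ.sub hσ).norm.mul_const _
        rw [integral_add i1 (hσ.norm.mul_const _), integral_mul_const, integral_mul_const]
        ring

end Velocity

/-! ### Mild solutions -/

section Sqrt

lemma intervalIntegrable_inv_sqrt (a b : ℝ) :
    IntervalIntegrable (fun s : ℝ => 1 / √s) volume a b := by
  have h := intervalIntegral.intervalIntegrable_rpow' (a := 0) (b := |a| + |b|)
    (r := -(1 / 2)) (by norm_num)
  have key : ∀ s : ℝ, 1 / √s = if 0 < s then s ^ (-(1 / 2) : ℝ) else 0 := by
    intro s
    split_ifs with hs
    · rw [Real.rpow_neg hs.le, Real.sqrt_eq_rpow, one_div]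
    · rw [Real.sqrt_eq_zero_of_nonpos (not_lt.1 hs), div_zero]
  have h2 : IntegrableOn (fun s : ℝ => 1 / √s) (Ioc 0 (|a| + |b|)) :=
    ((intervalIntegrable_iff_integrableOn_Ioc_of_le (by positivity)).1 h).congr_fun
      (fun s hs => by simp only [key, if_pos hs.1]) measurableSet_Ioc
  have h3 : IntegrableOn (fun s : ℝ => 1 / √s) (Iic 0) :=
    integrableOn_zero.congr_fun (fun s hs => by
      simp only [key, if_neg (not_lt.2 (Set.mem_Iic.1 hs))]) measurableSet_Iic
  rw [intervalIntegrable_iff]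
  refine (h3.union h2).mono_set fun s hs => ?_
  rcases le_or_gt s 0 with h | h
  · exact Or.inl h
  · refine Or.inr ⟨h, ?_⟩
    have := hs.2
    rcases max_cases a b with h | h <;> rw [h.1] at this <;>
      linarith [le_abs_self a, le_abs_self b, abs_nonneg a, abs_nonneg b]

lemma integral_inv_sqrt {t : ℝ} (ht : 0 ≤ t) : ∫ s in (0 : ℝ)..t, 1 / √s = 2 * √t := by
  have h : ∫ s in (0 : ℝ)..t, s ^ (-(1 / 2) : ℝ) = 2 * √t := by
    rw [integral_rpow (Or.inl (by norm_num)), Real.sqrt_eq_rpow]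
    norm_num; ring
  rw [← h]
  refine intervalIntegral.integral_congr_ae (ae_of_all _ fun s hs => ?_)
  rw [uIoc_of_le ht] at hs
  rw [Real.rpow_neg hs.1.le, Real.sqrt_eq_rpow, one_div]

lemma intervalIntegrable_inv_sqrt_sub (τ a b : ℝ) :
    IntervalIntegrable (fun s : ℝ => 1 / √(τ - s)) volume a b := by
  simpa using (intervalIntegrable_inv_sqrt (τ - a) (τ - b)).comp_sub_left τ

lemma integral_inv_sqrt_sub {t : ℝ} (ht : 0 ≤ t) :
    ∫ s in (0 : ℝ)..t, 1 / √(t - s) = 2 * √t := by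
  rw [intervalIntegral.integral_comp_sub_left (fun s => 1 / √s) t]
  simpa using integral_inv_sqrt ht

end Sqrt

section Mild

variable {n : ℕ} {g : Rn n → Rn n} {Γ : ℝ} {ρ₀ : Rn n →₁[volume] ℝ} {ρ : ℝ → (Rn n →₁[volume] ℝ)}

lemma integrable_coe (f : Rn n →₁[volume] ℝ) : Integrable f := L1.integrable_coeFn f

lemma integral_norm_coe (f : Rn n →₁[volume] ℝ) : ∫ x, ‖f x‖ = ‖f‖ :=
  (L1.norm_eq_integral_norm f).symm

lemma integral_norm_coe_sub (f h : Rn n →₁[volume] ℝ) : ∫ x, ‖f x - h x‖ = ‖f - h‖ := by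
  rw [L1.norm_eq_integral_norm]
  refine integral_congr_ae ?_
  filter_upwards [Lp.coeFn_sub f h] with x hx
  rw [hx]; rfl

lemma integral_norm_drift_coe_sub_le (hg : AEStronglyMeasurable g) (hΓ : ∀ᵐ x, ‖g x‖ ≤ Γ)
    (f h : Rn n →₁[volume] ℝ) :
    ∫ x, ‖drift g f x - drift g h x‖ ≤ Γ * (‖f‖ + ‖h‖) * ‖f - h‖ := by
  have := integral_norm_drift_sub_le hg hΓ (integrable_coe f) (integrable_coe h)
  rwa [integral_norm_coe, integral_norm_coe, integral_norm_coe_sub] at this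

lemma tendsto_integral_norm_drift_sub (hg : AEStronglyMeasurable g) (hΓ : ∀ᵐ x, ‖g x‖ ≤ Γ)
    {ι : Type*} {l : Filter ι} {f : ι → (Rn n →₁[volume] ℝ)} {f₀ : Rn n →₁[volume] ℝ}
    (h : Tendsto f l (𝓝 f₀)) :
    Tendsto (fun i => ∫ x, ‖drift g (f i) x - drift g f₀ x‖) l (𝓝 0) := by
  have h1 : Tendsto (fun i => Γ * (‖f i‖ + ‖f₀‖) * ‖f i - f₀‖) l (𝓝 0) := by
    have := ((h.norm.add_const ‖f₀‖).const_mul Γ).mul ((h.sub_const f₀).norm)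
    simpa using this
  exact squeeze_zero (fun _ => integral_nonneg fun _ => norm_nonneg _)
    (fun i => integral_norm_drift_coe_sub_le hg hΓ _ _) h1

lemma continuousAt_gradHeat {r : ℝ} (hr : 0 < r) (x : Rn n) :
    ContinuousAt (fun q : ℝ × Rn n => gradHeat n q.1 q.2) (r, x) := by
  have ho : IsOpen {p : ℝ × Rn n | 0 < p.1} := isOpen_lt continuous_const continuous_fst
  have hmem : (r, x) ∈ {p : ℝ × Rn n | 0 < p.1} := hr
  exact continuousOn_gradHeat_uncurry.continuousAt (ho.mem_nhds hmem)

/-- The Duhamel integrand `(s, x) ↦ (∇G_{τ-s} * F_s)(x)` is continuous before time `τ`. -/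
lemma continuousOn_duhamel (hg : AEStronglyMeasurable g) (hΓ : ∀ᵐ x, ‖g x‖ ≤ Γ)
    (hρ : ContinuousOn ρ (Ici 0)) (τ : ℝ) :
    ContinuousOn (fun p : ℝ × Rn n => divMoll (τ - p.1) (drift g (ρ p.1)) p.2)
      (Ico 0 τ ×ˢ univ) := by
  intro p₀ hp₀
  have hp1 : p₀.1 < τ := hp₀.1.2
  set l := 𝓝[Ico 0 τ ×ˢ univ] p₀
  have hfst : Tendsto (fun p : ℝ × Rn n => p.1) l (𝓝[Ici 0] p₀.1) := by
    refine tendsto_nhdsWithin_iff.2 ⟨continuous_fst.continuousAt.mono_left nhdsWithin_le_nhds, ?_⟩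
    filter_upwards [self_mem_nhdsWithin] with p hp using hp.1.1
  have hfst' : Tendsto (fun p : ℝ × Rn n => p.1) l (𝓝 p₀.1) :=
    continuous_fst.continuousAt.mono_left nhdsWithin_le_nhds
  have hsnd : Tendsto (fun p : ℝ × Rn n => p.2) l (𝓝 p₀.2) :=
    continuous_snd.continuousAt.mono_left nhdsWithin_le_nhds
  have hρt : Tendsto (fun p : ℝ × Rn n => ρ p.1) l (𝓝 (ρ p₀.1)) :=
    Tendsto.comp (hρ p₀.1 hp₀.1.1) hfst
  have hlt : ∀ᶠ p : ℝ × Rn n in l, (τ - p₀.1) / 2 ≤ τ - p.1 := by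
    filter_upwards [hfst'.eventually (gt_mem_nhds (show p₀.1 < (τ + p₀.1) / 2 by linarith))]
      with p hp
    linarith
  have hK : ∀ y, Tendsto (fun p : ℝ × Rn n => gradHeat n (τ - p.1) (p.2 - y)) l
      (𝓝 (gradHeat n (τ - p₀.1) (p₀.2 - y))) := by
    intro y
    have hc : ContinuousAt (fun q : ℝ × Rn n => gradHeat n q.1 q.2) (τ - p₀.1, p₀.2 - y) :=
      continuousAt_gradHeat (by linarith) _
    have h5 : Tendsto (fun p : ℝ × Rn n => ((τ - p.1, p.2 - y) : ℝ × Rn n)) l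
        (𝓝 (τ - p₀.1, p₀.2 - y)) := (hfst'.const_sub τ).prodMk_nhds (hsnd.sub_const y)
    have h6 := Filter.Tendsto.comp hc.tendsto h5
    simpa only [Function.comp_def] using h6
  have hb : ∀ᶠ p : ℝ × Rn n in l, ∀ y, ‖gradHeat n (τ - p.1) (p.2 - y)‖
      ≤ heatC n / √((τ - p₀.1) / 2) * (4 * π * ((τ - p₀.1) / 2)) ^ (-(n : ℝ) / 2) := by
    filter_upwards [hlt] with p hp y
    exact norm_gradHeat_le_const (by linarith) hp _
  have hm : ∀ᶠ p : ℝ × Rn n in l,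
      AEStronglyMeasurable (fun y => gradHeat n (τ - p.1) (p.2 - y)) volume :=
    Eventually.of_forall fun p => (by fun_prop : Continuous _).aestronglyMeasurable
  have key := tendsto_integral_bilin (L := innerSL ℝ) norm_innerSL_apply_le hm hb hK
    (Eventually.of_forall fun p : ℝ × Rn n => integrable_drift hg hΓ (integrable_coe (ρ p.1)))
    (integrable_drift hg hΓ (integrable_coe (ρ p₀.1)))
    (tendsto_integral_norm_drift_sub hg hΓ hρt)
  refine Tendsto.congr (fun p => ?_) (key.trans (le_of_eq (congrArg 𝓝 ?_)))
  · exact (divMoll_apply _ _ _).symm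
  · exact (divMoll_apply _ _ _).symm

lemma exists_norm_le (hρ : ContinuousOn ρ (Ici 0)) (T : ℝ) :
    ∃ R, 0 ≤ R ∧ ∀ s ∈ Icc 0 T, ‖ρ s‖ ≤ R := by
  obtain ⟨R, hR⟩ := (isCompact_Icc (a := (0 : ℝ)) (b := T)).exists_bound_of_continuousOn
    (hρ.mono Icc_subset_Ici_self)
  exact ⟨max R 0, le_max_right _ _, fun s hs => (hR s hs).trans (le_max_left _ _)⟩

lemma nonneg_of_ae_norm_le {E : Type*} [NormedAddCommGroup E] {g : Rn n → E}
    (hΓ : ∀ᵐ x, ‖g x‖ ≤ Γ) : 0 ≤ Γ := by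
  obtain ⟨x, hx⟩ := hΓ.exists
  exact (norm_nonneg _).trans hx

/-- The singularity of the Duhamel integrand at `s = τ` is integrable. -/
lemma integral_norm_duhamel_le (hg : AEStronglyMeasurable g) (hΓ : ∀ᵐ x, ‖g x‖ ≤ Γ)
    {R T τ s : ℝ} (hR : ∀ s ∈ Icc 0 T, ‖ρ s‖ ≤ R) (hs : s ∈ Icc 0 T) (hsτ : s < τ) :
    ∫ x, ‖divMoll (τ - s) (drift g (ρ s)) x‖ ≤ heatC n * Γ * R ^ 2 * (1 / √(τ - s)) := by
  have h1 := integral_norm_divMoll_le (n := n) (r := τ - s) (by linarith)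
    (integrable_drift hg hΓ (integrable_coe (ρ s)))
  have h2 := integral_norm_drift_le hg hΓ (integrable_coe (ρ s))
  rw [integral_norm_coe] at h2
  have hΓ0 := nonneg_of_ae_norm_le hΓ
  have hC := heatC_pos n
  have h3 : Γ * ‖ρ s‖ ^ 2 ≤ Γ * R ^ 2 := by gcongr; exact hR s hs
  calc _ ≤ heatC n / √(τ - s) * (Γ * R ^ 2) := h1.trans (by gcongr; exact h2.trans h3)
    _ = _ := by ring

/-- The Duhamel integrand is integrable in space-time, even up to the singularity. -/
lemma integrable_duhamel (hg : AEStronglyMeasurable g) (hΓ : ∀ᵐ x, ‖g x‖ ≤ Γ)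
    (hρ : ContinuousOn ρ (Ici 0)) {T τ : ℝ} (hT : T ≤ τ) :
    Integrable (fun p : ℝ × Rn n => divMoll (τ - p.1) (drift g (ρ p.1)) p.2)
      ((volume.restrict (Ioc 0 T)).prod volume) := by
  obtain ⟨R, -, hR⟩ := exists_norm_le hρ T
  have hae : (volume.restrict (Ioc 0 T)) = volume.restrict (Ioo (0 : ℝ) T) :=
    Measure.restrict_congr_set Ioo_ae_eq_Ioc.symm
  have hm : AEStronglyMeasurable
      (fun p : ℝ × Rn n => divMoll (τ - p.1) (drift g (ρ p.1)) p.2)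
      ((volume.restrict (Ioc 0 T)).prod volume) := by
    have hmeq : (volume.restrict (Ioc 0 T)).prod (volume : Measure (Rn n))
        = volume.restrict (Ioo 0 T ×ˢ univ) := by
      rw [hae, Measure.volume_eq_prod, ← Measure.prod_restrict, Measure.restrict_univ]
    rw [hmeq]
    refine ContinuousOn.aestronglyMeasurable ((continuousOn_duhamel hg hΓ hρ τ).mono ?_)
      (measurableSet_Ioo.prod MeasurableSet.univ)
    exact Set.prod_mono (fun s hs => ⟨hs.1.le, hs.2.trans_le hT⟩) subset_rfl
  have hmem : ∀ᵐ s ∂(volume.restrict (Ioc 0 T)), s ∈ Ioo 0 T := by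
    rw [hae]; exact ae_restrict_mem measurableSet_Ioo
  rw [integrable_prod_iff hm]
  constructor
  · filter_upwards [hmem] with s hs
    exact integrable_divMoll (by linarith [hs.2]) (integrable_drift hg hΓ (integrable_coe _))
  · have hmaj : Integrable (fun s => heatC n * Γ * R ^ 2 * (1 / √(τ - s)))
        (volume.restrict (Ioc 0 T)) := (intervalIntegrable_inv_sqrt_sub τ 0 T).1.const_mul _
    refine hmaj.mono' hm.norm.integral_prod_right' ?_
    filter_upwards [hmem] with s hs
    rw [Real.norm_of_nonneg (integral_nonneg fun _ => norm_nonneg _)]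
    exact integral_norm_duhamel_le hg hΓ hR ⟨hs.1.le, hs.2.le⟩ (by linarith [hs.2])

/-- Duhamel's formula in terms of `mollify` and `divMoll`. -/
lemma IsMildSolution.duhamel' (h : IsMildSolution g ρ₀ ρ) {t : ℝ} (ht : 0 < t) :
    ∀ᵐ x : Rn n, ρ t x = mollify t ρ₀ x
      + ∫ s in (0 : ℝ)..t, divMoll (t - s) (drift g (ρ s)) x := by
  have := h.duhamel t ht
  simpa only [gradient_heatKernel, conv_heatKernel, divMoll] using this

/-- Fubini for the Duhamel term tested against a bounded function. -/
lemma integral_mul_duhamel (hg : AEStronglyMeasurable g) (hΓ : ∀ᵐ x, ‖g x‖ ≤ Γ)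
    (hρ : ContinuousOn ρ (Ici 0)) {T τ : ℝ} (hT0 : 0 ≤ T) (hT : T ≤ τ) {φ : Rn n → ℝ} {C : ℝ}
    (hφ : AEStronglyMeasurable φ) (hφb : ∀ x, ‖φ x‖ ≤ C) :
    Integrable (fun x => φ x * ∫ s in (0 : ℝ)..T, divMoll (τ - s) (drift g (ρ s)) x) ∧
    ∫ x, φ x * ∫ s in (0 : ℝ)..T, divMoll (τ - s) (drift g (ρ s)) x
      = ∫ s in (0 : ℝ)..T, ∫ x, φ x * divMoll (τ - s) (drift g (ρ s)) x := by
  have h1 : Integrable (fun p : ℝ × Rn n => φ p.2 * divMoll (τ - p.1) (drift g (ρ p.1)) p.2)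
      ((volume.restrict (Ioc 0 T)).prod volume) :=
    (integrable_duhamel hg hΓ hρ hT).bdd_mul hφ.comp_snd (ae_of_all _ fun p => hφb p.2)
  simp only [intervalIntegral.integral_of_le hT0]
  constructor
  · simpa only [integral_const_mul] using h1.integral_prod_right
  · rw [integral_integral_swap h1]
    simp only [integral_const_mul]

variable (hg : AEStronglyMeasurable g) (hΓ : ∀ᵐ x, ‖g x‖ ≤ Γ)
include hg hΓ

/-- Duhamel's formula after mollification; it holds at every point. -/
lemma IsMildSolution.mollify_eq (h : IsMildSolution g ρ₀ ρ) {δ t : ℝ} (hδ : 0 < δ) (ht : 0 ≤ t)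
    (x : Rn n) :
    mollify δ (ρ t) x = mollify (δ + t) ρ₀ x
      + ∫ s in (0 : ℝ)..t, divMoll (δ + t - s) (drift g (ρ s)) x := by
  rcases ht.eq_or_lt with rfl | ht
  · simp [h.initial]
  have hφ : AEStronglyMeasurable (fun y => heatKernel n δ (x - y)) :=
    (by fun_prop : Continuous _).aestronglyMeasurable
  obtain ⟨h1, h2⟩ := integral_mul_duhamel hg hΓ h.continuousOn ht.le le_rfl hφ
    (fun y => norm_heatKernel_le hδ (x - y))
  rw [mollify_apply]
  have e1 : ∫ y, heatKernel n δ (x - y) • ρ t y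
      = ∫ y, (heatKernel n δ (x - y) • mollify t ρ₀ y + heatKernel n δ (x - y) *
          ∫ s in (0 : ℝ)..t, divMoll (t - s) (drift g (ρ s)) y) := by
    refine integral_congr_ae ?_
    filter_upwards [h.duhamel' ht] with y hy
    rw [hy, smul_eq_mul, smul_eq_mul, mul_add]
  rw [e1, integral_add (integrable_heatKernel_smul hδ
    (integrable_mollify ht (integrable_coe ρ₀)) x) h1, h2, ← mollify_apply,
    mollify_mollify hδ ht (integrable_coe ρ₀)]
  congr 1
  refine intervalIntegral.integral_congr_ae ?_
  have : ∀ᵐ s : ℝ, s ≠ t := by simp [ae_iff, measure_singleton]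
  filter_upwards [this] with s hs hs2
  rw [uIoc_of_le ht.le] at hs2
  have h3 := mollify_divMoll hδ (r := t - s) (by linarith [lt_of_le_of_ne hs2.2 hs])
    (integrable_drift hg hΓ (integrable_coe (ρ s))) x
  rw [mollify_apply] at h3
  rw [show δ + t - s = δ + (t - s) by ring, ← h3]
  rfl

/-- Duhamel's formula from time `t₀`: mollifying by `G_t` advances the formula at time `t₀` by `t`,
except for the source terms after `t₀`. -/
lemma IsMildSolution.restart (h : IsMildSolution g ρ₀ ρ) {t₀ : ℝ} (ht₀ : 0 ≤ t₀) :
    IsMildSolution g (ρ t₀) (fun s => ρ (t₀ + s)) where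
  continuousOn := h.continuousOn.comp (by fun_prop) fun s hs => by
    simp only [Set.mem_Ici] at hs ⊢; linarith
  initial := by simp
  duhamel := by
    intro t ht
    have hT : 0 < t₀ + t := by linarith
    have hI := (integrable_duhamel hg hΓ h.continuousOn (T := t₀ + t) le_rfl).prod_left_ae
    simp only [gradient_heatKernel, conv_heatKernel]
    filter_upwards [h.duhamel' hT, hI] with x hx hIx
    have hII : IntervalIntegrable (fun s => divMoll (t₀ + t - s) (drift g (ρ s)) x) volume
        0 (t₀ + t) := (intervalIntegrable_iff_integrableOn_Ioc_of_le hT.le).2 hIx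
    have hm := h.mollify_eq hg hΓ ht ht₀ x
    have hsplit := intervalIntegral.integral_add_adjacent_intervals
      (hII.mono_set (c := 0) (d := t₀) (by
        rw [uIcc_of_le ht₀, uIcc_of_le hT.le]; exact Icc_subset_Icc_right (by linarith)))
      (hII.mono_set (c := t₀) (d := t₀ + t) (by
        rw [uIcc_of_le (by linarith), uIcc_of_le hT.le]; exact Icc_subset_Icc_left ht₀))
    have hshift := intervalIntegral.integral_comp_add_left (a := 0) (b := t)
      (fun s => divMoll (t₀ + t - s) (drift g (ρ s)) x) t₀
    rw [hx, hm, ← hsplit, add_zero] at *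
    rw [← hshift, add_comm t t₀, add_assoc]
    congr 2
    refine intervalIntegral.integral_congr fun s _ => ?_
    simp only [divMoll]
    rw [show t₀ + t - (t₀ + s) = t - s by ring]

/-- Mass is conserved, because `∫ ∇G_r = 0`. -/
lemma IsMildSolution.integral_eq (h : IsMildSolution g ρ₀ ρ) {t : ℝ} (ht : 0 ≤ t) :
    ∫ x, ρ t x = ∫ x, ρ₀ x := by
  rcases ht.eq_or_lt with rfl | ht
  · rw [h.initial]
  obtain ⟨h1, h2⟩ := integral_mul_duhamel hg hΓ h.continuousOn ht.le le_rfl (C := 1)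
    (φ := fun _ => 1) aestronglyMeasurable_const (by simp)
  simp only [one_mul] at h1 h2
  rw [integral_congr_ae (h.duhamel' ht),
    integral_add (integrable_mollify ht (integrable_coe ρ₀)) h1, h2]
  have e1 : ∫ x, mollify t ρ₀ x = ∫ x, ρ₀ x := by
    have := integral_smul_convolution (L := ContinuousLinearMap.lsmul ℝ ℝ) (φ := fun _ => (1 : ℝ))
      (C := 1) (integrable_heatKernel (n := n) ht) (integrable_coe ρ₀)
      aestronglyMeasurable_const (by simp)
    simp only [one_smul] at this
    rw [mollify, this]
    congr 1; ext1 y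
    rw [integral_sub_right_eq_self (heatKernel n t), integral_heatKernel ht]; simp
  have e2 : ∀ s ∈ uIoc 0 t, s ≠ t → ∫ x, divMoll (t - s) (drift g (ρ s)) x = 0 := by
    intro s hs hst
    rw [uIoc_of_le ht.le] at hs
    have := integral_smul_convolution (L := innerSL ℝ) (φ := fun _ => (1 : ℝ))
      (C := 1) (integrable_gradHeat (n := n) (t := t - s) (by linarith [lt_of_le_of_ne hs.2 hst]))
      (integrable_drift hg hΓ (integrable_coe (ρ s))) aestronglyMeasurable_const (by simp)
    simp only [one_smul] at this
    rw [divMoll, this]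
    simp_rw [fun y => integral_sub_right_eq_self (gradHeat n (t - s)) y (μ := volume),
      integral_gradHeat]
    simp
  rw [e1, add_eq_left]
  refine intervalIntegral.integral_zero_ae ?_
  have : ∀ᵐ s : ℝ, s ≠ t := by simp [ae_iff, measure_singleton]
  filter_upwards [this] with s hs hs2 using e2 s hs2 hs

end Mild

/-! ### Gradients of convolutions -/

section GradientConvolution

variable {n : ℕ}

/-- Differentiation under the convolution: `∇(K * f) = ∇K * f` for a bounded kernel `K` with
bounded continuous gradient. -/
lemma hasGradientAt_convolution {K : Rn n → ℝ} {K' : Rn n → Rn n} {f : Rn n → ℝ} {C C' : ℝ}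
    (hK : ∀ x, HasGradientAt K (K' x) x) (hKc : Continuous K') (hKb : ∀ x, ‖K x‖ ≤ C)
    (hKb' : ∀ x, ‖K' x‖ ≤ C') (hf : Integrable f) (x : Rn n) :
    HasGradientAt (fun x => ∫ y, K (x - y) * f y) (∫ y, f y • K' (x - y)) x := by
  have hKcont : Continuous K :=
    continuous_iff_continuousAt.2 fun x => (hK x).continuousAt
  rw [hasGradientAt_iff_hasFDerivAt]
  have hi : ∀ x, Integrable fun y => f y • K' (x - y) := fun x =>
    hf.smul_bdd C' (by fun_prop : Continuous _).aestronglyMeasurable (ae_of_all _ fun y => hKb' _)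
  have key := hasFDerivAt_integral_of_dominated_of_fderiv_le (𝕜 := ℝ) (μ := volume)
    (F := fun x y => K (x - y) * f y) (s := univ) (x₀ := x)
    (F' := fun x y => f y • (innerSL ℝ (K' (x - y)) : Rn n →L[ℝ] ℝ))
    (bound := fun y => C' * ‖f y‖) univ_mem ?_ ?_ ?_ ?_ (hf.norm.const_mul C') ?_
  · refine key.congr_fderiv ?_
    have h := (innerSL ℝ : Rn n →L[ℝ] Rn n →L[ℝ] ℝ).integral_comp_comm (hi x)
    simp only [map_smul] at h
    exact h
  · exact Eventually.of_forall fun x => (by fun_prop : Continuous fun y => K (x - y))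
      |>.aestronglyMeasurable.mul hf.aestronglyMeasurable
  · exact hf.bdd_mul (by fun_prop : Continuous fun y => K (x - y)).aestronglyMeasurable
      (ae_of_all _ fun y => hKb _)
  · have hc : Continuous fun y => (innerSL ℝ (K' (x - y)) : Rn n →L[ℝ] ℝ) := by fun_prop
    exact hf.aestronglyMeasurable.smul hc.aestronglyMeasurable
  · refine ae_of_all _ fun y x _ => ?_
    rw [norm_smul, innerSL_apply_norm, mul_comm]
    gcongr; exact hKb' _
  · refine ae_of_all _ fun y x _ => ?_
    have h1 := hasGradientAt_iff_hasFDerivAt.1 (hK (x - y))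
    have h2 : HasFDerivAt (fun x : Rn n => x - y) (ContinuousLinearMap.id ℝ (Rn n)) x :=
      (hasFDerivAt_id x).sub_const y
    have h3 := (h1.comp x h2).mul_const (f y)
    simp only [Function.comp_def, ContinuousLinearMap.comp_id] at h3
    exact h3

/-- The convolution `∇G_δ * f`, the gradient of `G_δ * f`. -/
def gradMoll (δ : ℝ) (f : Rn n → ℝ) : Rn n → Rn n :=
  gradHeat n δ ⋆[(ContinuousLinearMap.lsmul ℝ ℝ).flip, volume] f

lemma gradMoll_apply (δ : ℝ) (f : Rn n → ℝ) (x : Rn n) :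
    gradMoll δ f x = ∫ y, f y • gradHeat n δ (x - y) := by
  rw [gradMoll, convolution_eq_swap]; rfl

lemma norm_lsmul_flip_apply_le (a : Rn n) (b : ℝ) :
    ‖(ContinuousLinearMap.lsmul ℝ ℝ).flip a b‖ ≤ ‖a‖ * ‖b‖ := by
  simp [norm_smul, mul_comm]

lemma hasGradientAt_mollify {δ : ℝ} (hδ : 0 < δ) {f : Rn n → ℝ} (hf : Integrable f) (x : Rn n) :
    HasGradientAt (mollify δ f) (gradMoll δ f x) x := by
  have := hasGradientAt_convolution (hasGradientAt_heatKernel δ) (continuous_gradHeat δ)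
    (norm_heatKernel_le hδ) (fun x => norm_gradHeat_le_const hδ le_rfl x) hf x
  rw [gradMoll_apply]
  convert this using 1
  ext1 x; rw [mollify_apply]; rfl

lemma integrable_gradMoll {δ : ℝ} (hδ : 0 < δ) {f : Rn n → ℝ} (hf : Integrable f) :
    Integrable (gradMoll δ f) :=
  (integrable_gradHeat hδ).integrable_convolution _ hf

lemma norm_gradMoll_le {δ : ℝ} (hδ : 0 < δ) {f : Rn n → ℝ} (hf : Integrable f) (x : Rn n) :
    ‖gradMoll δ f x‖ ≤ heatC n / √δ * (4 * π * δ) ^ (-(n : ℝ) / 2) * ∫ y, ‖f y‖ :=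
  norm_convolution_le norm_lsmul_flip_apply_le (fun x => norm_gradHeat_le_const hδ le_rfl x) hf x

lemma continuous_convolution_of_bounded {E₁ E₂ E₃ : Type*} [NormedAddCommGroup E₁]
    [NormedSpace ℝ E₁] [NormedAddCommGroup E₂] [NormedSpace ℝ E₂] [NormedAddCommGroup E₃]
    [NormedSpace ℝ E₃] {L : E₁ →L[ℝ] E₂ →L[ℝ] E₃} (hL : ∀ a b, ‖L a b‖ ≤ ‖a‖ * ‖b‖)
    {K : Rn n → E₁} {f : Rn n → E₂} {C : ℝ} (hK : Continuous K) (hKb : ∀ x, ‖K x‖ ≤ C)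
    (hf : Integrable f) : Continuous (K ⋆[L, volume] f) := by
  have e : (K ⋆[L, volume] f) = fun x => ∫ y, L (K (x - y)) (f y) := by
    ext1 x; rw [convolution_eq_swap]
  rw [e]
  refine continuous_of_dominated (bound := fun y => C * ‖f y‖) (fun x => ?_)
    (fun x => ae_of_all _ fun y => (hL _ _).trans (by gcongr; exact hKb _))
    (hf.norm.const_mul C) (ae_of_all _ fun y => ?_)
  · exact L.aestronglyMeasurable_comp₂ (by fun_prop : Continuous _).aestronglyMeasurable
      hf.aestronglyMeasurable
  · exact (L.flip (f y)).continuous.comp (by fun_prop : Continuous fun x => K (x - y))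

lemma continuous_gradMoll {δ : ℝ} (hδ : 0 < δ) {f : Rn n → ℝ} (hf : Integrable f) :
    Continuous (gradMoll δ f) :=
  continuous_convolution_of_bounded norm_lsmul_flip_apply_le (continuous_gradHeat δ)
    (fun x => norm_gradHeat_le_const hδ le_rfl x) hf

lemma continuous_mollify {E : Type*} [NormedAddCommGroup E] [NormedSpace ℝ E]
    {δ : ℝ} (hδ : 0 < δ) {f : Rn n → E} (hf : Integrable f) :
    Continuous (mollify δ f) :=
  continuous_convolution_of_bounded norm_lsmul_apply_le (continuous_heatKernel δ)
    (norm_heatKernel_le hδ) hf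

end GradientConvolution

/-! ### The heat equation in weak form -/

section IntegrationByParts

variable {n : ℕ} {f : Rn n → ℝ} {f' : Rn n → Rn n} {C C' : ℝ}

lemma HasGradientAt.hasLineDerivAt_inner {x : Rn n} {a : Rn n} (h : HasGradientAt f a x)
    (v : Rn n) : HasLineDerivAt ℝ f (inner ℝ a v) x v := by
  have := (hasGradientAt_iff_hasFDerivAt.1 h).hasLineDerivAt v
  simpa using this

variable (hf : ∀ x, HasGradientAt f (f' x) x) (hfc : Continuous f') (hfb : ∀ x, ‖f x‖ ≤ C)
  (hfb' : ∀ x, ‖f' x‖ ≤ C')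
include hf hfc hfb hfb'

/-- Integration by parts along a direction, against an integrable function with integrable
derivative. -/
lemma integral_mul_lineDeriv_eq {k k' : Rn n → ℝ} {v : Rn n} (hk : Integrable k)
    (hk' : Integrable k') (hkd : ∀ x, HasLineDerivAt ℝ k (k' x) x v) :
    ∫ x, f x * k' x = -∫ x, inner ℝ (f' x) v * k x := by
  have hfcont : Continuous f := continuous_iff_continuousAt.2 fun x => (hf x).continuousAt
  refine integral_bilinear_hasLineDerivAt_right_eq_neg_left_of_integrable
    (B := ContinuousLinearMap.mul ℝ ℝ) (v := v) ?_ ?_ ?_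
    (fun x _ => (hf x).hasLineDerivAt_inner v) fun x _ => hkd x
  · refine hk.bdd_mul (c := C' * ‖v‖) (by fun_prop : Continuous _).aestronglyMeasurable
      (ae_of_all _ fun x => ?_)
    exact (norm_inner_le_norm _ _).trans (by gcongr; exact hfb' x)
  · exact hk'.bdd_mul hfcont.aestronglyMeasurable (ae_of_all _ hfb)
  · exact hk.bdd_mul hfcont.aestronglyMeasurable (ae_of_all _ hfb)

lemma integral_smul_gradHeat_eq {r : ℝ} (hr : 0 < r) (y : Rn n) :
    ∫ x, f x • gradHeat n r (x - y) = -∫ x, heatKernel n r (x - y) • f' x := by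
  have hfcont : Continuous f := continuous_iff_continuousAt.2 fun x => (hf x).continuousAt
  have hi1 : Integrable fun x => f x • gradHeat n r (x - y) :=
    ((integrable_gradHeat hr).comp_sub_right y).bdd_smul C hfcont.aestronglyMeasurable
      (ae_of_all _ hfb)
  have hi2 : Integrable fun x => heatKernel n r (x - y) • f' x :=
    ((integrable_heatKernel hr).comp_sub_right y).smul_bdd C' hfc.aestronglyMeasurable
      (ae_of_all _ hfb')
  refine ext_inner_right ℝ fun v => ?_
  have e1 : inner ℝ (∫ x, f x • gradHeat n r (x - y)) v
      = ∫ x, f x * inner ℝ (gradHeat n r (x - y)) v := by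
    rw [real_inner_comm, ← integral_inner hi1]
    congr 1; ext1 x; rw [inner_smul_right, real_inner_comm]
  have e2 : inner ℝ (∫ x, heatKernel n r (x - y) • f' x) v
      = ∫ x, inner ℝ (f' x) v * heatKernel n r (x - y) := by
    rw [real_inner_comm, ← integral_inner hi2]
    congr 1; ext1 x; rw [inner_smul_right, real_inner_comm, mul_comm]
  rw [inner_neg_left, e1, e2]
  have h := integral_mul_lineDeriv_eq hf hfc hfb hfb' (v := v)
    (k := fun x => heatKernel n r (x - y)) (k' := fun x => inner ℝ (gradHeat n r (x - y)) v)
    ((integrable_heatKernel hr).comp_sub_right y)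
    (Integrable.inner_const (𝕜 := ℝ) ((integrable_gradHeat hr).comp_sub_right y) v) fun x => ?_
  · exact h
  · have h1 := hasGradientAt_iff_hasFDerivAt.1 (hasGradientAt_heatKernel r (x - y))
    have h2 : HasFDerivAt (fun x : Rn n => x - y) (ContinuousLinearMap.id ℝ (Rn n)) x :=
      (hasFDerivAt_id x).sub_const y
    simpa [Function.comp_def] using (h1.comp x h2).hasLineDerivAt v

/-- The heat equation `∂ₜG = ΔG` in weak form. -/
lemma integral_mul_dtHeat_eq {r : ℝ} (hr : 0 < r) (y : Rn n) :
    ∫ x, f x * dtHeat n r (x - y) = -∫ x, inner ℝ (f' x) (gradHeat n r (x - y)) := by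
  have hfcont : Continuous f := continuous_iff_continuousAt.2 fun x => (hf x).continuousAt
  let d : Fin n → Rn n → ℝ := fun i x => (1 / (4 * r ^ 2) * (x i) ^ 2 - 1 / (2 * r)) *
    heatKernel n r x
  have hdi : ∀ i, Integrable (d i) := by
    intro i
    refine (((integrable_heatKernel (n := n) (t := 2 * r) (by positivity)).const_mul
      (1 / (4 * r ^ 2) * (8 * heatC n * r))).add
      ((integrable_heatKernel (n := n) hr).const_mul (1 / (2 * r)))).mono'
      (by fun_prop : Continuous _).aestronglyMeasurable (ae_of_all _ fun x => ?_)
    have hG := (heatKernel_pos hr x).le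
    have h1 := norm_sq_mul_heatKernel_le hr x
    have h2 : (x i) ^ 2 ≤ ‖x‖ ^ 2 := by
      rw [EuclideanSpace.real_norm_sq_eq]
      exact Finset.single_le_sum (f := fun j => (x j) ^ 2) (fun j _ => sq_nonneg _)
        (Finset.mem_univ i)
    have h3 : |d i x| ≤ 1 / (4 * r ^ 2) * (x i) ^ 2 * heatKernel n r x
        + 1 / (2 * r) * heatKernel n r x := by
      simp only [d, sub_mul]
      refine (abs_sub _ _).trans (le_of_eq ?_)
      rw [abs_of_nonneg (by positivity), abs_of_nonneg (by positivity)]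
    have h4 : (x i) ^ 2 * heatKernel n r x ≤ 8 * heatC n * r * heatKernel n (2 * r) x :=
      (mul_le_mul_of_nonneg_right h2 hG).trans h1
    refine h3.trans ?_
    simp only [Pi.add_apply]
    have h5 : 1 / (4 * r ^ 2) * (x i) ^ 2 * heatKernel n r x
        ≤ 1 / (4 * r ^ 2) * (8 * heatC n * r) * heatKernel n (2 * r) x := by
      calc _ = 1 / (4 * r ^ 2) * ((x i) ^ 2 * heatKernel n r x) := by ring
        _ ≤ 1 / (4 * r ^ 2) * (8 * heatC n * r * heatKernel n (2 * r) x) := by gcongr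
        _ = _ := by ring
    linarith
  have hgi : ∀ i, Integrable fun x => gradHeat n r (x - y) i := fun i => by
    have := Integrable.inner_const (𝕜 := ℝ) ((integrable_gradHeat (n := n) hr).comp_sub_right y)
      (EuclideanSpace.single i (1 : ℝ))
    refine this.congr (ae_of_all _ fun x => ?_)
    simp [EuclideanSpace.inner_single_right]
  have hkey : ∀ i, ∫ x, f x * d i (x - y)
      = -∫ x, inner ℝ (f' x) (EuclideanSpace.single i (1 : ℝ)) * gradHeat n r (x - y) i := by
    intro i
    refine integral_mul_lineDeriv_eq hf hfc hfb hfb' (hgi i) ((hdi i).comp_sub_right y)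
      fun x => ?_
    have h1 := hasGradientAt_iff_hasFDerivAt.1 (hasGradientAt_heatKernel r (x - y))
    have h2 : HasFDerivAt (fun x : Rn n => x - y) (ContinuousLinearMap.id ℝ (Rn n)) x :=
      (hasFDerivAt_id x).sub_const y
    have h3 := (h1.comp x h2)
    have h4 : HasFDerivAt (fun x : Rn n => (x - y) i)
        (EuclideanSpace.proj i : Rn n →L[ℝ] ℝ) x := by
      exact ((EuclideanSpace.proj i : Rn n →L[ℝ] ℝ).hasFDerivAt).comp x h2
    have h5 := ((h3.const_mul (-(1 / (2 * r)))).mul h4).hasLineDerivAt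
      (EuclideanSpace.single i (1 : ℝ))
    have e1 : (fun x => gradHeat n r (x - y) i) = fun x => -(1 / (2 * r)) *
        (heatKernel n r ∘ fun x => x - y) x * (x - y) i := by
      ext x; simp [gradHeat]
    rw [e1]
    refine HasDerivAt.congr_deriv h5 ?_
    simp [d, gradHeat, EuclideanSpace.inner_single_right]
    field_simp
    ring
  have hsum : ∀ x : Rn n, dtHeat n r x = ∑ i, d i x := by
    intro x
    simp only [d, ← Finset.sum_mul, Finset.sum_sub_distrib, ← Finset.mul_sum, dtHeat,
      EuclideanSpace.real_norm_sq_eq]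
    simp
    left
    field_simp
  have hfd : ∀ i, Integrable fun x => f x * d i (x - y) := fun i =>
    ((hdi i).comp_sub_right y).bdd_mul hfcont.aestronglyMeasurable (ae_of_all _ hfb)
  simp only [hsum, Finset.mul_sum]
  rw [integral_finsetSum _ fun i _ => hfd i]
  simp only [hkey]
  rw [Finset.sum_neg_distrib, ← integral_finsetSum]
  · congr 2; ext1 x
    rw [PiLp.inner_apply]
    refine Finset.sum_congr rfl fun i _ => ?_
    simp [EuclideanSpace.inner_single_right]
    ring
  · intro i _
    refine (hgi i).bdd_mul (c := C' * 1) (by fun_prop : Continuous _).aestronglyMeasurable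
      (ae_of_all _ fun x => (norm_inner_le_norm _ _).trans ?_)
    simpa using hfb' x

end IntegrationByParts

/-! ### The mollified equation in weak form -/

section TimeDerivative

variable {n : ℕ} {f : Rn n → ℝ} {f' : Rn n → Rn n} {C C' : ℝ}

/-- Around time `δ`, the time derivative of the heat kernel is dominated by one fixed Gaussian. -/
lemma abs_dtHeat_le_of_mem {δ r : ℝ} (hδ : 0 < δ) (hr : r ∈ Icc (δ / 2) (2 * δ)) (x : Rn n) :
    |dtHeat n r x| ≤ 6 * heatC n * (n + 1) / δ * 4 ^ ((n : ℝ) / 2) * heatKernel n (4 * δ) x := by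
  have hr0 : 0 < r := by linarith [hr.1]
  have hC := heatC_pos n
  have hG := (heatKernel_pos (n := n) (t := 4 * δ) (by positivity) x).le
  have h1 := heatKernel_le_of_le (n := n) (s := 2 * r) (t := 4 * δ) (by positivity)
    (by linarith [hr.2]) x
  have h2 : (4 * δ / (2 * r)) ^ ((n : ℝ) / 2) ≤ 4 ^ ((n : ℝ) / 2) := by
    gcongr
    rw [div_le_iff₀ (by positivity)]; linarith [hr.1]
  refine (abs_dtHeat_le hr0 x).trans ?_
  have h3 : 3 * heatC n * (n + 1) / r ≤ 6 * heatC n * (n + 1) / δ := by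
    rw [div_le_div_iff₀ hr0 hδ]
    have : 0 ≤ 3 * heatC n * (n + 1) := by positivity
    nlinarith [hr.1]
  have h4 := (heatKernel_pos (n := n) (t := 2 * r) (by positivity) x).le
  calc _ ≤ 6 * heatC n * (n + 1) / δ * heatKernel n (2 * r) x := by gcongr
    _ ≤ 6 * heatC n * (n + 1) / δ * (4 ^ ((n : ℝ) / 2) * heatKernel n (4 * δ) x) := by
        refine mul_le_mul_of_nonneg_left (h1.trans ?_) (by positivity)
        gcongr
    _ = _ := by ring

lemma norm_gradHeat_le_of_mem {δ r : ℝ} (hδ : 0 < δ) (hr : r ∈ Icc (δ / 2) (2 * δ)) (x : Rn n) :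
    ‖gradHeat n r x‖ ≤ heatC n / √(δ / 2) * 4 ^ ((n : ℝ) / 2) * heatKernel n (4 * δ) x := by
  have hr0 : 0 < r := by linarith [hr.1]
  have hC := heatC_pos n
  have hG := (heatKernel_pos (n := n) (t := 4 * δ) (by positivity) x).le
  have h1 := heatKernel_le_of_le (n := n) (s := 2 * r) (t := 4 * δ) (by positivity)
    (by linarith [hr.2]) x
  have h2 : (4 * δ / (2 * r)) ^ ((n : ℝ) / 2) ≤ 4 ^ ((n : ℝ) / 2) := by
    gcongr
    rw [div_le_iff₀ (by positivity)]; linarith [hr.1]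
  have h4 := (heatKernel_pos (n := n) (t := 2 * r) (by positivity) x).le
  refine (norm_gradHeat_le hr0 x).trans ?_
  calc _ ≤ heatC n / √(δ / 2) * heatKernel n (2 * r) x := by gcongr; exact hr.1
    _ ≤ heatC n / √(δ / 2) * (4 ^ ((n : ℝ) / 2) * heatKernel n (4 * δ) x) := by
        refine mul_le_mul_of_nonneg_left (h1.trans ?_) (by positivity)
        gcongr
    _ = _ := by ring

lemma continuous_of_hasGradientAt (hf : ∀ x, HasGradientAt f (f' x) x) : Continuous f :=
  continuous_iff_continuousAt.2 fun x => (hf x).continuousAt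

/-- Fubini for the pairing of a bounded vector field with a convolution. -/
lemma integral_inner_gradMoll (hfc : Continuous f') (hfb' : ∀ x, ‖f' x‖ ≤ C') {δ : ℝ}
    (hδ : 0 < δ) {w : Rn n → ℝ} (hw : Integrable w) :
    ∫ x, inner ℝ (f' x) (gradMoll δ w x)
      = ∫ y, (∫ x, inner ℝ (f' x) (gradHeat n δ (x - y))) * w y := by
  have h1 : Integrable (fun p : Rn n × Rn n => w p.2 • gradHeat n δ (p.1 - p.2)) :=
    hw.convolution_integrand (ContinuousLinearMap.lsmul ℝ ℝ) (integrable_gradHeat hδ)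
  have h2 : Integrable (fun p : Rn n × Rn n =>
      inner ℝ (f' p.1) (w p.2 • gradHeat n δ (p.1 - p.2))) := by
    refine (h1.norm.const_mul C').mono' (hfc.aestronglyMeasurable.comp_fst.inner
      h1.aestronglyMeasurable) (ae_of_all _ fun p => (norm_inner_le_norm _ _).trans ?_)
    gcongr; exact hfb' _
  calc ∫ x, inner ℝ (f' x) (gradMoll δ w x)
      = ∫ x, ∫ y, inner ℝ (f' x) (w y • gradHeat n δ (x - y)) := by
        refine integral_congr_ae ?_
        filter_upwards [h1.prod_right_ae] with x hx
        rw [gradMoll_apply, integral_inner hx]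
    _ = ∫ y, ∫ x, inner ℝ (f' x) (w y • gradHeat n δ (x - y)) := integral_integral_swap h2
    _ = _ := by
        congr 1; ext1 y
        rw [← integral_mul_const]
        congr 1; ext1 x
        rw [inner_smul_right, mul_comm]

lemma integral_inner_mollify (hfc : Continuous f') (hfb' : ∀ x, ‖f' x‖ ≤ C') {δ : ℝ}
    (hδ : 0 < δ) {F : Rn n → Rn n} (hF : Integrable F) :
    ∫ x, inner ℝ (f' x) (mollify δ F x)
      = ∫ y, inner ℝ (∫ x, heatKernel n δ (x - y) • f' x) (F y) := by
  have h1 : Integrable (fun p : Rn n × Rn n => heatKernel n δ (p.1 - p.2) • F p.2) :=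
    hF.convolution_integrand (ContinuousLinearMap.lsmul ℝ ℝ).flip (integrable_heatKernel hδ)
  have h2 : Integrable (fun p : Rn n × Rn n =>
      inner ℝ (f' p.1) (heatKernel n δ (p.1 - p.2) • F p.2)) := by
    refine (h1.norm.const_mul C').mono' (hfc.aestronglyMeasurable.comp_fst.inner
      h1.aestronglyMeasurable) (ae_of_all _ fun p => (norm_inner_le_norm _ _).trans ?_)
    gcongr; exact hfb' _
  calc ∫ x, inner ℝ (f' x) (mollify δ F x)
      = ∫ x, ∫ y, inner ℝ (f' x) (heatKernel n δ (x - y) • F y) := by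
        congr 1; ext1 x
        rw [mollify_apply, integral_inner (integrable_heatKernel_smul hδ hF x)]
    _ = ∫ y, ∫ x, inner ℝ (f' x) (heatKernel n δ (x - y) • F y) := integral_integral_swap h2
    _ = _ := by
        congr 1; ext1 y
        have h3 : Integrable fun x => heatKernel n δ (x - y) • f' x :=
          ((integrable_heatKernel hδ).comp_sub_right y).smul_bdd C' hfc.aestronglyMeasurable
            (ae_of_all _ hfb')
        rw [real_inner_comm, ← integral_inner h3]
        congr 1; ext1 x
        rw [inner_smul_right, inner_smul_right, real_inner_comm]

variable (hf : ∀ x, HasGradientAt f (f' x) x) (hfc : Continuous f') (hfb : ∀ x, ‖f x‖ ≤ C)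
  (hfb' : ∀ x, ‖f' x‖ ≤ C')
include hf hfc hfb hfb'

/-- Weak form of the heat equation for `r ↦ G_r * w`. -/
lemma hasDerivAt_integral_mul_mollify {δ : ℝ} (hδ : 0 < δ) {w : Rn n → ℝ} (hw : Integrable w) :
    HasDerivAt (fun r => ∫ x, f x * mollify r w x)
      (-∫ x, inner ℝ (f' x) (gradMoll δ w x)) δ := by
  have hfcont := continuous_of_hasGradientAt hf
  have hInt : ∀ r, 0 < r → Integrable (fun p : Rn n × Rn n =>
      f p.1 • (heatKernel n r (p.1 - p.2) * w p.2)) := fun r hr =>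
    integrable_smul_convolution_integrand (L := ContinuousLinearMap.mul ℝ ℝ)
      (integrable_heatKernel hr) hw hfcont.aestronglyMeasurable hfb
  have hB : Integrable (fun p : Rn n × Rn n => heatKernel n (4 * δ) (p.1 - p.2) * ‖w p.2‖) :=
    hw.norm.convolution_integrand (ContinuousLinearMap.mul ℝ ℝ).flip
      (integrable_heatKernel (by positivity))
  set A := 6 * heatC n * (n + 1) / δ * 4 ^ ((n : ℝ) / 2) with hA
  have hA0 : 0 ≤ A := by have := heatC_pos n; positivity
  have hwm : AEStronglyMeasurable (fun p : Rn n × Rn n => w p.2) (volume.prod volume) :=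
    hw.aestronglyMeasurable.comp_snd
  have key := hasDerivAt_integral_of_dominated_loc_of_deriv_le (𝕜 := ℝ)
    (μ := (volume : Measure (Rn n)).prod volume) (x₀ := δ) (s := Icc (δ / 2) (2 * δ))
    (F := fun r p => f p.1 • (heatKernel n r (p.1 - p.2) * w p.2))
    (F' := fun r p => f p.1 • (dtHeat n r (p.1 - p.2) * w p.2))
    (bound := fun p => C * A * (heatKernel n (4 * δ) (p.1 - p.2) * ‖w p.2‖))
    (Icc_mem_nhds (by linarith) (by linarith)) ?_ (hInt δ hδ) ?_ ?_ (hB.const_mul _) ?_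
  · have e1 : ∫ p : Rn n × Rn n, f p.1 • (dtHeat n δ (p.1 - p.2) * w p.2)
        ∂((volume : Measure (Rn n)).prod volume) = -∫ x, inner ℝ (f' x) (gradMoll δ w x) := by
      rw [integral_prod_symm _ key.1, integral_inner_gradMoll hfc hfb' hδ hw, ← integral_neg]
      congr 1; ext1 y
      rw [← neg_mul, ← integral_mul_dtHeat_eq hf hfc hfb hfb' hδ y, ← integral_mul_const]
      congr 1; ext1 x
      rw [smul_eq_mul, mul_assoc]
    rw [← e1]
    refine key.2.congr_of_eventuallyEq ?_
    filter_upwards [lt_mem_nhds hδ] with r hr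
    rw [integral_prod _ (hInt r hr)]
    congr 1; ext1 x
    rw [mollify_apply, ← integral_const_mul]; rfl
  · filter_upwards [lt_mem_nhds hδ] with r hr using (hInt r hr).aestronglyMeasurable
  · exact hfcont.aestronglyMeasurable.comp_fst.smul
      ((by fun_prop : Continuous fun p : Rn n × Rn n => dtHeat n δ (p.1 - p.2)).aestronglyMeasurable.mul
        hwm)
  · refine ae_of_all _ fun p r hr => ?_
    rw [norm_smul, norm_mul]
    have h1 := abs_dtHeat_le_of_mem hδ hr (p.1 - p.2)
    have h2 := hfb p.1
    have hC0 : 0 ≤ C := (norm_nonneg _).trans h2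
    have hG := (heatKernel_pos (n := n) (t := 4 * δ) (by positivity) (p.1 - p.2)).le
    rw [← Real.norm_eq_abs] at h1
    calc ‖f p.1‖ * (‖dtHeat n r (p.1 - p.2)‖ * ‖w p.2‖)
        ≤ C * ((A * heatKernel n (4 * δ) (p.1 - p.2)) * ‖w p.2‖) := by gcongr
      _ = _ := by ring
  · refine ae_of_all _ fun p r hr => ?_
    have hr0 : 0 < r := by linarith [hr.1]
    exact ((hasDerivAt_heatKernel_time hr0 (p.1 - p.2)).mul_const (w p.2)).const_mul (f p.1)

/-- The divergence in `∇G_r * F = ∇ · (G_r * F)` is moved onto the test function. -/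
lemma integral_mul_divMoll_eq {r : ℝ} (hr : 0 < r) {F : Rn n → Rn n} (hF : Integrable F) :
    ∫ x, f x * divMoll r F x = -∫ x, inner ℝ (f' x) (mollify r F x) := by
  have hfcont := continuous_of_hasGradientAt hf
  have h1 := integral_smul_convolution (L := innerSL ℝ) (φ := f) (integrable_gradHeat hr) hF
    hfcont.aestronglyMeasurable hfb
  simp only [smul_eq_mul] at h1
  rw [divMoll, h1, integral_inner_mollify hfc hfb' hr hF, ← integral_neg]
  congr 1; ext1 y
  rw [integral_smul_gradHeat_eq hf hfc hfb hfb' hr y]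
  simp only [map_neg, neg_apply]
  rfl

omit hfc hfb' in
lemma tendsto_integral_smul_gradHeat {δ : ℝ} (hδ : 0 < δ) (y : Rn n) :
    Tendsto (fun r => ∫ x, f x • gradHeat n r (x - y)) (𝓝 δ)
      (𝓝 (∫ x, f x • gradHeat n δ (x - y))) := by
  have hfcont := continuous_of_hasGradientAt hf
  refine tendsto_integral_filter_of_dominated_convergence
    (fun x => C * (heatC n / √(δ / 2) * 4 ^ ((n : ℝ) / 2) * heatKernel n (4 * δ) (x - y)))
    (Eventually.of_forall fun r => (by fun_prop : Continuous _).aestronglyMeasurable) ?_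
    ((((integrable_heatKernel (by positivity)).comp_sub_right y).const_mul _).const_mul _)
    (ae_of_all _ fun x => ?_)
  · filter_upwards [Icc_mem_nhds (show δ / 2 < δ by linarith) (show δ < 2 * δ by linarith)]
      with r hr
    refine ae_of_all _ fun x => ?_
    rw [norm_smul]
    have hC0 : 0 ≤ C := (norm_nonneg _).trans (hfb x)
    exact mul_le_mul (hfb x) (norm_gradHeat_le_of_mem hδ hr _) (norm_nonneg _) hC0
  · have h5 : Tendsto (fun r : ℝ => ((r, x - y) : ℝ × Rn n)) (𝓝 δ) (𝓝 (δ, x - y)) :=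
      tendsto_id.prodMk_nhds tendsto_const_nhds
    have h6 := Filter.Tendsto.comp (continuousAt_gradHeat hδ (x - y)).tendsto h5
    exact Tendsto.const_smul h6 (f x)

variable {g : Rn n → Rn n} {Γ : ℝ} {ρ₀ : Rn n →₁[volume] ℝ} {ρ : ℝ → (Rn n →₁[volume] ℝ)}

omit hfc hfb' in
/-- The Duhamel term, tested against `f`, is continuous at the origin of `{s ≥ 0}` in the pair of
the kernel time and the source time. -/
lemma tendsto_integral_mul_divMoll (hg : AEStronglyMeasurable g) (hΓ : ∀ᵐ x, ‖g x‖ ≤ Γ)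
    (hρ : ContinuousOn ρ (Ici 0)) {δ : ℝ} (hδ : 0 < δ) :
    Tendsto (fun p : ℝ × ℝ => ∫ x, f x * divMoll (δ + p.1) (drift g (ρ p.2)) x)
      (𝓝[{p | 0 ≤ p.2}] (0, 0)) (𝓝 (∫ x, f x * divMoll δ (drift g (ρ 0)) x)) := by
  have hfcont := continuous_of_hasGradientAt hf
  set l := 𝓝[{p : ℝ × ℝ | 0 ≤ p.2}] ((0, 0) : ℝ × ℝ) with hl
  have hfst : Tendsto (fun p : ℝ × ℝ => δ + p.1) l (𝓝 δ) := by
    have : Continuous fun p : ℝ × ℝ => δ + p.1 := by fun_prop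
    simpa using (this.tendsto (0, 0)).mono_left (nhdsWithin_le_nhds (s := {p : ℝ × ℝ | 0 ≤ p.2}))
  have hsnd : Tendsto (fun p : ℝ × ℝ => p.2) l (𝓝[Ici 0] 0) := by
    refine tendsto_nhdsWithin_iff.2 ⟨?_, ?_⟩
    · have : Continuous fun p : ℝ × ℝ => p.2 := by fun_prop
      simpa using (this.tendsto (0, 0)).mono_left
        (nhdsWithin_le_nhds (s := {p : ℝ × ℝ | 0 ≤ p.2}))
    · filter_upwards [self_mem_nhdsWithin] with p hp using hp
  have hev : ∀ᶠ p : ℝ × ℝ in l, δ + p.1 ∈ Icc (δ / 2) (2 * δ) :=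
    hfst.eventually (Icc_mem_nhds (by linarith) (by linarith))
  have hρt : Tendsto (fun p : ℝ × ℝ => ρ p.2) l (𝓝 (ρ 0)) := Tendsto.comp (hρ 0 (by simp)) hsnd
  have key := tendsto_integral_bilin (L := innerSL ℝ) (l := l)
    (K := fun (p : ℝ × ℝ) y => ∫ x, f x • gradHeat n (δ + p.1) (x - y))
    (K₀ := fun y => ∫ x, f x • gradHeat n δ (x - y)) (f := fun p : ℝ × ℝ => drift g (ρ p.2))
    (f₀ := drift g (ρ 0)) (C := C * (heatC n / √(δ / 2))) norm_innerSL_apply_le ?_ ?_ ?_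
    (Eventually.of_forall fun p : ℝ × ℝ => integrable_drift hg hΓ (integrable_coe (ρ p.2)))
    (integrable_drift hg hΓ (integrable_coe _)) (tendsto_integral_norm_drift_sub hg hΓ hρt)
  · have e : ∀ r s, 0 < r → ∫ x, f x * divMoll r (drift g (ρ s)) x
        = ∫ y, innerSL ℝ (∫ x, f x • gradHeat n r (x - y)) (drift g (ρ s) y) := fun r s hr =>
      integral_smul_convolution (L := innerSL ℝ) (φ := f) (integrable_gradHeat hr)
        (integrable_drift hg hΓ (integrable_coe _)) hfcont.aestronglyMeasurable hfb
    rw [e δ 0 hδ]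
    refine key.congr' ?_
    filter_upwards [hev] with p hp
    exact (e _ _ (by linarith [hp.1])).symm
  · filter_upwards [hev] with p hp
    have hr : 0 < δ + p.1 := by linarith [hp.1]
    have hc : Continuous (gradHeat n (δ + p.1)) := continuous_gradHeat _
    have hi : AEStronglyMeasurable (fun q : Rn n × Rn n => f q.2 • gradHeat n (δ + p.1) (q.2 - q.1))
        (volume.prod volume) := (by fun_prop : Continuous _).aestronglyMeasurable
    exact hi.integral_prod_right'
  · filter_upwards [hev] with p hp y
    have hr : 0 < δ + p.1 := by linarith [hp.1]
    have hC0 : 0 ≤ C := (norm_nonneg _).trans (hfb 0)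
    have hH := heatC_pos n
    calc ‖∫ x, f x • gradHeat n (δ + p.1) (x - y)‖
        ≤ ∫ x, C * ‖gradHeat n (δ + p.1) (x - y)‖ := by
          refine norm_integral_le_of_norm_le
            (((integrable_gradHeat hr).comp_sub_right y).norm.const_mul C)
            (ae_of_all _ fun x => ?_)
          rw [norm_smul]; gcongr; exact hfb x
      _ = C * ∫ x, ‖gradHeat n (δ + p.1) x‖ := by
          rw [integral_const_mul, integral_sub_right_eq_self (fun x => ‖gradHeat n (δ + p.1) x‖)]
      _ ≤ C * (heatC n / √(δ / 2)) := by
          gcongr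
          refine (integral_norm_gradHeat_le hr).trans ?_
          gcongr
          exact hp.1
  · intro y
    exact (tendsto_integral_smul_gradHeat hf hfb hδ y).comp hfst

/-- The mollified equation in weak form: the right derivative at time `0` of `∫ f (G_δ * ρ_t)`. -/
lemma IsMildSolution.tendsto_weak_derivative (hg : AEStronglyMeasurable g)
    (hΓ : ∀ᵐ x, ‖g x‖ ≤ Γ) (h : IsMildSolution g ρ₀ ρ) {δ : ℝ} (hδ : 0 < δ) :
    Tendsto (fun t => t⁻¹ * ∫ x, f x * (mollify δ (ρ t) x - mollify δ ρ₀ x)) (𝓝[>] 0)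
      (𝓝 (-∫ x, inner ℝ (f' x) (gradMoll δ ρ₀ x + mollify δ (drift g ρ₀) x))) := by
  have hfcont := continuous_of_hasGradientAt hf
  have hF0 := integrable_drift hg hΓ (integrable_coe ρ₀)
  have hC0 : 0 ≤ C := (norm_nonneg _).trans (hfb 0)
  -- the heat part
  have h1 : Tendsto (fun t => t⁻¹ * ((∫ x, f x * mollify (δ + t) ρ₀ x)
      - ∫ x, f x * mollify δ ρ₀ x)) (𝓝[>] 0) (𝓝 (-∫ x, inner ℝ (f' x) (gradMoll δ ρ₀ x))) := by
    have hd := hasDerivAt_integral_mul_mollify hf hfc hfb hfb' hδ (integrable_coe ρ₀)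
    have := hd.tendsto_slope_zero_right
    simpa using this
  -- the drift part
  set q : ℝ × ℝ → ℝ := fun p => ∫ x, f x * divMoll (δ + p.1) (drift g (ρ p.2)) x with hq
  have h2 : Tendsto (fun t => t⁻¹ * ∫ s in (0 : ℝ)..t, q (t - s, s)) (𝓝[>] 0)
      (𝓝 (-∫ x, inner ℝ (f' x) (mollify δ (drift g ρ₀) x))) := by
    have hlim := tendsto_integral_mul_divMoll hf hfb hg hΓ h.continuousOn hδ
    rw [← integral_mul_divMoll_eq hf hfc hfb hfb' hδ hF0, ← h.initial]
    set q₀ := ∫ x, f x * divMoll δ (drift g (ρ 0)) x with hq₀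
    rw [Metric.tendsto_nhdsWithin_nhds] at hlim ⊢
    intro ε hε
    obtain ⟨η, hη, hη2⟩ := hlim (ε / 2) (by positivity)
    refine ⟨η, hη, fun {t} ht htη => ?_⟩
    have ht0 : 0 < t := ht
    rw [Real.dist_eq, sub_zero, abs_of_pos ht0] at htη
    have hqi : IntervalIntegrable (fun s => q (t - s, s)) volume 0 t := by
      rw [intervalIntegrable_iff_integrableOn_Ioc_of_le ht0.le]
      have h3 : Integrable (fun p : ℝ × Rn n =>
          f p.2 * divMoll (δ + t - p.1) (drift g (ρ p.1)) p.2)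
          ((volume.restrict (Ioc 0 t)).prod volume) :=
        (integrable_duhamel hg hΓ h.continuousOn (by linarith)).bdd_mul
          hfcont.aestronglyMeasurable.comp_snd (ae_of_all _ fun p => hfb p.2)
      have h4 := h3.integral_prod_left
      simp only [add_sub_assoc] at h4
      exact h4
    have hb : ∀ s ∈ uIoc 0 t, ‖q (t - s, s) - q₀‖ ≤ ε / 2 := by
      intro s hs
      rw [uIoc_of_le ht0.le] at hs
      have := hη2 (x := (t - s, s)) hs.1.le (by
        rw [Prod.dist_eq, max_lt_iff, Real.dist_eq, Real.dist_eq, sub_zero, sub_zero,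
          abs_of_nonneg (by linarith [hs.2]), abs_of_pos hs.1]
        exact ⟨by linarith [hs.1], by linarith [hs.2]⟩)
      rw [dist_eq_norm] at this
      exact this.le
    have h5 := intervalIntegral.norm_integral_le_of_norm_le_const hb
    rw [intervalIntegral.integral_sub hqi intervalIntegrable_const,
      intervalIntegral.integral_const, sub_zero, abs_of_pos ht0, smul_eq_mul] at h5
    rw [Real.dist_eq]
    have e : t⁻¹ * (∫ s in (0 : ℝ)..t, q (t - s, s)) - q₀
        = t⁻¹ * ((∫ s in (0 : ℝ)..t, q (t - s, s)) - t * q₀) := by field_simp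
    rw [e, abs_mul, abs_of_pos (inv_pos.2 ht0)]
    calc t⁻¹ * |(∫ s in (0 : ℝ)..t, q (t - s, s)) - t * q₀| ≤ t⁻¹ * (ε / 2 * t) := by
          gcongr; exact h5
      _ = ε / 2 := by field_simp
      _ < ε := by linarith
  have hsum := h1.add h2
  have hi1 : Integrable fun x => inner ℝ (f' x) (gradMoll δ ρ₀ x) :=
    ((integrable_gradMoll hδ (integrable_coe ρ₀)).norm.const_mul C').mono'
      (hfc.aestronglyMeasurable.inner
        (integrable_gradMoll hδ (integrable_coe ρ₀)).aestronglyMeasurable)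
      (ae_of_all _ fun x => (norm_inner_le_norm _ _).trans (by gcongr; exact hfb' x))
  have hi2 : Integrable fun x => inner ℝ (f' x) (mollify δ (drift g ρ₀) x) :=
    ((integrable_mollify hδ hF0).norm.const_mul C').mono'
      (hfc.aestronglyMeasurable.inner (integrable_mollify hδ hF0).aestronglyMeasurable)
      (ae_of_all _ fun x => (norm_inner_le_norm _ _).trans (by gcongr; exact hfb' x))
  have elim : -(∫ x, inner ℝ (f' x) (gradMoll δ ρ₀ x))
      + -(∫ x, inner ℝ (f' x) (mollify δ (drift g ρ₀) x))
      = -∫ x, inner ℝ (f' x) (gradMoll δ ρ₀ x + mollify δ (drift g ρ₀) x) := by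
    simp only [inner_add_right]
    rw [integral_add hi1 hi2]; ring
  rw [elim] at hsum
  refine hsum.congr' ?_
  filter_upwards [self_mem_nhdsWithin] with t ht
  have ht0 : 0 < t := ht
  obtain ⟨h3, h4⟩ := integral_mul_duhamel hg hΓ h.continuousOn (τ := δ + t) ht0.le (by linarith)
    hfcont.aestronglyMeasurable hfb
  have i1 : ∀ r, 0 < r → Integrable fun x => f x * mollify r ρ₀ x := fun r hr =>
    (integrable_mollify hr (integrable_coe ρ₀)).bdd_mul hfcont.aestronglyMeasurable
      (ae_of_all _ hfb)
  rw [← mul_add]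
  congr 1
  have e : ∀ x, f x * (mollify δ (ρ t) x - mollify δ ρ₀ x)
      = (f x * mollify (δ + t) ρ₀ x - f x * mollify δ ρ₀ x)
        + f x * ∫ s in (0 : ℝ)..t, divMoll (δ + t - s) (drift g (ρ s)) x := by
    intro x
    rw [h.mollify_eq hg hΓ hδ ht0.le]; ring
  simp only [e]
  have i2 : Integrable fun x => f x * mollify (δ + t) ρ₀ x - f x * mollify δ ρ₀ x :=
    (i1 _ (by positivity)).sub (i1 _ hδ)
  rw [integral_add i2 h3, h4, integral_sub (i1 _ (by positivity)) (i1 _ hδ)]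
  congr 1
  simp only [hq, add_sub_assoc]

end TimeDerivative

/-! ### The chain rule along the mollified solution -/

section Chain

variable {n : ℕ} {g : Rn n → Rn n} {Γ : ℝ} {ρ₀ : Rn n →₁[volume] ℝ} {ρ : ℝ → (Rn n →₁[volume] ℝ)}

lemma integral_norm_intervalIntegral_le {h : ℝ × Rn n → ℝ} {T : ℝ} (hT : 0 ≤ T)
    (hi : Integrable h ((volume.restrict (Ioc 0 T)).prod volume)) {b : ℝ → ℝ}
    (hb : IntervalIntegrable b volume 0 T) (hle : ∀ s ∈ Ioo 0 T, ∫ x, ‖h (s, x)‖ ≤ b s) :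
    ∫ x, ‖∫ s in (0 : ℝ)..T, h (s, x)‖ ≤ ∫ s in (0 : ℝ)..T, b s := by
  simp only [intervalIntegral.integral_of_le hT]
  have hn := hi.norm
  calc ∫ x, ‖∫ s in Ioc 0 T, h (s, x)‖ ≤ ∫ x, ∫ s in Ioc 0 T, ‖h (s, x)‖ :=
        integral_mono hi.integral_prod_right.norm hn.integral_prod_right
          fun x => norm_integral_le_integral_norm _
    _ = ∫ s in Ioc 0 T, ∫ x, ‖h (s, x)‖ := by
        rw [← integral_integral_swap hn]
    _ ≤ _ := by
        refine integral_mono_ae hn.integral_prod_left hb.1 ?_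
        have : (volume.restrict (Ioc 0 T)) = volume.restrict (Ioo (0 : ℝ) T) :=
          Measure.restrict_congr_set Ioo_ae_eq_Ioc.symm
        rw [this]
        filter_upwards [ae_restrict_mem measurableSet_Ioo] with s hs using hle s hs

lemma integral_norm_mollify_add_sub_le {δ t : ℝ} (hδ : 0 < δ) (ht : t ∈ Icc 0 δ) {w : Rn n → ℝ}
    (hw : Integrable w) :
    ∫ x, ‖mollify (δ + t) w x - mollify δ w x‖
      ≤ t * (6 * heatC n * (n + 1) / δ * 4 ^ ((n : ℝ) / 2)) * ∫ x, ‖w x‖ := by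
  set A := 6 * heatC n * (n + 1) / δ * 4 ^ ((n : ℝ) / 2) with hA
  have hA0 : 0 ≤ A := by have := heatC_pos n; positivity
  have hδt : 0 < δ + t := by linarith [ht.1]
  set K : Rn n → ℝ := fun z => heatKernel n (δ + t) z - heatKernel n δ z with hK
  have hKi : Integrable K := (integrable_heatKernel hδt).sub (integrable_heatKernel hδ)
  have hb : ∀ z, ‖K z‖ ≤ t * A * heatKernel n (4 * δ) z := by
    intro z
    have := (convex_Icc δ (2 * δ)).norm_image_sub_le_of_norm_hasDerivWithin_le
      (f := fun r => heatKernel n r z) (f' := fun r => dtHeat n r z)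
      (C := A * heatKernel n (4 * δ) z) (x := δ) (y := δ + t)
      (fun r hr => (hasDerivAt_heatKernel_time (by linarith [hr.1]) z).hasDerivWithinAt)
      (fun r hr => abs_dtHeat_le_of_mem hδ ⟨by linarith [hr.1], hr.2⟩ z)
      ⟨le_rfl, by linarith⟩ ⟨by linarith [ht.1], by linarith [ht.2]⟩
    rw [add_sub_cancel_left, Real.norm_of_nonneg ht.1] at this
    linarith
  have e : ∀ x, mollify (δ + t) w x - mollify δ w x
      = (K ⋆[ContinuousLinearMap.lsmul ℝ ℝ, volume] w) x := by
    intro x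
    rw [mollify_apply, mollify_apply, ← integral_sub (integrable_heatKernel_smul hδt hw x)
      (integrable_heatKernel_smul hδ hw x), convolution_eq_swap]
    congr 1; ext1 y
    simp [hK]
  simp only [e]
  refine (integral_norm_convolution_le norm_lsmul_apply_le hKi hw).trans ?_
  gcongr
  calc ∫ z, ‖K z‖ ≤ ∫ z, t * A * heatKernel n (4 * δ) z :=
        integral_mono hKi.norm ((integrable_heatKernel (by positivity)).const_mul _) hb
    _ = t * A := by rw [integral_const_mul, integral_heatKernel (by positivity), mul_one]

variable (hg : AEStronglyMeasurable g) (hΓ : ∀ᵐ x, ‖g x‖ ≤ Γ)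
include hg hΓ

/-- The mollified solution is Lipschitz in time at the origin, with values in `L¹`. -/
lemma IsMildSolution.exists_integral_norm_mollify_sub_le (h : IsMildSolution g ρ₀ ρ) {δ : ℝ}
    (hδ : 0 < δ) : ∃ C, 0 ≤ C ∧ ∀ t ∈ Icc 0 δ,
      ∫ x, ‖mollify δ (ρ t) x - mollify δ ρ₀ x‖ ≤ C * t := by
  obtain ⟨R, hR0, hR⟩ := exists_norm_le h.continuousOn δ
  have hC := heatC_pos n
  have hΓ0 := nonneg_of_ae_norm_le hΓ
  set A := 6 * heatC n * (n + 1) / δ * 4 ^ ((n : ℝ) / 2) with hA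
  refine ⟨A * (∫ x, ‖ρ₀ x‖) + heatC n * Γ * R ^ 2 * (1 / √δ), by positivity, fun t ht => ?_⟩
  have hi := integrable_duhamel hg hΓ h.continuousOn (T := t) (τ := δ + t) (by linarith)
  have h1 := integral_norm_mollify_add_sub_le hδ ht (integrable_coe ρ₀)
  have h2 := integral_norm_intervalIntegral_le (b := fun _ => heatC n * Γ * R ^ 2 * (1 / √δ))
    ht.1 hi intervalIntegrable_const (fun s hs => by
      refine (integral_norm_duhamel_le hg hΓ (T := t)
        (fun s hs => hR s ⟨hs.1, hs.2.trans ht.2⟩) ⟨hs.1.le, hs.2.le⟩ (by linarith [hs.2])).trans ?_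
      gcongr
      linarith [hs.2])
  simp only [intervalIntegral.integral_const, sub_zero, smul_eq_mul] at h2
  have e : ∀ x, mollify δ (ρ t) x - mollify δ ρ₀ x
      = (mollify (δ + t) ρ₀ x - mollify δ ρ₀ x)
        + ∫ s in (0 : ℝ)..t, divMoll (δ + t - s) (drift g (ρ s)) x := fun x => by
    rw [h.mollify_eq hg hΓ hδ ht.1]; ring
  have i1 : Integrable fun x => mollify (δ + t) ρ₀ x - mollify δ ρ₀ x :=
    (integrable_mollify (by linarith [ht.1]) (integrable_coe _)).sub
      (integrable_mollify hδ (integrable_coe _))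
  have i2 : Integrable fun x => ∫ s in (0 : ℝ)..t, divMoll (δ + t - s) (drift g (ρ s)) x := by
    simp only [intervalIntegral.integral_of_le ht.1]
    exact hi.integral_prod_right
  calc ∫ x, ‖mollify δ (ρ t) x - mollify δ ρ₀ x‖
      ≤ ∫ x, (‖mollify (δ + t) ρ₀ x - mollify δ ρ₀ x‖
        + ‖∫ s in (0 : ℝ)..t, divMoll (δ + t - s) (drift g (ρ s)) x‖) := by
        refine integral_mono_of_nonneg (ae_of_all _ fun _ => norm_nonneg _) (i1.norm.add i2.norm)
          (ae_of_all _ fun x => ?_)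
        simp only [e]
        exact norm_add_le _ _
    _ ≤ _ := by
        rw [integral_add i1.norm i2.norm]
        linarith

/-- Chain rule. If `I` is differentiable along the mollified solution with differential `∫ f ·`, up
to a quadratic error, then its right derivative at time `t₀` is the one that the equation
predicts. -/
lemma IsMildSolution.hasDerivWithinAt_of_quadratic (h : IsMildSolution g ρ₀ ρ) {δ t₀ : ℝ}
    (hδ : 0 < δ) (ht₀ : 0 ≤ t₀) {f : Rn n → ℝ} {f' : Rn n → Rn n} {C C' K : ℝ} {I : ℝ → ℝ}
    (hf : ∀ x, HasGradientAt f (f' x) x) (hfc : Continuous f') (hfb : ∀ x, ‖f x‖ ≤ C)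
    (hfb' : ∀ x, ‖f' x‖ ≤ C')
    (hI : ∀ t, t₀ < t → t ≤ t₀ + δ →
      |I t - I t₀ - ∫ x, f x * (mollify δ (ρ t) x - mollify δ (ρ t₀) x)|
      ≤ K * ‖ρ t - ρ t₀‖ * ∫ x, ‖mollify δ (ρ t) x - mollify δ (ρ t₀) x‖) :
    HasDerivWithinAt I
      (-∫ x, inner ℝ (f' x) (gradMoll δ (ρ t₀) x + mollify δ (drift g (ρ t₀)) x)) (Ici t₀) t₀ := by
  have hr := h.restart hg hΓ ht₀
  obtain ⟨A, hA0, hA⟩ := hr.exists_integral_norm_mollify_sub_le hg hΓ hδ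
  have hlim := hr.tendsto_weak_derivative hf hfc hfb hfb' hg hΓ hδ
  have hcont : Tendsto (fun t => |K| * ‖ρ (t₀ + t) - ρ t₀‖ * A) (𝓝[>] 0) (𝓝 0) := by
    have h1 : ContinuousWithinAt (fun t => ρ (t₀ + t)) (Ici 0) 0 := hr.continuousOn 0 (by simp)
    have h2 : Tendsto (fun t => ρ (t₀ + t)) (𝓝[>] 0) (𝓝 (ρ t₀)) := by
      have := h1.tendsto.mono_left (nhdsWithin_mono 0 Ioi_subset_Ici_self)
      simpa using this
    have h3 := ((h2.sub_const (ρ t₀)).norm.const_mul |K|).mul_const A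
    simpa using h3
  have herr : Tendsto (fun t => t⁻¹ * (I (t₀ + t) - I t₀ -
      ∫ x, f x * (mollify δ (ρ (t₀ + t)) x - mollify δ (ρ t₀) x))) (𝓝[>] 0) (𝓝 0) := by
    refine squeeze_zero_norm' ?_ hcont
    filter_upwards [Ioc_mem_nhdsGT hδ] with t ht
    rw [norm_mul, norm_inv, Real.norm_of_nonneg ht.1.le, Real.norm_eq_abs]
    have h1 := hI (t₀ + t) (by linarith [ht.1]) (by linarith [ht.2])
    have h2 := hA t ⟨ht.1.le, ht.2⟩
    have h3 : 0 ≤ ∫ x, ‖mollify δ (ρ (t₀ + t)) x - mollify δ (ρ t₀) x‖ :=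
      integral_nonneg fun _ => norm_nonneg _
    have ht0 := ht.1
    calc t⁻¹ * |I (t₀ + t) - I t₀ - ∫ x, f x * (mollify δ (ρ (t₀ + t)) x - mollify δ (ρ t₀) x)|
        ≤ t⁻¹ * (|K| * ‖ρ (t₀ + t) - ρ t₀‖ * (A * t)) := by
          gcongr
          refine h1.trans ?_
          gcongr
          exact le_abs_self K
      _ = _ := by field_simp
  have hsum := hlim.add herr
  rw [add_zero] at hsum
  have hs0 : Tendsto (fun t => t - t₀) (𝓝[>] t₀) (𝓝[>] 0) := by
    refine tendsto_nhdsWithin_iff.2 ⟨?_, ?_⟩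
    · have : Continuous fun t : ℝ => t - t₀ := by fun_prop
      simpa using (this.tendsto t₀).mono_left nhdsWithin_le_nhds
    · filter_upwards [self_mem_nhdsWithin] with t ht
      exact sub_pos.2 (show t₀ < t from ht)
  rw [← hasDerivWithinAt_Ioi_iff_Ici, hasDerivWithinAt_iff_tendsto_slope' (by simp)]
  refine (hsum.comp hs0).congr fun t => ?_
  simp only [Function.comp, add_sub_cancel, slope_def_module, smul_eq_mul]
  ring

end Chain

/-! ### Bounded variation of mild solutions -/

section BV

variable {n : ℕ} {g : Rn n → Rn n} {Γ : ℝ} {ρ₀ : Rn n →₁[volume] ℝ} {ρ : ℝ → (Rn n →₁[volume] ℝ)}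

lemma divMoll_translate_sub {r : ℝ} (hr : 0 < r) {F : Rn n → Rn n} (hF : Integrable F)
    (z : Rn n) (x : Rn n) : divMoll r F (x + z) - divMoll r F x
      = divMoll r (fun y => F (y + z) - F y) x := by
  have hb : ∀ w, ‖gradHeat n r w‖ ≤ heatC n / √r * (4 * π * r) ^ (-(n : ℝ) / 2) := fun w =>
    norm_gradHeat_le_const hr le_rfl w
  have hI : ∀ {H : Rn n → Rn n}, Integrable H →
      Integrable fun y => (inner ℝ (gradHeat n r (x - y)) (H y) : ℝ) := fun hH =>
    integrable_convolution_integrand_of_bounded norm_innerSL_apply_le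
      (continuous_gradHeat r).aestronglyMeasurable hb hH x
  have e : divMoll r F (x + z) = ∫ y, inner ℝ (gradHeat n r (x - y)) (F (y + z)) := by
    rw [divMoll_apply, ← integral_add_right_eq_self _ z]
    simp
  rw [e, divMoll_apply, divMoll_apply, ← integral_sub (hI (hF.comp_add_right z)) (hI hF)]
  congr 1; ext1 y
  rw [inner_sub_right]

lemma mollify_translate_sub {E : Type*} [NormedAddCommGroup E] [NormedSpace ℝ E] {r : ℝ}
    (hr : 0 < r) {F : Rn n → E} (hF : Integrable F)
    (z : Rn n) (x : Rn n) : mollify r F (x + z) - mollify r F x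
      = mollify r (fun y => F (y + z) - F y) x := by
  rw [mollify_sub hr (hF.comp_add_right z) hF]
  congr 1
  rw [mollify_apply, mollify_apply, ← integral_add_right_eq_self _ z]
  simp

lemma integral_norm_mollify_translate_sub_le {E : Type*} [NormedAddCommGroup E] [NormedSpace ℝ E]
    {r : ℝ} (hr : 0 < r) {F : Rn n → E} (hF : Integrable F) (z : Rn n) :
    ∫ x, ‖mollify r F (x + z) - mollify r F x‖ ≤ ∫ x, ‖F (x + z) - F x‖ := by
  simp only [mollify_translate_sub hr hF]
  exact integral_norm_mollify_le hr ((hF.comp_add_right z).sub hF)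

/-- Splits the product of the two singularities of the Beta integral `∫ s^{-1/2} (t - s)^{-1/2}`. -/
lemma one_div_sqrt_mul_sqrt_le {s t : ℝ} (hs : 0 < s) (hst : s < t) :
    1 / √s * (1 / √(t - s)) ≤ 1 / √t * (1 / √s + 1 / √(t - s)) := by
  have h1 : 0 < √s := Real.sqrt_pos.2 hs
  have h2 : 0 < √(t - s) := Real.sqrt_pos.2 (by linarith)
  have h3 : 0 < √t := Real.sqrt_pos.2 (by linarith)
  have h4 : √t ≤ √s + √(t - s) := by
    rw [Real.sqrt_le_iff]
    have h5 := Real.sq_sqrt hs.le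
    have h6 := Real.sq_sqrt (show 0 ≤ t - s by linarith)
    exact ⟨by positivity, by nlinarith [mul_pos h1 h2]⟩
  rw [div_add_div _ _ h1.ne' h2.ne', ← mul_div_mul_comm, ← mul_div_mul_comm,
    div_le_div_iff₀ (by positivity) (by positivity)]
  have : 0 < √s * √(t - s) := by positivity
  nlinarith

variable (hg : AEStronglyMeasurable g) (hΓ : ∀ᵐ x, ‖g x‖ ≤ Γ)
include hg hΓ

lemma integral_norm_drift_translate_sub_le {σ : Rn n → ℝ} (hσ : Integrable σ) (z : Rn n) :
    ∫ x, ‖drift g σ (x + z) - drift g σ x‖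
      ≤ 2 * Γ * (∫ x, ‖σ x‖) * ∫ x, ‖σ (x + z) - σ x‖ := by
  have h1 := integral_norm_drift_sub_le hg hΓ (hσ.comp_add_right z) hσ
  rw [integral_add_right_eq_self (fun x => ‖σ x‖) z] at h1
  have e : ∀ x, drift g σ (x + z) = drift g (fun y => σ (y + z)) x := fun x => by
    simp only [drift_eq, vel_translate]
  simp only [e]
  linarith

/-- The integral inequality for the `L¹` modulus of continuity of the solution. -/
lemma IsMildSolution.translate_le (h : IsMildSolution g ρ₀ ρ) {R S t : ℝ} (ht : 0 < t)
    (hR : ∀ s ∈ Icc 0 t, ‖ρ s‖ ≤ R) (z : Rn n)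
    (hS : ∀ s ∈ Ioo 0 t, ∫ x, ‖ρ s (x + z) - ρ s x‖ ≤ S * (1 / √s)) :
    ∫ x, ‖ρ t (x + z) - ρ t x‖
      ≤ ‖z‖ * (heatC n / √t * R) + 8 * heatC n * Γ * R * S := by
  have hC := heatC_pos n
  have hΓ0 := nonneg_of_ae_norm_le hΓ
  have hR0 : 0 ≤ R := (norm_nonneg _).trans (hR 0 ⟨le_rfl, ht.le⟩)
  have hi := integrable_duhamel hg hΓ h.continuousOn (T := t) (τ := t) le_rfl
  have hmp : MeasurePreserving (fun p : ℝ × Rn n => (p.1, p.2 + z))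
      ((volume.restrict (Ioc 0 t)).prod volume) ((volume.restrict (Ioc 0 t)).prod volume) :=
    (MeasurePreserving.id _).prod (measurePreserving_add_right volume z)
  have hiz := (hmp.integrable_comp hi.aestronglyMeasurable).2 hi
  have hd := hiz.sub hi
  set b : ℝ → ℝ := fun s => heatC n * (2 * Γ * R) * S * (1 / √t) * (1 / √s + 1 / √(t - s)) with hb
  have hbi : IntervalIntegrable b volume 0 t :=
    ((intervalIntegrable_inv_sqrt 0 t).add (intervalIntegrable_inv_sqrt_sub t 0 t)).const_mul _
  have hbint : ∫ s in (0 : ℝ)..t, b s = 8 * heatC n * Γ * R * S := by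
    simp only [hb]
    rw [intervalIntegral.integral_const_mul, intervalIntegral.integral_add
      (intervalIntegrable_inv_sqrt 0 t) (intervalIntegrable_inv_sqrt_sub t 0 t),
      integral_inv_sqrt ht.le, integral_inv_sqrt_sub ht.le]
    have : √t ≠ 0 := (Real.sqrt_pos.2 ht).ne'
    field_simp
    ring
  have h2 := integral_norm_intervalIntegral_le ht.le hd hbi (fun s hs => by
    have hr : 0 < t - s := by linarith [hs.2]
    have hF := integrable_drift hg hΓ (integrable_coe (ρ s))
    simp only [Pi.sub_apply, Function.comp, divMoll_translate_sub hr hF]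
    refine (integral_norm_divMoll_le hr ((hF.comp_add_right z).sub hF)).trans ?_
    have h3 := integral_norm_drift_translate_sub_le hg hΓ (integrable_coe (ρ s)) z
    rw [integral_norm_coe] at h3
    have hS' := hS s hs
    have h4 : 2 * Γ * ‖ρ s‖ * ∫ x, ‖ρ s (x + z) - ρ s x‖ ≤ 2 * Γ * R * (S * (1 / √s)) := by
      exact mul_le_mul (mul_le_mul_of_nonneg_left (hR s ⟨hs.1.le, hs.2.le⟩) (by positivity)) hS'
        (integral_nonneg fun _ => norm_nonneg _) (by positivity)
    have hS0 : 0 ≤ S := by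
      have h5 : 0 ≤ S * (1 / √s) := (integral_nonneg fun _ => norm_nonneg _).trans hS'
      have h6 : 0 < 1 / √s := by have := Real.sqrt_pos.2 hs.1; positivity
      exact nonneg_of_mul_nonneg_left h5 h6
    calc heatC n / √(t - s) * ∫ x, ‖drift g (ρ s) (x + z) - drift g (ρ s) x‖
        ≤ heatC n / √(t - s) * (2 * Γ * R * (S * (1 / √s))) := by
          gcongr; exact h3.trans h4
      _ = heatC n * (2 * Γ * R) * S * (1 / √s * (1 / √(t - s))) := by ring
      _ ≤ heatC n * (2 * Γ * R) * S * (1 / √t * (1 / √s + 1 / √(t - s))) := by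
          exact mul_le_mul_of_nonneg_left (one_div_sqrt_mul_sqrt_le hs.1 hs.2) (by positivity)
      _ = b s := by simp only [hb]; ring)
  rw [hbint] at h2
  have h1 := integral_norm_translate_sub_le (fun x => hasGradientAt_mollify ht (integrable_coe ρ₀) x)
    (continuous_gradMoll ht (integrable_coe ρ₀)) (integrable_gradMoll ht (integrable_coe ρ₀)) z
  have h1' : ∫ x, ‖gradMoll t ρ₀ x‖ ≤ heatC n / √t * R := by
    refine (integral_norm_convolution_le norm_lsmul_flip_apply_le (integrable_gradHeat ht)
      (integrable_coe ρ₀)).trans ?_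
    have h0 := hR 0 ⟨le_rfl, ht.le⟩
    rw [h.initial] at h0
    rw [integral_norm_coe]
    have := integral_norm_gradHeat_le (n := n) ht
    gcongr
  have hm := integrable_mollify ht (integrable_coe ρ₀)
  have i1 : Integrable fun x => mollify t ρ₀ (x + z) - mollify t ρ₀ x :=
    (hm.comp_add_right z).sub hm
  have i2 := hd.integral_prod_right
  simp only [← intervalIntegral.integral_of_le ht.le] at i2
  have hD := h.duhamel' ht
  have hDz := (measurePreserving_add_right volume z).quasiMeasurePreserving.ae hD
  have hs1 := hi.prod_left_ae
  have hs2 := hiz.prod_left_ae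
  calc ∫ x, ‖ρ t (x + z) - ρ t x‖ ≤ ∫ x, (‖mollify t ρ₀ (x + z) - mollify t ρ₀ x‖
        + ‖∫ s in (0 : ℝ)..t, (divMoll (t - s) (drift g (ρ s)) (x + z)
            - divMoll (t - s) (drift g (ρ s)) x)‖) := by
        refine integral_mono_of_nonneg (ae_of_all _ fun _ => norm_nonneg _) (i1.norm.add i2.norm) ?_
        filter_upwards [hD, hDz, hs1, hs2] with x h3 h4 h5 h6
        rw [h3, h4]
        have h7 := intervalIntegral.integral_sub
          ((intervalIntegrable_iff_integrableOn_Ioc_of_le ht.le).2 h6)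
          ((intervalIntegrable_iff_integrableOn_Ioc_of_le ht.le).2 h5)
        simp only [Function.comp] at h7
        rw [h7, show ∀ a b c d : ℝ, a + b - (c + d) = (a - c) + (b - d) by intros; ring]
        exact norm_add_le _ _
    _ = (∫ x, ‖mollify t ρ₀ (x + z) - mollify t ρ₀ x‖) + ∫ x, ‖∫ s in (0 : ℝ)..t,
          (divMoll (t - s) (drift g (ρ s)) (x + z) - divMoll (t - s) (drift g (ρ s)) x)‖ :=
        integral_add i1.norm i2.norm
    _ ≤ _ := add_le_add (h1.trans (by gcongr)) h2

/-- For short positive times a mild solution is of bounded variation, with the rate `t^{-1/2}`. -/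
lemma IsMildSolution.exists_translate_le (h : IsMildSolution g ρ₀ ρ) :
    ∃ T K : ℝ, 0 < T ∧ 0 ≤ K ∧ ∀ t ∈ Ioc 0 T, ∀ z : Rn n,
      ∫ x, ‖ρ t (x + z) - ρ t x‖ ≤ K * (1 / √t) * ‖z‖ := by
  obtain ⟨R, hR0, hR⟩ := exists_norm_le h.continuousOn 1
  have hC := heatC_pos n
  have hΓ0 := nonneg_of_ae_norm_le hΓ
  set A := 8 * heatC n * Γ * R with hA
  have hA0 : 0 ≤ A := by positivity
  -- `T` is so small that the Duhamel term can be absorbed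
  set T := min 1 ((1 / (2 * (A + 1))) ^ 2) with hT
  have hT0 : 0 < T := lt_min one_pos (by positivity)
  have hT1 : T ≤ 1 := min_le_left _ _
  have hTA : √T * A ≤ 1 / 2 := by
    have : √T ≤ 1 / (2 * (A + 1)) := by
      rw [Real.sqrt_le_left (by positivity)]; exact min_le_right _ _
    calc √T * A ≤ 1 / (2 * (A + 1)) * (A + 1) := by gcongr; linarith
      _ = 1 / 2 := by field_simp
  refine ⟨T, 2 * (heatC n * R), hT0, by positivity, fun t ht z => ?_⟩
  set m : ℝ → ℝ := fun t => ∫ x, ‖ρ t (x + z) - ρ t x‖ with hm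
  have hm0 : ∀ t, 0 ≤ m t := fun t => integral_nonneg fun _ => norm_nonneg _
  have hm2 : ∀ t ∈ Ioc 0 T, m t ≤ 2 * R := fun t ht => by
    have h1 := integral_norm_translate_le (integrable_coe (ρ t)) (-z)
    simp only [sub_neg_eq_add] at h1
    rw [integral_norm_coe] at h1
    have := hR t ⟨ht.1.le, ht.2.trans hT1⟩
    exact h1.trans (by linarith)
  set S := sSup ((fun t => √t * m t) '' Ioc 0 T) with hSdef
  have hbdd : BddAbove ((fun t => √t * m t) '' Ioc 0 T) := by
    refine ⟨√T * (2 * R), ?_⟩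
    rintro _ ⟨s, hs, rfl⟩
    have := hm0 s
    have := hm2 s hs
    have := Real.sqrt_le_sqrt hs.2
    dsimp only
    gcongr
  have hSle : ∀ s ∈ Ioc 0 T, √s * m s ≤ S := fun s hs => le_csSup hbdd ⟨s, hs, rfl⟩
  have hS0 : 0 ≤ S := (mul_nonneg (Real.sqrt_nonneg _) (hm0 t)).trans (hSle t ht)
  have key : ∀ t ∈ Ioc 0 T, √t * m t ≤ ‖z‖ * (heatC n * R) + S / 2 := by
    intro t ht
    have hst := Real.sqrt_pos.2 ht.1
    have h1 := h.translate_le hg hΓ (S := S) ht.1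
      (fun s hs => hR s ⟨hs.1, hs.2.trans (ht.2.trans hT1)⟩)
      z (fun s hs => by
        have h2 := hSle s ⟨hs.1, hs.2.le.trans ht.2⟩
        have h3 := Real.sqrt_pos.2 hs.1
        rw [mul_one_div, le_div_iff₀ h3]
        simp only [hm] at h2
        linarith)
    calc √t * m t ≤ √t * (‖z‖ * (heatC n / √t * R) + A * S) := by gcongr
      _ = ‖z‖ * (heatC n * R) + (√t * A) * S := by field_simp
      _ ≤ ‖z‖ * (heatC n * R) + (1 / 2) * S := by
          gcongr
          exact (mul_le_mul_of_nonneg_right (Real.sqrt_le_sqrt ht.2) hA0).trans hTA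
      _ = _ := by ring
  have hS1 : S ≤ ‖z‖ * (heatC n * R) + S / 2 := by
    refine csSup_le ⟨_, t, ht, rfl⟩ ?_
    rintro _ ⟨s, hs, rfl⟩
    exact key s hs
  have hst := Real.sqrt_pos.2 ht.1
  have h4 := hSle t ht
  have h5 : m t ≤ S * (1 / √t) := by rw [mul_one_div, le_div_iff₀ hst]; linarith
  calc m t ≤ S * (1 / √t) := h5
    _ ≤ (2 * (‖z‖ * (heatC n * R))) * (1 / √t) := by gcongr; linarith
    _ = _ := by ring

end BV

/-! ### The commutator of mollification and drift -/

section Commutator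

variable {n : ℕ}

/-- Integration by parts against a field of bounded variation. -/
lemma abs_integral_inner_le_of_translate {f : Rn n → ℝ} {f' e : Rn n → Rn n} {C C' K : ℝ}
    (hf : ∀ x, HasGradientAt f (f' x) x) (hfb : ∀ x, ‖f x‖ ≤ C)
    (hfb' : ∀ x, ‖f' x‖ ≤ C') (he : Integrable e)
    (hK : ∀ w, ∫ x, ‖e (x + w) - e x‖ ≤ K * ‖w‖) :
    |∫ x, inner ℝ (f' x) (e x)| ≤ n * (C * K) := by
  have hfcont := continuous_of_hasGradientAt hf
  have hC : 0 ≤ C := (norm_nonneg _).trans (hfb 0)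
  set h : ℕ → ℝ := fun k => 1 / ((k : ℝ) + 1) with hh
  have hpos : ∀ k, 0 < h k := fun k => by positivity
  have hlim : Tendsto h atTop (𝓝[>] 0) := tendsto_nhdsWithin_iff.2
    ⟨tendsto_one_div_add_atTop_nhds_zero_nat, Eventually.of_forall hpos⟩
  -- the difference quotients of `f` are bounded by `C'`
  have hlip : ∀ (v : Rn n) (k : ℕ) x, ‖f (x + h k • v) - f x‖ ≤ C' * (h k * ‖v‖) := by
    intro v k x
    have := (convex_univ).norm_image_sub_le_of_norm_hasFDerivWithin_le (𝕜 := ℝ) (f := f)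
      (C := C') (x := x) (y := x + h k • v)
      (fun y _ => (hasGradientAt_iff_hasFDerivAt.1 (hf y)).hasFDerivWithinAt)
      (fun y _ => by simpa using hfb' y) (mem_univ _) (mem_univ _)
    rwa [add_sub_cancel_left, norm_smul, Real.norm_of_nonneg (hpos k).le] at this
  have hdir : ∀ v : Rn n, ‖v‖ = 1 → Integrable (fun x => inner ℝ (f' x) v * inner ℝ v (e x)) ∧
      |∫ x, inner ℝ (f' x) v * inner ℝ v (e x)| ≤ C * K := by
    intro v hv
    have hev : Integrable fun x => (inner ℝ v (e x) : ℝ) := he.const_inner v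
    have hptw : ∀ x, Tendsto (fun k => (h k)⁻¹ * (f (x + h k • v) - f x) * inner ℝ v (e x)) atTop
        (𝓝 (inner ℝ (f' x) v * inner ℝ v (e x))) := by
      intro x
      have h1 := ((hf x).hasLineDerivAt_inner v).tendsto_slope_zero_right
      exact (h1.comp hlim).mul_const _
    have hmeas : ∀ k, AEStronglyMeasurable
        (fun x => (h k)⁻¹ * (f (x + h k • v) - f x) * inner ℝ v (e x)) :=
      fun k => ((by fun_prop : Continuous fun x =>
        (h k)⁻¹ * (f (x + h k • v) - f x)).aestronglyMeasurable).mul hev.aestronglyMeasurable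
    have hbd : ∀ k x, ‖(h k)⁻¹ * (f (x + h k • v) - f x) * inner ℝ v (e x)‖
        ≤ C' * ‖(inner ℝ v (e x) : ℝ)‖ := by
      intro k x
      have h1 := hlip v k x
      have h2 := hpos k
      rw [norm_mul, norm_mul, norm_inv, Real.norm_of_nonneg h2.le]
      gcongr
      rw [inv_mul_le_iff₀ h2]
      rw [hv, mul_one] at h1
      linarith
    have hI : Integrable fun x => inner ℝ (f' x) v * inner ℝ v (e x) := by
      refine (hev.norm.const_mul C').mono'
        (aestronglyMeasurable_of_tendsto_ae atTop hmeas (ae_of_all _ hptw)) (ae_of_all _ fun x => ?_)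
      exact le_of_tendsto (hptw x).norm (Eventually.of_forall fun k => hbd k x)
    refine ⟨hI, ?_⟩
    have hL := tendsto_integral_of_dominated_convergence (μ := volume) _ hmeas
      (hev.norm.const_mul C') (fun k => ae_of_all _ (hbd k)) (ae_of_all _ hptw)
    refine le_of_tendsto hL.abs (Eventually.of_forall fun k => ?_)
    have i0 : Integrable fun x => f x * inner ℝ v (e x) :=
      hev.bdd_mul hfcont.aestronglyMeasurable (ae_of_all _ hfb)
    have i1 : Integrable fun x => f (x + h k • v) * inner ℝ v (e x) :=
      hev.bdd_mul (by fun_prop : Continuous fun x => f (x + h k • v)).aestronglyMeasurable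
        (ae_of_all _ fun x => hfb _)
    have i2 : Integrable fun x => f x * inner ℝ v (e (x + -(h k • v))) :=
      (hev.comp_add_right (-(h k • v))).bdd_mul hfcont.aestronglyMeasurable (ae_of_all _ hfb)
    have e1 : ∫ x, (h k)⁻¹ * (f (x + h k • v) - f x) * inner ℝ v (e x)
        = (h k)⁻¹ * ∫ x, f x * inner ℝ v (e (x + -(h k • v)) - e x) := by
      rw [← integral_const_mul]
      have e2 : ∫ x, f (x + h k • v) * inner ℝ v (e x)
          = ∫ x, f x * inner ℝ v (e (x + -(h k • v))) := by
        rw [← integral_add_right_eq_self (fun x => f x * inner ℝ v (e (x + -(h k • v)))) (h k • v)]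
        simp
      simp only [mul_assoc]
      rw [integral_const_mul, integral_const_mul]
      congr 1
      simp only [sub_mul, inner_sub_right, mul_sub]
      rw [integral_sub i1 i0, integral_sub i2 i0, e2]
    rw [e1, abs_mul, abs_inv, abs_of_pos (hpos k), inv_mul_le_iff₀ (hpos k)]
    calc |∫ x, f x * inner ℝ v (e (x + -(h k • v)) - e x)|
        ≤ ∫ x, C * ‖e (x + -(h k • v)) - e x‖ := by
          rw [← Real.norm_eq_abs]
          refine norm_integral_le_of_norm_le
            (((he.comp_add_right (-(h k • v))).sub he).norm.const_mul C) (ae_of_all _ fun x => ?_)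
          rw [norm_mul]
          gcongr
          · exact hfb x
          · exact (norm_inner_le_norm _ _).trans (by rw [hv, one_mul])
      _ ≤ C * (K * ‖-(h k • v)‖) := by
          rw [integral_const_mul]; gcongr; exact hK _
      _ = h k * (C * K) := by
          rw [norm_neg, norm_smul, hv, Real.norm_of_nonneg (hpos k).le]; ring
  set b := EuclideanSpace.basisFun (Fin n) ℝ with hb
  have hsum : ∀ x, (inner ℝ (f' x) (e x) : ℝ) = ∑ i, inner ℝ (f' x) (b i) * inner ℝ (b i) (e x) :=
    fun x => (b.sum_inner_mul_inner (f' x) (e x)).symm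
  have hb1 : ∀ i, ‖b i‖ = 1 := fun i => b.norm_eq_one i
  simp only [hsum]
  rw [integral_finsetSum _ fun i _ => (hdir (b i) (hb1 i)).1]
  refine (Finset.abs_sum_le_sum_abs _ _).trans ?_
  calc ∑ i, |∫ x, inner ℝ (f' x) (b i) * inner ℝ (b i) (e x)| ≤ ∑ _i : Fin n, C * K :=
        Finset.sum_le_sum fun i _ => (hdir (b i) (hb1 i)).2
    _ = _ := by simp

variable {g : Rn n → Rn n} {Γ : ℝ} (hg : AEStronglyMeasurable g) (hΓ : ∀ᵐ x, ‖g x‖ ≤ Γ)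
include hg hΓ

/-- The commutator of mollification with the multiplication by the velocity `b = g * ρ`,
`G_δ * (ρ b) - (G_δ * ρ) (G_δ * b)`. -/
def driftComm (g : Rn n → Rn n) (δ : ℝ) (ρ : Rn n → ℝ) (x : Rn n) : Rn n :=
  mollify δ (drift g ρ) x - mollify δ ρ x • mollify δ (vel g ρ) x

lemma integrable_heatKernel_smul_vel {δ : ℝ} (hδ : 0 < δ) {ρ : Rn n → ℝ} (hρ : Integrable ρ)
    (x : Rn n) : Integrable fun y => heatKernel n δ y • vel g ρ (x - y) := by
  refine (integrable_heatKernel hδ).smul_bdd _ ?_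
    (ae_of_all _ fun y => norm_vel_le hΓ hρ (x - y))
  exact (aestronglyMeasurable_vel hg hρ.aestronglyMeasurable).comp_quasiMeasurePreserving
    (quasiMeasurePreserving_sub_left_of_right_invariant volume x)

omit hg in
lemma norm_mollify_vel_le {δ : ℝ} (hδ : 0 < δ) {ρ : Rn n → ℝ} (hρ : Integrable ρ)
    (x : Rn n) : ‖mollify δ (vel g ρ) x‖ ≤ Γ * ∫ y, ‖ρ y‖ := by
  calc ‖mollify δ (vel g ρ) x‖ ≤ ∫ y, heatKernel n δ y * (Γ * ∫ y, ‖ρ y‖) := by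
        rw [mollify_apply']
        refine norm_integral_le_of_norm_le ((integrable_heatKernel hδ).mul_const _)
          (ae_of_all _ fun y => ?_)
        have := (heatKernel_pos hδ y).le
        rw [norm_smul, Real.norm_of_nonneg this]
        gcongr; exact norm_vel_le hΓ hρ _
    _ = _ := by rw [integral_mul_const, integral_heatKernel hδ, one_mul]

omit hΓ in
lemma aestronglyMeasurable_mollify_vel {δ : ℝ} (hδ : 0 < δ) {ρ : Rn n → ℝ} (hρ : Integrable ρ) :
    AEStronglyMeasurable (mollify δ (vel g ρ)) :=
  AEStronglyMeasurable.integral_prod_right' (f := fun p : Rn n × Rn n =>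
      heatKernel n δ p.2 • vel g ρ (p.1 - p.2))
    ((integrable_heatKernel hδ).aestronglyMeasurable.convolution_integrand
      (ContinuousLinearMap.lsmul ℝ ℝ) (aestronglyMeasurable_vel hg hρ.aestronglyMeasurable))

lemma integrable_driftComm {δ : ℝ} (hδ : 0 < δ) {ρ : Rn n → ℝ} (hρ : Integrable ρ) :
    Integrable (driftComm g δ ρ) :=
  (integrable_mollify hδ (integrable_drift hg hΓ hρ)).sub
    ((integrable_mollify hδ hρ).smul_bdd _ (aestronglyMeasurable_mollify_vel hg hδ hρ)
      (ae_of_all _ fun x => norm_mollify_vel_le hΓ hδ hρ x))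

/-- The commutator as a covariance under the probability measure `G_δ(y) dy`. -/
lemma driftComm_eq {δ : ℝ} (hδ : 0 < δ) {ρ : Rn n → ℝ} (hρ : Integrable ρ) (x : Rn n) :
    driftComm g δ ρ x = ∫ y, heatKernel n δ y •
      ((ρ (x - y) - mollify δ ρ x) • (vel g ρ (x - y) - vel g ρ x)) := by
  have h0 : ∀ {E : Type} [NormedAddCommGroup E] [NormedSpace ℝ E] {F : Rn n → E}, Integrable F →
      Integrable fun y => heatKernel n δ y • F (x - y) := by
    intro E _ _ F hF
    have := (integrable_heatKernel_smul hδ hF x).comp_sub_left x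
    simpa using this
  have h1 := h0 (integrable_drift hg hΓ hρ)
  have h2 := (h0 hρ).smul_const (vel g ρ x)
  have h3 : Integrable fun y => mollify δ ρ x • (heatKernel n δ y • vel g ρ (x - y)) :=
    (integrable_heatKernel_smul_vel hg hΓ hδ hρ x).smul (mollify δ ρ x)
  have h4 := (integrable_heatKernel (n := n) hδ).smul_const (mollify δ ρ x • vel g ρ x)
  have e : ∀ y, heatKernel n δ y • ((ρ (x - y) - mollify δ ρ x) • (vel g ρ (x - y) - vel g ρ x))
      = (heatKernel n δ y • drift g ρ (x - y) - (heatKernel n δ y • ρ (x - y)) • vel g ρ x)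
        - (mollify δ ρ x • (heatKernel n δ y • vel g ρ (x - y))
          - heatKernel n δ y • (mollify δ ρ x • vel g ρ x)) := by
    intro y
    simp only [drift_eq, smul_eq_mul]
    module
  simp only [e]
  have i12 : Integrable fun y => heatKernel n δ y • drift g ρ (x - y)
      - (heatKernel n δ y • ρ (x - y)) • vel g ρ x := h1.sub h2
  have i34 : Integrable fun y => mollify δ ρ x • (heatKernel n δ y • vel g ρ (x - y))
          - heatKernel n δ y • (mollify δ ρ x • vel g ρ x) := h3.sub h4
  rw [integral_sub i12 i34, integral_sub h1 h2, integral_sub h3 h4, integral_smul_const,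
    integral_smul, integral_smul_const, integral_heatKernel hδ, ← mollify_apply', ← mollify_apply',
    ← mollify_apply', driftComm]
  module

/-- The commutator is small of order `√δ` in the space of functions of bounded variation. -/
lemma integral_norm_driftComm_translate_le {δ N : ℝ} (hδ : 0 < δ) (hN0 : 0 ≤ N) {ρ : Rn n → ℝ}
    (hρ : Integrable ρ) (hN : ∀ z, ∫ x, ‖ρ (x + z) - ρ x‖ ≤ N * ‖z‖) (w : Rn n) :
    ∫ x, ‖driftComm g δ ρ (x + w) - driftComm g δ ρ x‖
      ≤ 6 * Γ * N ^ 2 * (heatC n * √δ) * ‖w‖ := by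
  have hΓ0 := nonneg_of_ae_norm_le hΓ
  set u := mollify δ ρ with hu
  have hui : Integrable u := integrable_mollify hδ hρ
  set b := vel g ρ with hb
  set R := ∫ x, ‖ρ x‖ with hR
  have hR0 : 0 ≤ R := integral_nonneg fun _ => norm_nonneg _
  have hbb : ∀ x, ‖b x‖ ≤ Γ * R := norm_vel_le hΓ hρ
  have hbz : ∀ x z, ‖b (x + z) - b x‖ ≤ Γ * (N * ‖z‖) := by
    intro x z
    rw [hb, vel_translate]
    refine (norm_vel_sub_le hg hΓ (hρ.comp_add_right z) hρ x).trans ?_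
    gcongr; exact hN z
  have hbm : AEStronglyMeasurable b := aestronglyMeasurable_vel hg hρ.aestronglyMeasurable
  have hGc : Continuous fun p : Rn n × Rn n => heatKernel n δ p.2 := by fun_prop
  set H : Rn n × Rn n → Rn n := fun p => heatKernel n δ p.2 •
      ((ρ (p.1 - p.2) - u p.1) • (b (p.1 - p.2) - b p.1)) with hH
  have hqm : Measure.QuasiMeasurePreserving (fun p : Rn n × Rn n => p.1 - p.2)
      (volume.prod volume) volume := quasiMeasurePreserving_sub volume volume
  have hHi : Integrable H := by
    have i1 : Integrable fun p : Rn n × Rn n => heatKernel n δ p.2 * ρ (p.1 - p.2) :=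
      (integrable_heatKernel hδ).convolution_integrand (ContinuousLinearMap.mul ℝ ℝ) hρ
    have i2 : Integrable fun p : Rn n × Rn n => u p.1 * heatKernel n δ p.2 :=
      hui.mul_prod (integrable_heatKernel hδ)
    have i3 := (i1.sub i2).smul_bdd (f := fun p : Rn n × Rn n => b (p.1 - p.2) - b p.1)
      (Γ * R + Γ * R) ((hbm.comp_quasiMeasurePreserving hqm).sub hbm.comp_fst)
      (ae_of_all _ fun p => (norm_sub_le _ _).trans (add_le_add (hbb _) (hbb _)))
    refine i3.congr (ae_of_all _ fun p => ?_)
    simp only [hH, Pi.sub_apply, Pi.smul_apply', smul_smul]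
    congr 1; ring
  have hmp : MeasurePreserving (fun p : Rn n × Rn n => (p.1 + w, p.2)) :=
    (measurePreserving_add_right volume w).prod (MeasurePreserving.id _)
  have hHw := (hmp.integrable_comp hHi.aestronglyMeasurable).2 hHi
  have hD := hHw.sub hHi
  set A : Rn n → Rn n → ℝ := fun y x => ‖(ρ (x + w - y) - ρ (x - y)) - (u (x + w) - u x)‖ with hA
  set B : Rn n → Rn n → ℝ := fun y x => ‖ρ (x - y) - u x‖ with hB
  have hAi : ∀ y, Integrable (A y) := fun y => by
    have h1 : Integrable fun x => ρ (x + w - y) := by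
      simpa only [add_sub_assoc] using hρ.comp_add_right (w - y)
    exact ((h1.sub (hρ.comp_sub_right y)).sub ((hui.comp_add_right w).sub hui)).norm
  have hBi : ∀ y, Integrable (B y) := fun y => ((hρ.comp_sub_right y).sub hui).norm
  have hAle : ∀ y, ∫ x, A y x ≤ 2 * N * ‖w‖ := by
    intro y
    have i0 : Integrable fun x => ‖ρ (x + w) - ρ x‖ := ((hρ.comp_add_right w).sub hρ).norm
    have i1 : Integrable fun x => ‖ρ (x - y + w) - ρ (x - y)‖ := i0.comp_sub_right y
    have i2 : Integrable fun x => ‖u (x + w) - u x‖ := ((hui.comp_add_right w).sub hui).norm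
    calc ∫ x, A y x ≤ ∫ x, (‖ρ (x - y + w) - ρ (x - y)‖ + ‖u (x + w) - u x‖) :=
          integral_mono (hAi y) (i1.add i2) fun x => by
            simp only [hA, add_sub_right_comm x w y]
            exact norm_sub_le _ _
      _ = (∫ x, ‖ρ (x + w) - ρ x‖) + ∫ x, ‖u (x + w) - u x‖ := by
          rw [integral_add i1 i2, integral_sub_right_eq_self (fun x => ‖ρ (x + w) - ρ x‖)]
      _ ≤ _ := by
          have h1 := integral_norm_mollify_translate_sub_le hδ hρ w
          have h2 := hN w
          linarith
  have hBle : ∀ y, ∫ x, B y x ≤ N * ‖y‖ + N * (heatC n * √δ) := by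
    intro y
    have hNy : ∀ y, ∫ x, ‖ρ (x - y) - ρ x‖ ≤ 0 + N * ‖y‖ := fun y => by
      have := hN (-y)
      simpa [sub_eq_add_neg] using this
    have h1 := integral_norm_mollify_sub_le hδ hρ hNy hN0
    have i1 : Integrable fun x => ‖ρ (x - y) - ρ x‖ := ((hρ.comp_sub_right y).sub hρ).norm
    have i2 : Integrable fun x => ‖u x - ρ x‖ := (hui.sub hρ).norm
    calc ∫ x, B y x ≤ ∫ x, (‖ρ (x - y) - ρ x‖ + ‖u x - ρ x‖) :=
          integral_mono (hBi y) (i1.add i2) fun x => by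
            simp only [hB]
            rw [show ρ (x - y) - u x = (ρ (x - y) - ρ x) - (u x - ρ x) by ring]
            exact norm_sub_le _ _
      _ ≤ _ := by
          rw [integral_add i1 i2]
          have := hNy y
          linarith
  have hpt : ∀ y x, ‖H (x + w, y) - H (x, y)‖ ≤ heatKernel n δ y *
      (A y x * (Γ * (N * ‖y‖)) + B y x * (2 * (Γ * (N * ‖w‖)))) := by
    intro y x
    have e : H (x + w, y) - H (x, y) = heatKernel n δ y •
        ((((ρ (x + w - y) - ρ (x - y)) - (u (x + w) - u x)) • (b (x + w + -y) - b (x + w)))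
          + (ρ (x - y) - u x) • ((b (x - y + w) - b (x - y)) - (b (x + w) - b x))) := by
      simp only [hH, ← sub_eq_add_neg, add_sub_right_comm x w y]
      module
    have hG := (heatKernel_pos hδ y).le
    rw [e, norm_smul, Real.norm_of_nonneg hG]
    gcongr
    refine (norm_add_le _ _).trans ?_
    rw [norm_smul, norm_smul]
    gcongr
    · simpa using hbz (x + w) (-y)
    · refine (norm_sub_le _ _).trans ?_
      linarith [hbz (x - y) w, hbz x w]
  have hDn := hD.norm
  have hin : ∀ y, ∫ x, ‖H (x + w, y) - H (x, y)‖ ≤ heatKernel n δ y *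
      (2 * N * ‖w‖ * (Γ * (N * ‖y‖)) + (N * ‖y‖ + N * (heatC n * √δ)) * (2 * (Γ * (N * ‖w‖)))) := by
    intro y
    have hG := (heatKernel_pos hδ y).le
    have i1 := (hAi y).mul_const (Γ * (N * ‖y‖))
    have i2 := (hBi y).mul_const (2 * (Γ * (N * ‖w‖)))
    calc ∫ x, ‖H (x + w, y) - H (x, y)‖ ≤ ∫ x, heatKernel n δ y *
          (A y x * (Γ * (N * ‖y‖)) + B y x * (2 * (Γ * (N * ‖w‖)))) :=
          integral_mono_of_nonneg (ae_of_all _ fun _ => norm_nonneg _)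
            ((i1.add i2).const_mul _) (ae_of_all _ (hpt y))
      _ ≤ _ := by
          rw [integral_const_mul, integral_add i1 i2, integral_mul_const, integral_mul_const]
          gcongr
          · exact hAle y
          · exact hBle y
  have hfin : Integrable (fun y : Rn n => heatKernel n δ y *
      (2 * N * ‖w‖ * (Γ * (N * ‖y‖)) + (N * ‖y‖ + N * (heatC n * √δ)) * (2 * (Γ * (N * ‖w‖))))) ∧
      ∫ y : Rn n, heatKernel n δ y *
      (2 * N * ‖w‖ * (Γ * (N * ‖y‖)) + (N * ‖y‖ + N * (heatC n * √δ)) * (2 * (Γ * (N * ‖w‖))))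
      ≤ 6 * Γ * N ^ 2 * (heatC n * √δ) * ‖w‖ := by
    have e : ∀ y : Rn n, heatKernel n δ y *
      (2 * N * ‖w‖ * (Γ * (N * ‖y‖)) + (N * ‖y‖ + N * (heatC n * √δ)) * (2 * (Γ * (N * ‖w‖))))
      = (4 * Γ * N ^ 2 * ‖w‖) * (‖y‖ * heatKernel n δ y)
        + (2 * Γ * N ^ 2 * (heatC n * √δ) * ‖w‖) * heatKernel n δ y := fun y => by ring
    have j1 := (integrable_norm_mul_heatKernel (n := n) hδ).const_mul (4 * Γ * N ^ 2 * ‖w‖)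
    have j2 := (integrable_heatKernel (n := n) hδ).const_mul
      (2 * Γ * N ^ 2 * (heatC n * √δ) * ‖w‖)
    simp only [e]
    refine ⟨j1.add j2, ?_⟩
    rw [integral_add j1 j2, integral_const_mul, integral_const_mul, integral_heatKernel hδ]
    have h1 := integral_norm_mul_heatKernel_le (n := n) hδ
    have h2 : 4 * Γ * N ^ 2 * ‖w‖ * ∫ y : Rn n, ‖y‖ * heatKernel n δ y
        ≤ 4 * Γ * N ^ 2 * ‖w‖ * (heatC n * √δ) := by gcongr
    linarith
  calc ∫ x, ‖driftComm g δ ρ (x + w) - driftComm g δ ρ x‖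
      ≤ ∫ x, ∫ y, ‖H (x + w, y) - H (x, y)‖ := by
        refine integral_mono_of_nonneg (ae_of_all _ fun _ => norm_nonneg _)
          hDn.integral_prod_left ?_
        filter_upwards [hHw.prod_right_ae, hHi.prod_right_ae] with x h1 h2
        rw [driftComm_eq hg hΓ hδ hρ, driftComm_eq hg hΓ hδ hρ]
        have := integral_sub h1 h2
        simp only [Function.comp, hH] at this
        rw [← this]
        exact norm_integral_le_integral_norm _
    _ = ∫ y, ∫ x, ‖H (x + w, y) - H (x, y)‖ := integral_integral_swap hDn
    _ ≤ _ := (integral_mono_of_nonneg (ae_of_all _ fun y => integral_nonneg fun _ => norm_nonneg _)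
        hfin.1 (ae_of_all _ hin)).trans hfin.2

end Commutator

/-! ### Smoothed absolute values and Lipschitz functionals -/

section Contraction

/-- Second-order Taylor estimate for a function with a Lipschitz derivative. -/
lemma abs_sub_sub_le_of_lipschitz_deriv {s : Set ℝ} (hs : Convex ℝ s) {f f' : ℝ → ℝ} {L : ℝ}
    (hf : ∀ x ∈ s, HasDerivWithinAt f (f' x) s x)
    (hL : ∀ x ∈ s, ∀ y ∈ s, |f' x - f' y| ≤ L * |x - y|)
    {a b : ℝ} (ha : a ∈ s) (hb : b ∈ s) : |f b - f a - f' a * (b - a)| ≤ L * (b - a) ^ 2 := by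
  have hsub : uIcc a b ⊆ s := hs.ordConnected.uIcc_subset ha hb
  have h := (convex_uIcc a b).norm_image_sub_le_of_norm_hasDerivWithin_le
    (f := fun x => f x - f' a * x) (f' := fun x => f' x - f' a) (C := L * |b - a|)
    (fun x hx => ((hf x (hsub hx)).mono hsub).sub
      (by simpa using (hasDerivWithinAt_id x _).const_mul (f' a)))
    (fun x hx => (hL x (hsub hx) a ha).trans ?_) (left_mem_uIcc) (right_mem_uIcc)
  · rw [Real.norm_eq_abs, Real.norm_eq_abs, mul_assoc, abs_mul_abs_self] at h
    rw [show f b - f a - f' a * (b - a) = f b - f' a * b - (f a - f' a * a) by ring]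
    linarith
  · have hL0 : 0 ≤ L * |x - a| := (abs_nonneg _).trans (hL x (hsub hx) a ha)
    have h1 := abs_sub_left_of_mem_uIcc hx
    rcases eq_or_ne x a with rfl | hne
    · simp only [sub_self, abs_zero, mul_zero]
      rcases eq_or_ne b x with rfl | hbx
      · simp
      · exact mul_nonneg (nonneg_of_mul_nonneg_left ((abs_nonneg _).trans (hL b hb x ha))
          (abs_pos.2 (sub_ne_zero.2 hbx))) (abs_nonneg _)
    · exact mul_le_mul_of_nonneg_left h1
        (nonneg_of_mul_nonneg_left hL0 (abs_pos.2 (sub_ne_zero.2 hne)))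

/-- The smooth approximation `√(r² + η²) - η` of `|r|`. -/
def smoothAbs (η r : ℝ) : ℝ := √(r ^ 2 + η ^ 2) - η

variable {η : ℝ} (hη : 0 < η)
include hη

lemma sqrt_sq_add_sq_pos (r : ℝ) : 0 < √(r ^ 2 + η ^ 2) := Real.sqrt_pos.2 (by positivity)

lemma hasDerivAt_sqrt_sq_add (r : ℝ) :
    HasDerivAt (fun r => √(r ^ 2 + η ^ 2)) (r / √(r ^ 2 + η ^ 2)) r := by
  have h := (((hasDerivAt_id r).pow 2).add_const (η ^ 2)).sqrt (by simp; positivity)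
  refine h.congr_deriv ?_
  have h0 := (sqrt_sq_add_sq_pos hη r).ne'
  simp only [id, Pi.pow_apply]
  field_simp
  simp

lemma hasDerivAt_smoothAbs (r : ℝ) :
    HasDerivAt (smoothAbs η) (r / √(r ^ 2 + η ^ 2)) r :=
  (hasDerivAt_sqrt_sq_add hη r).sub_const η

lemma hasDerivAt_deriv_smoothAbs (r : ℝ) :
    HasDerivAt (fun r => r / √(r ^ 2 + η ^ 2)) (η ^ 2 / √(r ^ 2 + η ^ 2) ^ 3) r := by
  have h0 := sqrt_sq_add_sq_pos hη r
  have h := (hasDerivAt_id r).div (hasDerivAt_sqrt_sq_add hη r) h0.ne'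
  refine h.congr_deriv ?_
  have h1 : √(r ^ 2 + η ^ 2) ^ 2 = r ^ 2 + η ^ 2 := Real.sq_sqrt (by positivity)
  simp only [id]
  field_simp
  rw [h1]; ring

lemma abs_deriv_smoothAbs_le (r : ℝ) : |r / √(r ^ 2 + η ^ 2)| ≤ 1 := by
  have h0 := sqrt_sq_add_sq_pos hη r
  rw [abs_div, abs_of_pos h0, div_le_one h0]
  exact Real.abs_le_sqrt (by nlinarith)

omit hη in
lemma le_sqrt_sq_add (r : ℝ) : η ≤ √(r ^ 2 + η ^ 2) := Real.le_sqrt_of_sq_le (by nlinarith)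

lemma second_deriv_smoothAbs_le (r : ℝ) : η ^ 2 / √(r ^ 2 + η ^ 2) ^ 3 ≤ 1 / η := by
  have h0 := sqrt_sq_add_sq_pos hη r
  have h1 := le_sqrt_sq_add (η := η) r
  rw [div_le_div_iff₀ (by positivity) hη]
  calc η ^ 2 * η = η ^ 3 := by ring
    _ ≤ 1 * √(r ^ 2 + η ^ 2) ^ 3 := by rw [one_mul]; gcongr

/-- The second derivative of `smoothAbs` concentrates near `0` as `η → 0`: weighted by `r²`, it is at
most `min η |r|`, which tends to `0`. -/
lemma second_deriv_smoothAbs_mul_sq_le (r : ℝ) :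
    η ^ 2 / √(r ^ 2 + η ^ 2) ^ 3 * r ^ 2 ≤ min η |r| := by
  set S := √(r ^ 2 + η ^ 2) with hS
  have h0 : 0 < S := sqrt_sq_add_sq_pos hη r
  have h1 : η ≤ S := le_sqrt_sq_add r
  have h2 : |r| ≤ S := Real.abs_le_sqrt (by nlinarith)
  have h3 : 0 ≤ |r| := abs_nonneg r
  rw [← sq_abs r, div_mul_eq_mul_div, le_min_iff]
  constructor
  · rw [div_le_iff₀ (by positivity)]
    calc η ^ 2 * |r| ^ 2 = η * (η * |r| ^ 2) := by ring
      _ ≤ η * (S * S ^ 2) := by gcongr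
      _ = η * S ^ 3 := by ring
  · rw [div_le_iff₀ (by positivity)]
    calc η ^ 2 * |r| ^ 2 = |r| * (η ^ 2 * |r|) := by ring
      _ ≤ |r| * (S ^ 2 * S) := by gcongr
      _ = |r| * S ^ 3 := by ring

lemma abs_smoothAbs_sub_le (a b : ℝ) : |smoothAbs η a - smoothAbs η b| ≤ |a - b| := by
  have := (convex_univ).norm_image_sub_le_of_norm_hasDerivWithin_le (C := 1)
    (fun x _ => (hasDerivAt_smoothAbs hη x).hasDerivWithinAt)
    (fun x _ => abs_deriv_smoothAbs_le hη x) (mem_univ b) (mem_univ a)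
  simpa using this

lemma smoothAbs_zero : smoothAbs η 0 = 0 := by
  simp [smoothAbs, Real.sqrt_sq hη.le]

lemma abs_smoothAbs_sub_sub_le (a b : ℝ) :
    |smoothAbs η b - smoothAbs η a - a / √(a ^ 2 + η ^ 2) * (b - a)| ≤ 1 / η * (b - a) ^ 2 := by
  refine abs_sub_sub_le_of_lipschitz_deriv (f := smoothAbs η) (f' := fun r => r / √(r ^ 2 + η ^ 2))
    convex_univ (fun x _ => (hasDerivAt_smoothAbs hη x).hasDerivWithinAt) (fun x _ y _ => ?_)
    (mem_univ a) (mem_univ b)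
  have := (convex_univ).norm_image_sub_le_of_norm_hasDerivWithin_le (C := 1 / η)
    (fun x _ => (hasDerivAt_deriv_smoothAbs hη x).hasDerivWithinAt)
    (fun x _ => by
      rw [Real.norm_of_nonneg (by positivity)]
      exact second_deriv_smoothAbs_le hη x) (mem_univ y) (mem_univ x)
  simpa using this

omit hη in
lemma tendsto_smoothAbs (r : ℝ) : Tendsto (fun η => smoothAbs η r) (𝓝[>] 0) (𝓝 |r|) := by
  have h : Continuous fun η => smoothAbs η r := by unfold smoothAbs; fun_prop
  have := (h.tendsto 0).mono_left (nhdsWithin_le_nhds (s := Ioi 0))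
  simpa [smoothAbs, Real.sqrt_sq_eq_abs] using this

end Contraction

section LipschitzFunctional

variable {n : ℕ} {φ : ℝ → ℝ} (hφ : ∀ a b, |φ a - φ b| ≤ |a - b|) (hφ0 : φ 0 = 0)
include hφ

lemma continuous_of_abs_sub_le : Continuous φ := by
  refine (LipschitzWith.of_dist_le_mul (K := 1) fun a b => ?_).continuous
  simpa [Real.dist_eq] using hφ a b

include hφ0

lemma integrable_comp_of_abs_sub_le {f : Rn n → ℝ} (hf : Integrable f) :
    Integrable fun x => φ (f x) := by
  refine hf.norm.mono' ((continuous_of_abs_sub_le hφ).comp_aestronglyMeasurable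
    hf.aestronglyMeasurable) (ae_of_all _ fun x => ?_)
  simpa [hφ0] using hφ (f x) 0

lemma abs_integral_comp_sub_le {f h : Rn n → ℝ} (hf : Integrable f) (hh : Integrable h) :
    |(∫ x, φ (f x)) - ∫ x, φ (h x)| ≤ ∫ x, ‖f x - h x‖ := by
  rw [← integral_sub (integrable_comp_of_abs_sub_le hφ hφ0 hf)
    (integrable_comp_of_abs_sub_le hφ hφ0 hh), ← Real.norm_eq_abs]
  exact norm_integral_le_of_norm_le (hf.sub hh).norm (ae_of_all _ fun x => hφ _ _)

lemma tendsto_integral_comp_mollify {f : Rn n → ℝ} (hf : Integrable f) :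
    Tendsto (fun δ => ∫ x, φ (mollify δ f x)) (𝓝[>] 0) (𝓝 (∫ x, φ (f x))) := by
  rw [tendsto_iff_norm_sub_tendsto_zero]
  refine squeeze_zero' (Eventually.of_forall fun _ => norm_nonneg _) ?_
    (tendsto_integral_norm_mollify_sub hf)
  filter_upwards [self_mem_nhdsWithin] with δ hδ
  exact abs_integral_comp_sub_le hφ hφ0 (integrable_mollify hδ hf) hf

omit hφ hφ0 in
lemma integral_norm_mollify_sub_mollify_le {δ : ℝ} (hδ : 0 < δ) (f h : Rn n →₁[volume] ℝ) :
    ∫ x, ‖mollify δ f x - mollify δ h x‖ ≤ ‖f - h‖ := by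
  rw [← integral_norm_coe_sub]
  simp only [← mollify_sub hδ (integrable_coe f) (integrable_coe h)]
  exact integral_norm_mollify_le hδ ((integrable_coe f).sub (integrable_coe h))

omit hφ hφ0 in
lemma norm_mollify_sub_mollify_le {δ : ℝ} (hδ : 0 < δ) (f h : Rn n →₁[volume] ℝ) (x : Rn n) :
    ‖mollify δ f x - mollify δ h x‖ ≤ (4 * π * δ) ^ (-(n : ℝ) / 2) * ‖f - h‖ := by
  rw [← integral_norm_coe_sub, ← mollify_sub hδ (integrable_coe f) (integrable_coe h)]
  exact norm_mollify_le hδ ((integrable_coe f).sub (integrable_coe h)) x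

lemma continuousOn_integral_comp_mollify {ρ : ℝ → (Rn n →₁[volume] ℝ)} {s : Set ℝ}
    (hρ : ContinuousOn ρ s) {δ : ℝ} (hδ : 0 < δ) :
    ContinuousOn (fun t => ∫ x, φ (mollify δ (ρ t) x)) s := by
  have hL : LipschitzWith 1 fun f : Rn n →₁[volume] ℝ => ∫ x, φ (mollify δ f x) := by
    refine LipschitzWith.of_dist_le_mul fun f h => ?_
    rw [Real.dist_eq, dist_eq_norm, NNReal.coe_one, one_mul]
    exact (abs_integral_comp_sub_le hφ hφ0 (integrable_mollify hδ (integrable_coe f))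
      (integrable_mollify hδ (integrable_coe h))).trans
      (integral_norm_mollify_sub_mollify_le hδ f h)
  exact hL.continuous.comp_continuousOn hρ

lemma continuousOn_integral_comp {ρ : ℝ → (Rn n →₁[volume] ℝ)} {s : Set ℝ}
    (hρ : ContinuousOn ρ s) : ContinuousOn (fun t => ∫ x, φ (ρ t x)) s := by
  have hL : LipschitzWith 1 fun f : Rn n →₁[volume] ℝ => ∫ x, φ (f x) := by
    refine LipschitzWith.of_dist_le_mul fun f h => ?_
    rw [Real.dist_eq, dist_eq_norm, NNReal.coe_one, one_mul, ← integral_norm_coe_sub]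
    exact abs_integral_comp_sub_le hφ hφ0 (integrable_coe f) (integrable_coe h)
  exact hL.continuous.comp_continuousOn hρ

end LipschitzFunctional

/-! ### Positivity -/

section Positivity

variable {n : ℕ} {g : Rn n → Rn n} {Γ : ℝ} {ρ₀ : Rn n →₁[volume] ℝ} {ρ : ℝ → (Rn n →₁[volume] ℝ)}

lemma hasGradientAt_of_hasFDerivAt {f : Rn n → ℝ} {L : Rn n →L[ℝ] ℝ} {a x : Rn n}
    (h : HasFDerivAt f L x) (hL : ∀ v, L v = inner ℝ a v) : HasGradientAt f a x := by
  have e : L = InnerProductSpace.toDual ℝ (Rn n) a := by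
    ext v; rw [hL, InnerProductSpace.toDual_apply_apply]
  rw [hasGradientAt_iff_hasFDerivAt, ← e]
  exact h

lemma HasGradientAt.comp_hasDerivAt_left {u : Rn n → ℝ} {a : Rn n} {x : Rn n} {φ : ℝ → ℝ} {c : ℝ}
    (hφ : HasDerivAt φ c (u x)) (hu : HasGradientAt u a x) :
    HasGradientAt (fun y => φ (u y)) (c • a) x :=
  hasGradientAt_of_hasFDerivAt (hφ.comp_hasFDerivAt x (hasGradientAt_iff_hasFDerivAt.1 hu))
    fun v => by simp [inner_smul_left]

lemma abs_min_sub_min_le (η a b : ℝ) : |(min η |a|) - (min η |b|)| ≤ |a - b| :=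
  (abs_min_sub_min_le_max η |a| η |b|).trans (by simpa using abs_abs_sub_abs_le a b)

lemma mollify_drift_eq (δ : ℝ) (σ : Rn n → ℝ) (x : Rn n) :
    mollify δ (drift g σ) x = mollify δ σ x • mollify δ (vel g σ) x + driftComm g δ σ x := by
  simp [driftComm]

variable (hg : AEStronglyMeasurable g) (hΓ : ∀ᵐ x, ‖g x‖ ≤ Γ)
include hg hΓ

/-- The production of the smoothed `L¹` norm along the mollified equation. The commutator has
bounded variation of order `√δ`, so its contribution is integrated by parts. -/
lemma production_smoothAbs_le {η δ N R : ℝ} (hη : 0 < η) (hδ : 0 < δ) (hN0 : 0 ≤ N) {σ : Rn n → ℝ}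
    (hσ : Integrable σ) (hN : ∀ z, ∫ x, ‖σ (x + z) - σ x‖ ≤ N * ‖z‖) (hR : ∫ x, ‖σ x‖ ≤ R) :
    -∫ x, inner ℝ ((η ^ 2 / √(mollify δ σ x ^ 2 + η ^ 2) ^ 3) • gradMoll δ σ x)
        (gradMoll δ σ x + mollify δ (drift g σ) x)
      ≤ (Γ * R) ^ 2 / 4 * (∫ x, min η |σ x|)
        + ((Γ * R) ^ 2 / 4 * N + n * (6 * Γ * N ^ 2)) * (heatC n * √δ) := by
  have hΓ0 := nonneg_of_ae_norm_le hΓ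
  have hR0 : 0 ≤ R := (integral_nonneg fun _ => norm_nonneg _).trans hR
  set u := mollify δ σ with hu
  set G := gradMoll δ σ with hG
  set b := mollify δ (vel g σ) with hb
  set e := driftComm g δ σ with he
  set k : Rn n → ℝ := fun x => η ^ 2 / √(u x ^ 2 + η ^ 2) ^ 3 with hk
  have hui : Integrable u := integrable_mollify hδ hσ
  have huc : Continuous u := continuous_mollify hδ hσ
  have hGc : Continuous G := continuous_gradMoll hδ hσ
  have hGi : Integrable G := integrable_gradMoll hδ hσ
  obtain ⟨CG, hCG⟩ : ∃ C, ∀ x, ‖G x‖ ≤ C := ⟨_, norm_gradMoll_le hδ hσ⟩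
  have hk0 : ∀ x, 0 ≤ k x := fun x => by positivity
  have hk1 : ∀ x, k x ≤ 1 / η := fun x => second_deriv_smoothAbs_le hη (u x)
  have hkc : Continuous k := by
    have : ∀ x, √(u x ^ 2 + η ^ 2) ^ 3 ≠ 0 := fun x =>
      (pow_pos (sqrt_sq_add_sq_pos hη (u x)) 3).ne'
    fun_prop (disch := assumption)
  have hf'b : ∀ x, ‖k x • G x‖ ≤ 1 / η * CG := fun x => by
    rw [norm_smul, Real.norm_of_nonneg (hk0 x)]
    exact mul_le_mul (hk1 x) (hCG x) (norm_nonneg _) (by positivity)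
  have hf'm : AEStronglyMeasurable fun x => k x • G x := (hkc.smul hGc).aestronglyMeasurable
  have hbdd : ∀ {F : Rn n → Rn n}, Integrable F →
      Integrable fun x => (inner ℝ (k x • G x) (F x) : ℝ) := fun hF =>
    (hF.norm.const_mul (1 / η * CG)).mono' (hf'm.inner hF.aestronglyMeasurable)
      (ae_of_all _ fun x => (norm_inner_le_norm _ _).trans (by gcongr; exact hf'b x))
  have hei : Integrable e := integrable_driftComm hg hΓ hδ hσ
  have hbR : ∀ x, ‖b x‖ ≤ Γ * R := fun x =>
    (norm_mollify_vel_le hΓ hδ hσ x).trans (by gcongr)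
  have hub : Integrable fun x => u x • b x :=
    hui.smul_bdd _ (aestronglyMeasurable_mollify_vel hg hδ hσ) (ae_of_all _ hbR)
  have h1 := abs_integral_inner_le_of_translate (f := fun x => u x / √(u x ^ 2 + η ^ 2))
    (f' := fun x => k x • G x)
    (fun x => (hasGradientAt_mollify hδ hσ x).comp_hasDerivAt_left
      (hasDerivAt_deriv_smoothAbs hη (u x)))
    (fun x => abs_deriv_smoothAbs_le hη (u x)) hf'b hei
    (integral_norm_driftComm_translate_le hg hΓ hδ hN0 hσ hN)
  have hmin := abs_integral_comp_sub_le (φ := fun r => min η |r|) (abs_min_sub_min_le η)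
    (by simpa using hη.le) hui hσ
  have hmi := integrable_comp_of_abs_sub_le (φ := fun r => min η |r|) (abs_min_sub_min_le η)
    (by simpa using hη.le) hui
  have hus := integral_norm_mollify_sub_le (a := 0) hδ hσ (fun y => by
    simpa [sub_eq_add_neg] using hN (-y)) hN0
  -- completing the square
  have hpt : ∀ x, -(inner ℝ (k x • G x) (G x + u x • b x) : ℝ)
      ≤ (Γ * R) ^ 2 / 4 * min η |u x| := by
    intro x
    have h2 := second_deriv_smoothAbs_mul_sq_le hη (u x)
    have h3 : -(inner ℝ (G x) (G x + u x • b x) : ℝ) ≤ u x ^ 2 * (Γ * R) ^ 2 / 4 := by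
      rw [inner_add_right, real_inner_self_eq_norm_sq]
      have h4 : |(inner ℝ (G x) (u x • b x) : ℝ)| ≤ ‖G x‖ * (|u x| * (Γ * R)) := by
        refine (abs_real_inner_le_norm _ _).trans ?_
        rw [norm_smul, Real.norm_eq_abs]
        gcongr; exact hbR x
      have h5 := neg_abs_le (inner ℝ (G x) (u x • b x) : ℝ)
      rw [← sq_abs (u x)]
      nlinarith [sq_nonneg (‖G x‖ - |u x| * (Γ * R) / 2)]
    rw [inner_smul_left]
    simp only [conj_trivial]
    calc -(k x * inner ℝ (G x) (G x + u x • b x)) = k x * -inner ℝ (G x) (G x + u x • b x) := by ring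
      _ ≤ k x * (u x ^ 2 * (Γ * R) ^ 2 / 4) := mul_le_mul_of_nonneg_left h3 (hk0 x)
      _ = (Γ * R) ^ 2 / 4 * (k x * u x ^ 2) := by ring
      _ ≤ _ := by gcongr
  have hsplit : ∀ x, (inner ℝ (k x • G x) (G x + mollify δ (drift g σ) x) : ℝ)
      = inner ℝ (k x • G x) (G x + u x • b x) + inner ℝ (k x • G x) (e x) := fun x => by
    rw [mollify_drift_eq, ← add_assoc, inner_add_right]
  have i1 := hbdd (hGi.add hub)
  simp only [Pi.add_apply] at i1
  change -∫ x, inner ℝ (k x • G x) (G x + mollify δ (drift g σ) x) ≤ _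
  simp only [hsplit]
  rw [integral_add i1 (hbdd hei), neg_add, ← integral_neg]
  have h6 : ∫ x, -(inner ℝ (k x • G x) (G x + u x • b x) : ℝ)
      ≤ (Γ * R) ^ 2 / 4 * ∫ x, min η |u x| := by
    rw [← integral_const_mul]
    exact integral_mono i1.neg (hmi.const_mul _) hpt
  have h7 : ∫ x, min η |u x| ≤ (∫ x, min η |σ x|) + N * (heatC n * √δ) := by
    have := (abs_le.1 hmin).2
    linarith
  have h8 := (abs_le.1 h1).1
  have h9 : (Γ * R) ^ 2 / 4 * ∫ x, min η |u x|
      ≤ (Γ * R) ^ 2 / 4 * ((∫ x, min η |σ x|) + N * (heatC n * √δ)) := by gcongr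
  nlinarith

/-- As long as the solution stays of bounded variation, its `L¹` norm does not increase: first
`δ → 0` removes the commutator, then `η → 0` the remaining production `∫ min η |ρ|`. -/
lemma IsMildSolution.norm_le_of_translate_le (h : IsMildSolution g ρ₀ ρ) {s t N : ℝ} (hs : 0 ≤ s)
    (hst : s ≤ t) (hN0 : 0 ≤ N)
    (hN : ∀ r ∈ Icc s t, ∀ z, ∫ x, ‖ρ r (x + z) - ρ r x‖ ≤ N * ‖z‖) : ‖ρ t‖ ≤ ‖ρ s‖ := by
  obtain ⟨R, hR0, hR⟩ := exists_norm_le h.continuousOn t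
  have hΓ0 := nonneg_of_ae_norm_le hΓ
  have hcont : ContinuousOn ρ (Icc s t) := h.continuousOn.mono fun r hr => hs.trans hr.1
  set A := (Γ * R) ^ 2 / 4 with hA
  set B := (A * N + n * (6 * Γ * N ^ 2)) * heatC n with hB
  have hmi : ∀ η, 0 < η → ContinuousOn (fun r => ∫ x, min η |ρ r x|) (Icc s t) := fun η hη =>
    continuousOn_integral_comp (φ := fun r => min η |r|) (abs_min_sub_min_le η)
      (by simpa using hη.le) hcont
  have hii : ∀ η, 0 < η → IntervalIntegrable (fun r => A * ∫ x, min η |ρ r x|) volume s t :=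
    fun η hη => (((hmi η hη).const_mul _).mono (by rw [uIcc_of_le hst])).intervalIntegrable
  -- the inequality for the mollified solution and the smoothed modulus
  have h1 : ∀ η, 0 < η → ∀ δ, 0 < δ →
      (∫ x, smoothAbs η (mollify δ (ρ t) x)) - ∫ x, smoothAbs η (mollify δ (ρ s) x)
        ≤ (∫ r in s..t, A * ∫ x, min η |ρ r x|) + (t - s) * (B * √δ) := by
    intro η hη δ hδ
    have h2 := intervalIntegral.sub_le_integral_of_hasDeriv_right_of_le hst
      (g := fun t => ∫ x, smoothAbs η (mollify δ (ρ t) x))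
      (φ := fun r => A * (∫ x, min η |ρ r x|) + B * √δ)
      (g' := fun r => -∫ x, inner ℝ
        ((η ^ 2 / √(mollify δ (ρ r) x ^ 2 + η ^ 2) ^ 3) • gradMoll δ (ρ r) x)
        (gradMoll δ (ρ r) x + mollify δ (drift g (ρ r)) x))
      (continuousOn_integral_comp_mollify (abs_smoothAbs_sub_le hη) (smoothAbs_zero hη) hcont hδ)
      ?_ ?_ ?_
    · rwa [intervalIntegral.integral_add (hii η hη) intervalIntegrable_const,
        intervalIntegral.integral_const, smul_eq_mul] at h2
    · intro r hr
      have hr0 : 0 ≤ r := hs.trans hr.1.le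
      have hui := fun t => integrable_mollify hδ (integrable_coe (ρ t))
      obtain ⟨CG, hCG⟩ : ∃ C, ∀ x, ‖gradMoll δ (ρ r) x‖ ≤ C :=
        ⟨_, norm_gradMoll_le hδ (integrable_coe (ρ r))⟩
      refine HasDerivWithinAt.Ioi_of_Ici ?_
      refine h.hasDerivWithinAt_of_quadratic hg hΓ (C := 1) (C' := 1 / η * CG)
        (K := 1 / η * (4 * π * δ) ^ (-(n : ℝ) / 2)) hδ hr0
        (f := fun x => mollify δ (ρ r) x / √(mollify δ (ρ r) x ^ 2 + η ^ 2))
        (fun x => (hasGradientAt_mollify hδ (integrable_coe (ρ r)) x).comp_hasDerivAt_left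
          (hasDerivAt_deriv_smoothAbs hη (mollify δ (ρ r) x))) ?_
        (fun x => abs_deriv_smoothAbs_le hη _) ?_ ?_
      · have h3 := continuous_mollify hδ (integrable_coe (ρ r))
        have h4 := continuous_gradMoll hδ (integrable_coe (ρ r))
        have : ∀ x, √(mollify δ (ρ r) x ^ 2 + η ^ 2) ^ 3 ≠ 0 := fun x =>
          (pow_pos (sqrt_sq_add_sq_pos hη _) 3).ne'
        fun_prop (disch := assumption)
      · intro x
        rw [norm_smul, Real.norm_of_nonneg (by positivity)]
        exact mul_le_mul (second_deriv_smoothAbs_le hη _) (hCG x) (norm_nonneg _) (by positivity)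
      · intro q _ _
        have hjq := fun q => integrable_comp_of_abs_sub_le (abs_smoothAbs_sub_le hη)
          (smoothAbs_zero hη) (hui q)
        have hf : Integrable fun x => mollify δ (ρ r) x / √(mollify δ (ρ r) x ^ 2 + η ^ 2)
            * (mollify δ (ρ q) x - mollify δ (ρ r) x) := by
          refine ((hui q).sub (hui r)).bdd_mul ?_
            (ae_of_all _ fun x => abs_deriv_smoothAbs_le hη _)
          have h3 := continuous_mollify hδ (integrable_coe (ρ r))
          have : ∀ x, √(mollify δ (ρ r) x ^ 2 + η ^ 2) ≠ 0 := fun x =>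
            (sqrt_sq_add_sq_pos hη _).ne'
          exact (by fun_prop (disch := assumption) : Continuous _).aestronglyMeasurable
        have hjd : Integrable fun x => smoothAbs η (mollify δ (ρ q) x)
            - smoothAbs η (mollify δ (ρ r) x) := (hjq q).sub (hjq r)
        rw [← integral_sub (hjq q) (hjq r), ← integral_sub hjd hf,
          ← integral_const_mul, ← Real.norm_eq_abs]
        refine norm_integral_le_of_norm_le (((hui q).sub (hui r)).norm.const_mul _)
          (ae_of_all _ fun x => ?_)
        refine (abs_smoothAbs_sub_sub_le hη _ _).trans ?_
        have h5 := norm_mollify_sub_mollify_le hδ (ρ q) (ρ r) x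
        rw [← sq_abs, ← Real.norm_eq_abs]
        calc 1 / η * ‖mollify δ (ρ q) x - mollify δ (ρ r) x‖ ^ 2
            = 1 / η * ‖mollify δ (ρ q) x - mollify δ (ρ r) x‖
              * ‖mollify δ (ρ q) x - mollify δ (ρ r) x‖ := by ring
          _ ≤ 1 / η * ((4 * π * δ) ^ (-(n : ℝ) / 2) * ‖ρ q - ρ r‖)
              * ‖mollify δ (ρ q) x - mollify δ (ρ r) x‖ := by gcongr
          _ = _ := by ring
    · exact (((hmi η hη).const_mul A).add continuousOn_const).integrableOn_Icc
    · intro r hr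
      have := production_smoothAbs_le hg hΓ (R := R) hη hδ hN0 (integrable_coe (ρ r))
        (hN r ⟨hr.1.le, hr.2.le⟩)
        (by rw [integral_norm_coe]; exact hR r ⟨hs.trans hr.1.le, hr.2.le⟩)
      refine this.trans (le_of_eq ?_)
      simp only [hB, hA]; ring
  -- `δ → 0`
  have h2 : ∀ η, 0 < η → (∫ x, smoothAbs η (ρ t x)) - ∫ x, smoothAbs η (ρ s x)
        ≤ ∫ r in s..t, A * ∫ x, min η |ρ r x| := by
    intro η hη
    have l1 := fun q => tendsto_integral_comp_mollify (abs_smoothAbs_sub_le hη) (smoothAbs_zero hη)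
      (integrable_coe (ρ q))
    have l2 : Tendsto (fun δ => (∫ r in s..t, A * ∫ x, min η |ρ r x|) + (t - s) * (B * √δ))
        (𝓝[>] 0) (𝓝 (∫ r in s..t, A * ∫ x, min η |ρ r x|)) := by
      have : Continuous fun δ => (∫ r in s..t, A * ∫ x, min η |ρ r x|) + (t - s) * (B * √δ) := by
        fun_prop
      simpa using (this.tendsto 0).mono_left (nhdsWithin_le_nhds (s := Ioi 0))
    refine le_of_tendsto_of_tendsto ((l1 t).sub (l1 s)) l2 ?_
    filter_upwards [self_mem_nhdsWithin] with δ hδ using h1 η hη δ hδ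
  -- `η → 0`
  have l1 : ∀ q, Tendsto (fun η => ∫ x, smoothAbs η (ρ q x)) (𝓝[>] 0) (𝓝 ‖ρ q‖) := by
    intro q
    rw [← integral_norm_coe]
    refine tendsto_integral_filter_of_dominated_convergence (fun x => ‖ρ q x‖) ?_ ?_
      (integrable_coe (ρ q)).norm (ae_of_all _ fun x => tendsto_smoothAbs _)
    · filter_upwards [self_mem_nhdsWithin] with η hη
      exact (integrable_comp_of_abs_sub_le (abs_smoothAbs_sub_le hη)
        (smoothAbs_zero hη) (integrable_coe (ρ q))).aestronglyMeasurable
    · filter_upwards [self_mem_nhdsWithin] with η hη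
      refine ae_of_all _ fun x => ?_
      have := abs_smoothAbs_sub_le hη (ρ q x) 0
      rwa [smoothAbs_zero hη, sub_zero, sub_zero] at this
  have l0 : ∀ q, Tendsto (fun η => ∫ x, min η |ρ q x|) (𝓝[>] 0) (𝓝 0) := by
    intro q
    suffices H : Tendsto (fun η => ∫ x, min η |ρ q x|) (𝓝[>] 0) (𝓝 (∫ x : Rn n, (0 : ℝ))) by
      simpa using H
    refine tendsto_integral_filter_of_dominated_convergence (fun x => ‖ρ q x‖) ?_ ?_
      (integrable_coe (ρ q)).norm (ae_of_all _ fun x => ?_)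
    · exact Eventually.of_forall fun η =>
        (continuous_of_abs_sub_le (abs_min_sub_min_le η)).comp_aestronglyMeasurable
          (integrable_coe (ρ q)).aestronglyMeasurable
    · filter_upwards [self_mem_nhdsWithin] with η hη
      refine ae_of_all _ fun x => ?_
      have hη' : 0 < η := hη
      rw [Real.norm_of_nonneg (le_min hη'.le (abs_nonneg _))]
      exact min_le_right _ _
    · have : Continuous fun η => min η |ρ q x| := by fun_prop
      have := (this.tendsto 0).mono_left (nhdsWithin_le_nhds (s := Ioi 0))
      simpa using this
  have l2 : Tendsto (fun η => ∫ r in s..t, A * ∫ x, min η |ρ r x|) (𝓝[>] 0) (𝓝 0) := by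
    suffices H : Tendsto (fun η => ∫ r in s..t, A * ∫ x, min η |ρ r x|) (𝓝[>] 0)
        (𝓝 (∫ r in s..t, (0 : ℝ))) by simpa using H
    refine intervalIntegral.tendsto_integral_filter_of_dominated_convergence (fun _ => A * R)
      ?_ ?_ intervalIntegrable_const (ae_of_all _ fun r _ => by simpa using (l0 r).const_mul A)
    · filter_upwards [self_mem_nhdsWithin] with η hη
      exact (hii η hη).def'.aestronglyMeasurable
    · filter_upwards [self_mem_nhdsWithin] with η hη
      refine ae_of_all _ fun r hr => ?_
      rw [uIoc_of_le hst] at hr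
      have hη' : 0 < η := hη
      have h3 : 0 ≤ ∫ x, min η |ρ r x| := integral_nonneg fun x => le_min hη'.le (abs_nonneg _)
      rw [Real.norm_of_nonneg (by positivity)]
      gcongr
      refine (?_ : _ ≤ ‖ρ r‖).trans (hR r ⟨hs.trans hr.1.le, hr.2⟩)
      rw [← integral_norm_coe]
      exact integral_mono (integrable_comp_of_abs_sub_le (φ := fun r => min η |r|)
        (abs_min_sub_min_le η) (by simpa using hη'.le) (integrable_coe (ρ r)))
        (integrable_coe (ρ r)).norm fun x => min_le_right _ _
  have l3 := le_of_tendsto_of_tendsto ((l1 t).sub (l1 s)) l2 (by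
    filter_upwards [self_mem_nhdsWithin] with η hη using h2 η hη)
  linarith

omit hg hΓ in
/-- An integrable function whose norm is at most its integral is nonnegative. -/
lemma nonneg_of_norm_le_integral {f : Rn n →₁[volume] ℝ} (h : ‖f‖ ≤ ∫ x, f x) : 0 ≤ f := by
  rw [← integral_norm_coe] at h
  have hi := integrable_coe f
  have h0 : 0 ≤ᵐ[volume] fun x => ‖f x‖ - f x := ae_of_all _ fun x => sub_nonneg.2 (le_abs_self _)
  have h1 : ∫ x, (‖f x‖ - f x) = 0 := by
    refine le_antisymm ?_ (integral_nonneg_of_ae h0)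
    rw [integral_sub hi.norm hi]; linarith
  have h2 := (integral_eq_zero_iff_of_nonneg_ae h0 (hi.norm.sub hi)).1 h1
  rw [← Lp.coeFn_nonneg]
  filter_upwards [h2] with x hx
  have : ‖f x‖ = f x := by simpa [sub_eq_zero] using hx
  simp only [Pi.zero_apply]
  rw [← this]; exact norm_nonneg _

omit hg hΓ in
lemma norm_eq_integral_of_nonneg {f : Rn n →₁[volume] ℝ} (h : 0 ≤ f) : ‖f‖ = ∫ x, f x := by
  rw [← integral_norm_coe]
  refine integral_congr_ae ?_
  filter_upwards [(Lp.coeFn_nonneg f).2 h] with x hx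
  exact Real.norm_of_nonneg hx

/-- Mass is conserved and the `L¹` norm does not increase for a short time after any time, so the two
agree as long as the solution is nonnegative at the start; nonnegativity is a closed condition, and
therefore propagates to all times. -/
lemma IsMildSolution.nonneg (h : IsMildSolution g ρ₀ ρ) (h0 : 0 ≤ ρ₀) {t : ℝ} (ht : 0 ≤ t) :
    0 ≤ ρ t := by
  -- local statement at any time at which the solution is nonnegative
  have hloc : ∀ s, 0 ≤ s → 0 ≤ ρ s → ∀ᶠ r in 𝓝[>] s, 0 ≤ ρ r := by
    intro s hs hρs
    have hr := h.restart hg hΓ hs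
    obtain ⟨T, K, hT, hK, hTK⟩ := hr.exists_translate_le hg hΓ
    filter_upwards [Ioc_mem_nhdsGT (show s < s + T by linarith)] with r hr'
    refine nonneg_of_norm_le_integral ?_
    rw [h.integral_eq hg hΓ (hs.trans hr'.1.le), ← h.integral_eq hg hΓ hs,
      ← norm_eq_integral_of_nonneg hρs]
    have hle : ∀ᶠ q in 𝓝[>] (0 : ℝ), ‖ρ (s + (r - s))‖ ≤ ‖ρ (s + q)‖ := by
      filter_upwards [Ioc_mem_nhdsGT (show 0 < r - s by linarith [hr'.1])] with q hq
      have hq0 := Real.sqrt_pos.2 hq.1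
      refine hr.norm_le_of_translate_le hg hΓ hq.1.le hq.2 (N := K * (1 / √q)) (by positivity)
        fun p hp z => (hTK p ⟨hq.1.trans_le hp.1, by linarith [hp.2, hr'.2]⟩ z).trans ?_
      gcongr
      exact hp.1
    have hc : ContinuousWithinAt (fun q => ρ (s + q)) (Ici 0) 0 := hr.continuousOn 0 (by simp)
    have hlim := (hc.tendsto.mono_left (nhdsWithin_mono 0 Ioi_subset_Ici_self)).norm
    have := ge_of_tendsto hlim hle
    simpa using this
  have hclosed : IsClosed ({r | 0 ≤ ρ r} ∩ Icc 0 t) := by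
    have hc : ContinuousOn ρ (Icc 0 t) := h.continuousOn.mono Icc_subset_Ici_self
    have := hc.preimage_isClosed_of_isClosed isClosed_Icc (isClosed_Ici (a := (0 : Rn n →₁[volume] ℝ)))
    rwa [inter_comm]
  have := hclosed.Icc_subset_of_forall_mem_nhdsWithin (by simpa [h.initial] using h0)
    (fun s hs => hloc s hs.2.1 hs.1)
  exact this ⟨ht, le_rfl⟩

end Positivity

/-! ### Smooth approximations of the potential -/

section Kernels

variable {n : ℕ}

lemma exists_subseq_tendsto_ae {E : Type*} [NormedAddCommGroup E] {f : ℕ → Rn n → E}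
    {f₀ : Rn n → E} (hf : ∀ j, Integrable (f j)) (hf₀ : Integrable f₀)
    (h : Tendsto (fun j => ∫ x, ‖f j x - f₀ x‖) atTop (𝓝 0)) :
    ∃ φ : ℕ → ℕ, StrictMono φ ∧ ∀ᵐ x, Tendsto (fun j => f (φ j) x) atTop (𝓝 (f₀ x)) := by
  refine (tendstoInMeasure_of_tendsto_eLpNorm (p := 1) one_ne_zero
    (fun j => (hf j).aestronglyMeasurable) hf₀.aestronglyMeasurable ?_).exists_seq_tendsto_ae
  have e : ∀ j, eLpNorm (f j - f₀) 1 volume = ENNReal.ofReal (∫ x, ‖f j x - f₀ x‖) := fun j => by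
    rw [eLpNorm_one_eq_lintegral_enorm]
    exact (ofReal_integral_norm_eq_lintegral_enorm ((hf j).sub hf₀)).symm
  simp only [e]
  simpa [Function.comp_def] using (ENNReal.continuous_ofReal.tendsto 0).comp h

lemma ae_norm_le_of_memLp_top {E : Type*} [NormedAddCommGroup E] {f : Rn n → E}
    (hf : MemLp f ∞ volume) : ∀ᵐ x, ‖f x‖ ≤ (eLpNorm f ∞ volume).toReal := by
  have h := ae_le_eLpNormEssSup (f := f) (μ := volume)
  filter_upwards [h] with x hx
  rw [← eLpNorm_exponent_top] at hx
  rw [← toReal_enorm]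
  exact ENNReal.toReal_mono hf.2.ne hx

/-- A smooth even cutoff function, with its gradient. -/
lemma exists_cutoff (n : ℕ) : ∃ (χ : Rn n → ℝ) (χ' : Rn n → Rn n) (A : ℝ),
    ContDiff ℝ (⊤ : ℕ∞) χ ∧ HasCompactSupport χ ∧ (∀ x, HasGradientAt χ (χ' x) x) ∧
    Continuous χ' ∧ HasCompactSupport χ' ∧ (∀ x, ‖χ' x‖ ≤ A) ∧ (∀ x, 0 ≤ χ x) ∧ (∀ x, χ x ≤ 1) ∧
    (∀ x, χ (-x) = χ x) ∧ ∀ x, ‖x‖ ≤ 1 → χ x = 1 := by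
  let f : ContDiffBump (0 : Rn n) := ⟨1, 2, one_pos, one_lt_two⟩
  have hd : ContDiff ℝ (⊤ : ℕ∞) f := f.contDiff
  have hdiff : Differentiable ℝ f := hd.differentiable (by simp)
  have hg : ∀ x, HasGradientAt f (gradient f x) x := fun x => (hdiff x).hasGradientAt
  have hc : Continuous (gradient f) :=
    (InnerProductSpace.toDual ℝ (Rn n)).symm.continuous.comp (hd.continuous_fderiv (by simp))
  have hs : HasCompactSupport (gradient f) :=
    (f.hasCompactSupport.fderiv (𝕜 := ℝ)).comp_left (g := (InnerProductSpace.toDual ℝ (Rn n)).symm)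
      (map_zero _)
  obtain ⟨A, hA⟩ := hs.exists_bound_of_continuous hc
  exact ⟨f, gradient f, A, hd, f.hasCompactSupport, hg, hc, hs, hA, fun x => f.nonneg,
    fun x => f.le_one, f.neg, fun x hx => f.one_of_mem_closedBall (by simpa using hx)⟩

lemma norm_mollify_le_of_ae {E : Type*} [NormedAddCommGroup E] [NormedSpace ℝ E] {δ C : ℝ}
    (hδ : 0 < δ) {f : Rn n → E} (hf : ∀ᵐ x, ‖f x‖ ≤ C) (x : Rn n) : ‖mollify δ f x‖ ≤ C := by
  calc ‖mollify δ f x‖ ≤ ∫ y, heatKernel n δ (x - y) * C := by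
        rw [mollify_apply]
        refine norm_integral_le_of_norm_le ((integrable_heatKernel_sub hδ x).mul_const _) ?_
        filter_upwards [hf] with y hy
        have := (heatKernel_pos hδ (x - y)).le
        rw [norm_smul, Real.norm_of_nonneg this]
        gcongr
    _ = C := by rw [integral_mul_const, integral_heatKernel_sub hδ, one_mul]

/-- An even `C¹` kernel `K` with `|K| ≤ M`, whose gradient `k` is integrable with `|k| ≤ Γ`. -/
structure IsSmoothKernel (K : Rn n → ℝ) (k : Rn n → Rn n) (M Γ : ℝ) : Prop where
  hasGradientAt : ∀ x, HasGradientAt K (k x) x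
  continuous_grad : Continuous k
  norm_le : ∀ x, ‖K x‖ ≤ M
  norm_grad_le : ∀ x, ‖k x‖ ≤ Γ
  integrable_grad : Integrable k
  even : ∀ x, K (-x) = K x

/-- Smooth even kernels with integrable gradients which approximate an even potential in
`𝒲^{1,∞}`: truncation followed by mollification. -/
lemma exists_kernel_approx {W : Rn n → ℝ} {g : Rn n → Rn n} (hW : IsSobolevOneInfty W g)
    (heven : ∀ᵐ x : Rn n, W (-x) = W x) :
    ∃ (K : ℕ → Rn n → ℝ) (k : ℕ → Rn n → Rn n) (Γ : ℝ),
      (∀ j, IsSmoothKernel (K j) (k j) (supNorm W) Γ) ∧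
        (∀ᵐ x, Tendsto (fun j => K j x) atTop (𝓝 (W x))) ∧
      ∀ᵐ x, Tendsto (fun j => k j x) atTop (𝓝 (g x)) := by
  obtain ⟨χ, χ', A, hχs, hχc, hχg, hχ'c, hχ's, hχA, hχ0, hχ1, hχe, hχone⟩ := exists_cutoff n
  have hWM := ae_norm_le_of_memLp_top hW.memLp
  have hgM := ae_norm_le_of_memLp_top hW.memLp_grad
  change ∀ᵐ x, ‖W x‖ ≤ supNorm W at hWM
  set M := supNorm W with hM
  set Γ₀ := (eLpNorm g ∞ volume).toReal with hΓ₀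
  have hM0 := nonneg_of_ae_norm_le hWM
  have hΓ0 := nonneg_of_ae_norm_le hgM
  have hWm := hW.memLp.1
  have hgm := hW.memLp_grad.1
  have hA0 : 0 ≤ A := (norm_nonneg _).trans (hχA 0)
  -- the truncated potentials and their gradients
  set R : ℕ → ℝ := fun j => 1 / ((j : ℝ) + 1) with hR
  have hR0 : ∀ j, 0 < R j := fun j => by positivity
  have hR1 : ∀ j, R j ≤ 1 := fun j => by
    simp only [hR]; rw [div_le_one (by positivity)]; linarith [(Nat.cast_nonneg j : (0:ℝ) ≤ j)]
  set X : ℕ → Rn n → ℝ := fun j x => χ (R j • x) with hX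
  set X' : ℕ → Rn n → Rn n := fun j x => R j • χ' (R j • x) with hX'
  have hXg : ∀ j x, HasGradientAt (X j) (X' j x) x := by
    intro j x
    have h1 := (hasGradientAt_iff_hasFDerivAt.1 (hχg (R j • x))).comp x
      ((hasFDerivAt_id x).const_smul (R j))
    exact hasGradientAt_of_hasFDerivAt h1 fun v => by simp [hX', inner_smul_left]
  have hXs : ∀ j, ContDiff ℝ (⊤ : ℕ∞) (X j) := fun j => hχs.comp (contDiff_const_smul _)
  have hXc : ∀ j, HasCompactSupport (X j) := fun j =>
    hχc.comp_homeomorph (Homeomorph.smulOfNeZero (R j) (hR0 j).ne')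
  have hX'c : ∀ j, Continuous (X' j) := fun j => by fun_prop
  have hX's : ∀ j, HasCompactSupport (X' j) := fun j =>
    (hχ's.comp_homeomorph (Homeomorph.smulOfNeZero (R j) (hR0 j).ne')).smul_left
      (f := fun _ => R j)
  have hXi : ∀ j, Integrable (X j) := fun j =>
    (hXs j).continuous.integrable_of_hasCompactSupport (hXc j)
  have hX'i : ∀ j, Integrable (X' j) := fun j =>
    (hX'c j).integrable_of_hasCompactSupport (hX's j)
  have hX'b : ∀ j x, ‖X' j x‖ ≤ R j * A := fun j x => by
    simp only [hX']; rw [norm_smul, Real.norm_of_nonneg (hR0 j).le]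
    exact mul_le_mul_of_nonneg_left (hχA _) (hR0 j).le
  have hRlim : Tendsto R atTop (𝓝 0) := tendsto_one_div_add_atTop_nhds_zero_nat
  have hXlim : ∀ x, ∀ᶠ j in atTop, X j x = 1 := fun x => by
    have h1 : Tendsto (fun j => R j * ‖x‖) atTop (𝓝 0) := by simpa using hRlim.mul_const ‖x‖
    filter_upwards [h1.eventually (gt_mem_nhds one_pos)] with j hj
    refine hχone _ ?_
    rw [norm_smul, Real.norm_of_nonneg (hR0 j).le]; exact hj.le
  set WR : ℕ → Rn n → ℝ := fun j x => X j x * W x with hWR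
  set gR : ℕ → Rn n → Rn n := fun j x => X j x • g x + W x • X' j x with hgR
  have hWRi : ∀ j, Integrable (WR j) := fun j => (hXi j).mul_bdd hWm hWM
  have hgRi : ∀ j, Integrable (gR j) := fun j =>
    ((hXi j).smul_bdd Γ₀ hgm hgM).add ((hX'i j).bdd_smul M hWm hWM)
  have hWRb : ∀ j, ∀ᵐ x, ‖WR j x‖ ≤ M := fun j => by
    filter_upwards [hWM] with x hx
    rw [norm_mul, Real.norm_of_nonneg (hχ0 _)]
    exact (mul_le_of_le_one_left (norm_nonneg _) (hχ1 _)).trans hx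
  have hgRb : ∀ j, ∀ᵐ x, ‖gR j x‖ ≤ Γ₀ + M * A := fun j => by
    filter_upwards [hWM, hgM] with x hx hx'
    refine (norm_add_le _ _).trans (add_le_add ?_ ?_)
    · rw [norm_smul, Real.norm_of_nonneg (hχ0 _)]
      exact (mul_le_of_le_one_left (norm_nonneg _) (hχ1 _)).trans hx'
    · rw [norm_smul]
      exact mul_le_mul hx ((hX'b j x).trans (mul_le_of_le_one_left hA0 (hR1 j)))
        (norm_nonneg _) hM0
  have hWRe : ∀ j, ∀ᵐ x, WR j (-x) = WR j x := fun j => by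
    filter_upwards [heven] with x hx
    simp only [hWR, hX, smul_neg, hχe, hx]
  -- the mollified truncation has the mollified gradient
  have hgrad : ∀ j δ, 0 < δ → ∀ x, gradMoll δ (WR j) x = mollify δ (gR j) x := by
    intro j δ hδ x
    set φ : Rn n → ℝ := fun y => X j y * heatKernel n δ (x - y) with hφ
    have hφg : ∀ y, HasGradientAt φ
        (heatKernel n δ (x - y) • X' j y - X j y • gradHeat n δ (x - y)) y := by
      intro y
      have h1 := hasGradientAt_iff_hasFDerivAt.1 (hXg j y)
      have h2 := (hasGradientAt_iff_hasFDerivAt.1 (hasGradientAt_heatKernel (n := n) δ (x - y))).comp y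
        ((hasFDerivAt_id y).const_sub x)
      have h3 := h1.mul h2
      refine hasGradientAt_of_hasFDerivAt h3 fun v => ?_
      simp [inner_sub_left, inner_smul_left]
      ring
    have h1 := hW.weakGradient φ ((hXs j).mul ((contDiff_heatKernel δ).comp
      (contDiff_const.sub contDiff_id))) ((hXc j).mul_right)
    have hGb : ∀ y, ‖heatKernel n δ (x - y)‖ ≤ (4 * π * δ) ^ (-(n : ℝ) / 2) := fun y =>
      norm_heatKernel_le hδ _
    have i1 : Integrable fun y => heatKernel n δ (x - y) • (W y • X' j y) :=
      ((hX'i j).bdd_smul M hWm hWM).bdd_smul _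
        (by fun_prop : Continuous fun y => heatKernel n δ (x - y)).aestronglyMeasurable
        (ae_of_all _ hGb)
    have i2 : Integrable fun y => WR j y • gradHeat n δ (x - y) :=
      integrable_convolution_integrand_of_bounded (L := (ContinuousLinearMap.lsmul ℝ ℝ).flip)
        norm_lsmul_flip_apply_le (continuous_gradHeat δ).aestronglyMeasurable
        (fun y => norm_gradHeat_le_const hδ le_rfl y) (hWRi j) x
    have i3 : Integrable fun y => heatKernel n δ (x - y) • (X j y • g y) :=
      ((hXi j).smul_bdd Γ₀ hgm hgM).bdd_smul _
        (by fun_prop : Continuous fun y => heatKernel n δ (x - y)).aestronglyMeasurable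
        (ae_of_all _ hGb)
    have e1 : ∫ y, W y • gradient φ y = (∫ y, heatKernel n δ (x - y) • (W y • X' j y))
        - ∫ y, WR j y • gradHeat n δ (x - y) := by
      rw [← integral_sub i1 i2]
      congr 1; ext1 y
      rw [(hφg y).gradient]
      simp only [hWR]
      module
    have e2 : ∫ y, φ y • g y = ∫ y, heatKernel n δ (x - y) • (X j y • g y) := by
      congr 1; ext1 y
      simp only [hφ]
      module
    rw [e1, e2] at h1
    rw [gradMoll_apply, mollify_apply]
    simp only [hgR, smul_add]
    rw [integral_add i3 i1]
    rw [sub_eq_iff_eq_add] at h1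
    rw [h1]; abel
  -- choice of the mollification parameters
  have hδex : ∀ j, ∃ δ, 0 < δ ∧ ∫ x, ‖mollify δ (WR j) x - WR j x‖ ≤ R j ∧
      ∫ x, ‖mollify δ (gR j) x - gR j x‖ ≤ R j := fun j => by
    have h1 := (tendsto_integral_norm_mollify_sub (hWRi j)).eventually (gt_mem_nhds (hR0 j))
    have h2 := (tendsto_integral_norm_mollify_sub (hgRi j)).eventually (gt_mem_nhds (hR0 j))
    obtain ⟨δ, h3, h4, h5⟩ := (h1.and (h2.and self_mem_nhdsWithin)).exists
    exact ⟨δ, h5, h3.le, h4.le⟩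
  choose δ hδ0 hδ1 hδ2 using hδex
  have lim : ∀ {E : Type} [NormedAddCommGroup E] [NormedSpace ℝ E] (F : ℕ → Rn n → E)
      (hF : ∀ j, Integrable (F j)) (hb : ∀ j, ∫ x, ‖mollify (δ j) (F j) x - F j x‖ ≤ R j)
      (φ : ℕ → ℕ) (hφ : StrictMono φ), ∃ ψ : ℕ → ℕ, StrictMono ψ ∧
        ∀ᵐ x, Tendsto (fun j => mollify (δ (φ (ψ j))) (F (φ (ψ j))) x - F (φ (ψ j)) x) atTop (𝓝 0) := by
    intro E _ _ F hF hb φ hφ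
    refine exists_subseq_tendsto_ae (f := fun j x => mollify (δ (φ j)) (F (φ j)) x - F (φ j) x)
      (f₀ := fun _ => 0) (fun j => (integrable_mollify (hδ0 _) (hF _)).sub (hF _))
      (integrable_zero _ _ _) ?_
    simp only [sub_zero]
    exact squeeze_zero (fun _ => integral_nonneg fun _ => norm_nonneg _) (fun j => hb (φ j))
      (hRlim.comp hφ.tendsto_atTop)
  obtain ⟨φ, hφ, hφlim⟩ := lim WR hWRi hδ1 id strictMono_id
  obtain ⟨ψ, hψ, hψlim⟩ := lim gR hgRi hδ2 φ hφ
  have hφψ : Tendsto (fun j => φ (ψ j)) atTop atTop := (hφ.comp hψ).tendsto_atTop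
  refine ⟨fun j => mollify (δ (φ (ψ j))) (WR (φ (ψ j))), fun j => mollify (δ (φ (ψ j))) (gR (φ (ψ j))),
    Γ₀ + M * A, fun j => ⟨fun x => ?_, continuous_mollify (hδ0 _) (hgRi _),
      norm_mollify_le_of_ae (hδ0 _) (hWRb _), norm_mollify_le_of_ae (hδ0 _) (hgRb _),
      integrable_mollify (hδ0 _) (hgRi _), fun x => ?_⟩, ?_, ?_⟩
  · dsimp only
    rw [← hgrad _ _ (hδ0 _)]
    exact hasGradientAt_mollify (hδ0 _) (hWRi _) x
  · dsimp only
    rw [mollify_apply, mollify_apply, ← integral_neg_eq_self]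
    refine integral_congr_ae ?_
    filter_upwards [hWRe (φ (ψ j))] with y hy
    rw [hy, show -x - -y = -(x - y) by abel, heatKernel_neg]
  · filter_upwards [hφlim] with x hx
    have h1 : Tendsto (fun j => WR (φ (ψ j)) x) atTop (𝓝 (W x)) := by
      refine tendsto_const_nhds.congr' ?_
      filter_upwards [hφψ.eventually (hXlim x)] with j hj
      simp only [hWR, hj, one_mul]
    have h2 := (hx.comp hψ.tendsto_atTop).add h1
    simpa [Function.comp_def] using h2
  · filter_upwards [hψlim] with x hx
    have h0 : Tendsto (fun j => X' (φ (ψ j)) x) atTop (𝓝 0) := by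
      refine squeeze_zero_norm (fun j => hX'b _ x) ?_
      simpa using (hRlim.comp hφψ).mul_const A
    have h1 : Tendsto (fun j => gR (φ (ψ j)) x) atTop (𝓝 (g x)) := by
      have h2 : Tendsto (fun j => g x + W x • X' (φ (ψ j)) x) atTop (𝓝 (g x)) := by
        simpa using (h0.const_smul (W x)).const_add (g x)
      refine h2.congr' ?_
      filter_upwards [hφψ.eventually (hXlim x)] with j hj
      simp only [hgR, hj, one_smul]
    have h2 := hx.add h1
    simpa using h2

end Kernels

/-! ### The regularised entropy -/

section RegularizedEntropy

/-- The regularised entropy density `(r + ε) log (1 + r / ε)`, whose second derivative is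
`1 / (r + ε)`. For `r ≥ 0`, adding `r log ε` gives a function that decreases to `r log r` as
`ε → 0`. -/
def entReg (ε r : ℝ) : ℝ := (r + ε) * Real.log (1 + r / ε)

variable {ε r : ℝ} (hε : 0 < ε)

lemma measurable_entReg (ε : ℝ) : Measurable (entReg ε) := by unfold entReg; fun_prop

lemma entReg_zero (ε : ℝ) : entReg ε 0 = 0 := by simp [entReg]

include hε

lemma one_add_div_eq (r : ℝ) : 1 + r / ε = (r + ε) / ε := by field_simp; ring

lemma hasDerivAt_log_one_add_div (hr : 0 ≤ r) :
    HasDerivAt (fun r => Real.log (1 + r / ε) + 1) (1 / (r + ε)) r := by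
  have h := ((((hasDerivAt_id r).div_const ε).const_add 1).log (by
    simp only [id]; positivity)).add_const 1
  refine h.congr_deriv ?_
  simp only [id]
  field_simp
  ring

lemma hasDerivAt_entReg (hr : 0 ≤ r) :
    HasDerivAt (entReg ε) (Real.log (1 + r / ε) + 1) r := by
  have h1 := ((((hasDerivAt_id r).div_const ε).const_add 1).log (by
    simp only [id]; positivity))
  have h2 := ((hasDerivAt_id r).add_const ε).mul h1
  refine h2.congr_deriv ?_
  simp only [id]
  have : 1 + r / ε ≠ 0 := by positivity
  rw [one_mul, add_right_inj, one_add_div_eq hε]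
  have : r + ε ≠ 0 := by positivity
  field_simp

lemma log_one_add_div_nonneg (hr : 0 ≤ r) : 0 ≤ Real.log (1 + r / ε) :=
  Real.log_nonneg (by have : 0 ≤ r / ε := by positivity
                      linarith)

lemma entReg_nonneg (hr : 0 ≤ r) : 0 ≤ entReg ε r :=
  mul_nonneg (by positivity) (log_one_add_div_nonneg hε hr)

lemma entReg_le (hr : 0 ≤ r) : entReg ε r ≤ r * (Real.log (1 + r / ε) + 1) := by
  have h1 : Real.log (1 + r / ε) ≤ r / ε := by
    have := Real.log_le_sub_one_of_pos (show 0 < 1 + r / ε by positivity)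
    linarith
  have h2 : ε * Real.log (1 + r / ε) ≤ r := by
    calc _ ≤ ε * (r / ε) := by gcongr
      _ = r := by field_simp
  unfold entReg
  linarith

/-- Convexity of the regularised entropy: it lies above its tangents. -/
lemma entReg_tangent_le {a b : ℝ} (ha : 0 ≤ a) (hb : 0 ≤ b) :
    entReg ε a + (Real.log (1 + a / ε) + 1) * (b - a) ≤ entReg ε b := by
  have ha' : 0 < a + ε := by positivity
  have hb' : 0 < b + ε := by positivity
  have h1 := Real.log_le_sub_one_of_pos (show 0 < (a + ε) / (b + ε) by positivity)
  have h2 : Real.log ((a + ε) / (b + ε)) = Real.log (1 + a / ε) - Real.log (1 + b / ε) := by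
    rw [one_add_div_eq hε, one_add_div_eq hε, Real.log_div ha'.ne' hb'.ne',
      Real.log_div ha'.ne' hε.ne', Real.log_div hb'.ne' hε.ne']
    ring
  have h3 : (b + ε) * ((a + ε) / (b + ε) - 1) = a - b := by field_simp; ring
  have h4 : (b + ε) * (Real.log (1 + a / ε) - Real.log (1 + b / ε)) ≤ a - b := by
    rw [← h2, ← h3]; gcongr
  unfold entReg
  nlinarith

lemma abs_entReg_sub_le {a b B : ℝ} (ha : 0 ≤ a) (hb : 0 ≤ b) (haB : a ≤ B) (hbB : b ≤ B) :
    |entReg ε a - entReg ε b| ≤ (Real.log (1 + B / ε) + 1) * |a - b| := by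
  have key : ∀ a b : ℝ, 0 ≤ a → 0 ≤ b → a ≤ B →
      entReg ε a - entReg ε b ≤ (Real.log (1 + B / ε) + 1) * |a - b| := by
    intro a b ha hb haB
    have h1 := entReg_tangent_le hε ha hb
    have h2 : Real.log (1 + a / ε) ≤ Real.log (1 + B / ε) :=
      Real.log_le_log (by positivity) (by gcongr)
    have h3 := log_one_add_div_nonneg hε ha
    calc entReg ε a - entReg ε b ≤ (Real.log (1 + a / ε) + 1) * (a - b) := by linarith
      _ ≤ (Real.log (1 + a / ε) + 1) * |a - b| := by gcongr; exact le_abs_self _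
      _ ≤ _ := by gcongr
  rw [abs_le]
  constructor
  · have := key b a hb ha hbB
    rw [abs_sub_comm] at this; linarith
  · exact key a b ha hb haB

lemma abs_entReg_sub_sub_le {a b : ℝ} (ha : 0 ≤ a) (hb : 0 ≤ b) :
    |entReg ε b - entReg ε a - (Real.log (1 + a / ε) + 1) * (b - a)| ≤ 1 / ε * (b - a) ^ 2 := by
  refine abs_sub_sub_le_of_lipschitz_deriv (f := entReg ε)
    (f' := fun r => Real.log (1 + r / ε) + 1) (convex_Ici 0)
    (fun x hx => (hasDerivAt_entReg hε hx).hasDerivWithinAt) (fun x hx y hy => ?_) ha hb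
  exact (convex_Ici (0 : ℝ)).norm_image_sub_le_of_norm_hasDerivWithin_le (C := 1 / ε)
    (fun x hx => (hasDerivAt_log_one_add_div hε hx).hasDerivWithinAt)
    (fun x hx => by
      have hx' : 0 ≤ x := hx
      rw [Real.norm_of_nonneg (by positivity)]
      gcongr; linarith) hy hx

omit hε in
/-- The left-hand side is `(r + ε₁) log (r + ε₁) - ε₁ log ε₁`, with derivative
`log (r + ε₁) - log ε₁ ≥ 0` in `ε₁`. -/
lemma entReg_add_mul_log_mono {ε₁ ε₂ : ℝ} (h1 : 0 < ε₁) (h12 : ε₁ ≤ ε₂) (hr : 0 ≤ r) :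
    entReg ε₁ r + r * Real.log ε₁ ≤ entReg ε₂ r + r * Real.log ε₂ := by
  have h2 : 0 < ε₂ := h1.trans_le h12
  have e : ∀ ε, 0 < ε → entReg ε r + r * Real.log ε
      = (r + ε) * Real.log (r + ε) - ε * Real.log ε := fun ε hε => by
    rw [entReg, one_add_div_eq hε, Real.log_div (by positivity) hε.ne']; ring
  have hd : ∀ x ∈ Ioi (0 : ℝ), HasDerivAt (fun x => (r + x) * Real.log (r + x) - x * Real.log x)
      (Real.log (r + x) - Real.log x) x := by
    intro x hx
    have hx' : 0 < x := hx
    have h3 := ((Real.hasDerivAt_mul_log (x := r + x) (by positivity)).comp_const_add r x).sub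
      (Real.hasDerivAt_mul_log hx'.ne')
    exact h3.congr_deriv (by ring)
  rw [e _ h1, e _ h2]
  refine monotoneOn_of_deriv_nonneg (convex_Ioi (0 : ℝ))
    (fun x hx => (hd x hx).continuousAt.continuousWithinAt)
    (fun x hx => (hd x (interior_subset hx)).differentiableAt.differentiableWithinAt)
    (fun x hx => ?_) h1 h2 h12
  rw [(hd x (interior_subset hx)).deriv]
  have hx' : 0 < x := interior_subset hx
  have := Real.log_le_log hx' (show x ≤ r + x by linarith)
  linarith

omit hε in
lemma tendsto_entReg_add_mul_log (hr : 0 ≤ r) :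
    Tendsto (fun ε => entReg ε r + r * Real.log ε) (𝓝[>] 0) (𝓝 (r * Real.log r)) := by
  have hc : Continuous fun ε => (r + ε) * Real.log (r + ε) - ε * Real.log ε :=
    (Real.continuous_mul_log.comp (continuous_const.add continuous_id)).sub Real.continuous_mul_log
  have := (hc.tendsto 0).mono_left (nhdsWithin_le_nhds (s := Ioi 0))
  simp only [add_zero, zero_mul, sub_zero] at this
  refine this.congr' ?_
  filter_upwards [self_mem_nhdsWithin] with ε hε
  have hε' : 0 < ε := hε
  rw [entReg, one_add_div_eq hε', Real.log_div (by positivity) hε'.ne']; ring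

end RegularizedEntropy

section Truncation

/-- The regularisation `r² / (r + κ)` of the identity on `[0, ∞)`, flat at the origin. Its gradient
along `u` is controlled by `∇u / √(u + ε)`, which is all that the regularised dissipation gives. -/
def flatReg (κ r : ℝ) : ℝ := r ^ 2 / (r + κ)

variable {κ r : ℝ} (hκ : 0 < κ)
include hκ

lemma hasDerivAt_flatReg (hr : 0 ≤ r) :
    HasDerivAt (flatReg κ) ((r ^ 2 + 2 * r * κ) / (r + κ) ^ 2) r := by
  have h := ((hasDerivAt_id r).pow 2).div ((hasDerivAt_id r).add_const κ)
    (by simp only [id]; positivity)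
  refine h.congr_deriv ?_
  simp only [id, Pi.pow_apply]
  congr 1
  push_cast
  ring

lemma deriv_flatReg_le_one (hr : 0 ≤ r) : (r ^ 2 + 2 * r * κ) / (r + κ) ^ 2 ≤ 1 := by
  rw [div_le_one (by positivity)]
  nlinarith [sq_nonneg κ]

lemma deriv_flatReg_le (hr : 0 ≤ r) :
    (r ^ 2 + 2 * r * κ) / (r + κ) ^ 2 ≤ 2 * (r / (r + κ)) := by
  rw [← mul_div_assoc, div_le_div_iff₀ (by positivity) (by positivity)]
  have : (0 : ℝ) ≤ r ^ 2 * (r + κ) := by positivity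
  nlinarith

lemma flatReg_nonneg (hr : 0 ≤ r) : 0 ≤ flatReg κ r := by unfold flatReg; positivity

lemma flatReg_le (hr : 0 ≤ r) : flatReg κ r ≤ r := by
  rw [flatReg, div_le_iff₀ (by positivity)]; nlinarith [mul_nonneg hr hκ.le]

lemma sub_flatReg_le (hr : 0 ≤ r) : r - flatReg κ r ≤ κ := by
  have : r - flatReg κ r = κ * (r / (r + κ)) := by
    unfold flatReg
    have : r + κ ≠ 0 := by positivity
    field_simp; ring
  rw [this]
  refine mul_le_of_le_one_right hκ.le ?_
  rw [div_le_one (by positivity)]; linarith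

lemma abs_flatReg_sub_le {a b : ℝ} (ha : 0 ≤ a) (hb : 0 ≤ b) :
    |flatReg κ a - flatReg κ b| ≤ |a - b| := by
  have := (convex_Ici (0 : ℝ)).norm_image_sub_le_of_norm_hasDerivWithin_le (C := 1)
    (f := flatReg κ) (x := b) (y := a)
    (fun x hx => (hasDerivAt_flatReg hκ hx).hasDerivWithinAt)
    (fun x hx => by
      have hx' : 0 ≤ x := hx
      rw [Real.norm_of_nonneg (by positivity)]
      exact deriv_flatReg_le_one hκ hx) hb ha
  simpa using this

end Truncation

/-! ### The interaction energy -/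

section Interaction

variable {n : ℕ} {K : Rn n → ℝ} {M : ℝ}

/-- The interaction `∫ f (K * h)` of two densities. -/
def inter (K f h : Rn n → ℝ) : ℝ := ∫ x, f x * vel K h x

variable (hK : AEStronglyMeasurable K) (hM : ∀ᵐ x, ‖K x‖ ≤ M)
include hK hM

lemma integrable_inter {f h : Rn n → ℝ} (hf : Integrable f) (hh : Integrable h) :
    Integrable fun x => f x * vel K h x :=
  hf.mul_bdd (aestronglyMeasurable_vel hK hh.aestronglyMeasurable)
    (ae_of_all _ fun x => norm_vel_le hM hh x)

lemma abs_inter_le {f h : Rn n → ℝ} (hf : Integrable f) (hh : Integrable h) :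
    |inter K f h| ≤ M * (∫ x, ‖f x‖) * ∫ x, ‖h x‖ := by
  have h1 : ∀ x, ‖f x * vel K h x‖ ≤ ‖f x‖ * (M * ∫ x, ‖h x‖) := fun x => by
    rw [norm_mul]; gcongr; exact norm_vel_le hM hh x
  calc |inter K f h| ≤ ∫ x, ‖f x‖ * (M * ∫ x, ‖h x‖) := by
        rw [← Real.norm_eq_abs]
        exact norm_integral_le_of_norm_le (hf.norm.mul_const _) (ae_of_all _ h1)
    _ = _ := by rw [integral_mul_const]; ring

lemma inter_sub_left {f f' h : Rn n → ℝ} (hf : Integrable f) (hf' : Integrable f')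
    (hh : Integrable h) : inter K (fun x => f x - f' x) h = inter K f h - inter K f' h := by
  simp only [inter, sub_mul]
  exact integral_sub (integrable_inter hK hM hf hh) (integrable_inter hK hM hf' hh)

lemma inter_sub_right {f h h' : Rn n → ℝ} (hf : Integrable f) (hh : Integrable h)
    (hh' : Integrable h') : inter K f (fun x => h x - h' x) = inter K f h - inter K f h' := by
  simp only [inter, ← vel_sub hK hM hh hh', mul_sub]
  exact integral_sub (integrable_inter hK hM hf hh) (integrable_inter hK hM hf hh')

lemma inter_comm (he : ∀ᵐ x : Rn n, K (-x) = K x) {f h : Rn n → ℝ} (hf : Integrable f)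
    (hh : Integrable h) : inter K f h = inter K h f := by
  have hqm : Measure.QuasiMeasurePreserving (fun p : Rn n × Rn n => p.1 - p.2)
      (volume.prod volume) volume := quasiMeasurePreserving_sub volume volume
  have i1 : Integrable fun p : Rn n × Rn n => f p.1 * (h p.2 * K (p.1 - p.2)) := by
    have := (hf.mul_prod hh).mul_bdd (c := M) (hK.comp_quasiMeasurePreserving hqm) (hqm.ae hM)
    exact this.congr (ae_of_all _ fun p => by simp only [Function.comp]; ring)
  have e1 : inter K f h = ∫ x, ∫ y, f x * (h y * K (x - y)) := by
    simp only [inter, vel_apply, smul_eq_mul, integral_const_mul]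
  have e2 : inter K h f = ∫ y, ∫ x, h y * (f x * K (y - x)) := by
    simp only [inter, vel_apply, smul_eq_mul, integral_const_mul]
  rw [e1, integral_integral_swap i1, e2]
  congr 1; ext1 y
  refine integral_congr_ae ?_
  have h2 := (quasiMeasurePreserving_sub_left_of_right_invariant (volume : Measure (Rn n)) y).ae he
  filter_upwards [h2] with x hx
  rw [← hx, neg_sub]; ring

lemma abs_inter_self_sub_le {f h : Rn n → ℝ} (hf : Integrable f) (hh : Integrable h) :
    |inter K f f - inter K h h| ≤ M * ((∫ x, ‖f x‖) + ∫ x, ‖h x‖) * ∫ x, ‖f x - h x‖ := by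
  have hd : Integrable fun x => f x - h x := hf.sub hh
  have e : inter K f f - inter K h h
      = inter K (fun x => f x - h x) f + inter K h (fun x => f x - h x) := by
    rw [inter_sub_left hK hM hf hh hf, inter_sub_right hK hM hh hf hh]; ring
  rw [e]
  refine (abs_add_le _ _).trans ?_
  have h1 := abs_inter_le hK hM hd hf
  have h2 := abs_inter_le hK hM hh hd
  linarith

/-- The interaction energy is quadratic. -/
lemma abs_inter_self_sub_sub_le (he : ∀ᵐ x : Rn n, K (-x) = K x) {f h : Rn n → ℝ}
    (hf : Integrable f) (hh : Integrable h) :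
    |1 / 2 * inter K f f - 1 / 2 * inter K h h - inter K (fun x => f x - h x) h|
      ≤ M / 2 * (∫ x, ‖f x - h x‖) ^ 2 := by
  have hd : Integrable fun x => f x - h x := hf.sub hh
  have e : 1 / 2 * inter K f f - 1 / 2 * inter K h h - inter K (fun x => f x - h x) h
      = 1 / 2 * inter K (fun x => f x - h x) (fun x => f x - h x) := by
    rw [inter_sub_left hK hM hf hh hd, inter_sub_right hK hM hf hf hh,
      inter_sub_right hK hM hh hf hh, inter_sub_left hK hM hf hh hh,
      inter_comm hK hM he hh hf]
    ring
  rw [e, abs_mul, abs_of_pos (by norm_num : (0 : ℝ) < 1 / 2)]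
  have := abs_inter_le hK hM hd hd
  nlinarith

end Interaction

/-! ### Dissipation of the regularised free energy -/

section Density

variable {n : ℕ}

lemma integral_mollify {δ : ℝ} (hδ : 0 < δ) {f : Rn n → ℝ} (hf : Integrable f) :
    ∫ x, mollify δ f x = ∫ x, f x := by
  have := integral_smul_convolution (L := ContinuousLinearMap.lsmul ℝ ℝ) (φ := fun _ => (1 : ℝ))
    (C := 1) (integrable_heatKernel (n := n) hδ) hf aestronglyMeasurable_const (by simp)
  simp only [one_smul] at this
  rw [mollify, this]
  congr 1; ext1 y
  rw [integral_sub_right_eq_self (heatKernel n δ), integral_heatKernel hδ]; simp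

/-- A probability density. -/
structure IsDensity (σ : Rn n → ℝ) : Prop where
  integrable : Integrable σ
  nonneg : 0 ≤ᵐ[volume] σ
  mass : ∫ x, σ x = 1

lemma IsDensity.integral_norm {σ : Rn n → ℝ} (h : IsDensity σ) : ∫ x, ‖σ x‖ = 1 := by
  rw [← h.mass]
  refine integral_congr_ae ?_
  filter_upwards [h.nonneg] with x hx using Real.norm_of_nonneg hx

lemma mollify_nonneg {δ : ℝ} (hδ : 0 < δ) {σ : Rn n → ℝ} (hσ : 0 ≤ᵐ[volume] σ) (x : Rn n) :
    0 ≤ mollify δ σ x := by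
  rw [mollify_apply]
  refine integral_nonneg_of_ae ?_
  filter_upwards [hσ] with y hy
  exact mul_nonneg (heatKernel_pos hδ _).le hy

lemma IsDensity.mollify {σ : Rn n → ℝ} (h : IsDensity σ) {δ : ℝ} (hδ : 0 < δ) :
    IsDensity (mollify δ σ) :=
  ⟨integrable_mollify hδ h.integrable, ae_of_all _ (mollify_nonneg hδ h.nonneg),
    (integral_mollify hδ h.integrable).trans h.mass⟩

lemma IsDensity.norm_vel_le {E : Type*} [NormedAddCommGroup E] [NormedSpace ℝ E] {g : Rn n → E}
    {Γ : ℝ} {σ : Rn n → ℝ} (h : IsDensity σ) (hΓ : ∀ᵐ x, ‖g x‖ ≤ Γ) (x : Rn n) :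
    ‖vel g σ x‖ ≤ Γ := by
  have := _root_.norm_vel_le hΓ h.integrable x
  rwa [h.integral_norm, mul_one] at this

end Density

section Level

variable {n : ℕ}

/-- The flux `∇u + u (k * u)` of the mollified density `u = G_δ * σ`. -/
def flux (k : Rn n → Rn n) (δ : ℝ) (σ : Rn n → ℝ) (x : Rn n) : Rn n :=
  gradMoll δ σ x + drift k (mollify δ σ) x

/-- The difference between the mollified drift of `σ` and the drift, with the velocity `k * u`, of
the mollified density `u = G_δ * σ`. -/
def fluxErr (g k : Rn n → Rn n) (δ : ℝ) (σ : Rn n → ℝ) (x : Rn n) : Rn n :=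
  mollify δ (drift g σ) x - drift k (mollify δ σ) x

/-- The regularised dissipation `∫ |J|² / (u + ε)`, where `J` is the flux of `u = G_δ * σ`. -/
def dissip (k : Rn n → Rn n) (ε δ : ℝ) (σ : Rn n → ℝ) : ℝ :=
  ∫ x, ‖flux k δ σ x‖ ^ 2 / (mollify δ σ x + ε)

/-- The regularised free energy of `u = G_δ * σ` with the interaction kernel `K`. -/
def regEnergy (K : Rn n → ℝ) (ε δ : ℝ) (σ : Rn n → ℝ) : ℝ :=
  (∫ x, entReg ε (mollify δ σ x)) + 1 / 2 * inter K (mollify δ σ) (mollify δ σ)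

variable {K : Rn n → ℝ} {k : Rn n → Rn n} {M Γ' : ℝ} (hK : IsSmoothKernel K k M Γ')

include hK

lemma IsSmoothKernel.continuous : Continuous K := continuous_of_hasGradientAt hK.hasGradientAt

lemma IsSmoothKernel.aesm : AEStronglyMeasurable K := hK.continuous.aestronglyMeasurable

lemma IsSmoothKernel.aesm_grad : AEStronglyMeasurable k := hK.continuous_grad.aestronglyMeasurable

lemma IsSmoothKernel.hasGradientAt_vel {u : Rn n → ℝ} (hu : Integrable u) (x : Rn n) :
    HasGradientAt (vel K u) (vel k u x) x := by
  have h := hasGradientAt_convolution hK.hasGradientAt hK.continuous_grad hK.norm_le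
    hK.norm_grad_le hu x
  have e : (fun x => ∫ y, K (x - y) * u y) = vel K u := by
    ext1 x; rw [vel_apply]; congr 1; ext1 y; rw [smul_eq_mul, mul_comm]
  rwa [e] at h

lemma IsSmoothKernel.continuous_vel_grad {u : Rn n → ℝ} (hu : Integrable u) :
    Continuous (vel k u) := by
  have h := continuous_convolution_of_bounded (L := (ContinuousLinearMap.lsmul ℝ ℝ).flip)
    norm_lsmul_flip_apply_le hK.continuous_grad hK.norm_grad_le hu
  rwa [convolution_flip] at h

lemma IsSmoothKernel.integral_norm_vel_grad_le {u : Rn n → ℝ} (hu : IsDensity u) :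
    Integrable (vel k u) ∧ ∫ x, ‖vel k u x‖ ≤ ∫ x, ‖k x‖ := by
  refine ⟨hu.integrable.integrable_convolution _ hK.integrable_grad, ?_⟩
  have := integral_norm_convolution_le norm_lsmul_apply_le hu.integrable hK.integrable_grad
  rwa [hu.integral_norm, one_mul] at this

variable {δ : ℝ} (hδ : 0 < δ) {σ : Rn n → ℝ} (hσ : IsDensity σ)
include hδ hσ

lemma continuous_flux : Continuous (flux k δ σ) :=
  (continuous_gradMoll hδ hσ.integrable).add ((continuous_mollify hδ hσ.integrable).smul
    (hK.continuous_vel_grad (hσ.mollify hδ).integrable))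

lemma integrable_flux : Integrable (flux k δ σ) :=
  (integrable_gradMoll hδ hσ.integrable).add
    (integrable_drift hK.aesm_grad (ae_of_all _ hK.norm_grad_le) (hσ.mollify hδ).integrable)

lemma norm_drift_mollify_le (x : Rn n) : ‖drift k (mollify δ σ) x‖ ≤ mollify δ σ x * Γ' := by
  have h0 := mollify_nonneg hδ hσ.nonneg x
  rw [drift_eq, norm_smul, Real.norm_of_nonneg h0]
  gcongr
  exact (hσ.mollify hδ).norm_vel_le (ae_of_all _ hK.norm_grad_le) x

variable {ε : ℝ} (hε : 0 < ε)
include hε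

lemma integrable_dissip_integrand :
    Integrable fun x => ‖flux k δ σ x‖ ^ 2 / (mollify δ σ x + ε) := by
  have hc := continuous_flux hK hδ hσ
  have hu0 := mollify_nonneg hδ hσ.nonneg
  have huc := continuous_mollify hδ hσ.integrable
  obtain ⟨CG, hCG⟩ : ∃ C, ∀ x, ‖gradMoll δ σ x‖ ≤ C := ⟨_, norm_gradMoll_le hδ hσ.integrable⟩
  obtain ⟨B, hB⟩ : ∃ C, ∀ x, ‖mollify δ σ x‖ ≤ C := ⟨_, norm_mollify_le hδ hσ.integrable⟩
  have hΓ0 : 0 ≤ Γ' := (norm_nonneg _).trans (hK.norm_grad_le 0)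
  have hJ : ∀ x, ‖flux k δ σ x‖ ≤ CG + B * Γ' := fun x =>
    (norm_add_le _ _).trans (add_le_add (hCG x) ((norm_drift_mollify_le hK hδ hσ x).trans
      (by gcongr; exact (le_abs_self _).trans (hB x))))
  refine ((integrable_flux hK hδ hσ).norm.const_mul ((CG + B * Γ') / ε)).mono' ?_
    (ae_of_all _ fun x => ?_)
  · have : ∀ x, mollify δ σ x + ε ≠ 0 := fun x => by have := hu0 x; positivity
    exact (by fun_prop (disch := assumption) : Continuous _).aestronglyMeasurable
  · have h0 := hu0 x
    rw [Real.norm_of_nonneg (by positivity), sq, div_mul_eq_mul_div]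
    refine div_le_div₀ ?_ ?_ hε (by linarith)
    · exact mul_nonneg ((norm_nonneg _).trans (hJ x)) (norm_nonneg _)
    · exact mul_le_mul_of_nonneg_right (hJ x) (norm_nonneg _)

lemma dissip_nonneg : 0 ≤ dissip k ε δ σ := integral_nonneg fun x => by
  have := mollify_nonneg hδ hσ.nonneg x
  positivity

/-- The dissipation controls the `L¹` modulus of continuity of a flattened version of `u e^{K*u}`,
for `∇ (u e^{K * u}) = e^{K * u} J`. -/
lemma integral_norm_flatReg_translate_le {l : ℝ} (hl : 0 < l) (z : Rn n) :
    ∫ x, ‖flatReg (Real.exp M * ε) (mollify δ σ (x + z) * Real.exp (vel K (mollify δ σ) (x + z)))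
        - flatReg (Real.exp M * ε) (mollify δ σ x * Real.exp (vel K (mollify δ σ) x))‖
      ≤ ‖z‖ * (l * Real.exp M ^ 2 + dissip k ε δ σ / (2 * l)) := by
  set u := mollify δ σ with hu
  have hud : IsDensity u := hσ.mollify hδ
  set V := vel K u with hV
  set b := vel k u with hb
  set κ := Real.exp M * ε with hκ
  have hκ0 : 0 < κ := by positivity
  have hu0 : ∀ x, 0 ≤ u x := mollify_nonneg hδ hσ.nonneg
  have hVM : ∀ x, V x ≤ M := fun x =>
    (le_abs_self _).trans (hud.norm_vel_le (ae_of_all _ hK.norm_le) x)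
  set h : Rn n → ℝ := fun x => u x * Real.exp (V x) with hh
  have hh0 : ∀ x, 0 ≤ h x := fun x => mul_nonneg (hu0 x) (Real.exp_pos _).le
  set c : Rn n → ℝ := fun x => (h x ^ 2 + 2 * h x * κ) / (h x + κ) ^ 2 with hc
  have hc0 : ∀ x, 0 ≤ c x := fun x => by have := hh0 x; positivity
  have hVc : Continuous V := continuous_of_hasGradientAt (hK.hasGradientAt_vel hud.integrable)
  have huc : Continuous u := continuous_mollify hδ hσ.integrable
  have hhc : Continuous h := by fun_prop
  have hcc : Continuous c := by
    have : ∀ x, (h x + κ) ^ 2 ≠ 0 := fun x => by have := hh0 x; positivity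
    fun_prop (disch := assumption)
  have hJc := continuous_flux hK hδ hσ
  have hJi := integrable_flux hK hδ hσ
  have hgrad : ∀ x, HasGradientAt (fun x => flatReg κ (h x))
      (c x • (Real.exp (V x) • flux k δ σ x)) x := by
    intro x
    have h1 := hasGradientAt_iff_hasFDerivAt.1 (hasGradientAt_mollify hδ hσ.integrable x)
    have h2 := hasGradientAt_iff_hasFDerivAt.1 ((hK.hasGradientAt_vel hud.integrable x).comp_hasDerivAt_left
      (Real.hasDerivAt_exp (V x)))
    have h3 : HasGradientAt h (Real.exp (V x) • flux k δ σ x) x := by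
      refine hasGradientAt_of_hasFDerivAt (h1.mul h2) fun v => ?_
      simp [flux, drift_eq, inner_smul_left, inner_add_left]
      ring
    exact h3.comp_hasDerivAt_left (hasDerivAt_flatReg hκ0 (hh0 x))
  have hcle : ∀ x, ‖c x * Real.exp (V x)‖ ≤ Real.exp M := fun x => by
    rw [norm_mul, Real.norm_of_nonneg (hc0 x), Real.norm_of_nonneg (Real.exp_pos _).le]
    exact (mul_le_of_le_one_left (Real.exp_pos _).le (deriv_flatReg_le_one hκ0 (hh0 x))).trans
      (Real.exp_le_exp.2 (hVM x))
  have hgc : Continuous fun x => c x • (Real.exp (V x) • flux k δ σ x) := by fun_prop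
  have hgi : Integrable fun x => c x • (Real.exp (V x) • flux k δ σ x) := by
    refine (hJi.norm.const_mul (Real.exp M)).mono' hgc.aestronglyMeasurable (ae_of_all _ fun x => ?_)
    rw [smul_smul, norm_smul]
    gcongr; exact hcle x
  refine (integral_norm_translate_sub_le hgrad hgc hgi z).trans ?_
  gcongr
  have hDi := integrable_dissip_integrand hK hδ hσ hε
  -- weighted Young inequality, with `c² (u + ε) ≤ 2 u`
  have hpt : ∀ x, ‖c x • (Real.exp (V x) • flux k δ σ x)‖ ≤ (l * Real.exp M ^ 2) * u x
      + (‖flux k δ σ x‖ ^ 2 / (u x + ε)) / (2 * l) := by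
    intro x
    set j := ‖flux k δ σ x‖ with hj
    have hx := hu0 x
    have hw : 0 < u x + ε := by positivity
    set A := c x * Real.exp (V x) with hA
    have hA0 : 0 ≤ A := mul_nonneg (hc0 x) (Real.exp_pos _).le
    have h1 : A * j ≤ l / 2 * (A ^ 2 * (u x + ε)) + j ^ 2 / (u x + ε) / (2 * l) := by
      have : l / 2 * (A ^ 2 * (u x + ε)) + j ^ 2 / (u x + ε) / (2 * l) - A * j
          = (A * l * (u x + ε) - j) ^ 2 / (2 * l * (u x + ε)) := by field_simp; ring
      have h2 : 0 ≤ (A * l * (u x + ε) - j) ^ 2 / (2 * l * (u x + ε)) := by positivity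
      linarith
    have hexp : Real.exp (V x) ≤ Real.exp M := Real.exp_le_exp.2 (hVM x)
    have h3 : c x ^ 2 * (u x + ε) ≤ 2 * u x := by
      have h4 : c x ^ 2 ≤ 2 * (h x / (h x + κ)) := by
        have h5 := deriv_flatReg_le hκ0 (hh0 x)
        have h6 := deriv_flatReg_le_one hκ0 (hh0 x)
        calc c x ^ 2 = c x * c x := sq _
          _ ≤ 1 * c x := by gcongr
          _ ≤ _ := by rw [one_mul]; exact h5
      have h7 : h x / (h x + κ) * (u x + ε) ≤ u x := by
        have := hh0 x
        rw [div_mul_eq_mul_div, div_le_iff₀ (by positivity)]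
        have h8 : u x * (Real.exp (V x) * ε) ≤ u x * (Real.exp M * ε) := by gcongr
        simp only [hh, hκ]
        nlinarith
      calc c x ^ 2 * (u x + ε) ≤ 2 * (h x / (h x + κ)) * (u x + ε) := by gcongr
        _ = 2 * (h x / (h x + κ) * (u x + ε)) := by ring
        _ ≤ 2 * u x := by linarith
    have h9 : A ^ 2 * (u x + ε) ≤ 2 * Real.exp M ^ 2 * u x := by
      calc A ^ 2 * (u x + ε) = Real.exp (V x) ^ 2 * (c x ^ 2 * (u x + ε)) := by rw [hA]; ring
        _ ≤ Real.exp M ^ 2 * (2 * u x) := by gcongr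
        _ = _ := by ring
    rw [smul_smul, norm_smul, Real.norm_of_nonneg hA0]
    have h10 : l / 2 * (A ^ 2 * (u x + ε)) ≤ l / 2 * (2 * Real.exp M ^ 2 * u x) := by gcongr
    linarith
  calc ∫ x, ‖c x • (Real.exp (V x) • flux k δ σ x)‖
      ≤ ∫ x, ((l * Real.exp M ^ 2) * u x + (‖flux k δ σ x‖ ^ 2 / (u x + ε)) / (2 * l)) :=
        integral_mono hgi.norm ((hud.integrable.const_mul _).add (hDi.div_const _)) hpt
    _ = _ := by
        rw [integral_add (hud.integrable.const_mul _) (hDi.div_const _), integral_const_mul,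
          hud.mass, integral_div, mul_one]
        rfl

variable {g : Rn n → Rn n} {Γ : ℝ} (hg : AEStronglyMeasurable g) (hΓ : ∀ᵐ x, ‖g x‖ ≤ Γ)
include hg hΓ

omit hε in
/-- Since both drifts are bounded by multiples of `u`, the quotient `|fluxErr|² / (u + ε)` is of first
order in `fluxErr`. -/
lemma norm_fluxErr_le (x : Rn n) : ‖fluxErr g k δ σ x‖ ≤ (Γ + Γ') * mollify δ σ x := by
  have h1 : ‖mollify δ (drift g σ) x‖ ≤ Γ * mollify δ σ x := by
    rw [mollify_apply, mollify_apply, ← integral_const_mul]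
    refine norm_integral_le_of_norm_le ((integrable_heatKernel_smul hδ hσ.integrable x).const_mul Γ) ?_
    filter_upwards [hσ.nonneg] with y hy
    have hG := (heatKernel_pos hδ (x - y)).le
    have hy' : 0 ≤ σ y := hy
    rw [norm_smul, Real.norm_of_nonneg hG, drift_eq, norm_smul, Real.norm_of_nonneg hy']
    calc heatKernel n δ (x - y) * (σ y * ‖vel g σ y‖) ≤ heatKernel n δ (x - y) * (σ y * Γ) := by
          gcongr; exact hσ.norm_vel_le hΓ y
      _ = Γ * (heatKernel n δ (x - y) • σ y) := by rw [smul_eq_mul]; ring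
  refine (norm_sub_le _ _).trans ?_
  have := norm_drift_mollify_le hK hδ hσ x
  linarith

omit hε in
lemma integrable_fluxErr : Integrable (fluxErr g k δ σ) :=
  (integrable_mollify hδ (integrable_drift hg hΓ hσ.integrable)).sub
    (integrable_drift hK.aesm_grad (ae_of_all _ hK.norm_grad_le) (hσ.mollify hδ).integrable)

/-- The production of the regularised free energy along the mollified equation. With `b = k * u`
and `e` the flux error it is `-∫ (J + ε b) · (J + e) / (u + ε)`, and the cross terms are absorbed. -/
lemma production_energy_le :
    -∫ x, inner ℝ ((1 / (mollify δ σ x + ε)) • gradMoll δ σ x + vel k (mollify δ σ) x)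
        (gradMoll δ σ x + mollify δ (drift g σ) x)
      ≤ -(1 / 2 * dissip k ε δ σ)
        + 3 / 2 * ((Γ + Γ') * (∫ x, ‖fluxErr g k δ σ x‖) + ε * Γ' * ∫ x, ‖k x‖) := by
  have hΓ0 := nonneg_of_ae_norm_le hΓ
  have hΓ0' : 0 ≤ Γ' := (norm_nonneg _).trans (hK.norm_grad_le 0)
  set u := mollify δ σ with hu
  have hud : IsDensity u := hσ.mollify hδ
  set b := vel k u with hb
  have hu0 : ∀ x, 0 ≤ u x := mollify_nonneg hδ hσ.nonneg
  have hbi := hK.integral_norm_vel_grad_le hud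
  have hbΓ : ∀ x, ‖b x‖ ≤ Γ' := hud.norm_vel_le (ae_of_all _ hK.norm_grad_le)
  have hDi := integrable_dissip_integrand hK hδ hσ hε
  have hei := integrable_fluxErr hK hδ hσ hg hΓ
  have hpt : ∀ x, -(inner ℝ ((1 / (u x + ε)) • gradMoll δ σ x + b x)
        (gradMoll δ σ x + mollify δ (drift g σ) x) : ℝ)
      ≤ -(1 / 2 * (‖flux k δ σ x‖ ^ 2 / (u x + ε)))
        + 3 / 2 * ((Γ + Γ') * ‖fluxErr g k δ σ x‖ + ε * Γ' * ‖b x‖) := by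
    intro x
    have hx := hu0 x
    have hw : 0 < u x + ε := by positivity
    set J := flux k δ σ x with hJ
    set e := fluxErr g k δ σ x with he
    -- both factors of the production in terms of the flux
    have e1 : gradMoll δ σ x + mollify δ (drift g σ) x = J + e := by
      simp only [hJ, he, flux, fluxErr]; abel
    have e2 : (1 / (u x + ε)) • gradMoll δ σ x + b x = (1 / (u x + ε)) • (J + ε • b x) := by
      have : b x = (1 / (u x + ε)) • ((u x + ε) • b x) := by
        rw [smul_smul, one_div_mul_cancel hw.ne', one_smul]
      conv_lhs => rw [this]
      rw [← smul_add, hJ, flux, drift_eq]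
      congr 1
      simp only [← hu, ← hb, add_smul]
      abel
    rw [e1, e2, inner_smul_left]
    simp only [conj_trivial]
    have h1 : 1 / 2 * ‖J‖ ^ 2 - 3 / 2 * (‖e‖ ^ 2 + (ε * ‖b x‖) ^ 2)
        ≤ inner ℝ (J + ε • b x) (J + e) := by
      rw [inner_add_left, inner_add_right, inner_add_right, real_inner_self_eq_norm_sq]
      have i1 := neg_le_of_abs_le (abs_real_inner_le_norm J e)
      have i2 := neg_le_of_abs_le (abs_real_inner_le_norm (ε • b x) J)
      have i3 := neg_le_of_abs_le (abs_real_inner_le_norm (ε • b x) e)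
      rw [norm_smul, Real.norm_of_nonneg hε.le] at i2 i3
      nlinarith [sq_nonneg (‖J‖ - ‖e‖ - ε * ‖b x‖), sq_nonneg (‖e‖ - ε * ‖b x‖)]
    have h2 : 1 / (u x + ε) * ‖e‖ ^ 2 ≤ (Γ + Γ') * ‖e‖ := by
      rw [one_div, inv_mul_le_iff₀ hw, sq]
      have h3 : ‖e‖ ≤ (Γ + Γ') * (u x + ε) := (norm_fluxErr_le hK hδ hσ hg hΓ x).trans (by
        gcongr; linarith)
      calc ‖e‖ * ‖e‖ ≤ ((Γ + Γ') * (u x + ε)) * ‖e‖ := by gcongr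
        _ = _ := by ring
    have h4 : 1 / (u x + ε) * (ε * ‖b x‖) ^ 2 ≤ ε * Γ' * ‖b x‖ := by
      rw [one_div, inv_mul_le_iff₀ hw]
      calc (ε * ‖b x‖) ^ 2 = ε * (ε * ‖b x‖ * ‖b x‖) := by ring
        _ ≤ (u x + ε) * (ε * Γ' * ‖b x‖) := by
            gcongr
            · linarith
            · exact hbΓ x
    have h5 : 0 < 1 / (u x + ε) := by positivity
    have h6 := mul_le_mul_of_nonneg_left h1 h5.le
    have h7 : ‖J‖ ^ 2 / (u x + ε) = 1 / (u x + ε) * ‖J‖ ^ 2 := by ring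
    rw [h7]
    nlinarith
  have i2 : Integrable fun x => ε * Γ' * ‖b x‖ := hbi.1.norm.const_mul _
  have i1 : Integrable fun x => (Γ + Γ') * ‖fluxErr g k δ σ x‖ := hei.norm.const_mul _
  have i3 : Integrable fun x => -(1 / 2 * (‖flux k δ σ x‖ ^ 2 / (u x + ε))) :=
    (hDi.const_mul _).neg
  have i4 : Integrable fun x => 3 / 2 * ((Γ + Γ') * ‖fluxErr g k δ σ x‖ + ε * Γ' * ‖b x‖) :=
    (i1.add i2).const_mul _
  have hgi := integrable_gradMoll hδ hσ.integrable
  have hai : Integrable fun x => gradMoll δ σ x + mollify δ (drift g σ) x :=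
    hgi.add (integrable_mollify hδ (integrable_drift hg hΓ hσ.integrable))
  obtain ⟨CG, hCG⟩ : ∃ C, ∀ x, ‖gradMoll δ σ x‖ ≤ C := ⟨_, norm_gradMoll_le hδ hσ.integrable⟩
  have hli : Integrable fun x => (inner ℝ ((1 / (u x + ε)) • gradMoll δ σ x + b x)
      (gradMoll δ σ x + mollify δ (drift g σ) x) : ℝ) := by
    have hne : ∀ x, u x + ε ≠ 0 := fun x => by have := hu0 x; positivity
    have huc : Continuous u := continuous_mollify hδ hσ.integrable
    have hGc := continuous_gradMoll hδ hσ.integrable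
    have hbc : Continuous b := hK.continuous_vel_grad hud.integrable
    have hm : Continuous fun x => (1 / (u x + ε)) • gradMoll δ σ x + b x := by
      fun_prop (disch := assumption)
    refine (hai.norm.const_mul (1 / ε * CG + Γ')).mono'
      (hm.aestronglyMeasurable.inner hai.aestronglyMeasurable) (ae_of_all _ fun x => ?_)
    refine (norm_inner_le_norm _ _).trans ?_
    gcongr
    refine (norm_add_le _ _).trans (add_le_add ?_ (hbΓ x))
    have hx := hu0 x
    rw [norm_smul, Real.norm_of_nonneg (by positivity)]
    gcongr
    · linarith
    · exact hCG x
  rw [← integral_neg]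
  refine (integral_mono hli.neg (i3.add i4) hpt).trans ?_
  simp only [Pi.add_apply]
  rw [integral_add i3 i4, integral_neg, integral_const_mul, integral_const_mul,
    integral_add i1 i2, integral_const_mul, integral_const_mul]
  have h8 : ε * Γ' * ∫ x, ‖b x‖ ≤ ε * Γ' * ∫ x, ‖k x‖ :=
    mul_le_mul_of_nonneg_left hbi.2 (by positivity)
  simp only [dissip]
  linarith

end Level

/-! ### Evolution of the regularised free energy -/

section Evolution

variable {n : ℕ}

lemma integrable_entReg_of_le {ε B : ℝ} (hε : 0 < ε) {f : Rn n → ℝ} (hf : Integrable f)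
    (h0 : ∀ x, 0 ≤ f x) (hB : ∀ x, f x ≤ B) : Integrable fun x => entReg ε (f x) := by
  refine (hf.norm.const_mul (Real.log (1 + B / ε) + 1)).mono'
    ((measurable_entReg ε).comp_aemeasurable hf.aemeasurable).aestronglyMeasurable
    (ae_of_all _ fun x => ?_)
  have := abs_entReg_sub_le hε (h0 x) le_rfl (hB x) ((h0 x).trans (hB x))
  simpa [entReg_zero] using this

lemma IsDensity.mollify_le {σ : Rn n → ℝ} (hσ : IsDensity σ) {δ : ℝ} (hδ : 0 < δ) (x : Rn n) :
    _root_.mollify δ σ x ≤ (4 * π * δ) ^ (-(n : ℝ) / 2) := by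
  have h := norm_mollify_le hδ hσ.integrable x
  rw [hσ.integral_norm, mul_one] at h
  exact (le_abs_self _).trans h

lemma IsDensity.integrable_entReg_mollify {σ : Rn n → ℝ} (hσ : IsDensity σ) {δ ε : ℝ} (hδ : 0 < δ)
    (hε : 0 < ε) : Integrable fun x => entReg ε (_root_.mollify δ σ x) :=
  integrable_entReg_of_le hε (integrable_mollify hδ hσ.integrable)
    (mollify_nonneg hδ hσ.nonneg) (hσ.mollify_le hδ)

variable {K : Rn n → ℝ} {k : Rn n → Rn n} {M Γ' : ℝ} (hK : IsSmoothKernel K k M Γ')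
  {ε δ : ℝ} (hε : 0 < ε) (hδ : 0 < δ)
include hK hε hδ

lemma abs_regEnergy_sub_le {σ τ : Rn n → ℝ} (hσ : IsDensity σ) (hτ : IsDensity τ) :
    |regEnergy K ε δ σ - regEnergy K ε δ τ|
      ≤ (Real.log (1 + (4 * π * δ) ^ (-(n : ℝ) / 2) / ε) + 1 + M)
        * ∫ x, ‖mollify δ σ x - mollify δ τ x‖ := by
  set B := (4 * π * δ) ^ (-(n : ℝ) / 2)
  have hσ' := hσ.mollify hδ
  have hτ' := hτ.mollify hδ
  have h1 : |(∫ x, entReg ε (mollify δ σ x)) - ∫ x, entReg ε (mollify δ τ x)|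
      ≤ (Real.log (1 + B / ε) + 1) * ∫ x, ‖mollify δ σ x - mollify δ τ x‖ := by
    rw [← integral_sub (hσ.integrable_entReg_mollify hδ hε) (hτ.integrable_entReg_mollify hδ hε),
      ← integral_const_mul, ← Real.norm_eq_abs]
    exact norm_integral_le_of_norm_le ((hσ'.integrable.sub hτ'.integrable).norm.const_mul _)
      (ae_of_all _ fun x => abs_entReg_sub_le hε (mollify_nonneg hδ hσ.nonneg x)
        (mollify_nonneg hδ hτ.nonneg x) (hσ.mollify_le hδ x) (hτ.mollify_le hδ x))
  have h2 := abs_inter_self_sub_le hK.aesm (ae_of_all _ hK.norm_le) hσ'.integrable hτ'.integrable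
  rw [hσ'.integral_norm, hτ'.integral_norm] at h2
  unfold regEnergy
  have h3 := abs_le.1 h1
  have h4 := abs_le.1 h2
  rw [abs_le]
  constructor <;> nlinarith

variable {g : Rn n → Rn n} {Γ : ℝ} (hg : AEStronglyMeasurable g) (hΓ : ∀ᵐ x, ‖g x‖ ≤ Γ)
  {ρ₀ : Rn n →₁[volume] ℝ} {ρ : ℝ → (Rn n →₁[volume] ℝ)} (h : IsMildSolution g ρ₀ ρ)
  (hd : ∀ t, 0 ≤ t → IsDensity (ρ t))
include h hd

lemma IsMildSolution.continuousOn_regEnergy (t : ℝ) :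
    ContinuousOn (fun s => regEnergy K ε δ (ρ s)) (Icc 0 t) := by
  intro s hs
  set L := Real.log (1 + (4 * π * δ) ^ (-(n : ℝ) / 2) / ε) + 1 + M with hL
  have hL0 : 0 ≤ L := by
    have h1 := log_one_add_div_nonneg hε
      (show 0 ≤ (4 * π * δ) ^ (-(n : ℝ) / 2) by positivity)
    have h2 : 0 ≤ M := (norm_nonneg _).trans (hK.norm_le 0)
    positivity
  have hc : ContinuousWithinAt ρ (Icc 0 t) s := (h.continuousOn.mono fun r hr => hr.1) s hs
  rw [ContinuousWithinAt, tendsto_iff_norm_sub_tendsto_zero] at hc ⊢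
  refine squeeze_zero' (Eventually.of_forall fun _ => norm_nonneg _) ?_
    (by simpa using hc.const_mul L)
  filter_upwards [self_mem_nhdsWithin] with r hr
  refine (abs_regEnergy_sub_le hK hε hδ (hd r hr.1) (hd s hs.1)).trans ?_
  exact mul_le_mul_of_nonneg_left (integral_norm_mollify_sub_mollify_le hδ _ _) hL0

include hg hΓ

/-- The differential of the regularised energy at `u` is `log (1 + u/ε) + 1 + K * u`; its gradient is
`∇u / (u + ε) + k * u`. -/
lemma IsMildSolution.hasDerivWithinAt_regEnergy {r : ℝ} (hr : 0 ≤ r) :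
    HasDerivWithinAt (fun s => regEnergy K ε δ (ρ s))
      (-∫ x, inner ℝ ((1 / (mollify δ (ρ r) x + ε)) • gradMoll δ (ρ r) x
          + vel k (mollify δ (ρ r)) x)
        (gradMoll δ (ρ r) x + mollify δ (drift g (ρ r)) x)) (Ici r) r := by
  set B := (4 * π * δ) ^ (-(n : ℝ) / 2) with hB
  set u : ℝ → Rn n → ℝ := fun s => mollify δ (ρ s) with hu
  have hud : ∀ s, 0 ≤ s → IsDensity (u s) := fun s hs => (hd s hs).mollify hδ
  have hu0 : ∀ s, 0 ≤ s → ∀ x, 0 ≤ u s x := fun s hs => mollify_nonneg hδ (hd s hs).nonneg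
  have huB : ∀ x, u r x ≤ B := (hd r hr).mollify_le hδ
  have hM0 : 0 ≤ M := (norm_nonneg _).trans (hK.norm_le 0)
  have hB0 : 0 ≤ B := by positivity
  obtain ⟨CG, hCG⟩ : ∃ C, ∀ x, ‖gradMoll δ (ρ r) x‖ ≤ C :=
    ⟨_, norm_gradMoll_le hδ (integrable_coe (ρ r))⟩
  have hVc : Continuous (vel K (u r)) :=
    continuous_of_hasGradientAt (hK.hasGradientAt_vel (hud r hr).integrable)
  have huc : Continuous (u r) := continuous_mollify hδ (integrable_coe (ρ r))
  have hpos : ∀ x, 0 < u r x + ε := fun x => by linarith [hu0 r hr x]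
  have hfb1 : ∀ x, ‖Real.log (1 + u r x / ε) + 1‖ ≤ Real.log (1 + B / ε) + 1 := fun x => by
    have h1 := log_one_add_div_nonneg hε (hu0 r hr x)
    rw [Real.norm_of_nonneg (by positivity)]
    have h2 : Real.log (1 + u r x / ε) ≤ Real.log (1 + B / ε) := by
      refine Real.log_le_log (by have := hu0 r hr x; positivity) ?_
      have := huB x
      gcongr
    linarith
  refine h.hasDerivWithinAt_of_quadratic hg hΓ (C := Real.log (1 + B / ε) + 1 + M)
    (C' := 1 / ε * CG + Γ') (K := 1 / ε * B + M / 2) hδ hr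
    (f := fun x => Real.log (1 + u r x / ε) + 1 + vel K (u r) x) ?_ ?_ ?_ ?_ ?_
  · intro x
    have h1 := (hasGradientAt_mollify hδ (integrable_coe (ρ r)) x).comp_hasDerivAt_left
      (hasDerivAt_log_one_add_div hε (hu0 r hr x))
    have h2 := hK.hasGradientAt_vel (hud r hr).integrable x
    refine hasGradientAt_of_hasFDerivAt (h1.hasFDerivAt.add h2.hasFDerivAt) fun v => ?_
    simp [inner_add_left, real_inner_smul_left, hu]
  · have h4 := continuous_gradMoll hδ (integrable_coe (ρ r))
    have h5 := hK.continuous_vel_grad (hud r hr).integrable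
    have : ∀ x, u r x + ε ≠ 0 := fun x => (hpos x).ne'
    exact (by fun_prop (disch := assumption) :
      Continuous fun x => (1 / (u r x + ε)) • gradMoll δ (ρ r) x + vel k (u r) x)
  · exact fun x => (norm_add_le _ _).trans (add_le_add (hfb1 x)
      ((hud r hr).norm_vel_le (ae_of_all _ hK.norm_le) x))
  · intro x
    refine (norm_add_le _ _).trans (add_le_add ?_
      ((hud r hr).norm_vel_le (ae_of_all _ hK.norm_grad_le) x))
    have hx := hpos x
    have hx0 := hu0 r hr x
    rw [norm_smul, Real.norm_of_nonneg (by positivity)]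
    refine mul_le_mul ?_ (hCG x) (norm_nonneg _) (by positivity)
    exact one_div_le_one_div_of_le hε (by linarith)
  · intro q hq _
    have hq0 : 0 ≤ q := hr.trans hq.le
    have hwi : Integrable fun x => u q x - u r x :=
      (hud q hq0).integrable.sub (hud r hr).integrable
    have i1 : Integrable fun x => (Real.log (1 + u r x / ε) + 1) * (u q x - u r x) := by
      refine hwi.bdd_mul ?_ (ae_of_all _ hfb1)
      have : ∀ x, 1 + u r x / ε ≠ 0 := fun x => by have := hu0 r hr x; positivity
      exact (by fun_prop (disch := assumption) : Continuous _).aestronglyMeasurable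
    have i2 : Integrable fun x => vel K (u r) x * (u q x - u r x) :=
      hwi.bdd_mul hVc.aestronglyMeasurable (ae_of_all _ fun x =>
        (hud r hr).norm_vel_le (ae_of_all _ hK.norm_le) x)
    have hw1 : ∫ x, ‖u q x - u r x‖ ≤ ‖ρ q - ρ r‖ := integral_norm_mollify_sub_mollify_le hδ _ _
    have hw0 : 0 ≤ ∫ x, ‖u q x - u r x‖ := integral_nonneg fun x => norm_nonneg _
    have e1 := (hd q hq0).integrable_entReg_mollify hδ hε
    have e2 := (hd r hr).integrable_entReg_mollify hδ hε
    have hent : |(∫ x, entReg ε (u q x)) - (∫ x, entReg ε (u r x))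
        - ∫ x, (Real.log (1 + u r x / ε) + 1) * (u q x - u r x)|
        ≤ 1 / ε * B * ‖ρ q - ρ r‖ * ∫ x, ‖u q x - u r x‖ := by
      have e3 : Integrable fun x => entReg ε (u q x) - entReg ε (u r x) := e1.sub e2
      rw [← integral_sub e1 e2, ← integral_sub e3 i1, ← integral_const_mul, ← Real.norm_eq_abs]
      refine norm_integral_le_of_norm_le (hwi.norm.const_mul _) (ae_of_all _ fun x => ?_)
      refine (abs_entReg_sub_sub_le hε (hu0 r hr x) (hu0 q hq0 x)).trans ?_
      have h5 := norm_mollify_sub_mollify_le hδ (ρ q) (ρ r) x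
      rw [← sq_abs, ← Real.norm_eq_abs]
      calc 1 / ε * ‖u q x - u r x‖ ^ 2 = 1 / ε * ‖u q x - u r x‖ * ‖u q x - u r x‖ := by ring
        _ ≤ 1 / ε * (B * ‖ρ q - ρ r‖) * ‖u q x - u r x‖ := by gcongr
        _ = _ := by ring
    have hint := abs_inter_self_sub_sub_le hK.aesm (ae_of_all _ hK.norm_le)
      (ae_of_all _ hK.even) (hud q hq0).integrable (hud r hr).integrable
    have e4 : inter K (fun x => u q x - u r x) (u r) = ∫ x, vel K (u r) x * (u q x - u r x) :=
      integral_congr_ae (ae_of_all _ fun x => mul_comm _ _)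
    rw [e4] at hint
    have hsplit : ∫ x, (Real.log (1 + u r x / ε) + 1 + vel K (u r) x) * (u q x - u r x)
        = (∫ x, (Real.log (1 + u r x / ε) + 1) * (u q x - u r x))
          + ∫ x, vel K (u r) x * (u q x - u r x) := by
      rw [← integral_add i1 i2]; simp only [add_mul]
    change |regEnergy K ε δ (ρ q) - regEnergy K ε δ (ρ r)
      - ∫ x, (Real.log (1 + u r x / ε) + 1 + vel K (u r) x) * (u q x - u r x)| ≤ _
    rw [hsplit]
    unfold regEnergy
    -- the interaction energy has a quadratic error as well
    have hsq : M / 2 * (∫ x, ‖u q x - u r x‖) ^ 2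
        ≤ M / 2 * ‖ρ q - ρ r‖ * ∫ x, ‖u q x - u r x‖ := by
      rw [sq, mul_assoc]; gcongr
    have h6 := abs_le.1 hent
    have h7 := abs_le.1 hint
    rw [abs_le]
    change _ ≤ (∫ x, entReg ε (u q x)) + 1 / 2 * inter K (u q) (u q)
      - ((∫ x, entReg ε (u r x)) + 1 / 2 * inter K (u r) (u r)) - _ ∧
      (∫ x, entReg ε (u q x)) + 1 / 2 * inter K (u q) (u q)
      - ((∫ x, entReg ε (u r x)) + 1 / 2 * inter K (u r) (u r)) - _ ≤ _
    constructor <;> nlinarith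

/-- Some intermediate time has a dissipation at most the mean decrease of the regularised energy,
up to the errors made by the regularisations. -/
lemma IsMildSolution.exists_dissip_le {t η : ℝ} (ht : 0 < t) (hη : 0 < η) :
    ∃ s ∈ Ioo 0 t, 1 / 2 * dissip k ε δ (ρ s)
      ≤ (regEnergy K ε δ (ρ 0) - regEnergy K ε δ (ρ t)) / t + η
        + 3 / 2 * ((Γ + Γ') * (∫ x, ‖fluxErr g k δ (ρ s) x‖) + ε * Γ' * ∫ x, ‖k x‖) := by
  by_contra! hcon
  have h2 := intervalIntegral.sub_le_integral_of_hasDeriv_right_of_le ht.le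
    (φ := fun _ => -((regEnergy K ε δ (ρ 0) - regEnergy K ε δ (ρ t)) / t + η))
    (h.continuousOn_regEnergy hK hε hδ hd t)
    (fun r hr => (h.hasDerivWithinAt_regEnergy hK hε hδ hg hΓ hd hr.1.le).Ioi_of_Ici)
    continuousOn_const.integrableOn_Icc (fun r hr => by
      have h3 := production_energy_le hK hδ (hd r hr.1.le) hε hg hΓ
      have h4 := hcon r hr
      linarith)
  rw [intervalIntegral.integral_const, smul_eq_mul, sub_zero] at h2
  have h5 : t * ((regEnergy K ε δ (ρ 0) - regEnergy K ε δ (ρ t)) / t)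
      = regEnergy K ε δ (ρ 0) - regEnergy K ε δ (ρ t) := by field_simp
  nlinarith [mul_pos ht hη]

end Evolution

/-! ### Removing the regularisations -/

section Limits

variable {n : ℕ} {E : Type*} [NormedAddCommGroup E] [NormedSpace ℝ E]

lemma tendsto_integral_norm_mollify_seq_sub [CompleteSpace E] {F : ℕ → Rn n → E} {F₀ : Rn n → E}
    {δ : ℕ → ℝ} (hF : ∀ j, Integrable (F j)) (hF₀ : Integrable F₀) (hδ : ∀ j, 0 < δ j)
    (hδ0 : Tendsto δ atTop (𝓝 0)) (h : Tendsto (fun j => ∫ x, ‖F j x - F₀ x‖) atTop (𝓝 0)) :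
    Tendsto (fun j => ∫ x, ‖mollify (δ j) (F j) x - F₀ x‖) atTop (𝓝 0) := by
  have hδ' : Tendsto δ atTop (𝓝[>] 0) :=
    tendsto_nhdsWithin_iff.2 ⟨hδ0, Eventually.of_forall hδ⟩
  have h2 := h.add ((tendsto_integral_norm_mollify_sub hF₀).comp hδ')
  rw [add_zero] at h2
  refine squeeze_zero (fun _ => integral_nonneg fun _ => norm_nonneg _) (fun j => ?_) h2
  have i1 := integrable_mollify (hδ j) ((hF j).sub hF₀)
  have i2 := (integrable_mollify (hδ j) hF₀).sub hF₀
  calc ∫ x, ‖mollify (δ j) (F j) x - F₀ x‖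
      ≤ ∫ x, (‖mollify (δ j) (fun y => F j y - F₀ y) x‖ + ‖mollify (δ j) F₀ x - F₀ x‖) := by
        refine integral_mono ((integrable_mollify (hδ j) (hF j)).sub hF₀).norm
          (i1.norm.add i2.norm) fun x => ?_
        simp only
        rw [mollify_sub (hδ j) (hF j) hF₀]
        exact norm_sub_le_norm_sub_add_norm_sub _ _ _
    _ = (∫ x, ‖mollify (δ j) (fun y => F j y - F₀ y) x‖) + ∫ x, ‖mollify (δ j) F₀ x - F₀ x‖ :=
        integral_add i1.norm i2.norm
    _ ≤ _ := add_le_add_left (integral_norm_mollify_le (hδ j) ((hF j).sub hF₀)) _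

variable {k : ℕ → Rn n → E} {g : Rn n → E} {Γ : ℝ} {u : ℕ → Rn n → ℝ} {σ : Rn n → ℝ}
  (hk : ∀ j, AEStronglyMeasurable (k j)) (hkΓ : ∀ j x, ‖k j x‖ ≤ Γ)
  (hkg : ∀ᵐ x, Tendsto (fun j => k j x) atTop (𝓝 (g x)))
  (hu : ∀ j, Integrable (u j)) (hσ : Integrable σ)
  (hlim : Tendsto (fun j => ∫ x, ‖u j x - σ x‖) atTop (𝓝 0))
include hk hkΓ hkg hu hσ hlim

/-- Convergence holds at every point, because only the values of `k` almost everywhere matter. -/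
lemma tendsto_vel (x : Rn n) :
    Tendsto (fun j => vel (k j) (u j) x) atTop (𝓝 (vel g σ x)) := by
  have h1 : Tendsto (fun j => vel (k j) σ x) atTop (𝓝 (vel g σ x)) := by
    simp only [vel_apply]
    refine tendsto_integral_of_dominated_convergence (fun y => ‖σ y‖ * Γ)
      (fun j => (integrable_vel_integrand (hk j) (ae_of_all _ (hkΓ j)) hσ x).aestronglyMeasurable)
      (hσ.norm.mul_const _) (fun j => ae_of_all _ fun y => ?_) ?_
    · rw [norm_smul]; gcongr; exact hkΓ j _
    · filter_upwards [(quasiMeasurePreserving_sub_left volume x).ae hkg] with y hy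
      exact hy.const_smul _
  have h2 : Tendsto (fun j => vel (k j) (u j) x - vel (k j) σ x) atTop (𝓝 0) := by
    refine squeeze_zero_norm (fun j => norm_vel_sub_le (hk j) (ae_of_all _ (hkΓ j)) (hu j) hσ x) ?_
    simpa using hlim.const_mul Γ
  simpa using h2.add h1

variable (hg : AEStronglyMeasurable g)
include hg

/-- The product `u (k * u)` is continuous in `L¹` under convergence of `u` in `L¹` and bounded almost
everywhere convergence of `k`. This covers the drift and the interaction energy. -/
lemma tendsto_integral_norm_smul_vel_sub :
    Tendsto (fun j => ∫ x, ‖u j x • vel (k j) (u j) x - σ x • vel g σ x‖) atTop (𝓝 0) := by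
  have hΓ : ∀ᵐ x, ‖g x‖ ≤ Γ := by
    filter_upwards [hkg] with x hx
    exact le_of_tendsto hx.norm (Eventually.of_forall fun j => hkΓ j x)
  have hΓ0 := nonneg_of_ae_norm_le hΓ
  obtain ⟨R, hR⟩ : ∃ R, ∀ j, ∫ x, ‖u j x‖ ≤ R := by
    obtain ⟨C, hC⟩ := hlim.bddAbove_range
    refine ⟨C + ∫ x, ‖σ x‖, fun j => ?_⟩
    calc ∫ x, ‖u j x‖ ≤ ∫ x, (‖u j x - σ x‖ + ‖σ x‖) :=
          integral_mono (hu j).norm (((hu j).sub hσ).norm.add hσ.norm) fun x => by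
            simpa using norm_add_le (u j x - σ x) (σ x)
      _ = (∫ x, ‖u j x - σ x‖) + ∫ x, ‖σ x‖ := integral_add ((hu j).sub hσ).norm hσ.norm
      _ ≤ _ := add_le_add_left (hC ⟨j, rfl⟩) _
  have hvm : ∀ j, AEStronglyMeasurable (vel (k j) (u j)) := fun j =>
    aestronglyMeasurable_vel (hk j) (hu j).aestronglyMeasurable
  have hvb : ∀ j x, ‖vel (k j) (u j) x‖ ≤ Γ * R := fun j x =>
    (norm_vel_le (ae_of_all _ (hkΓ j)) (hu j) x).trans (by gcongr; exact hR j)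
  have hgm := aestronglyMeasurable_vel hg hσ.aestronglyMeasurable
  have hgb : ∀ x, ‖vel g σ x‖ ≤ Γ * ∫ x, ‖σ x‖ := norm_vel_le hΓ hσ
  have i2 : ∀ j, Integrable fun x => σ x • (vel (k j) (u j) x - vel g σ x) := fun j =>
    hσ.smul_bdd (Γ * R + Γ * ∫ x, ‖σ x‖) ((hvm j).sub hgm) (ae_of_all _ fun x =>
      (norm_sub_le _ _).trans (add_le_add (hvb j x) (hgb x)))
  have h2 : Tendsto (fun j => ∫ x, ‖σ x • (vel (k j) (u j) x - vel g σ x)‖) atTop (𝓝 0) := by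
    have : Tendsto (fun j => ∫ x, ‖σ x • (vel (k j) (u j) x - vel g σ x)‖) atTop
        (𝓝 (∫ _ : Rn n, (0 : ℝ))) := by
      refine tendsto_integral_of_dominated_convergence
        (fun x => ‖σ x‖ * (Γ * R + Γ * ∫ x, ‖σ x‖)) (fun j => (i2 j).norm.aestronglyMeasurable)
        (hσ.norm.mul_const _) (fun j => ae_of_all _ fun x => ?_) (ae_of_all _ fun x => ?_)
      · rw [norm_norm, norm_smul]
        gcongr
        exact (norm_sub_le _ _).trans (add_le_add (hvb j x) (hgb x))
      · have h3 := (tendsto_vel hk hkΓ hkg hu hσ hlim x).sub_const (vel g σ x)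
        rw [sub_self] at h3
        simpa using (h3.const_smul (σ x)).norm
    simpa using this
  have h4 := (hlim.const_mul (Γ * R)).add h2
  rw [mul_zero, add_zero] at h4
  refine squeeze_zero (fun _ => integral_nonneg fun _ => norm_nonneg _) (fun j => ?_) h4
  have i1 : Integrable fun x => Γ * R * ‖u j x - σ x‖ := ((hu j).sub hσ).norm.const_mul _
  rw [← integral_const_mul, ← integral_add i1 (i2 j).norm]
  refine integral_mono_of_nonneg (ae_of_all _ fun _ => norm_nonneg _)
    (i1.add (i2 j).norm) (ae_of_all _ fun x => ?_)
  simp only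
  have e : u j x • vel (k j) (u j) x - σ x • vel g σ x
      = (u j x - σ x) • vel (k j) (u j) x + σ x • (vel (k j) (u j) x - vel g σ x) := by
    rw [sub_smul, smul_sub]; abel
  rw [e]
  refine (norm_add_le _ _).trans (add_le_add_left ?_ _)
  rw [norm_smul, mul_comm]
  exact mul_le_mul_of_nonneg_right (hvb j x) (norm_nonneg _)

end Limits

section ScalarLimits

variable {n : ℕ} {K : ℕ → Rn n → ℝ} {W : Rn n → ℝ} {M : ℝ} {u : ℕ → Rn n → ℝ} {σ : Rn n → ℝ}
  (hK : ∀ j, AEStronglyMeasurable (K j)) (hKM : ∀ j x, ‖K j x‖ ≤ M)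
  (hKW : ∀ᵐ x, Tendsto (fun j => K j x) atTop (𝓝 (W x))) (hW : AEStronglyMeasurable W)
include hK hKM hKW hW

lemma tendsto_inter (hu : ∀ j, Integrable (u j)) (hσ : Integrable σ)
    (hlim : Tendsto (fun j => ∫ x, ‖u j x - σ x‖) atTop (𝓝 0)) :
    Tendsto (fun j => inter (K j) (u j) (u j)) atTop (𝓝 (inter W σ σ)) := by
  have hWM : ∀ᵐ x, ‖W x‖ ≤ M := by
    filter_upwards [hKW] with x hx
    exact le_of_tendsto hx.norm (Eventually.of_forall fun j => hKM j x)
  have h := tendsto_integral_norm_smul_vel_sub hK hKM hKW hu hσ hlim hW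
  rw [tendsto_iff_norm_sub_tendsto_zero]
  refine squeeze_zero (fun _ => norm_nonneg _) (fun j => ?_) h
  have i1 := integrable_inter (hK j) (ae_of_all _ (hKM j)) (hu j) (hu j)
  have i2 := integrable_inter hW hWM hσ hσ
  rw [inter, inter, ← integral_sub i1 i2]
  exact norm_integral_le_integral_norm _

/-- Translation estimates for the flattened functions pass to the limit `κ → 0`, since these
converge in `L¹` to `σ e^{W * σ}`. -/
lemma integral_norm_translate_le_of_flatReg (hu : ∀ j, IsDensity (u j)) (hσ : IsDensity σ)
    (hlim : Tendsto (fun j => ∫ x, ‖u j x - σ x‖) atTop (𝓝 0)) {κ S : ℕ → ℝ} {S₀ : ℝ}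
    (hu0 : ∀ j x, 0 ≤ u j x) (hκ : ∀ j, 0 < κ j) (hκ0 : Tendsto κ atTop (𝓝 0))
    (hS : Tendsto S atTop (𝓝 S₀)) (z : Rn n)
    (hle : ∀ j, ∫ x, ‖flatReg (κ j) (u j (x + z) * Real.exp (vel (K j) (u j) (x + z)))
        - flatReg (κ j) (u j x * Real.exp (vel (K j) (u j) x))‖ ≤ S j) :
    ∫ x, ‖σ (x + z) * Real.exp (vel W σ (x + z)) - σ x * Real.exp (vel W σ x)‖ ≤ S₀ := by
  have hWM : ∀ᵐ x, ‖W x‖ ≤ M := by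
    filter_upwards [hKW] with x hx
    exact le_of_tendsto hx.norm (Eventually.of_forall fun j => hKM j x)
  set h : ℕ → Rn n → ℝ := fun j x => u j x * Real.exp (vel (K j) (u j) x) with hh
  set h₀ : Rn n → ℝ := fun x => σ x * Real.exp (vel W σ x) with hh₀
  have hexp : ∀ j x, Real.exp (vel (K j) (u j) x) ≤ Real.exp M := fun j x => Real.exp_le_exp.2
    ((le_abs_self _).trans ((hu j).norm_vel_le (ae_of_all _ (hKM j)) x))
  have hexp₀ : ∀ x, Real.exp (vel W σ x) ≤ Real.exp M := fun x => Real.exp_le_exp.2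
    ((le_abs_self _).trans (hσ.norm_vel_le hWM x))
  have hem : ∀ j, AEStronglyMeasurable fun x => Real.exp (vel (K j) (u j) x) := fun j =>
    Real.continuous_exp.comp_aestronglyMeasurable
      (aestronglyMeasurable_vel (hK j) (hu j).integrable.aestronglyMeasurable)
  have hem₀ : AEStronglyMeasurable fun x => Real.exp (vel W σ x) :=
    Real.continuous_exp.comp_aestronglyMeasurable
      (aestronglyMeasurable_vel hW hσ.integrable.aestronglyMeasurable)
  have hi : ∀ j, Integrable (h j) := fun j => (hu j).integrable.mul_bdd (hem j)
    (ae_of_all _ fun x => by rw [Real.norm_of_nonneg (Real.exp_pos _).le]; exact hexp j x)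
  have hi₀ : Integrable h₀ := hσ.integrable.mul_bdd hem₀
    (ae_of_all _ fun x => by rw [Real.norm_of_nonneg (Real.exp_pos _).le]; exact hexp₀ x)
  have hpos : ∀ j x, 0 ≤ h j x := fun j x => mul_nonneg (hu0 j x) (Real.exp_pos _).le
  have hpos₀ : ∀ᵐ x, 0 ≤ h₀ x := by
    filter_upwards [hσ.nonneg] with x hx using mul_nonneg hx (Real.exp_pos _).le
  have hfm : ∀ j, Measurable (flatReg (κ j)) := fun j => by unfold flatReg; fun_prop
  have hfi : ∀ j, Integrable fun x => flatReg (κ j) (h j x) := fun j =>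
    (hi j).mono' ((hfm j).comp_aemeasurable (hi j).aemeasurable).aestronglyMeasurable
      (ae_of_all _ fun x => by
        rw [Real.norm_of_nonneg (flatReg_nonneg (hκ j) (hpos j x))]
        exact flatReg_le (hκ j) (hpos j x))
  -- convergence of the flattened functions in `L¹`
  have i2 : ∀ j, Integrable fun x => σ x * (Real.exp (vel (K j) (u j) x) - Real.exp (vel W σ x)) :=
    fun j => by
      refine ((hi₀.norm.add (hσ.integrable.norm.mul_const (Real.exp M)))).mono'
        (hσ.integrable.aestronglyMeasurable.mul ((hem j).sub hem₀)) (ae_of_all _ fun x => ?_)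
      rw [mul_sub, Pi.add_apply, add_comm]
      refine (norm_sub_le _ _).trans (add_le_add_left ?_ _)
      rw [norm_mul, Real.norm_of_nonneg (Real.exp_pos _).le]
      exact mul_le_mul_of_nonneg_left (hexp j x) (norm_nonneg _)
  have l2 : Tendsto (fun j => ∫ x, ‖σ x * (Real.exp (vel (K j) (u j) x) - Real.exp (vel W σ x))‖)
      atTop (𝓝 0) := by
    have : Tendsto (fun j => ∫ x, ‖σ x * (Real.exp (vel (K j) (u j) x) - Real.exp (vel W σ x))‖)
        atTop (𝓝 (∫ _ : Rn n, (0 : ℝ))) := by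
      refine tendsto_integral_of_dominated_convergence
        (fun x => ‖σ x‖ * (Real.exp M + Real.exp M)) (fun j => (i2 j).norm.aestronglyMeasurable)
        (hσ.integrable.norm.mul_const _) (fun j => ae_of_all _ fun x => ?_)
        (ae_of_all _ fun x => ?_)
      · rw [norm_norm, norm_mul]
        gcongr
        refine (norm_sub_le _ _).trans ?_
        rw [Real.norm_of_nonneg (Real.exp_pos _).le, Real.norm_of_nonneg (Real.exp_pos _).le]
        exact add_le_add (hexp j x) (hexp₀ x)
      · have h3 := ((Real.continuous_exp.tendsto _).comp
          (tendsto_vel hK hKM hKW (fun j => (hu j).integrable) hσ.integrable hlim x)).sub_const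
            (Real.exp (vel W σ x))
        rw [sub_self] at h3
        simpa using (h3.const_mul (σ x)).norm
    simpa using this
  have i3 : ∀ j, Integrable fun x => ‖h₀ x‖ ⊓ κ j := fun j => by
    refine hi₀.norm.mono' (hi₀.norm.aestronglyMeasurable.inf aestronglyMeasurable_const)
      (ae_of_all _ fun x => ?_)
    rw [Real.norm_of_nonneg (le_inf (norm_nonneg _) (hκ j).le)]
    exact inf_le_left
  have l3 : Tendsto (fun j => ∫ x, ‖h₀ x‖ ⊓ κ j) atTop (𝓝 0) := by
    have : Tendsto (fun j => ∫ x, ‖h₀ x‖ ⊓ κ j) atTop (𝓝 (∫ _ : Rn n, (0 : ℝ))) := by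
      refine tendsto_integral_of_dominated_convergence (fun x => ‖h₀ x‖)
        (fun j => (i3 j).aestronglyMeasurable) hi₀.norm (fun j => ae_of_all _ fun x => ?_)
        (ae_of_all _ fun x => ?_)
      · rw [Real.norm_of_nonneg (le_inf (norm_nonneg _) (hκ j).le)]
        exact inf_le_left
      · have := (tendsto_const_nhds (x := ‖h₀ x‖)).inf_nhds hκ0
        rwa [inf_eq_right.2 (norm_nonneg _)] at this
    simpa using this
  have lf : Tendsto (fun j => ∫ x, ‖flatReg (κ j) (h j x) - h₀ x‖) atTop (𝓝 0) := by
    have l4 := ((hlim.const_mul (Real.exp M)).add l2).add l3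
    simp only [mul_zero, add_zero] at l4
    refine squeeze_zero (fun _ => integral_nonneg fun _ => norm_nonneg _) (fun j => ?_) l4
    have i1 : Integrable fun x => Real.exp M * ‖u j x - σ x‖ :=
      ((hu j).integrable.sub hσ.integrable).norm.const_mul _
    have i4 : Integrable fun x => Real.exp M * ‖u j x - σ x‖
        + ‖σ x * (Real.exp (vel (K j) (u j) x) - Real.exp (vel W σ x))‖ := i1.add (i2 j).norm
    rw [← integral_const_mul, ← integral_add i1 (i2 j).norm, ← integral_add i4 (i3 j)]
    refine integral_mono_ae ((hfi j).sub hi₀).norm (i4.add (i3 j)) ?_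
    filter_upwards [hpos₀] with x hx
    have a1 : |flatReg (κ j) (h j x) - flatReg (κ j) (h₀ x)| ≤ |h j x - h₀ x| :=
      abs_flatReg_sub_le (hκ j) (hpos j x) hx
    have a2 : |flatReg (κ j) (h₀ x) - h₀ x| ≤ ‖h₀ x‖ ⊓ κ j := by
      rw [abs_sub_comm, abs_of_nonneg (by linarith [flatReg_le (hκ j) hx]), Real.norm_of_nonneg hx]
      exact le_inf (by linarith [flatReg_nonneg (hκ j) hx]) (sub_flatReg_le (hκ j) hx)
    have a3 : |h j x - h₀ x| ≤ Real.exp M * ‖u j x - σ x‖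
        + ‖σ x * (Real.exp (vel (K j) (u j) x) - Real.exp (vel W σ x))‖ := by
      have e : h j x - h₀ x = Real.exp (vel (K j) (u j) x) * (u j x - σ x)
          + σ x * (Real.exp (vel (K j) (u j) x) - Real.exp (vel W σ x)) := by
        simp only [hh, hh₀]; ring
      rw [e, ← Real.norm_eq_abs]
      refine (norm_add_le _ _).trans (add_le_add_left ?_ _)
      rw [norm_mul, Real.norm_of_nonneg (Real.exp_pos _).le]
      exact mul_le_mul_of_nonneg_right (hexp j x) (norm_nonneg _)
    rw [Real.norm_eq_abs]
    exact (abs_sub_le _ (flatReg (κ j) (h₀ x)) _).trans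
      (add_le_add (a1.trans a3) a2)
  have hfin : ∀ j, ∫ x, ‖h₀ (x + z) - h₀ x‖
      ≤ S j + 2 * ∫ x, ‖flatReg (κ j) (h j x) - h₀ x‖ := fun j => by
    have d : Integrable fun x => ‖flatReg (κ j) (h j x) - h₀ x‖ := ((hfi j).sub hi₀).norm
    have dz : Integrable fun x => ‖flatReg (κ j) (h j (x + z)) - h₀ (x + z)‖ := d.comp_add_right z
    have t1 : Integrable fun x => ‖flatReg (κ j) (h j (x + z)) - flatReg (κ j) (h j x)‖ :=
      (((hfi j).comp_add_right z).sub (hfi j)).norm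
    have e := integral_add_right_eq_self (μ := (volume : Measure (Rn n)))
      (fun x => ‖flatReg (κ j) (h j x) - h₀ x‖) z
    calc ∫ x, ‖h₀ (x + z) - h₀ x‖
        ≤ ∫ x, (‖flatReg (κ j) (h j (x + z)) - flatReg (κ j) (h j x)‖
          + (‖flatReg (κ j) (h j (x + z)) - h₀ (x + z)‖
            + ‖flatReg (κ j) (h j x) - h₀ x‖)) := by
          refine integral_mono ((hi₀.comp_add_right z).sub hi₀).norm (t1.add (dz.add d)) fun x => ?_
          simp only [Real.norm_eq_abs]
          have b1 := abs_sub_le (h₀ (x + z)) (flatReg (κ j) (h j (x + z))) (h₀ x)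
          have b2 := abs_sub_le (flatReg (κ j) (h j (x + z))) (flatReg (κ j) (h j x)) (h₀ x)
          rw [abs_sub_comm (h₀ (x + z)) (flatReg (κ j) (h j (x + z)))] at b1
          linarith
      _ = (∫ x, ‖flatReg (κ j) (h j (x + z)) - flatReg (κ j) (h j x)‖)
          + ((∫ x, ‖flatReg (κ j) (h j (x + z)) - h₀ (x + z)‖)
            + ∫ x, ‖flatReg (κ j) (h j x) - h₀ x‖) := by
          rw [← integral_add dz d]; exact integral_add t1 (dz.add d)
      _ ≤ _ := by
          rw [e]; linarith [hle j]
  have hend := hS.add (lf.const_mul 2)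
  rw [mul_zero, add_zero] at hend
  exact ge_of_tendsto' hend hfin

end ScalarLimits

section EntropyLimits

variable {n : ℕ} {ε : ℝ} (hε : 0 < ε)
include hε

/-- Fatou's lemma for the regularised entropy. -/
lemma integral_entReg_le_of_tendsto {f : ℕ → Rn n → ℝ} {f₀ : Rn n → ℝ} {B : ℝ}
    (hf : ∀ j, Integrable (f j)) (hf₀ : Integrable f₀) (hf0 : ∀ j x, 0 ≤ f j x)
    (hi : ∀ j, Integrable fun x => entReg ε (f j x)) (hB : ∀ j, ∫ x, entReg ε (f j x) ≤ B)
    (h : Tendsto (fun j => ∫ x, ‖f j x - f₀ x‖) atTop (𝓝 0)) :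
    Integrable (fun x => entReg ε (f₀ x)) ∧ ∫ x, entReg ε (f₀ x) ≤ B := by
  obtain ⟨φ, -, hφ⟩ := exists_subseq_tendsto_ae hf hf₀ h
  have h0 : ∀ᵐ x, 0 ≤ f₀ x := by
    filter_upwards [hφ] with x hx
    exact ge_of_tendsto' hx fun j => hf0 _ x
  have hB0 : 0 ≤ B := (integral_nonneg fun x => entReg_nonneg hε (hf0 0 x)).trans (hB 0)
  have hm : AEStronglyMeasurable fun x => entReg ε (f₀ x) :=
    ((measurable_entReg ε).comp_aemeasurable hf₀.aemeasurable).aestronglyMeasurable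
  have hnn : 0 ≤ᵐ[volume] fun x => entReg ε (f₀ x) := by
    filter_upwards [h0] with x hx using entReg_nonneg hε hx
  have key : ∫⁻ x, ENNReal.ofReal (entReg ε (f₀ x)) ≤ ENNReal.ofReal B := by
    calc ∫⁻ x, ENNReal.ofReal (entReg ε (f₀ x))
        = ∫⁻ x, liminf (fun j => ENNReal.ofReal (entReg ε (f (φ j) x))) atTop := by
          refine lintegral_congr_ae ?_
          filter_upwards [hφ, h0] with x hx hx0
          exact (((ENNReal.continuous_ofReal.tendsto _).comp
            ((hasDerivAt_entReg hε hx0).continuousAt.tendsto.comp hx)).liminf_eq).symm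
      _ ≤ liminf (fun j => ∫⁻ x, ENNReal.ofReal (entReg ε (f (φ j) x))) atTop :=
          lintegral_liminf_le' fun j =>
            ((measurable_entReg ε).comp_aemeasurable (hf _).aemeasurable).ennreal_ofReal
      _ ≤ ENNReal.ofReal B := by
          refine liminf_le_of_le (by isBoundedDefault) fun b hb => ?_
          obtain ⟨j, hj⟩ := hb.exists
          refine hj.trans ?_
          rw [← ofReal_integral_eq_lintegral_ofReal (hi _)
            (ae_of_all _ fun x => entReg_nonneg hε (hf0 _ x))]
          exact ENNReal.ofReal_le_ofReal (hB _)
  have hint : Integrable fun x => entReg ε (f₀ x) := by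
    refine ⟨hm, ?_⟩
    rw [hasFiniteIntegral_iff_ofReal hnn]
    exact key.trans_lt ENNReal.ofReal_lt_top
  refine ⟨hint, ?_⟩
  rw [← ofReal_integral_eq_lintegral_ofReal hint hnn] at key
  exact (ENNReal.ofReal_le_ofReal_iff hB0).1 key

/-- Jensen's inequality for the regularised entropy of a mollified density. -/
lemma integral_entReg_mollify_le {σ : Rn n → ℝ} (hσ : IsDensity σ)
    (hi : Integrable fun x => entReg ε (σ x)) {δ : ℝ} (hδ : 0 < δ) :
    ∫ x, entReg ε (mollify δ σ x) ≤ ∫ x, entReg ε (σ x) := by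
  rw [← integral_mollify hδ hi]
  refine integral_mono (hσ.integrable_entReg_mollify hδ hε) (integrable_mollify hδ hi) fun x => ?_
  set a := mollify δ σ x with ha
  have ha0 : 0 ≤ a := mollify_nonneg hδ hσ.nonneg x
  set c := Real.log (1 + a / ε) + 1
  have iG := integrable_heatKernel_sub hδ x
  have iσ := integrable_heatKernel_smul hδ hσ.integrable x
  have e : entReg ε a = ∫ y, ((entReg ε a - c * a) * heatKernel n δ (x - y)
      + c * (heatKernel n δ (x - y) • σ y)) := by
    rw [integral_add (iG.const_mul _) (iσ.const_mul _), integral_const_mul, integral_const_mul,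
      integral_heatKernel_sub hδ, ← mollify_apply, ← ha]
    ring
  simp only
  rw [e, mollify_apply]
  refine integral_mono_ae ((iG.const_mul _).add (iσ.const_mul _))
    (integrable_heatKernel_smul hδ hi x) ?_
  filter_upwards [hσ.nonneg] with y hy
  have h1 := mul_le_mul_of_nonneg_left (entReg_tangent_le hε ha0 hy) (heatKernel_pos hδ (x - y)).le
  simp only [smul_eq_mul]
  refine le_trans (le_of_eq ?_) h1
  ring

/-- Lower semicontinuity of the regularised entropy along mollifications. No integrability is assumed:
otherwise Fatou's lemma would bound the integral. -/
lemma exists_entReg_mollify_ge {σ : Rn n → ℝ} (hσ : IsDensity σ) {η : ℝ} (hη : 0 < η) :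
    ∃ δ, 0 < δ ∧ δ ≤ η ∧ (∫ x, entReg ε (σ x)) - η ≤ ∫ x, entReg ε (mollify δ σ x) := by
  by_contra! hcon
  set δ : ℕ → ℝ := fun j => η * (1 / (j + 1)) with hδ
  have hδ0 : ∀ j, 0 < δ j := fun j => by simp only [hδ]; positivity
  have hδ1 : ∀ j, δ j ≤ η := fun j => mul_le_of_le_one_right hη.le (by
    rw [div_le_one (by positivity)]; linarith [j.cast_nonneg (α := ℝ)])
  have hδl : Tendsto δ atTop (𝓝 0) := by
    simpa [hδ] using (tendsto_one_div_add_atTop_nhds_zero_nat (𝕜 := ℝ)).const_mul η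
  have h := (integral_entReg_le_of_tendsto hε (f := fun j => mollify (δ j) σ) (f₀ := σ)
    (fun j => integrable_mollify (hδ0 j) hσ.integrable) hσ.integrable
    (fun j => mollify_nonneg (hδ0 j) hσ.nonneg)
    (fun j => hσ.integrable_entReg_mollify (hδ0 j) hε)
    (fun j => (hcon (δ j) (hδ0 j) (hδ1 j)).le)
    (tendsto_integral_norm_mollify_seq_sub (fun _ => hσ.integrable) hσ.integrable hδ0 hδl
      (by simp))).2
  linarith

end EntropyLimits

/-! ### Energy decay and gradient bounds at intermediate times -/

section Decay

variable {n : ℕ} {g : Rn n → Rn n} {Γ : ℝ}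
  (hg : AEStronglyMeasurable g) (hΓ : ∀ᵐ x, ‖g x‖ ≤ Γ)
  {ρ₀ : Rn n →₁[volume] ℝ} {ρ : ℝ → (Rn n →₁[volume] ℝ)} (h : IsMildSolution g ρ₀ ρ)
  (hd : ∀ t, 0 ≤ t → IsDensity (ρ t))
include hg hΓ

lemma tendsto_integral_norm_fluxErr {k : ℕ → Rn n → Rn n} {Γ' : ℝ} {K : ℕ → Rn n → ℝ} {M : ℝ}
    (hK : ∀ j, IsSmoothKernel (K j) (k j) M Γ')
    (hkg : ∀ᵐ x, Tendsto (fun j => k j x) atTop (𝓝 (g x))) {δ : ℕ → ℝ} (hδ : ∀ j, 0 < δ j)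
    (hδ0 : Tendsto δ atTop (𝓝 0)) {f : ℕ → (Rn n →₁[volume] ℝ)} {f₀ : Rn n →₁[volume] ℝ}
    (hf : Tendsto f atTop (𝓝 f₀))
    (hu : Tendsto (fun j => ∫ x, ‖mollify (δ j) (f j) x - f₀ x‖) atTop (𝓝 0)) :
    Tendsto (fun j => ∫ x, ‖fluxErr g (k j) (δ j) (f j) x‖) atTop (𝓝 0) := by
  have hdi := fun f : Rn n →₁[volume] ℝ => integrable_drift hg hΓ (integrable_coe f)
  have hui : ∀ j, Integrable (mollify (δ j) (f j)) := fun j =>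
    integrable_mollify (hδ j) (integrable_coe _)
  have h1 := tendsto_integral_norm_mollify_seq_sub (fun j => hdi (f j)) (hdi f₀) hδ hδ0
    (tendsto_integral_norm_drift_sub hg hΓ hf)
  have h2 := tendsto_integral_norm_smul_vel_sub (fun j => (hK j).aesm_grad)
    (fun j => (hK j).norm_grad_le) hkg hui (integrable_coe f₀) hu hg
  have h3 := h1.add h2
  rw [add_zero] at h3
  refine squeeze_zero (fun _ => integral_nonneg fun _ => norm_nonneg _) (fun j => ?_) h3
  have i1 : Integrable fun x => ‖mollify (δ j) (drift g (f j)) x - drift g f₀ x‖ :=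
    ((integrable_mollify (hδ j) (hdi (f j))).sub (hdi f₀)).norm
  have i3 := integrable_drift (hK j).aesm_grad (ae_of_all _ (hK j).norm_grad_le) (hui j)
  have i2 : Integrable fun x => ‖mollify (δ j) (f j) x • vel (k j) (mollify (δ j) (f j)) x
      - f₀ x • vel g f₀ x‖ := (i3.sub (hdi f₀)).norm
  rw [← integral_add i1 i2]
  refine integral_mono ((integrable_mollify (hδ j) (hdi (f j))).sub i3).norm (i1.add i2) fun x => ?_
  have e : mollify (δ j) (drift g (f j)) x - drift (k j) (mollify (δ j) (f j)) x
      = (mollify (δ j) (drift g (f j)) x - drift g f₀ x)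
        - (drift (k j) (mollify (δ j) (f j)) x - drift g f₀ x) := by abel
  change ‖mollify (δ j) (drift g (f j)) x - drift (k j) (mollify (δ j) (f j)) x‖ ≤ _
  rw [e]
  exact norm_sub_le _ _

include h hd

/-- The regularised entropy stays finite along the flow: the energy estimate without interaction,
whose error is bounded because `fluxErr` has bounded mass. -/
lemma IsMildSolution.integrable_entReg {ε : ℝ} (hε : 0 < ε)
    (hi : Integrable fun x => entReg ε (ρ 0 x)) {t : ℝ} (ht : 0 < t) :
    Integrable fun x => entReg ε (ρ t x) := by
  have h0 : IsSmoothKernel (0 : Rn n → ℝ) (0 : Rn n → Rn n) 0 0 :=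
    ⟨fun x => hasGradientAt_const x 0, continuous_const, by simp, by simp,
      integrable_zero _ _ _, by simp⟩
  have hinter : ∀ f : Rn n → ℝ, inter (0 : Rn n → ℝ) f f = 0 := fun f => by
    simp [inter, vel_apply]
  have hΓ0 := nonneg_of_ae_norm_le hΓ
  set B := (∫ x, entReg ε (ρ 0 x)) + t * (1 + 3 / 2 * (Γ * Γ)) with hB
  have hdt := hd t ht.le
  -- a bound uniform in `δ`, from the energy inequality for the zero kernel
  have key : ∀ δ, 0 < δ → ∫ x, entReg ε (mollify δ (ρ t) x) ≤ B := by
    intro δ hδ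
    obtain ⟨s, hs, hsle⟩ := h.exists_dissip_le h0 hε hδ hg hΓ hd ht one_pos
    have hds := hd s hs.1.le
    have h1 := dissip_nonneg h0 hδ hds hε
    have h2 : ∫ x, ‖fluxErr g 0 δ (ρ s) x‖ ≤ Γ := by
      calc _ ≤ ∫ x, Γ * mollify δ (ρ s) x := by
            refine integral_mono (integrable_fluxErr h0 hδ hds hg hΓ).norm
              ((hds.mollify hδ).integrable.const_mul _) fun x => ?_
            simpa using norm_fluxErr_le h0 hδ hds hg hΓ x
        _ = Γ := by rw [integral_const_mul, (hds.mollify hδ).mass, mul_one]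
    have h3 := integral_entReg_mollify_le hε (hd 0 le_rfl) hi hδ
    simp only [regEnergy, hinter, mul_zero, add_zero, zero_mul] at hsle
    have h4 : 0 ≤ ((∫ x, entReg ε (mollify δ (ρ 0) x)) - ∫ x, entReg ε (mollify δ (ρ t) x)) / t
        + (1 + 3 / 2 * (Γ * Γ)) := by
      have : Γ * (∫ x, ‖fluxErr g 0 δ (ρ s) x‖) ≤ Γ * Γ := by gcongr
      linarith
    have h5 := mul_nonneg ht.le h4
    rw [mul_add, mul_div_cancel₀ _ ht.ne'] at h5
    linarith
  set δ : ℕ → ℝ := fun j => 1 / (j + 1)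
  have hδ0 : ∀ j, 0 < δ j := fun j => Nat.one_div_pos_of_nat
  exact (integral_entReg_le_of_tendsto hε (f := fun j => mollify (δ j) (ρ t)) (f₀ := ρ t)
    (fun j => integrable_mollify (hδ0 j) hdt.integrable) hdt.integrable
    (fun j => mollify_nonneg (hδ0 j) hdt.nonneg)
    (fun j => hdt.integrable_entReg_mollify (hδ0 j) hε) (fun j => key _ (hδ0 j))
    (tendsto_integral_norm_mollify_seq_sub (fun _ => hdt.integrable) hdt.integrable hδ0
      tendsto_one_div_add_atTop_nhds_zero_nat (by simp))).1

omit hg hΓ in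
/-- The free energy does not increase, and at some intermediate time the gradient of
`ρ e^{W * ρ}`, measured by translations in `L¹`, is controlled by the mean decrease of the free
energy. -/
lemma IsMildSolution.exists_translate_le_of_decrease {W : Rn n → ℝ} (hW : IsSobolevOneInfty W g)
    (heven : ∀ᵐ x : Rn n, W (-x) = W x)
    (hi : ∀ ε, 0 < ε → Integrable fun x => entReg ε (ρ 0 x)) {t a : ℝ} (ht : 0 < t)
    (ha : ∀ᶠ ε in 𝓝[>] 0, (∫ x, entReg ε (ρ 0 x)) - ∫ x, entReg ε (ρ t x) ≤ a) {d : ℝ}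
    (hda : d = a + 1 / 2 * (inter W (ρ 0) (ρ 0) - inter W (ρ t) (ρ t))) :
    0 ≤ d ∧ ∃ r ∈ Icc 0 t, ∀ l, 0 < l → ∀ z,
      ∫ x, ‖ρ r (x + z) * Real.exp (vel W (ρ r) (x + z)) - ρ r x * Real.exp (vel W (ρ r) x)‖
        ≤ ‖z‖ * (l * Real.exp (supNorm W) ^ 2 + d / t / l) := by
  obtain ⟨K, k, Γ', hK, hKW, hkg⟩ := exists_kernel_approx hW heven
  have hgm := hW.memLp_grad.1
  have hgΓ := ae_norm_le_of_memLp_top hW.memLp_grad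
  set Γ := (eLpNorm g ∞ volume).toReal
  set M := supNorm W
  have hWm := hW.memLp.1
  have hΓ0' : 0 ≤ Γ' := (norm_nonneg _).trans ((hK 0).norm_grad_le 0)
  set η : ℕ → ℝ := fun j => 1 / (j + 1) with hη
  have hη0 : ∀ j, 0 < η j := fun j => Nat.one_div_pos_of_nat
  have hηl : Tendsto η atTop (𝓝 0) := tendsto_one_div_add_atTop_nhds_zero_nat
  -- `ε` is chosen after the kernel, to absorb the norm of its gradient in `L¹`; then `δ`, so that
  -- mollification hardly decreases the entropy at time `t`; then the time of small dissipation
  have hε : ∀ j, ∃ ε, 0 < ε ∧ ε ≤ η j ∧ ε * Γ' * (∫ x, ‖k j x‖) ≤ η j ∧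
      (∫ x, entReg ε (ρ 0 x)) - ∫ x, entReg ε (ρ t x) ≤ a := by
    intro j
    have h1 : Tendsto (fun ε : ℝ => ε * Γ' * ∫ x, ‖k j x‖) (𝓝[>] 0) (𝓝 0) := by
      have : Continuous fun ε : ℝ => ε * Γ' * ∫ x, ‖k j x‖ := by fun_prop
      simpa using (this.tendsto 0).mono_left (nhdsWithin_le_nhds (s := Ioi 0))
    have h2 : ∀ᶠ ε in 𝓝[>] (0 : ℝ), ε ∈ Ioo 0 (η j) := Ioo_mem_nhdsGT (hη0 j)
    obtain ⟨ε, ⟨e1, e2⟩, e3⟩ :=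
      ((h2.and (h1.eventually (ge_mem_nhds (hη0 j)))).and ha).exists
    exact ⟨ε, e1.1, e1.2.le, e2, e3⟩
  choose ε hε0 hεη hεk hεa using hε
  choose δ hδ0 hδη hδent using fun j => exists_entReg_mollify_ge (hε0 j) (hd t ht.le) (hη0 j)
  have hδl : Tendsto δ atTop (𝓝 0) := squeeze_zero (fun j => (hδ0 j).le) hδη hηl
  have hεl : Tendsto ε atTop (𝓝 0) := squeeze_zero (fun j => (hε0 j).le) hεη hηl
  choose s hs hsle using fun j =>
    h.exists_dissip_le (hK j) (hε0 j) (hδ0 j) hgm hgΓ hd ht (hη0 j)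
  obtain ⟨r, hr, φ, hφ, hφl⟩ := isCompact_Icc.tendsto_subseq fun j => Ioo_subset_Icc_self (hs j)
  have hφt := hφ.tendsto_atTop
  -- the solution at the selected times converges in `L¹`
  have hρl : Tendsto (fun j => ρ (s (φ j))) atTop (𝓝 (ρ r)) :=
    ((h.continuousOn.mono fun x hx => hx.1 : ContinuousOn ρ (Icc 0 t)) r hr).tendsto.comp
      (tendsto_nhdsWithin_iff.2 ⟨hφl, Eventually.of_forall fun j => Ioo_subset_Icc_self (hs (φ j))⟩)
  have hρl1 : Tendsto (fun j => ∫ x, ‖ρ (s (φ j)) x - ρ r x‖) atTop (𝓝 0) := by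
    simp only [integral_norm_coe_sub]
    exact tendsto_iff_norm_sub_tendsto_zero.1 hρl
  have hul := tendsto_integral_norm_mollify_seq_sub (fun j => integrable_coe (ρ (s (φ j))))
    (integrable_coe (ρ r)) (fun j => hδ0 (φ j)) (hδl.comp hφt) hρl1
  have hKWφ : ∀ᵐ x, Tendsto (fun j => K (φ j) x) atTop (𝓝 (W x)) :=
    hKW.mono fun x hx => hx.comp hφt
  have herr := tendsto_integral_norm_fluxErr hgm hgΓ (fun j => hK (φ j))
    (hkg.mono fun x hx => hx.comp hφt) (fun j => hδ0 (φ j)) (hδl.comp hφt) hρl hul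
  have hint : ∀ q, Tendsto (fun j => inter (K (φ j)) (mollify (δ (φ j)) (ρ q))
      (mollify (δ (φ j)) (ρ q))) atTop (𝓝 (inter W (ρ q) (ρ q))) := fun q =>
    tendsto_inter (fun j => (hK (φ j)).aesm) (fun j => (hK (φ j)).norm_le) hKWφ hWm
      (fun j => integrable_mollify (hδ0 _) (integrable_coe _)) (integrable_coe _)
      (tendsto_integral_norm_mollify_seq_sub (fun j => integrable_coe (ρ q))
        (integrable_coe (ρ q)) (fun j => hδ0 (φ j)) (hδl.comp hφt) (by simp))
  set Y : ℕ → ℝ := fun j => (a + η (φ j) + 1 / 2 *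
    (inter (K (φ j)) (mollify (δ (φ j)) (ρ 0)) (mollify (δ (φ j)) (ρ 0))
      - inter (K (φ j)) (mollify (δ (φ j)) (ρ t)) (mollify (δ (φ j)) (ρ t)))) / t + η (φ j)
    + 3 / 2 * ((Γ + Γ') * (∫ x, ‖fluxErr g (k (φ j)) (δ (φ j)) (ρ (s (φ j))) x‖) + η (φ j)) with hY
  have hηφ := hηl.comp hφt
  -- `Y` bounds half the dissipation at the selected times
  have hYl : Tendsto Y atTop (𝓝 (d / t)) := by
    have := ((((hηφ.const_add a).add (((hint 0).sub (hint t)).const_mul (1 / 2))).div_const t).add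
      hηφ).add (((herr.const_mul (Γ + Γ')).add hηφ).const_mul (3 / 2))
    simpa [hda, hY] using this
  have hDY : ∀ j, 1 / 2 * dissip (k (φ j)) (ε (φ j)) (δ (φ j)) (ρ (s (φ j))) ≤ Y j := by
    intro j
    refine (hsle (φ j)).trans ?_
    have h1 := integral_entReg_mollify_le (hε0 (φ j)) (hd 0 le_rfl) (hi _ (hε0 (φ j))) (hδ0 (φ j))
    have h2 := hδent (φ j)
    have h3 := hεa (φ j)
    have h4 := hεk (φ j)
    simp only [hY, regEnergy]
    refine add_le_add (add_le_add (div_le_div_of_nonneg_right ?_ ht.le) le_rfl) ?_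
    · linarith
    · linarith
  have hY0 : ∀ j, 0 ≤ Y j := fun j => by
    have := dissip_nonneg (hK (φ j)) (hδ0 (φ j)) (hd _ (hs (φ j)).1.le) (hε0 (φ j))
    linarith [hDY j]
  refine ⟨?_, r, hr, fun l hl z => ?_⟩
  · have h1 := ge_of_tendsto' hYl hY0
    have h2 := mul_nonneg h1 ht.le
    rwa [div_mul_cancel₀ _ ht.ne'] at h2
  · refine integral_norm_translate_le_of_flatReg (fun j => (hK (φ j)).aesm)
      (fun j => (hK (φ j)).norm_le) hKWφ hWm
      (u := fun j => mollify (δ (φ j)) (ρ (s (φ j))))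
      (fun j => (hd _ (hs (φ j)).1.le).mollify (hδ0 _)) (hd r hr.1) hul
      (κ := fun j => Real.exp M * ε (φ j)) (S := fun j => ‖z‖ * (l * Real.exp M ^ 2 + Y j / l))
      (fun j => mollify_nonneg (hδ0 _) (hd _ (hs (φ j)).1.le).nonneg)
      (fun j => mul_pos (Real.exp_pos _) (hε0 _)) ?_ ?_ z (fun j => ?_)
    · simpa using (hεl.comp hφt).const_mul (Real.exp M)
    · exact ((hYl.div_const l).const_add _).const_mul _
    · refine (integral_norm_flatReg_translate_le (hK (φ j)) (hδ0 _) (hd _ (hs (φ j)).1.le)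
        (hε0 _) hl z).trans ?_
      have h1 := hDY j
      have h2 : dissip (k (φ j)) (ε (φ j)) (δ (φ j)) (ρ (s (φ j))) / (2 * l) ≤ Y j / l := by
        rw [div_le_div_iff₀ (by positivity) hl]
        nlinarith
      gcongr

end Decay

/-! ### The free energy as a limit of regularised energies -/

section ExtIntegral

variable {n : ℕ}

lemma extIntegral_mono_ae {f h : Rn n → ℝ} (hfh : ∀ᵐ x, f x ≤ h x) :
    extIntegral f ≤ extIntegral h := by
  have h1 : ∫⁻ x, ENNReal.ofReal (f x) ≤ ∫⁻ x, ENNReal.ofReal (h x) :=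
    lintegral_mono_ae (hfh.mono fun x hx => ENNReal.ofReal_le_ofReal hx)
  have h2 : ∫⁻ x, ENNReal.ofReal (-h x) ≤ ∫⁻ x, ENNReal.ofReal (-f x) :=
    lintegral_mono_ae (hfh.mono fun x hx => ENNReal.ofReal_le_ofReal (neg_le_neg hx))
  unfold extIntegral
  split_ifs with hf hh hh
  · exact le_rfl
  · exact absurd (top_le_iff.1 (hf ▸ h1)) hh
  · exact le_top
  · exact EReal.sub_le_sub (EReal.coe_ennreal_le_coe_ennreal_iff.2 h1)
      (EReal.coe_ennreal_le_coe_ennreal_iff.2 h2)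

lemma extIntegral_eq_integral {f : Rn n → ℝ} (hf : Integrable f) :
    extIntegral f = ((∫ x, f x : ℝ) : EReal) := by
  have h1 : ∫⁻ x, ENNReal.ofReal (f x) ≠ ⊤ := hf.lintegral_lt_top.ne
  have h2 : ∫⁻ x, ENNReal.ofReal (-f x) ≠ ⊤ := hf.neg.lintegral_lt_top.ne
  rw [extIntegral, if_neg h1, integral_eq_lintegral_pos_part_sub_lintegral_neg_part hf,
    EReal.coe_sub, EReal.coe_ennreal_toReal h1, EReal.coe_ennreal_toReal h2]

lemma lintegral_ne_top_of_extIntegral_lt_top {f : Rn n → ℝ} (hf : extIntegral f < ⊤) :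
    ∫⁻ x, ENNReal.ofReal (f x) ≠ ⊤ := fun h => by
  rw [extIntegral, if_pos h] at hf
  exact lt_irrefl _ hf

end ExtIntegral

section FreeEnergy

variable {n : ℕ}

lemma mul_log_le_entReg {ε r : ℝ} (hε : 0 < ε) (hr : 0 ≤ r) :
    r * Real.log r ≤ entReg ε r + r * Real.log ε := by
  refine le_of_tendsto (tendsto_entReg_add_mul_log hr) ?_
  filter_upwards [Ioo_mem_nhdsGT hε] with ε' h
  exact entReg_add_mul_log_mono h.1 h.2.le hr

lemma entReg_le_mul_log {ε r : ℝ} (hε : 0 < ε) (hr : 0 ≤ r) :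
    entReg ε r ≤ r * (Real.log 2 + 1 + |Real.log ε|) + max (r * Real.log r) 0 := by
  refine (entReg_le hε hr).trans ?_
  rcases le_total r ε with h | h
  · have h1 : Real.log (1 + r / ε) ≤ Real.log 2 := by
      refine Real.log_le_log (by positivity) ?_
      have : r / ε ≤ 1 := (div_le_one hε).2 h
      linarith
    have h2 := mul_le_mul_of_nonneg_left h1 hr
    have h3 := mul_nonneg hr (abs_nonneg (Real.log ε))
    have h4 := le_max_right (r * Real.log r) 0
    nlinarith
  · have hr0 : 0 < r := hε.trans_le h
    have h1 : Real.log (1 + r / ε) ≤ Real.log 2 + (Real.log r - Real.log ε) := by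
      rw [← Real.log_div hr0.ne' hε.ne', ← Real.log_mul two_ne_zero (by positivity)]
      refine Real.log_le_log (by positivity) ?_
      have : 1 ≤ r / ε := (one_le_div hε).2 h
      linarith
    have h2 := mul_le_mul_of_nonneg_left h1 hr
    have h3 := mul_le_mul_of_nonneg_left (neg_abs_le (Real.log ε)) hr
    have h4 := le_max_left (r * Real.log r) 0
    nlinarith

lemma conv_eq_vel (W σ : Rn n → ℝ) : conv W σ = vel W σ := by
  ext1 x
  rw [conv, convolution_mul_swap, vel_apply]
  congr 1; ext1 y
  rw [smul_eq_mul, mul_comm]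

variable {W : Rn n → ℝ} {M : ℝ} (hW : AEStronglyMeasurable W) (hWM : ∀ᵐ x, ‖W x‖ ≤ M)
  {σ : Rn n → ℝ} (hσ : IsDensity σ)
include hW hWM hσ

lemma IsDensity.integrable_mul_conv : Integrable fun x => 1 / 2 * (σ x * conv W σ x) := by
  rw [conv_eq_vel]
  exact (integrable_inter hW hWM hσ.integrable hσ.integrable).const_mul _

/-- A density of energy below `+∞` has finite regularised entropy: only the positive part of
`σ log σ` matters. -/
lemma IsDensity.integrable_entReg (hE : freeEnergy W σ < ⊤) {ε : ℝ} (hε : 0 < ε) :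
    Integrable fun x => entReg ε (σ x) := by
  have hP := hσ.integrable_mul_conv hW hWM
  have hE' := lintegral_ne_top_of_extIntegral_lt_top hE
  set φ : Rn n → ℝ := fun x => σ x * Real.log (σ x) + 1 / 2 * (σ x * conv W σ x) with hφ
  have hφm : AEMeasurable φ :=
    (hσ.integrable.aemeasurable.mul hσ.integrable.aemeasurable.log).add hP.aemeasurable
  have hφi : Integrable fun x => (ENNReal.ofReal (φ x)).toReal :=
    integrable_toReal_of_lintegral_ne_top hφm.ennreal_ofReal hE'
  refine ((hσ.integrable.mul_const (Real.log 2 + 1 + |Real.log ε|)).add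
    (hφi.add hP.norm)).mono'
    ((measurable_entReg ε).comp_aemeasurable hσ.integrable.aemeasurable).aestronglyMeasurable ?_
  filter_upwards [hσ.nonneg] with x hx
  rw [Real.norm_of_nonneg (entReg_nonneg hε hx)]
  refine (entReg_le_mul_log hε hx).trans (add_le_add_right ?_ _)
  simp only [Pi.add_apply, ENNReal.toReal_ofReal']
  refine max_le ?_ (by positivity)
  have h1 : φ x ≤ max (φ x) 0 := le_max_left _ _
  have h2 := neg_abs_le (1 / 2 * (σ x * conv W σ x))
  rw [Real.norm_eq_abs]
  have h3 : φ x = σ x * Real.log (σ x) + 1 / 2 * (σ x * conv W σ x) := rfl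
  linarith

lemma IsDensity.integral_regularised {ε β : ℝ} (hi : Integrable fun x => entReg ε (σ x)) :
    Integrable (fun x => entReg ε (σ x) + σ x * Real.log ε + 1 / 2 * (σ x * conv W σ x)
      + β * σ x) ∧
    ∫ x, (entReg ε (σ x) + σ x * Real.log ε + 1 / 2 * (σ x * conv W σ x) + β * σ x)
      = (∫ x, entReg ε (σ x)) + Real.log ε + 1 / 2 * inter W σ σ + β := by
  have hP := hσ.integrable_mul_conv hW hWM
  have i1 := hσ.integrable.mul_const (Real.log ε)
  have i2 := hσ.integrable.const_mul β
  have i3 : Integrable fun x => entReg ε (σ x) + σ x * Real.log ε := hi.add i1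
  have i4 : Integrable fun x => entReg ε (σ x) + σ x * Real.log ε
    + 1 / 2 * (σ x * conv W σ x) := i3.add hP
  refine ⟨i4.add i2, ?_⟩
  rw [integral_add i4 i2, integral_add i3 hP, integral_add hi i1, integral_mul_const,
    integral_const_mul, integral_const_mul, hσ.mass, conv_eq_vel, one_mul, mul_one]
  rfl

/-- The regularised integrand lies above that of the free energy. The extra term `β σ` is the one that
arises in self-similar variables. -/
lemma IsDensity.extIntegral_le {ε β : ℝ} (hε : 0 < ε)
    (hi : Integrable fun x => entReg ε (σ x)) :
    extIntegral (fun x => σ x * Real.log (σ x) + 1 / 2 * (σ x * conv W σ x) + β * σ x)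
      ≤ (((∫ x, entReg ε (σ x)) + Real.log ε + 1 / 2 * inter W σ σ + β : ℝ) : EReal) := by
  obtain ⟨h1, h2⟩ := hσ.integral_regularised hW hWM (β := β) hi
  rw [← h2, ← extIntegral_eq_integral h1]
  refine extIntegral_mono_ae ?_
  filter_upwards [hσ.nonneg] with x hx
  have := mul_log_le_entReg hε hx
  linarith

lemma IsDensity.freeEnergy_le {ε : ℝ} (hε : 0 < ε) (hi : Integrable fun x => entReg ε (σ x)) :
    freeEnergy W σ
      ≤ (((∫ x, entReg ε (σ x)) + Real.log ε + 1 / 2 * inter W σ σ : ℝ) : EReal) := by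
  simpa [freeEnergy] using hσ.extIntegral_le hW hWM (β := 0) hε hi

/-- The regularised energies decrease to the free energy, also when the latter is `-∞`. -/
lemma IsDensity.eventually_regularised_lt (hi : ∀ ε, 0 < ε → Integrable fun x => entReg ε (σ x))
    {c : ℝ} (hc : freeEnergy W σ < c) :
    ∀ᶠ ε in 𝓝[>] 0, (∫ x, entReg ε (σ x)) + Real.log ε + 1 / 2 * inter W σ σ < c := by
  set A : ℝ → Rn n → ℝ := fun ε x =>
    entReg ε (σ x) + σ x * Real.log ε + 1 / 2 * (σ x * conv W σ x) with hA
  have hAi : ∀ ε, 0 < ε → Integrable (A ε) := fun ε hε => by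
    simpa [hA] using (hσ.integral_regularised hW hWM (β := 0) (hi ε hε)).1
  have hAe : ∀ ε, 0 < ε → ∫ x, A ε x
      = (∫ x, entReg ε (σ x)) + Real.log ε + 1 / 2 * inter W σ σ := fun ε hε => by
    simpa [hA] using (hσ.integral_regularised hW hWM (β := 0) (hi ε hε)).2
  have hmono : ∀ ε₁ ε₂, 0 < ε₁ → ε₁ ≤ ε₂ → ∀ᵐ x, A ε₁ x ≤ A ε₂ x := fun ε₁ ε₂ h1 h12 => by
    filter_upwards [hσ.nonneg] with x hx
    have := entReg_add_mul_log_mono h1 h12 hx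
    simp only [hA]; linarith
  suffices hex : ∃ ε, 0 < ε ∧ ∫ x, A ε x < c by
    obtain ⟨ε, hε, hlt⟩ := hex
    filter_upwards [Ioo_mem_nhdsGT hε] with ε' h
    rw [← hAe ε' h.1]
    exact (integral_mono_ae (hAi _ h.1) (hAi _ hε) (hmono _ _ h.1 h.2.le)).trans_lt hlt
  by_contra! hcon
  set φ : Rn n → ℝ := fun x => σ x * Real.log (σ x) + 1 / 2 * (σ x * conv W σ x) with hφ
  set η : ℕ → ℝ := fun j => 1 / (j + 1) with hη
  have hη0 : ∀ j, 0 < η j := fun j => Nat.one_div_pos_of_nat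
  have hη1 : ∀ j, η j ≤ 1 := fun j => by
    simp only [hη]
    rw [div_le_one (by positivity)]; linarith [j.cast_nonneg (α := ℝ)]
  have hηl : Tendsto η atTop (𝓝[>] 0) := tendsto_nhdsWithin_iff.2
    ⟨tendsto_one_div_add_atTop_nhds_zero_nat, Eventually.of_forall hη0⟩
  have hφm : AEMeasurable φ := (hσ.integrable.aemeasurable.mul
    hσ.integrable.aemeasurable.log).add (hσ.integrable_mul_conv hW hWM).aemeasurable
  have hlim : ∀ᵐ x, Tendsto (fun j => A (η j) x) atTop (𝓝 (φ x)) := by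
    filter_upwards [hσ.nonneg] with x hx
    exact ((tendsto_entReg_add_mul_log hx).comp hηl).add_const _
  have hle : ∀ᵐ x, 0 ≤ A 1 x - φ x := by
    filter_upwards [hσ.nonneg] with x hx
    have := mul_log_le_entReg one_pos hx
    simp only [hA, hφ]; linarith
  have hB : ∀ j, ∫ x, (A 1 x - A (η j) x) ≤ (∫ x, A 1 x) - c := fun j => by
    rw [integral_sub (hAi 1 one_pos) (hAi _ (hη0 j))]
    linarith [hcon _ (hη0 j)]
  have hnn : ∀ j, 0 ≤ᵐ[volume] fun x => A 1 x - A (η j) x := fun j => by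
    filter_upwards [hmono _ _ (hη0 j) (hη1 j)] with x hx using sub_nonneg.2 hx
  -- Fatou's lemma for the increasing differences
  have key : ∫⁻ x, ENNReal.ofReal (A 1 x - φ x) ≤ ENNReal.ofReal ((∫ x, A 1 x) - c) := by
    calc ∫⁻ x, ENNReal.ofReal (A 1 x - φ x)
        = ∫⁻ x, liminf (fun j => ENNReal.ofReal (A 1 x - A (η j) x)) atTop := by
          refine lintegral_congr_ae ?_
          filter_upwards [hlim] with x hx
          exact ((ENNReal.continuous_ofReal.tendsto _).comp (hx.const_sub _)).liminf_eq.symm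
      _ ≤ liminf (fun j => ∫⁻ x, ENNReal.ofReal (A 1 x - A (η j) x)) atTop :=
          lintegral_liminf_le' fun j =>
            ((hAi 1 one_pos).sub (hAi _ (hη0 j))).aemeasurable.ennreal_ofReal
      _ ≤ ENNReal.ofReal ((∫ x, A 1 x) - c) := by
          refine liminf_le_of_le (by isBoundedDefault) fun b hb => ?_
          obtain ⟨j, hj⟩ := hb.exists
          refine hj.trans ?_
          rw [← ofReal_integral_eq_lintegral_ofReal (f := fun x => A 1 x - A (η j) x)
            ((hAi 1 one_pos).sub (hAi _ (hη0 j))) (hnn j)]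
          exact ENNReal.ofReal_le_ofReal (hB j)
  have hψi : Integrable fun x => A 1 x - φ x := by
    refine ⟨((hAi 1 one_pos).aemeasurable.sub hφm).aestronglyMeasurable, ?_⟩
    rw [hasFiniteIntegral_iff_ofReal hle]
    exact key.trans_lt ENNReal.ofReal_lt_top
  have hφi : Integrable φ := by
    refine ((hAi 1 one_pos).sub hψi).congr (ae_of_all _ fun x => ?_)
    simp
  rw [← ofReal_integral_eq_lintegral_ofReal hψi hle, ENNReal.ofReal_le_ofReal_iff
    ((integral_nonneg_of_ae (hnn 0)).trans (hB 0)), integral_sub (hAi 1 one_pos) hφi] at key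
  have h1 : freeEnergy W σ = ((∫ x, φ x : ℝ) : EReal) := extIntegral_eq_integral hφi
  rw [h1, EReal.coe_lt_coe_iff] at hc
  linarith

end FreeEnergy

/-! ### An entropic Sobolev inequality -/

section Functional

variable {n : ℕ}

/-- Dyadic layers bound the entropy: `r log (r/a) ≤ 2r + ∑ₖ (r - 2ᵏ a)₊`. -/
lemma mul_log_le_add_tsum {a r : ℝ} (ha : 0 < a) (hr : 0 ≤ r)
    (hfin : ∑' k : ℕ, ENNReal.ofReal (r - a * 2 ^ k) ≠ ⊤) :
    r * Real.log r ≤ r * (2 + Real.log a) + (∑' k : ℕ, ENNReal.ofReal (r - a * 2 ^ k)).toReal := by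
  rcases lt_or_ge r a with h | h
  · rcases hr.eq_or_lt with rfl | hr0
    · simp
    have h1 : Real.log r ≤ Real.log a := Real.log_le_log hr0 h.le
    have h2 : (0 : ℝ) ≤ (∑' k : ℕ, ENNReal.ofReal (r - a * 2 ^ k)).toReal := ENNReal.toReal_nonneg
    nlinarith
  -- with `2ᵐ a ≤ r < 2ᵐ⁺¹ a`, the layers up to `m` are positive and sum up to `(m + 1) r - 2r` at least
  obtain ⟨m, hm1, hm2⟩ := exists_nat_pow_near ((one_le_div ha).2 h) one_lt_two
  have hr0 : 0 < r := ha.trans_le h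
  have h1 : ENNReal.ofReal (∑ k ∈ Finset.range (m + 1), (r - a * 2 ^ k))
      ≤ ∑' k : ℕ, ENNReal.ofReal (r - a * 2 ^ k) := by
    rw [ENNReal.ofReal_sum_of_nonneg]
    · exact ENNReal.sum_le_tsum _
    · intro k hk
      have h2 : (2 : ℝ) ^ k ≤ 2 ^ m :=
        pow_le_pow_right₀ one_le_two (Nat.lt_succ_iff.1 (Finset.mem_range.1 hk))
      have h3 := (le_div_iff₀ ha).1 (h2.trans hm1)
      linarith
  have h2 := (ENNReal.ofReal_le_iff_le_toReal hfin).1 h1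
  have h3 : ∑ k ∈ Finset.range (m + 1), (r - a * 2 ^ k) = (m + 1) * r - a * (2 ^ (m + 1) - 1) := by
    rw [Finset.sum_sub_distrib, ← Finset.mul_sum, geom_sum_eq (by norm_num)]
    norm_num
  have h4 : a * 2 ^ m ≤ r := by rw [mul_comm]; exact (le_div_iff₀ ha).1 hm1
  have h5 : Real.log r ≤ (m + 1) + Real.log a := by
    have h6 : Real.log (r / a) ≤ (m + 1) * Real.log 2 := by
      have := Real.log_le_log (by positivity) hm2.le
      rwa [Real.log_pow, Nat.cast_add, Nat.cast_one] at this
    rw [Real.log_div hr0.ne' ha.ne'] at h6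
    have h7 : Real.log 2 ≤ 1 := by linarith [Real.log_two_lt_d9]
    nlinarith [(m.cast_nonneg : (0 : ℝ) ≤ m)]
  have h6 := mul_le_mul_of_nonneg_left h5 hr
  rw [pow_succ] at h3
  nlinarith

variable {W : Rn n → ℝ} {M : ℝ} (hW : AEStronglyMeasurable W) (hWM : ∀ᵐ x, ‖W x‖ ≤ M)
  {σ : Rn n → ℝ} (hσ : IsDensity σ) {S : ℝ} (hS : 0 < S)
  (hz : ∀ z, ∫ x, ‖σ (x + z) * Real.exp (vel W σ (x + z)) - σ x * Real.exp (vel W σ x)‖ ≤ S * ‖z‖)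

/-- The constant in the estimate of the layers `∫ (σ - a)₊`. -/
def layerC (n : ℕ) (M : ℝ) : ℝ :=
  Real.exp M * heatC n * (Real.exp (2 * M) ^ (1 / (n : ℝ)) / √(4 * π))

lemma layerC_pos (n : ℕ) (M : ℝ) : 0 < layerC n M := by
  have := heatC_pos n
  unfold layerC; positivity

include hW hWM hσ hS hz

/-- A density with bounded variation, up to the weight `e^{W * σ}`, has small upper layers. The
weighted density is compared with its mollification, at the scale where the latter is at most
`e^{-M} a`. -/
lemma lintegral_layer_le (hn : 1 ≤ n) {a : ℝ} (ha : 0 < a) :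
    ∫⁻ x, ENNReal.ofReal (σ x - a) ≤ ENNReal.ofReal (layerC n M * S * a ^ (-(1 / (n : ℝ)))) := by
  have hn0 : (n : ℝ) ≠ 0 := by positivity
  set h : Rn n → ℝ := fun x => σ x * Real.exp (vel W σ x) with hh
  have hV : ∀ x, |vel W σ x| ≤ M := hσ.norm_vel_le hWM
  have hexp : ∀ x, Real.exp (vel W σ x) ≤ Real.exp M := fun x =>
    Real.exp_le_exp.2 (abs_le.1 (hV x)).2
  have hexp' : ∀ x, Real.exp (-M) ≤ Real.exp (vel W σ x) := fun x =>
    Real.exp_le_exp.2 (abs_le.1 (hV x)).1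
  have hi : Integrable h := hσ.integrable.mul_bdd (Real.continuous_exp.comp_aestronglyMeasurable
    (aestronglyMeasurable_vel hW hσ.integrable.aestronglyMeasurable))
    (ae_of_all _ fun x => by rw [Real.norm_of_nonneg (Real.exp_pos _).le]; exact hexp x)
  have hnorm : ∫ x, ‖h x‖ ≤ Real.exp M := by
    calc ∫ x, ‖h x‖ ≤ ∫ x, Real.exp M * ‖σ x‖ := by
          refine integral_mono hi.norm (hσ.integrable.norm.const_mul _) fun x => ?_
          simp only [hh]
          rw [norm_mul, Real.norm_of_nonneg (Real.exp_pos _).le, mul_comm]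
          exact mul_le_mul_of_nonneg_right (hexp x) (norm_nonneg _)
      _ = Real.exp M := by rw [integral_const_mul, hσ.integral_norm, mul_one]
  set y := Real.exp (2 * M) / a with hy
  have hy0 : 0 < y := by positivity
  -- the scale at which `(4πδ)^{-n/2} e^M = e^{-M} a`
  set δ := (y ^ (1 / (n : ℝ)) / √(4 * π)) ^ 2 with hδ
  have hδ0 : 0 < δ := by positivity
  have hsq : √δ = y ^ (1 / (n : ℝ)) / √(4 * π) := Real.sqrt_sq (by positivity)
  have hpow : (4 * π * δ) ^ (-(n : ℝ) / 2) = y⁻¹ := by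
    have e1 : 4 * π * δ = y ^ (2 / (n : ℝ)) := by
      rw [hδ, div_pow, Real.sq_sqrt (by positivity), mul_div_cancel₀ _ (by positivity),
        ← Real.rpow_natCast, ← Real.rpow_mul hy0.le]
      congr 1; push_cast; ring
    rw [e1, ← Real.rpow_mul hy0.le, show 2 / (n : ℝ) * (-(n : ℝ) / 2) = -1 by field_simp,
      Real.rpow_neg_one]
  have hmol : ∀ x, mollify δ h x ≤ Real.exp (-M) * a := fun x => by
    refine (le_abs_self _).trans ((norm_mollify_le hδ0 hi x).trans ?_)
    rw [hpow]
    calc y⁻¹ * ∫ x, ‖h x‖ ≤ y⁻¹ * Real.exp M := by gcongr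
      _ = Real.exp (-M) * a := by
        rw [hy, inv_div, two_mul, Real.exp_add, Real.exp_neg]
        field_simp
  have hL1 : ∫ x, ‖mollify δ h x - h x‖ ≤ S * (heatC n * √δ) := by
    have := integral_norm_mollify_sub_le hδ0 hi (a := 0) (c := S)
      (fun y => by simpa [sub_eq_add_neg] using hz (-y)) hS.le
    rwa [zero_add] at this
  have hmi : Integrable fun x => ‖mollify δ h x - h x‖ :=
    ((integrable_mollify hδ0 hi).sub hi).norm
  calc ∫⁻ x, ENNReal.ofReal (σ x - a)
      ≤ ∫⁻ x, ENNReal.ofReal (Real.exp M * ‖mollify δ h x - h x‖) := by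
        refine lintegral_mono_ae ?_
        filter_upwards [hσ.nonneg] with x hx
        rcases le_total (σ x) a with hxa | hxa
        · rw [ENNReal.ofReal_of_nonpos (by linarith)]; exact zero_le
        refine ENNReal.ofReal_le_ofReal ?_
        have h1 : Real.exp (-M) * (σ x - a) ≤ h x - mollify δ h x := by
          have h2 : Real.exp (-M) * σ x ≤ h x := by
            simp only [hh]
            rw [mul_comm]; exact mul_le_mul_of_nonneg_left (hexp' x) hx
          linarith [hmol x]
        have h3 : h x - mollify δ h x ≤ ‖mollify δ h x - h x‖ := by
          rw [norm_sub_rev]; exact le_abs_self _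
        have h4 := mul_le_mul_of_nonneg_left (h1.trans h3) (Real.exp_pos M).le
        rwa [← mul_assoc, ← Real.exp_add, add_neg_cancel, Real.exp_zero, one_mul] at h4
    _ = ENNReal.ofReal (∫ x, Real.exp M * ‖mollify δ h x - h x‖) :=
        (ofReal_integral_eq_lintegral_ofReal (hmi.const_mul _)
          (ae_of_all _ fun x => by positivity)).symm
    _ ≤ _ := by
        refine ENNReal.ofReal_le_ofReal ?_
        rw [integral_const_mul]
        calc Real.exp M * ∫ x, ‖mollify δ h x - h x‖
            ≤ Real.exp M * (S * (heatC n * √δ)) := by gcongr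
          _ = _ := by
            rw [hsq, hy, Real.div_rpow (Real.exp_pos _).le ha.le, Real.rpow_neg ha.le, layerC]
            ring

/-- An entropic Sobolev inequality: the free energy of a density with translation modulus `S` is
at most `n log S` up to a constant. -/
lemma IsDensity.freeEnergy_le_log (hn : 1 ≤ n) :
    freeEnergy W σ ≤ ((n * Real.log S
      + (2 + layerC n M / (1 - (2 : ℝ) ^ (-(1 / (n : ℝ)))) + M / 2) : ℝ) : EReal) := by
  have hn0 : (n : ℝ) ≠ 0 := by positivity
  set q : ℝ := (2 : ℝ) ^ (-(1 / (n : ℝ))) with hq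
  have hq0 : 0 < q := by positivity
  have hq1 : q < 1 := Real.rpow_lt_one_of_one_lt_of_neg one_lt_two (by
    have : 0 < 1 / (n : ℝ) := by positivity
    linarith)
  have hC := layerC_pos n M
  -- the scaling for which the `k`-th layer is bounded by a geometric series
  set a := S ^ n with ha
  have ha0 : 0 < a := by positivity
  have haS : a ^ (-(1 / (n : ℝ))) = S⁻¹ := by
    rw [ha, ← Real.rpow_natCast, ← Real.rpow_mul hS.le,
      show (n : ℝ) * -(1 / (n : ℝ)) = -1 by field_simp, Real.rpow_neg_one]
  have hlayer : ∀ k : ℕ, ∫⁻ x, ENNReal.ofReal (σ x - a * 2 ^ k)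
      ≤ ENNReal.ofReal (layerC n M * q ^ k) := fun k => by
    refine (lintegral_layer_le hW hWM hσ hS hz hn (show 0 < a * 2 ^ k by positivity)).trans
      (le_of_eq ?_)
    rw [Real.mul_rpow ha0.le (by positivity), haS, ← Real.rpow_natCast 2 k,
      ← Real.rpow_mul two_pos.le, mul_comm (k : ℝ), Real.rpow_mul two_pos.le, ← hq,
      Real.rpow_natCast]
    congr 1
    field_simp
  have hm : ∀ k : ℕ, AEMeasurable fun x => ENNReal.ofReal (σ x - a * 2 ^ k) := fun k =>
    (hσ.integrable.aemeasurable.sub_const _).ennreal_ofReal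
  have hgeo := hasSum_geometric_of_lt_one hq0.le hq1
  have hsum : ∫⁻ x, ∑' k : ℕ, ENNReal.ofReal (σ x - a * 2 ^ k)
      ≤ ENNReal.ofReal (layerC n M / (1 - q)) := by
    rw [lintegral_tsum hm]
    refine (ENNReal.tsum_le_tsum hlayer).trans (le_of_eq ?_)
    rw [← ENNReal.ofReal_tsum_of_nonneg (fun k => by positivity) (hgeo.summable.mul_left _),
      (hgeo.mul_left _).tsum_eq, div_eq_mul_inv]
  have hsne := (hsum.trans_lt ENNReal.ofReal_lt_top).ne
  have hmt : AEMeasurable fun x => ∑' k : ℕ, ENNReal.ofReal (σ x - a * 2 ^ k) :=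
    AEMeasurable.tsum hm
  have hgi := integrable_toReal_of_lintegral_ne_top hmt hsne
  have hfin := ae_lt_top' hmt hsne
  have hP := hσ.integrable_mul_conv hW hWM
  have i1 : Integrable fun x => σ x * (2 + Real.log a) := hσ.integrable.mul_const _
  have i2 : Integrable fun x => σ x * (2 + Real.log a)
    + (∑' k : ℕ, ENNReal.ofReal (σ x - a * 2 ^ k)).toReal := i1.add hgi
  refine (extIntegral_mono_ae (h := fun x => σ x * (2 + Real.log a)
    + (∑' k : ℕ, ENNReal.ofReal (σ x - a * 2 ^ k)).toReal + 1 / 2 * (σ x * conv W σ x)) ?_).trans ?_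
  · filter_upwards [hσ.nonneg, hfin] with x hx hx'
    have := mul_log_le_add_tsum ha0 hx hx'.ne
    linarith
  · have i3 : Integrable fun x => σ x * (2 + Real.log a)
      + (∑' k : ℕ, ENNReal.ofReal (σ x - a * 2 ^ k)).toReal + 1 / 2 * (σ x * conv W σ x) :=
      i2.add hP
    rw [extIntegral_eq_integral i3, EReal.coe_le_coe_iff, integral_add i2 hP,
      integral_add i1 hgi, integral_mul_const, hσ.mass, integral_toReal hmt hfin,
      integral_const_mul, conv_eq_vel, one_mul]
    have h1 : (∫⁻ x, ∑' k : ℕ, ENNReal.ofReal (σ x - a * 2 ^ k)).toReal ≤ layerC n M / (1 - q) :=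
      ENNReal.toReal_le_of_le_ofReal (div_nonneg hC.le (by linarith)) hsum
    have h2 := abs_inter_le hW hWM hσ.integrable hσ.integrable
    rw [hσ.integral_norm, mul_one, mul_one] at h2
    have h3 : ∫ x, σ x * vel W σ x = inter W σ σ := rfl
    have h4 := (abs_le.1 h2).2
    rw [h3, ha, Real.log_pow]
    linarith

end Functional

/-! ### The differential inequality for the free energy -/

section Ode

/-- Integrated form of the differential inequality `f' ≤ -k e^{m f}`, for a function which is not
assumed to be continuous: `z = e^{-m f}` increases by at least `m k (t - s) z(s) / z(t)` on `[s, t]`,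
and over equal partitions the factors `z(s) / z(t)` tend to `1` on average. -/
lemma exp_neg_add_le_of_decay {f : ℝ → ℝ} {T k m : ℝ} (hT : 0 ≤ T) (hk : 0 ≤ k) (hm : 0 < m)
    (h : ∀ s t, 0 ≤ s → s < t → t ≤ T → k * (t - s) * Real.exp (m * f t) ≤ f s - f t) :
    Real.exp (-(m * f 0)) + m * k * T ≤ Real.exp (-(m * f T)) := by
  set z : ℝ → ℝ := fun t => Real.exp (-(m * f t)) with hz
  have hz0 : ∀ t, 0 < z t := fun t => Real.exp_pos _
  have hmono : ∀ s t, 0 ≤ s → s ≤ t → t ≤ T → z s ≤ z t := by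
    intro s t hs hst ht
    rcases hst.eq_or_lt with rfl | hst
    · exact le_rfl
    refine Real.exp_le_exp.2 (neg_le_neg (mul_le_mul_of_nonneg_left ?_ hm.le))
    have h1 := h s t hs hst ht
    have h2 : 0 ≤ k * (t - s) * Real.exp (m * f t) :=
      mul_nonneg (mul_nonneg hk (by linarith)) (Real.exp_pos _).le
    linarith
  have hstep : ∀ s t, 0 ≤ s → s < t → t ≤ T →
      m * k * (t - s) * (1 - (z t - z s) / z 0) ≤ z t - z s := by
    intro s t hs hst ht
    have h1 := h s t hs hst ht
    have e1 : z t = z s * Real.exp (m * (f s - f t)) := by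
      simp only [hz]; rw [← Real.exp_add]; congr 1; ring
    have e2 : Real.exp (m * f t) = 1 / z t := by
      simp only [hz]; rw [Real.exp_neg, one_div, inv_inv]
    have h2 : z s * (1 + m * (k * (t - s) * (1 / z t))) ≤ z t := by
      conv_rhs => rw [e1]
      refine mul_le_mul_of_nonneg_left ?_ (hz0 s).le
      rw [← e2]
      have := Real.add_one_le_exp (m * (f s - f t))
      nlinarith
    have h3 : m * k * (t - s) * (1 - (z t - z s) / z t) ≤ z t - z s := by
      have e3 : m * k * (t - s) * (1 - (z t - z s) / z t)
          = z s * (m * (k * (t - s) * (1 / z t))) := by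
        have := (hz0 t).ne'
        field_simp; ring
      linarith
    refine le_trans (mul_le_mul_of_nonneg_left ?_
      (mul_nonneg (mul_nonneg hm.le hk) (by linarith))) h3
    refine sub_le_sub_left (div_le_div_of_nonneg_left ?_ (hz0 0) (hmono 0 t le_rfl
      (hs.trans hst.le) ht)) _
    linarith [hmono s t hs hst.le ht]
  rcases hT.eq_or_lt with rfl | hT
  · simp
  have hN : ∀ N : ℕ, m * k * T - m * k * T * ((z T - z 0) / z 0) * (1 / ((N : ℝ) + 1))
      ≤ z T - z 0 := by
    intro N
    set p : ℝ := T / ((N : ℝ) + 1) with hp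
    have hp0 : 0 < p := by positivity
    have hpN : ((N + 1 : ℕ) : ℝ) * p = T := by rw [hp]; push_cast; field_simp
    -- summation of the increments over the partition into `N + 1` intervals
    have hind : ∀ i : ℕ, i ≤ N + 1 →
        m * k * p * (i - (z (i * p) - z 0) / z 0) ≤ z (i * p) - z 0 := by
      intro i
      induction i with
      | zero => intro _; simp
      | succ i ih =>
        intro hi
        have h1 := ih (by omega)
        have h2 : ((i + 1 : ℕ) : ℝ) * p ≤ T := by
          rw [← hpN]; gcongr
        have e : ((i + 1 : ℕ) : ℝ) * p = i * p + p := by push_cast; ring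
        rw [e] at h2 ⊢
        have h3 := hstep (i * p) (i * p + p) (by positivity) (by linarith) h2
        rw [add_sub_cancel_left] at h3
        push_cast
        have e4 : (z (i * p + p) - z 0) / z 0
            = (z (i * p + p) - z (i * p)) / z 0 + (z (i * p) - z 0) / z 0 := by ring
        rw [e4]
        nlinarith
    have h1 := hind (N + 1) le_rfl
    rw [hpN] at h1
    refine le_trans (le_of_eq ?_) h1
    rw [hp]; push_cast; field_simp
  have hlim : Tendsto (fun N : ℕ => m * k * T - m * k * T * ((z T - z 0) / z 0)
      * (1 / ((N : ℝ) + 1))) atTop (𝓝 (m * k * T - m * k * T * ((z T - z 0) / z 0) * 0)) :=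
    (tendsto_one_div_add_atTop_nhds_zero_nat.const_mul _).const_sub _
  have := le_of_tendsto' hlim hN
  rw [mul_zero, sub_zero] at this
  change z 0 + m * k * T ≤ z T
  linarith

end Ode

/-! ### Decay of the free energy -/

section Flow

variable {n : ℕ} {W : Rn n → ℝ} {g : Rn n → Rn n} (hW : IsSobolevOneInfty W g)
  {ρ₀ : Rn n →₁[volume] ℝ} (h0 : 0 ≤ ρ₀) (h1 : ∫ x, ρ₀ x = 1)
  {ρ : ℝ → (Rn n →₁[volume] ℝ)} (h : IsMildSolution g ρ₀ ρ)
include hW h0 h1 h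

lemma IsMildSolution.isDensity {t : ℝ} (ht : 0 ≤ t) : IsDensity (ρ t) := by
  have hg := hW.memLp_grad.1
  have hΓ := ae_norm_le_of_memLp_top hW.memLp_grad
  exact ⟨integrable_coe _, Lp.coeFn_nonneg _ |>.2 (h.nonneg hg hΓ h0 ht),
    (h.integral_eq hg hΓ ht).trans h1⟩

variable (hE : freeEnergy W ρ₀ < ⊤)
include hE

lemma IsMildSolution.integrable_entReg_of_freeEnergy_lt {t ε : ℝ} (ht : 0 ≤ t) (hε : 0 < ε) :
    Integrable fun x => entReg ε (ρ t x) := by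
  have hi0 : Integrable fun x => entReg ε (ρ 0 x) := by
    refine (h.isDensity hW h0 h1 le_rfl).integrable_entReg hW.memLp.1
      (ae_norm_le_of_memLp_top hW.memLp) ?_ hε
    rwa [h.initial]
  rcases ht.eq_or_lt with rfl | ht
  · exact hi0
  exact h.integrable_entReg hW.memLp_grad.1 (ae_norm_le_of_memLp_top hW.memLp_grad)
    (fun t ht => h.isDensity hW h0 h1 ht) hε hi0 ht

variable (heven : ∀ᵐ x : Rn n, W (-x) = W x)
include heven

/-- Any real numbers above the energy at time `s` and below that at time `t` may replace the two
energies; in this form the statement includes infinite ones. -/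
lemma IsMildSolution.exists_translate_le_of_freeEnergy {s t c b : ℝ} (hs : 0 ≤ s) (hst : s < t)
    (hc : freeEnergy W (ρ s) < c) (hb : (b : EReal) ≤ freeEnergy W (ρ t)) :
    0 ≤ c - b ∧ ∃ r ∈ Icc s t, ∀ l, 0 < l → ∀ z,
      ∫ x, ‖ρ r (x + z) * Real.exp (vel W (ρ r) (x + z)) - ρ r x * Real.exp (vel W (ρ r) x)‖
        ≤ ‖z‖ * (l * Real.exp (supNorm W) ^ 2 + (c - b) / (t - s) / l) := by
  have hWm := hW.memLp.1
  have hWM : ∀ᵐ x, ‖W x‖ ≤ supNorm W := ae_norm_le_of_memLp_top hW.memLp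
  have ht : 0 ≤ t := hs.trans hst.le
  have hd := fun t (ht : 0 ≤ t) => h.isDensity hW h0 h1 ht
  have hi := fun t ε (ht : 0 ≤ t) (hε : 0 < ε) =>
    h.integrable_entReg_of_freeEnergy_lt hW h0 h1 hE ht hε
  have hr := h.restart hW.memLp_grad.1 (ae_norm_le_of_memLp_top hW.memLp_grad) hs
  have e1 : s + 0 = s := add_zero s
  have e2 : s + (t - s) = t := by ring
  have ha : ∀ᶠ ε in 𝓝[>] 0, (∫ x, entReg ε (ρ (s + 0) x)) - ∫ x, entReg ε (ρ (s + (t - s)) x)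
      ≤ c - b - 1 / 2 * (inter W (ρ s) (ρ s) - inter W (ρ t) (ρ t)) := by
    rw [e1, e2]
    filter_upwards [(hd s hs).eventually_regularised_lt hWm hWM (fun ε hε => hi s ε hs hε) hc,
      self_mem_nhdsWithin] with ε h2 hε
    have h3 := hb.trans ((hd t ht).freeEnergy_le hWm hWM hε (hi t ε ht hε))
    rw [EReal.coe_le_coe_iff] at h3
    linarith
  obtain ⟨h2, r, hr', h3⟩ := hr.exists_translate_le_of_decrease
    (fun u hu => hd (s + u) (by linarith)) hW heven
    (fun ε hε => by simpa using hi s ε hs hε) (sub_pos.2 hst) ha (d := c - b)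
    (by simp only [e1, e2]; ring)
  exact ⟨h2, s + r, ⟨by linarith [hr'.1], by linarith [hr'.2]⟩, h3⟩

lemma IsMildSolution.freeEnergy_anti {s t : ℝ} (hs : 0 ≤ s) (hst : s ≤ t) :
    freeEnergy W (ρ t) ≤ freeEnergy W (ρ s) := by
  rcases hst.eq_or_lt with rfl | hst
  · exact le_rfl
  by_contra! hlt
  obtain ⟨c, hc1, hc2⟩ := EReal.lt_iff_exists_real_btwn.1 hlt
  obtain ⟨b, hb1, hb2⟩ := EReal.lt_iff_exists_real_btwn.1 hc2
  have h2 := (h.exists_translate_le_of_freeEnergy hW h0 h1 hE heven hs hst hc1 hb2.le).1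
  rw [EReal.coe_lt_coe_iff] at hb1
  linarith

omit hW h0 h1 h hE heven in
/-- The additive constant in the entropic Sobolev inequality along the flow. -/
def decayC (n : ℕ) (M : ℝ) : ℝ :=
  n * (Real.log 2 + M) + (2 + layerC n M / (1 - (2 : ℝ) ^ (-(1 / (n : ℝ)))) + M / 2)

/-- The difference form of `F' ≤ -C e^{2F/n}`, where `F` is the free energy. -/
lemma IsMildSolution.mul_exp_le_sub (hn : 1 ≤ n) {s t c b : ℝ} (hs : 0 ≤ s) (hst : s < t)
    (hc : freeEnergy W (ρ s) < c) (hb : (b : EReal) ≤ freeEnergy W (ρ t)) (hbc : b < c) :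
    (t - s) * Real.exp (2 / n * (b - decayC n (supNorm W))) ≤ c - b := by
  have hWm := hW.memLp.1
  have hWM : ∀ᵐ x, ‖W x‖ ≤ supNorm W := ae_norm_le_of_memLp_top hW.memLp
  have hn0 : (0 : ℝ) < n := by positivity
  obtain ⟨-, r, hr, h2⟩ := h.exists_translate_le_of_freeEnergy hW h0 h1 hE heven hs hst hc hb
  have hr0 : 0 ≤ r := hs.trans hr.1
  set M := supNorm W
  set q := (c - b) / (t - s) with hq
  have hts : 0 < t - s := sub_pos.2 hst
  have hq0 : 0 < q := div_pos (sub_pos.2 hbc) hts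
  set S := 2 * (Real.exp M * √q) with hS
  have hS0 : 0 < S := by positivity
  have hsq : √q * √q = q := Real.mul_self_sqrt hq0.le
  have hz : ∀ z, ∫ x, ‖ρ r (x + z) * Real.exp (vel W (ρ r) (x + z))
      - ρ r x * Real.exp (vel W (ρ r) x)‖ ≤ S * ‖z‖ := fun z => by
    -- the choice of `l` which balances the two terms
    refine (h2 (√q / Real.exp M) (by positivity) z).trans (le_of_eq ?_)
    have e1 : q / (√q / Real.exp M) = Real.exp M * √q := by
      rw [div_div_eq_mul_div, div_eq_iff (by positivity)]
      linear_combination (-Real.exp M) * hsq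
    rw [e1, hS]
    field_simp
    ring
  have h3 := (hb.trans (h.freeEnergy_anti hW h0 h1 hE heven hr0 hr.2)).trans
    ((h.isDensity hW h0 h1 hr0).freeEnergy_le_log hWm hWM hS0 hz hn)
  rw [EReal.coe_le_coe_iff] at h3
  have h4 : Real.log S = Real.log 2 + M + Real.log q / 2 := by
    rw [hS, Real.log_mul two_ne_zero (by positivity), Real.log_mul (by positivity) (by positivity),
      Real.log_exp, Real.log_sqrt hq0.le]
    ring
  have h5 : b - decayC n M ≤ n / 2 * Real.log q := by
    rw [h4] at h3
    unfold decayC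
    linarith
  have h6 : 2 / n * (b - decayC n M) ≤ Real.log q := by
    calc 2 / n * (b - decayC n M) ≤ 2 / n * (n / 2 * Real.log q) := by gcongr
      _ = Real.log q := by field_simp
  calc (t - s) * Real.exp (2 / n * (b - decayC n M)) ≤ (t - s) * q := by
        gcongr
        rwa [← Real.le_log_iff_exp_le hq0]
    _ = c - b := by rw [hq]; field_simp

omit hW h0 h1 h hE heven in
/-- The rate in the decay estimate. -/
def decayRate (n : ℕ) (M : ℝ) : ℝ := 2 / n * Real.exp (-(2 / n * decayC n M))

/-- The decay of a finite energy. -/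
lemma IsMildSolution.freeEnergy_le_neg_log (hn : 1 ≤ n) {T f₀ : ℝ} (hT : 0 ≤ T)
    (hf₀ : freeEnergy W ρ₀ = f₀) :
    freeEnergy W (ρ T) ≤ ((-(n / 2 * Real.log (decayRate n (supNorm W) * T
      + Real.exp (-(2 / n * f₀)))) : ℝ) : EReal) := by
  have hn0 : (0 : ℝ) < n := by positivity
  rcases eq_or_ne (freeEnergy W (ρ T)) ⊥ with hbot | hbot
  · rw [hbot]; exact bot_le
  set f : ℝ → ℝ := fun t => (freeEnergy W (ρ t)).toReal with hf
  have hcoe : ∀ t, 0 ≤ t → t ≤ T → freeEnergy W (ρ t) = f t := by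
    intro t ht htT
    refine (EReal.coe_toReal ?_ ?_).symm
    · have h2 := h.freeEnergy_anti hW h0 h1 hE heven le_rfl ht
      rw [h.initial] at h2
      exact (h2.trans_lt hE).ne
    · intro h2
      have h3 := h.freeEnergy_anti hW h0 h1 hE heven ht htT
      rw [h2, le_bot_iff] at h3
      exact hbot h3
  have key := exp_neg_add_le_of_decay (f := f) (k := Real.exp (-(2 / n * decayC n (supNorm W))))
    (m := 2 / n) hT (Real.exp_pos _).le (by positivity) (fun s t hs hst htT => by
      have hanti := h.freeEnergy_anti hW h0 h1 hE heven hs hst.le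
      rw [hcoe s hs (hst.le.trans htT), hcoe t (hs.trans hst.le) htT, EReal.coe_le_coe_iff] at hanti
      refine le_of_forall_pos_le_add fun η hη => ?_
      have h2 := h.mul_exp_le_sub hW h0 h1 hE heven hn hs hst (c := f s + η) (b := f t)
        (by rw [hcoe s hs (hst.le.trans htT), EReal.coe_lt_coe_iff]; linarith)
        (hcoe t (hs.trans hst.le) htT).ge (by linarith)
      calc Real.exp (-(2 / n * decayC n (supNorm W))) * (t - s) * Real.exp (2 / n * f t)
          = (t - s) * Real.exp (2 / n * (f t - decayC n (supNorm W))) := by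
            have e : Real.exp (2 / n * (f t - decayC n (supNorm W)))
                = Real.exp (-(2 / n * decayC n (supNorm W))) * Real.exp (2 / n * f t) := by
              rw [← Real.exp_add]; congr 1; ring
            rw [e]; ring
        _ ≤ f s - f t + η := by linarith)
  have hf0 : f 0 = f₀ := by
    simp only [hf]; rw [h.initial, hf₀, EReal.toReal_coe]
  rw [hf0] at key
  rw [hcoe T hT le_rfl, EReal.coe_le_coe_iff]
  have hpos : 0 < decayRate n (supNorm W) * T + Real.exp (-(2 / n * f₀)) := by
    have : 0 ≤ decayRate n (supNorm W) := by unfold decayRate; positivity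
    positivity
  have h3 : Real.log (decayRate n (supNorm W) * T + Real.exp (-(2 / n * f₀))) ≤ -(2 / n * f T) := by
    rw [Real.log_le_iff_le_exp hpos]
    unfold decayRate
    linarith
  have h4 := mul_le_mul_of_nonneg_left h3 (show (0 : ℝ) ≤ n / 2 by positivity)
  have h5 : (n : ℝ) / 2 * -(2 / n * f T) = -f T := by field_simp
  linarith

end Flow

/-! ### Self-similar variables -/

section Rescaling

variable {n : ℕ}

lemma integrable_comp_smul_and_integral {F : Rn n → ℝ} (hF : Integrable F) (τ : ℝ) :
    Integrable (fun y => Real.exp (n * τ) * F (Real.exp τ • y)) ∧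
      ∫ y, Real.exp (n * τ) * F (Real.exp τ • y) = ∫ x, F x := by
  refine ⟨(hF.comp_smul (Real.exp_pos τ).ne').const_mul _, ?_⟩
  rw [integral_const_mul, Measure.integral_comp_smul, finrank_euclideanSpace_fin, ← Real.exp_nat_mul,
    abs_of_pos (by positivity), smul_eq_mul, mul_inv_cancel_left₀ (Real.exp_pos _).ne']

lemma conv_rescaled (W σ : Rn n → ℝ) (τ : ℝ) (y : Rn n) :
    conv (fun y => W (Real.exp τ • y)) (fun y => Real.exp (n * τ) * σ (Real.exp τ • y)) y
      = conv W σ (Real.exp τ • y) := by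
  have e : ∀ z, W (Real.exp τ • z) * (Real.exp (n * τ) * σ (Real.exp τ • (y - z)))
      = Real.exp (n * τ) * (fun x => W x * σ (Real.exp τ • y - x)) (Real.exp τ • z) := fun z => by
    simp only [smul_sub]; ring
  rw [conv, conv, convolution_mul, convolution_mul]
  simp_rw [e]
  rw [integral_const_mul, Measure.integral_comp_smul volume
    (fun x => W x * σ (Real.exp τ • y - x)), finrank_euclideanSpace_fin, ← Real.exp_nat_mul,
    abs_of_pos (by positivity), smul_eq_mul, mul_inv_cancel_left₀ (Real.exp_pos _).ne']

/-- In self-similar variables the free energy increases by `nτ`. The bound is stated for the real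
numbers above the energy, so that it includes the energy `-∞`. -/
lemma rescaledEnergy_le {W : Rn n → ℝ} {M : ℝ} (hW : AEStronglyMeasurable W)
    (hWM : ∀ᵐ x, ‖W x‖ ≤ M) {ρ : ℝ → (Rn n →₁[volume] ℝ)} {τ c : ℝ}
    (hσ : IsDensity (ρ ((Real.exp (2 * τ) - 1) / 2)))
    (hi : ∀ ε, 0 < ε → Integrable fun x => entReg ε (ρ ((Real.exp (2 * τ) - 1) / 2) x))
    (hc : freeEnergy W (ρ ((Real.exp (2 * τ) - 1) / 2)) < c) :
    rescaledEnergy W ρ τ ≤ ((c + n * τ : ℝ) : EReal) := by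
  set σ : Rn n → ℝ := ⇑(ρ ((Real.exp (2 * τ) - 1) / 2)) with hσdef
  obtain ⟨ε, hlt, hε⟩ := ((hσ.eventually_regularised_lt hW hWM hi hc).and
    self_mem_nhdsWithin).exists
  replace hε : 0 < ε := hε
  obtain ⟨i1, e1⟩ := hσ.integral_regularised hW hWM (β := n * τ) (hi ε hε)
  obtain ⟨i2, e2⟩ := integrable_comp_smul_and_integral i1 τ
  refine (extIntegral_mono_ae (h := fun y => Real.exp (n * τ) * _) ?_).trans
    ((extIntegral_eq_integral i2).le.trans ?_)
  · have hae : ∀ᵐ y : Rn n, 0 ≤ σ (Real.exp τ • y) :=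
      (Measure.quasiMeasurePreserving_smul volume (Real.exp_pos τ).ne').ae hσ.nonneg
    filter_upwards [hae] with y hy
    have e3 : conv (rescaledPotential W τ) (rescaledDensity ρ τ) y = conv W σ (Real.exp τ • y) :=
      conv_rescaled W σ τ y
    have e4 : rescaledDensity ρ τ y = Real.exp (n * τ) * σ (Real.exp τ • y) := rfl
    rw [e3, e4]
    set r := σ (Real.exp τ • y)
    have h1 := mul_log_le_entReg hε hy
    have h2 : r * Real.log (Real.exp (n * τ) * r) = r * Real.log r + n * τ * r := by
      rcases eq_or_ne r 0 with h0 | h0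
      · simp [h0]
      · rw [Real.log_mul (Real.exp_pos _).ne' h0, Real.log_exp]; ring
    calc _ = Real.exp (n * τ) * (r * Real.log r + 1 / 2 * (r * conv W σ (Real.exp τ • y))
          + n * τ * r) := by
          linear_combination Real.exp (n * τ) * h2
      _ ≤ _ := mul_le_mul_of_nonneg_left (by linarith) (Real.exp_pos _).le
  · rw [e2, e1, EReal.coe_le_coe_iff]
    linarith

end Rescaling
end

/-- Decay of the free energy along the aggregation-diffusion flow, and the resulting uniform upper
bound of the rescaled energy. `c` depends only on `n` and `‖W‖_∞`, and `C` only on `n`, `‖W‖_∞` and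
`E[ρ₀]`. The right-hand side of the first bound is computed in `[-∞, ∞]`; it is the usual
real number when `E[ρ₀]` is finite, and `-∞` when `E[ρ₀] = -∞`. -/
theorem mainTheorem4 (n : ℕ) (hn : 1 ≤ n) :
    ∃ (c : ℝ → ℝ) (C : ℝ → EReal → ℝ), (∀ M : ℝ, 0 < c M) ∧
      ∀ (W : Rn n → ℝ) (gradW : Rn n → Rn n), IsSobolevOneInfty W gradW →
        (∀ᵐ x : Rn n, W (-x) = W x) →
        ∀ (ρ₀ : Rn n →₁[volume] ℝ), 0 ≤ ρ₀ → ∫ x, ρ₀ x = 1 → freeEnergy W ρ₀ < ⊤ →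
          ∀ (ρ : ℝ → (Rn n →₁[volume] ℝ)), IsMildSolution gradW ρ₀ ρ →
            (∀ t : ℝ, 0 ≤ t →
              freeEnergy W (ρ t) ≤
                -(((n / 2 : ℝ) : EReal) *
                  ENNReal.log (ENNReal.ofReal (c (supNorm W) * t) +
                    EReal.exp (-(((2 / n : ℝ) : EReal) * freeEnergy W ρ₀))))) ∧
            (∀ τ : ℝ, 0 ≤ τ →
              rescaledEnergy W ρ τ ≤ ((C (supNorm W) (freeEnergy W ρ₀) : ℝ) : EReal)) := by
  have hn0 : (0 : ℝ) < n := by positivity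
  have hrate : ∀ M, 0 < decayRate n M := fun M => by unfold decayRate; positivity
  refine ⟨decayRate n, fun M E₀ => -(n / 2 * Real.log
    (min (decayRate n M / 2) (Real.exp (-(2 / n * E₀.toReal))))), hrate, ?_⟩
  intro W g hW heven ρ₀ h0 h1 hE ρ h
  set c := decayRate n (supNorm W) with hc
  have hc0 : 0 < c := hrate _
  -- an infinitely negative energy stays infinitely negative
  have hbot : freeEnergy W ρ₀ = ⊥ → ∀ t, 0 ≤ t → freeEnergy W (ρ t) = ⊥ := fun hE0 t ht => by
    have h2 := h.freeEnergy_anti hW h0 h1 hE heven le_rfl ht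
    rwa [h.initial, hE0, le_bot_iff] at h2
  refine ⟨fun t ht => ?_, fun τ hτ => ?_⟩
  · rcases eq_or_ne (freeEnergy W ρ₀) ⊥ with hE0 | hE0
    · rw [hbot hE0 t ht]; exact bot_le
    · have hf₀ := (EReal.coe_toReal hE.ne hE0).symm
      refine (h.freeEnergy_le_neg_log hW h0 h1 hE heven hn ht hf₀).trans (le_of_eq ?_)
      rw [hf₀, ← EReal.coe_mul, ← EReal.coe_neg, EReal.exp_coe,
        ← ENNReal.ofReal_add (by positivity) (Real.exp_pos _).le,
        ENNReal.log_ofReal_of_pos (by positivity), ← EReal.coe_mul, ← EReal.coe_neg,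
        EReal.toReal_coe]
  · -- `c T + A ≥ min (c / 2) A e^{2τ}`, whose logarithm compensates for the term `nτ`
    have ht : 0 ≤ (Real.exp (2 * τ) - 1) / 2 := by
      have := Real.one_le_exp (show 0 ≤ 2 * τ by positivity)
      linarith
    set T := (Real.exp (2 * τ) - 1) / 2 with hT
    set A := Real.exp (-(2 / n * (freeEnergy W ρ₀).toReal)) with hA
    have hA0 : 0 < A := Real.exp_pos _
    have hm0 : 0 < min (c / 2) A := lt_min (by positivity) hA0
    have hle : freeEnergy W (ρ T) ≤
        ((-(n / 2 * Real.log (min (c / 2) A)) - n * τ : ℝ) : EReal) := by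
      rcases eq_or_ne (freeEnergy W ρ₀) ⊥ with hE0 | hE0
      · rw [hbot hE0 T ht]; exact bot_le
      refine (h.freeEnergy_le_neg_log hW h0 h1 hE heven hn ht
        (EReal.coe_toReal hE.ne hE0).symm).trans (EReal.coe_le_coe_iff.2 ?_)
      rw [← hA, ← hc]
      have h2 : min (c / 2) A * Real.exp (2 * τ) ≤ c * T + A := by
        have h3 : 0 ≤ Real.exp (2 * τ) - 1 := by linarith
        have h4 := mul_le_mul_of_nonneg_right (min_le_left (c / 2) A) h3
        have h5 := min_le_right (c / 2) A
        rw [hT]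
        linarith
      have h3 := Real.log_le_log (by positivity) h2
      rw [Real.log_mul hm0.ne' (Real.exp_pos _).ne', Real.log_exp] at h3
      have h4 := mul_le_mul_of_nonneg_left h3 (show (0 : ℝ) ≤ n / 2 by positivity)
      linarith
    refine EReal.le_of_forall_lt_iff_le.1 fun b hb => ?_
    rw [EReal.coe_lt_coe_iff] at hb
    have h2 : freeEnergy W (ρ T) < ((b - n * τ : ℝ) : EReal) :=
      hle.trans_lt (EReal.coe_lt_coe_iff.2 (by linarith))
    have h3 := rescaledEnergy_le hW.memLp.1 (ae_norm_le_of_memLp_top hW.memLp)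
      (h.isDensity hW h0 h1 ht)
      (fun ε hε => h.integrable_entReg_of_freeEnergy_lt hW h0 h1 hE ht hε) h2
    rwa [sub_add_cancel] at h3
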